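/- Let $0<\rho_1<\rho_2$, let $\Omega=\{x\in\mathbb R^2:\rho_1<|x|<\rho_2\}$, let $B\in C^\infty(\overline\Omega,\mathbb R)$ be radial and strictly positive, and let $A=(A_1,A_2)\in C^\infty(\overline\Omega,\mathbb R^2)$ satisfy $\partial_xA_2-\partial_yA_1=B$ in $\Omega$. Let $\phi$ be the solution in $H^1_0(\Omega)$ of $\Delta\phi=B$ in $\Omega$; it is radial and smooth on $\overline\Omega$, and we write $B(r)$, $\partial_r\phi(r)$ for $B$, $\partial_r\phi$ on the circle $|x|=r$. Let $0<h\le 1$ and $p\in\mathbb Z$, and put $$c_0=\frac1{2\pi}\int_{|x|=\rho_1}A-\rho_1\,\partial_r\phi(\rho_1),\qquad \gamma_{h,p}=p+\frac{c_0}{h},$$ where the circulation is taken anticlockwise. Denote by $\sigma_1,\sigma_2,\sigma_3$ the Pauli matrices and put $\mathbf p=-ih\nabla$. * $\mathcal P_h=[\sigma\cdot(\mathbf p-A)]^2$ is the Dirichlet-Pauli operator on $L^2(\Omega,\mathbb C^2)$, with domain $H^2(\Omega,\mathbb C^2)\cap H^1_0(\Omega,\mathbb C^2)$. * For $m\in\mathbb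 Z$, $\mathcal P_{h,m}$ is the operator on $L^2(]\rho_1,\rho_2[,\mathbb C^2;dr)$, with domain $H^2\cap H^1_0(]\rho_1,\rho_2[,\mathbb C^2)$, $$\mathcal P_{h,m}=\Big[-h^2\Big(\partial_r^2+\frac1{4r^2}\Big)+\Big(h\,\frac{m-\gamma_{h,p}}r-\partial_r\phi(r)\Big)^2\Big]I_2-hB(r)\sigma_3 .$$ * $\widetilde{\mathcal P}_h$ is the operator on $L^2(]\rho_1,\rho_2[\times]0,2\pi[,\mathbb C^2;r\,dr\,ds)$ $$\widetilde{\mathcal P}_h=\Big[-h^2\Big(\partial_r^2+\frac1r\partial_r\Big)+\Big(h\,\frac{-i\partial_s-\gamma_{h,p}}r-\partial_r\phi(r)\Big)^2\Big]I_2-hB(r)\sigma_3 ,$$ whose domain consists of the functions of $H^2(\Omega,\mathbb C^2)\cap H^1_0(\Omega,\mathbb C^2)$ written in the polar coordinates $(r,s)$. Then $$\mathrm{Sp}(\mathcal P_h)=\bigcup_{m\in\mathbb Z}\mathrm{Sp}(\mathcal P_{h,m}),$$ and the same equality holds when, in the definition of $\mathcal P_h$, the potential $A$ is replaced by $$\mathbf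 A_{h,p}=\nabla^\perp\phi+h\,\gamma_{h,p}\ln(\rho_1/\rho_2)\,\nabla^\perp\theta,\qquad \theta(x)=\frac{\ln(|x|/\rho_2)}{\ln(\rho_1/\rho_2)},\qquad \nabla^\perp=(-\partial_y,\partial_x)$$ (with $\gamma_{h,p}$ and the $\mathcal P_{h,m}$ unchanged, that is, still defined from the original $A$). Moreover, if $v_m$ is an eigenfunction of $\mathcal P_{h,m}$, then $(r,s)\mapsto \frac1{\sqrt r}\,v_m(r)\,e^{ims}$ is an eigenfunction of $\widetilde{\mathcal P}_h$ associated with the same eigenvalue. -/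

import Mathlib

open MeasureTheory Filter Topology
open scoped ContDiff ENNReal

noncomputable section

namespace DirichletPauli

/-! ### Weak derivatives and Sobolev spaces on an open set -/

section Sobolev

variable {E F : Type*} [NormedAddCommGroup E] [NormedSpace ℝ E] [MeasureSpace E]
  [NormedAddCommGroup F] [NormedSpace ℝ F]

/-- `η ∈ C_c^∞(Ω, F)`. -/
def IsTestFunction (Ω : Set E) (η : E → F) : Prop :=
  ContDiff ℝ ∞ η ∧ HasCompactSupport η ∧ tsupport η ⊆ Ω

/-- `g` is the weak derivative of `u` on `Ω` in the direction `v`. -/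
def HasWeakDeriv (Ω : Set E) (v : E) (u g : E → F) : Prop :=
  LocallyIntegrableOn u Ω ∧ LocallyIntegrableOn g Ω ∧
    ∀ η : E → ℝ, IsTestFunction Ω η →
      ∫ x in Ω, (fderiv ℝ η x v) • u x = -∫ x in Ω, η x • g x

/-- `u ∈ H²(Ω, F)`: `u` and all its weak derivatives of order one and two are in `L²(Ω, F)`. -/
def MemH2 (Ω : Set E) (u : E → F) : Prop :=
  MemLp u 2 (volume.restrict Ω) ∧
    ∀ v : E, ∃ g : E → F, MemLp g 2 (volume.restrict Ω) ∧ HasWeakDeriv Ω v u g ∧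
      ∀ w : E, ∃ k : E → F, MemLp k 2 (volume.restrict Ω) ∧ HasWeakDeriv Ω w g k

/-- `u ∈ H¹₀(Ω, F)`: `u` is the limit, for the `H¹` norm, of a sequence in `C_c^∞(Ω, F)`. -/
def MemH10 (Ω : Set E) (u : E → F) : Prop :=
  MemLp u 2 (volume.restrict Ω) ∧
    ∃ η : ℕ → E → F, (∀ n, IsTestFunction Ω (η n)) ∧
      Tendsto (fun n => eLpNorm (fun x => η n x - u x) 2 (volume.restrict Ω)) atTop (𝓝 0) ∧
      ∀ v : E, ∃ g : E → F, MemLp g 2 (volume.restrict Ω) ∧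
        Tendsto (fun n => eLpNorm (fun x => fderiv ℝ (η n) x v - g x) 2 (volume.restrict Ω))
          atTop (𝓝 0)

end Sobolev

/-! ### Unbounded operators on a Hilbert space -/

section Operators

variable {H : Type*} [NormedAddCommGroup H] [NormedSpace ℂ H]

/-- `z` is in the resolvent set of `T` when `T - z : Dom T → H` is bijective with a bounded
inverse. -/
def resolventSet (T : H →ₗ.[ℂ] H) : Set ℂ :=
  {z | ∃ R : H →L[ℂ] H,
    (∀ f : H, ∃ u : T.domain, (u : H) = R f ∧ T u - z • (u : H) = f) ∧
    ∀ u : T.domain, R (T u - z • (u : H)) = u}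

/-- The spectrum of an unbounded operator. -/
def opSpectrum (T : H →ₗ.[ℂ] H) : Set ℂ := (resolventSet T)ᶜ

/-- `u` is an eigenfunction of `T` for the eigenvalue `z`. -/
def IsEigenfunction (T : H →ₗ.[ℂ] H) (z : ℂ) (u : H) : Prop :=
  u ≠ 0 ∧ ∃ w : T.domain, (w : H) = u ∧ T w = z • u

end Operators

/-! ### The geometry and the magnetic data -/

/-- The open annulus `Ω`. -/
def annulus (ρ₁ ρ₂ : ℝ) : Set (ℝ × ℝ) :=
  {x | ρ₁ ^ 2 < x.1 ^ 2 + x.2 ^ 2 ∧ x.1 ^ 2 + x.2 ^ 2 < ρ₂ ^ 2}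

/-- The closed annulus, the closure of `Ω`. -/
def closedAnnulus (ρ₁ ρ₂ : ℝ) : Set (ℝ × ℝ) :=
  {x | ρ₁ ^ 2 ≤ x.1 ^ 2 + x.2 ^ 2 ∧ x.1 ^ 2 + x.2 ^ 2 ≤ ρ₂ ^ 2}

/-- `rot A = ∂ₓA₂ - ∂_yA₁`. -/
def rot (A : ℝ × ℝ → ℝ × ℝ) (x : ℝ × ℝ) : ℝ :=
  fderiv ℝ (fun y => (A y).2) x (1, 0) - fderiv ℝ (fun y => (A y).1) x (0, 1)

/-- `∇^⊥ f = (-∂_y f, ∂ₓ f)`. -/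
def gradPerp (f : ℝ × ℝ → ℝ) (x : ℝ × ℝ) : ℝ × ℝ :=
  (-fderiv ℝ f x (0, 1), fderiv ℝ f x (1, 0))

/-- `φ` is the (continuous version of the) weak solution in `H¹₀(Ω)` of `Δφ = B` in `Ω`,
`φ = 0` on `∂Ω`. -/
def IsScalarPotential (ρ₁ ρ₂ : ℝ) (B φ : ℝ × ℝ → ℝ) : Prop :=
  ContinuousOn φ (closedAnnulus ρ₁ ρ₂) ∧ MemH10 (annulus ρ₁ ρ₂) φ ∧
    ∃ g₁ g₂ : ℝ × ℝ → ℝ,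
      HasWeakDeriv (annulus ρ₁ ρ₂) (1, 0) φ g₁ ∧ HasWeakDeriv (annulus ρ₁ ρ₂) (0, 1) φ g₂ ∧
      ∀ η : ℝ × ℝ → ℝ, IsTestFunction (annulus ρ₁ ρ₂) η →
        ∫ x in annulus ρ₁ ρ₂, (g₁ x * fderiv ℝ η x (1, 0) + g₂ x * fderiv ℝ η x (0, 1)) =
          -∫ x in annulus ρ₁ ρ₂, B x * η x

/-- `∂_r φ (r)` for a radial function `φ` on the closed annulus (one-sided for `r = ρ₁, ρ₂`). -/
def radialDeriv (ρ₁ ρ₂ : ℝ) (φ : ℝ × ℝ → ℝ) (r : ℝ) : ℝ :=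
  derivWithin (fun t => φ (t, 0)) (Set.Icc ρ₁ ρ₂) r

/-- The circulation of `A` along the circle of radius `ρ`, with its anticlockwise
parametrization. -/
def circulation (ρ : ℝ) (A : ℝ × ℝ → ℝ × ℝ) : ℝ :=
  ∫ t in (0 : ℝ)..(2 * Real.pi),
    ((A (ρ * Real.cos t, ρ * Real.sin t)).1 * (-(ρ * Real.sin t)) +
      (A (ρ * Real.cos t, ρ * Real.sin t)).2 * (ρ * Real.cos t))

/-- The constant `c₀`. -/
def fluxConst (ρ₁ ρ₂ : ℝ) (A : ℝ × ℝ → ℝ × ℝ) (φ : ℝ × ℝ → ℝ) : ℝ :=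
  1 / (2 * Real.pi) * circulation ρ₁ A - ρ₁ * radialDeriv ρ₁ ρ₂ φ ρ₁

/-- `γ_{h,p} = p + c₀ / h`. -/
def gaugeConst (ρ₁ ρ₂ h : ℝ) (A : ℝ × ℝ → ℝ × ℝ) (φ : ℝ × ℝ → ℝ) (p : ℤ) : ℝ :=
  (p : ℝ) + fluxConst ρ₁ ρ₂ A φ / h

/-- The harmonic function `θ` equal to `1` on the inner circle and to `0` on the outer one. -/
def harmonicPotential (ρ₁ ρ₂ : ℝ) (x : ℝ × ℝ) : ℝ :=
  Real.log (Real.sqrt (x.1 ^ 2 + x.2 ^ 2) / ρ₂) / Real.log (ρ₁ / ρ₂)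

/-- The vector potential `A_{h,p} = ∇^⊥ φ + h γ_{h,p} ln(ρ₁ / ρ₂) ∇^⊥ θ`. -/
def gaugePotential (ρ₁ ρ₂ h : ℝ) (A : ℝ × ℝ → ℝ × ℝ) (φ : ℝ × ℝ → ℝ) (p : ℤ) (x : ℝ × ℝ) :
    ℝ × ℝ :=
  gradPerp φ x +
    (h * gaugeConst ρ₁ ρ₂ h A φ p * Real.log (ρ₁ / ρ₂)) • gradPerp (harmonicPotential ρ₁ ρ₂) x

/-! ### The operators -/

/-- `ℂ²` with its Hermitian norm. -/
abbrev Spinor : Type := EuclideanSpace ℂ (Fin 2)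

/-- The action of a `2 × 2` matrix on `ℂ²`. -/
def spinMul (M : Matrix (Fin 2) (Fin 2) ℂ) : Spinor →ₗ[ℂ] Spinor := Matrix.toLpLin 2 2 M

def σ₁ : Matrix (Fin 2) (Fin 2) ℂ := !![0, 1; 1, 0]

def σ₂ : Matrix (Fin 2) (Fin 2) ℂ := !![0, -Complex.I; Complex.I, 0]

def σ₃ : Matrix (Fin 2) (Fin 2) ℂ := !![1, 0; 0, -1]

/-- `w = σ · (p - A) u` on `Ω`, with `p = -ih∇` and weak derivatives. -/
def HasDirac (Ω : Set (ℝ × ℝ)) (h : ℝ) (A : ℝ × ℝ → ℝ × ℝ) (u w : ℝ × ℝ → Spinor) : Prop :=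
  ∃ u₁ u₂ : ℝ × ℝ → Spinor, HasWeakDeriv Ω (1, 0) u u₁ ∧ HasWeakDeriv Ω (0, 1) u u₂ ∧
    w =ᵐ[volume.restrict Ω] fun x =>
      spinMul σ₁ ((-Complex.I * (h : ℂ)) • u₁ x - ((A x).1 : ℂ) • u x) +
      spinMul σ₂ ((-Complex.I * (h : ℂ)) • u₂ x - ((A x).2 : ℂ) • u x)

/-- `u ∈ H² ∩ H¹₀` and `f = [σ · (p - A)]² u`. -/
def PauliRel (ρ₁ ρ₂ h : ℝ) (A : ℝ × ℝ → ℝ × ℝ) (u f : ℝ × ℝ → Spinor) : Prop :=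
  MemH2 (annulus ρ₁ ρ₂) u ∧ MemH10 (annulus ρ₁ ρ₂) u ∧
    ∃ w : ℝ × ℝ → Spinor, HasDirac (annulus ρ₁ ρ₂) h A u w ∧ HasDirac (annulus ρ₁ ρ₂) h A w f

/-- `u ∈ H² ∩ H¹₀(]ρ₁, ρ₂[)` and
`f = -h² (u'' + u / (4r²)) + (h (m - γ) / r - ∂_rφ)² u - h B σ₃ u`. -/
def FiberRel (ρ₁ ρ₂ h γ : ℝ) (B φ : ℝ × ℝ → ℝ) (m : ℤ) (u f : ℝ → Spinor) : Prop :=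
  MemH2 (Set.Ioo ρ₁ ρ₂) u ∧ MemH10 (Set.Ioo ρ₁ ρ₂) u ∧
    ∃ u₁ u₂ : ℝ → Spinor,
      HasWeakDeriv (Set.Ioo ρ₁ ρ₂) 1 u u₁ ∧ HasWeakDeriv (Set.Ioo ρ₁ ρ₂) 1 u₁ u₂ ∧
      f =ᵐ[volume.restrict (Set.Ioo ρ₁ ρ₂)] fun r =>
        (-((h ^ 2 : ℝ) : ℂ)) • (u₂ r + ((1 / (4 * r ^ 2) : ℝ) : ℂ) • u r) +
        (((h * (((m : ℝ) - γ) / r) - radialDeriv ρ₁ ρ₂ φ r) ^ 2 : ℝ) : ℂ) • u r -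
        ((h * B (r, 0) : ℝ) : ℂ) • spinMul σ₃ (u r)

/-- The rectangle `]ρ₁, ρ₂[ × ]0, 2π[` of the polar coordinates `(r, s)`. -/
def polarRect (ρ₁ ρ₂ : ℝ) : Set (ℝ × ℝ) := Set.Ioo ρ₁ ρ₂ ×ˢ Set.Ioo 0 (2 * Real.pi)

/-- The measure `r dr ds` on the rectangle. -/
def polarMeasure (ρ₁ ρ₂ : ℝ) : Measure (ℝ × ℝ) :=
  (volume.restrict (polarRect ρ₁ ρ₂)).withDensity fun q => ENNReal.ofReal q.1

def polarMap (q : ℝ × ℝ) : ℝ × ℝ := (q.1 * Real.cos q.2, q.1 * Real.sin q.2)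

/-- `w = (h (-i∂_s - γ) / r - ∂_rφ(r)) u`, with a weak derivative. -/
def HasAngular (ρ₁ ρ₂ h γ : ℝ) (φ : ℝ × ℝ → ℝ) (u w : ℝ × ℝ → Spinor) : Prop :=
  ∃ us : ℝ × ℝ → Spinor, HasWeakDeriv (polarRect ρ₁ ρ₂) (0, 1) u us ∧
    w =ᵐ[volume.restrict (polarRect ρ₁ ρ₂)] fun q =>
      ((h / q.1 : ℝ) : ℂ) • ((-Complex.I) • us q - (γ : ℂ) • u q) -
        (radialDeriv ρ₁ ρ₂ φ q.1 : ℂ) • u q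

/-- `u` is in polar coordinates a function of `H² ∩ H¹₀(Ω)`, and
`f = -h² (∂²_r u + ∂_r u / r) + (h (-i∂_s - γ) / r - ∂_rφ)² u - h B σ₃ u`. -/
def PolarRel (ρ₁ ρ₂ h γ : ℝ) (B φ : ℝ × ℝ → ℝ) (u f : ℝ × ℝ → Spinor) : Prop :=
  (∃ U : ℝ × ℝ → Spinor, MemH2 (annulus ρ₁ ρ₂) U ∧ MemH10 (annulus ρ₁ ρ₂) U ∧
    u =ᵐ[volume.restrict (polarRect ρ₁ ρ₂)] fun q => U (polarMap q)) ∧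
    ∃ ur urr w z : ℝ × ℝ → Spinor,
      HasWeakDeriv (polarRect ρ₁ ρ₂) (1, 0) u ur ∧ HasWeakDeriv (polarRect ρ₁ ρ₂) (1, 0) ur urr ∧
      HasAngular ρ₁ ρ₂ h γ φ u w ∧ HasAngular ρ₁ ρ₂ h γ φ w z ∧
      f =ᵐ[volume.restrict (polarRect ρ₁ ρ₂)] fun q =>
        (-((h ^ 2 : ℝ) : ℂ)) • (urr q + ((1 / q.1 : ℝ) : ℂ) • ur q) + z q -
        ((h * B (q.1, 0) : ℝ) : ℂ) • spinMul σ₃ (u q)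

/-! ### Helper facts: the relations above are graphs of linear operators -/

section Helpers

set_option linter.unusedSectionVars false

theorem IsTestFunction.add {E F : Type*} [NormedAddCommGroup E] [NormedSpace ℝ E]
    [NormedAddCommGroup F] [NormedSpace ℝ F] {Ω : Set E} {η ξ : E → F}
    (h₁ : IsTestFunction Ω η) (h₂ : IsTestFunction Ω ξ) :
    IsTestFunction Ω (fun x => η x + ξ x) :=
  ⟨h₁.1.add h₂.1, h₁.2.1.add h₂.2.1,
    (tsupport_add η ξ).trans (Set.union_subset h₁.2.2 h₂.2.2)⟩

theorem IsTestFunction.smul {E : Type*} [NormedAddCommGroup E] [NormedSpace ℝ E]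
    {Ω : Set E} {η : E → Spinor} (c : ℂ) (h₁ : IsTestFunction Ω η) :
    IsTestFunction Ω (fun x => c • η x) :=
  ⟨h₁.1.const_smul c, h₁.2.1.smul_left (f := fun _ => c),
    (closure_mono (Function.support_const_smul_subset c η)).trans h₁.2.2⟩

theorem integrable_test_smul {E : Type*} [NormedAddCommGroup E] [MeasureSpace E] [BorelSpace E]
    {Ω : Set E} {u : E → Spinor} (hu : LocallyIntegrableOn u Ω) {η : E → ℝ} (hη : Continuous η)
    (hc : HasCompactSupport η) (hs : tsupport η ⊆ Ω) :
    Integrable (fun x => η x • u x) (volume.restrict Ω) := by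
  have h1 : IntegrableOn u (tsupport η) := hu.integrableOn_compact_subset hs hc
  have h2 : IntegrableOn (fun x => η x • u x) (tsupport η) :=
    IntegrableOn.continuousOn_smul h1 hη.continuousOn hc
  have h3 : Integrable (fun x => η x • u x) := by
    rw [← integrableOn_iff_integrable_of_support_subset (s := tsupport η)]
    · exact h2
    · intro x hx
      apply subset_tsupport
      intro h0
      apply hx
      simp [h0]
  exact h3.restrict

variable {E : Type*} [NormedAddCommGroup E] [NormedSpace ℝ E] [MeasureSpace E] [BorelSpace E]
  {Ω : Set E} {v : E} {u u' g g' : E → Spinor}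

theorem integrable_fderiv_smul (hu : LocallyIntegrableOn u Ω) {η : E → ℝ}
    (hη : IsTestFunction Ω η) (v : E) :
    Integrable (fun x => (fderiv ℝ η x v) • u x) (volume.restrict Ω) := by
  apply integrable_test_smul hu (η := fun x => fderiv ℝ η x v)
  · exact (hη.1.continuous_fderiv (by simp)).clm_apply continuous_const
  · exact (hη.2.1.fderiv_apply (𝕜 := ℝ) v)
  · exact (tsupport_fderiv_apply_subset ℝ v).trans hη.2.2

theorem HasWeakDeriv.add (h : HasWeakDeriv Ω v u g) (h' : HasWeakDeriv Ω v u' g') :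
    HasWeakDeriv Ω v (fun x => u x + u' x) (fun x => g x + g' x) := by
  refine ⟨h.1.add h'.1, h.2.1.add h'.2.1, fun η hη => ?_⟩
  simp only [smul_add]
  rw [integral_add (integrable_fderiv_smul h.1 hη v) (integrable_fderiv_smul h'.1 hη v),
    integral_add (integrable_test_smul h.2.1 hη.1.continuous hη.2.1 hη.2.2)
      (integrable_test_smul h'.2.1 hη.1.continuous hη.2.1 hη.2.2), h.2.2 η hη, h'.2.2 η hη]
  abel

theorem HasWeakDeriv.smul (c : ℂ) (h : HasWeakDeriv Ω v u g) :
    HasWeakDeriv Ω v (fun x => c • u x) (fun x => c • g x) := by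
  refine ⟨fun x hx => ?_, fun x hx => ?_, fun η hη => ?_⟩
  · obtain ⟨s, hs, hi⟩ := h.1 x hx
    exact ⟨s, hs, Integrable.smul c hi⟩
  · obtain ⟨s, hs, hi⟩ := h.2.1 x hx
    exact ⟨s, hs, Integrable.smul c hi⟩
  · simp only [smul_comm _ c]
    rw [integral_smul, integral_smul, h.2.2 η hη, smul_neg]

theorem HasWeakDeriv.congr (h : HasWeakDeriv Ω v u g)
    (hu : u' =ᵐ[volume.restrict Ω] u) : HasWeakDeriv Ω v u' g := by
  refine ⟨fun x hx => ?_, h.2.1, fun η hη => ?_⟩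
  · obtain ⟨s, hs, hi⟩ := h.1 x hx
    refine ⟨s ∩ Ω, Filter.inter_mem hs self_mem_nhdsWithin, ?_⟩
    exact (hi.mono_set Set.inter_subset_left).congr
      (ae_mono (Measure.restrict_mono Set.inter_subset_right le_rfl) hu.symm)
  · rw [← h.2.2 η hη]
    apply integral_congr_ae
    filter_upwards [hu] with x hx
    rw [hx]

theorem HasWeakDeriv.zero : HasWeakDeriv Ω v (fun _ => (0 : Spinor)) (fun _ => 0) :=
  ⟨(integrable_zero E Spinor volume).locallyIntegrable.locallyIntegrableOn Ω,
    (integrable_zero E Spinor volume).locallyIntegrable.locallyIntegrableOn Ω, fun η _ => by simp⟩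

/-- Uniqueness of weak derivatives. -/
theorem HasWeakDeriv.ae_zero [FiniteDimensional ℝ E] (hΩ : IsOpen Ω) (h : HasWeakDeriv Ω v u g)
    (hu : u =ᵐ[volume.restrict Ω] 0) : g =ᵐ[volume.restrict Ω] 0 := by
  have key := hΩ.ae_eq_zero_of_integral_contDiff_smul_eq_zero h.2.1 (fun η h1 h2 h3 => ?_)
  · exact (ae_restrict_iff' hΩ.measurableSet).2 key
  · have h4 := h.2.2 η ⟨h1, h2, h3⟩
    have h5 : ∫ x in Ω, (fderiv ℝ η x v) • u x = 0 := by
      rw [integral_eq_zero_of_ae]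
      filter_upwards [hu] with x hx
      simp [hx]
    rw [h5] at h4
    rw [← setIntegral_eq_integral_of_forall_compl_eq_zero (s := Ω)]
    · exact neg_eq_zero.1 h4.symm
    · intro x hx
      have : η x = 0 := by
        by_contra h0
        exact hx (h3 (subset_tsupport η h0))
      simp [this]

theorem MemH2.add (h : MemH2 Ω u) (h' : MemH2 Ω u') : MemH2 Ω (fun x => u x + u' x) := by
  refine ⟨h.1.add h'.1, fun v => ?_⟩
  obtain ⟨g, a, b, c⟩ := h.2 v
  obtain ⟨g', a', b', c'⟩ := h'.2 v
  refine ⟨_, a.add a', b.add b', fun w => ?_⟩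
  obtain ⟨k, d, e⟩ := c w
  obtain ⟨k', d', e'⟩ := c' w
  exact ⟨_, d.add d', e.add e'⟩

theorem MemH2.smul (c : ℂ) (h : MemH2 Ω u) : MemH2 Ω (fun x => c • u x) := by
  refine ⟨h.1.const_smul c, fun v => ?_⟩
  obtain ⟨g, a, b, d⟩ := h.2 v
  refine ⟨_, a.const_smul c, b.smul c, fun w => ?_⟩
  obtain ⟨k, e, f⟩ := d w
  exact ⟨_, e.const_smul c, f.smul c⟩

theorem MemH2.zero : MemH2 Ω (fun _ => (0 : Spinor)) :=
  ⟨MemLp.zero', fun _ => ⟨_, MemLp.zero', HasWeakDeriv.zero,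
    fun _ => ⟨_, MemLp.zero', HasWeakDeriv.zero⟩⟩⟩

theorem MemH2.congr (h : MemH2 Ω u)
    (hu : u' =ᵐ[volume.restrict Ω] u) : MemH2 Ω u' := by
  refine ⟨(memLp_congr_ae hu).2 h.1, fun v => ?_⟩
  obtain ⟨g, a, b, c⟩ := h.2 v
  exact ⟨g, a, b.congr hu, c⟩

theorem tendsto_add_aux {μ : Measure E} {a a' : ℕ → E → Spinor}
    (ha : ∀ n, AEStronglyMeasurable (a n) μ) (ha' : ∀ n, AEStronglyMeasurable (a' n) μ)
    (hu : AEStronglyMeasurable u μ) (hu' : AEStronglyMeasurable u' μ)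
    (h : Tendsto (fun n => eLpNorm (fun x => a n x - u x) 2 μ) atTop (𝓝 0))
    (h' : Tendsto (fun n => eLpNorm (fun x => a' n x - u' x) 2 μ) atTop (𝓝 0)) :
    Tendsto (fun n => eLpNorm (fun x => (a n x + a' n x) - (u x + u' x)) 2 μ) atTop (𝓝 0) := by
  have hs : Tendsto (fun n => eLpNorm (fun x => a n x - u x) 2 μ +
      eLpNorm (fun x => a' n x - u' x) 2 μ) atTop (𝓝 0) := by
    simpa using h.add h'
  refine tendsto_of_tendsto_of_tendsto_of_le_of_le tendsto_const_nhds hs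
    (fun _ => zero_le) (fun n => ?_)
  have := eLpNorm_add_le ((ha n).sub hu) ((ha' n).sub hu') (p := 2) (by norm_num)
  refine le_trans (le_of_eq ?_) this
  congr 1
  funext x
  simp only [Pi.add_apply, Pi.sub_apply]
  abel

theorem tendsto_smul_aux {μ : Measure E} {a : ℕ → E → Spinor} (c : ℂ)
    (h : Tendsto (fun n => eLpNorm (fun x => a n x - u x) 2 μ) atTop (𝓝 0)) :
    Tendsto (fun n => eLpNorm (fun x => c • a n x - c • u x) 2 μ) atTop (𝓝 0) := by
  have h2 : Tendsto (fun n => ‖c‖ₑ * eLpNorm (fun x => a n x - u x) 2 μ) atTop (𝓝 0) := by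
    simpa using ENNReal.Tendsto.const_mul h (Or.inr (by simp))
  refine h2.congr fun n => ?_
  rw [← eLpNorm_const_smul]
  congr 1
  funext x
  simp [smul_sub]

theorem IsTestFunction.aesm_fderiv [SecondCountableTopology E] {η : E → Spinor}
    (hη : IsTestFunction Ω η) (v : E) {μ : Measure E} :
    AEStronglyMeasurable (fun x => fderiv ℝ η x v) μ :=
  ((hη.1.continuous_fderiv (by simp)).clm_apply continuous_const).aestronglyMeasurable

theorem MemH10.add [SecondCountableTopology E] (h : MemH10 Ω u) (h' : MemH10 Ω u') :
    MemH10 Ω (fun x => u x + u' x) := by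
  obtain ⟨hu, η, h1, h2, h3⟩ := h
  obtain ⟨hu', η', h1', h2', h3'⟩ := h'
  refine ⟨hu.add hu', fun n x => η n x + η' n x, fun n => (h1 n).add (h1' n),
    tendsto_add_aux (fun n => (h1 n).1.continuous.aestronglyMeasurable)
      (fun n => (h1' n).1.continuous.aestronglyMeasurable) hu.1 hu'.1 h2 h2', fun v => ?_⟩
  obtain ⟨g, a, b⟩ := h3 v
  obtain ⟨g', a', b'⟩ := h3' v
  refine ⟨_, a.add a', (tendsto_add_aux (fun n => (h1 n).aesm_fderiv v)
    (fun n => (h1' n).aesm_fderiv v) a.1 a'.1 b b').congr fun n => ?_⟩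
  congr 1
  funext x
  rw [fderiv_fun_add ((h1 n).1.differentiable (by simp) x)
    ((h1' n).1.differentiable (by simp) x)]
  rfl

theorem MemH10.smul (c : ℂ) (h : MemH10 Ω u) : MemH10 Ω (fun x => c • u x) := by
  obtain ⟨hu, η, h1, h2, h3⟩ := h
  refine ⟨hu.const_smul c, fun n x => c • η n x, fun n => (h1 n).smul c,
    tendsto_smul_aux c h2, fun v => ?_⟩
  obtain ⟨g, a, b⟩ := h3 v
  refine ⟨_, a.const_smul c, (tendsto_smul_aux c b).congr fun n => ?_⟩
  congr 1
  funext x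
  rw [fderiv_fun_const_smul ((h1 n).1.differentiable (by simp) x)]
  rfl

theorem MemH10.zero : MemH10 Ω (fun _ => (0 : Spinor)) := by
  refine ⟨MemLp.zero', fun _ _ => 0, fun n => ⟨contDiff_const, HasCompactSupport.zero, ?_⟩, ?_,
    fun v => ⟨fun _ => 0, MemLp.zero', ?_⟩⟩
  · simp [tsupport]
  · simp
  · simp

theorem MemH10.congr (h : MemH10 Ω u) (hu : u' =ᵐ[volume.restrict Ω] u) : MemH10 Ω u' := by
  obtain ⟨h0, η, h1, h2, h3⟩ := h
  refine ⟨(memLp_congr_ae hu).2 h0, η, h1, h2.congr fun n => ?_, h3⟩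
  apply eLpNorm_congr_ae
  filter_upwards [hu] with x hx
  rw [hx]

theorem isOpen_annulus (ρ₁ ρ₂ : ℝ) : IsOpen (annulus ρ₁ ρ₂) :=
  (isOpen_lt (f := fun _ : ℝ × ℝ => ρ₁ ^ 2) (g := fun x => x.1 ^ 2 + x.2 ^ 2)
    (by fun_prop) (by fun_prop)).inter
  (isOpen_lt (f := fun x : ℝ × ℝ => x.1 ^ 2 + x.2 ^ 2) (g := fun _ => ρ₂ ^ 2)
    (by fun_prop) (by fun_prop))

theorem isOpen_polarRect (ρ₁ ρ₂ : ℝ) : IsOpen (polarRect ρ₁ ρ₂) := isOpen_Ioo.prod isOpen_Ioo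

theorem ae_polarMeasure_iff {ρ₁ ρ₂ : ℝ} (hρ : 0 < ρ₁) {P : ℝ × ℝ → Prop} :
    (∀ᵐ q ∂polarMeasure ρ₁ ρ₂, P q) ↔ ∀ᵐ q ∂volume.restrict (polarRect ρ₁ ρ₂), P q := by
  constructor
  · intro h
    refine (withDensity_absolutelyContinuous' (by fun_prop) ?_) h
    filter_upwards [ae_restrict_mem (isOpen_polarRect ρ₁ ρ₂).measurableSet] with q hq
    simpa using hρ.trans hq.1.1
  · intro h
    exact (withDensity_absolutelyContinuous _ _) h

theorem HasDirac.add {D : Set (ℝ × ℝ)} {h : ℝ} {A : ℝ × ℝ → ℝ × ℝ}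
    {u w u' w' : ℝ × ℝ → Spinor} (H : HasDirac D h A u w) (H' : HasDirac D h A u' w') :
    HasDirac D h A (fun x => u x + u' x) (fun x => w x + w' x) := by
  obtain ⟨a, b, h1, h2, h3⟩ := H
  obtain ⟨a', b', h1', h2', h3'⟩ := H'
  refine ⟨_, _, h1.add h1', h2.add h2', ?_⟩
  filter_upwards [h3, h3'] with x hx hx'
  rw [hx, hx']
  simp only [map_add, map_sub, map_smul, smul_add]
  abel

theorem HasDirac.smul {D : Set (ℝ × ℝ)} {h : ℝ} {A : ℝ × ℝ → ℝ × ℝ}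
    {u w : ℝ × ℝ → Spinor} (c : ℂ) (H : HasDirac D h A u w) :
    HasDirac D h A (fun x => c • u x) (fun x => c • w x) := by
  obtain ⟨a, b, h1, h2, h3⟩ := H
  refine ⟨_, _, h1.smul c, h2.smul c, ?_⟩
  filter_upwards [h3] with x hx
  rw [hx]
  simp only [map_sub, map_smul]
  module

theorem HasDirac.congr {D : Set (ℝ × ℝ)} {h : ℝ} {A : ℝ × ℝ → ℝ × ℝ}
    {u w u' w' : ℝ × ℝ → Spinor} (H : HasDirac D h A u w) (hu : u' =ᵐ[volume.restrict D] u)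
    (hw : w' =ᵐ[volume.restrict D] w) : HasDirac D h A u' w' := by
  obtain ⟨a, b, h1, h2, h3⟩ := H
  refine ⟨a, b, h1.congr hu, h2.congr hu, ?_⟩
  filter_upwards [h3, hu, hw] with x hx hx' hx''
  rw [hx'', hx, hx']

theorem HasDirac.zero {D : Set (ℝ × ℝ)} {h : ℝ} {A : ℝ × ℝ → ℝ × ℝ} :
    HasDirac D h A (fun _ => 0) (fun _ => 0) :=
  ⟨_, _, HasWeakDeriv.zero, HasWeakDeriv.zero, by filter_upwards with x; simp⟩

theorem HasDirac.ae_zero {D : Set (ℝ × ℝ)} (hD : IsOpen D) {h : ℝ} {A : ℝ × ℝ → ℝ × ℝ}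
    {u w : ℝ × ℝ → Spinor} (H : HasDirac D h A u w) (hu : u =ᵐ[volume.restrict D] 0) :
    w =ᵐ[volume.restrict D] 0 := by
  obtain ⟨a, b, h1, h2, h3⟩ := H
  filter_upwards [h3, hu, h1.ae_zero hD hu, h2.ae_zero hD hu] with x hx hx' ha hb
  simp [hx, hx', ha, hb]

theorem HasAngular.add {ρ₁ ρ₂ h γ : ℝ} {φ : ℝ × ℝ → ℝ} {u w u' w' : ℝ × ℝ → Spinor}
    (H : HasAngular ρ₁ ρ₂ h γ φ u w) (H' : HasAngular ρ₁ ρ₂ h γ φ u' w') :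
    HasAngular ρ₁ ρ₂ h γ φ (fun x => u x + u' x) (fun x => w x + w' x) := by
  obtain ⟨a, h1, h2⟩ := H
  obtain ⟨a', h1', h2'⟩ := H'
  refine ⟨_, h1.add h1', ?_⟩
  filter_upwards [h2, h2'] with x hx hx'
  rw [hx, hx']
  module

theorem HasAngular.smul {ρ₁ ρ₂ h γ : ℝ} {φ : ℝ × ℝ → ℝ} {u w : ℝ × ℝ → Spinor}
    (c : ℂ) (H : HasAngular ρ₁ ρ₂ h γ φ u w) :
    HasAngular ρ₁ ρ₂ h γ φ (fun x => c • u x) (fun x => c • w x) := by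
  obtain ⟨a, h1, h2⟩ := H
  refine ⟨_, h1.smul c, ?_⟩
  filter_upwards [h2] with x hx
  rw [hx]
  module

theorem HasAngular.congr {ρ₁ ρ₂ h γ : ℝ} {φ : ℝ × ℝ → ℝ} {u u' w : ℝ × ℝ → Spinor}
    (H : HasAngular ρ₁ ρ₂ h γ φ u w) (hu : u' =ᵐ[volume.restrict (polarRect ρ₁ ρ₂)] u) :
    HasAngular ρ₁ ρ₂ h γ φ u' w := by
  obtain ⟨a, h1, h2⟩ := H
  refine ⟨a, h1.congr hu, ?_⟩
  filter_upwards [h2, hu] with x hx hx'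
  rw [hx, hx']

theorem HasAngular.zero {ρ₁ ρ₂ h γ : ℝ} {φ : ℝ × ℝ → ℝ} :
    HasAngular ρ₁ ρ₂ h γ φ (fun _ => 0) (fun _ => 0) :=
  ⟨_, HasWeakDeriv.zero, by filter_upwards with x; simp⟩

theorem HasAngular.ae_zero {ρ₁ ρ₂ h γ : ℝ} {φ : ℝ × ℝ → ℝ} {u w : ℝ × ℝ → Spinor}
    (H : HasAngular ρ₁ ρ₂ h γ φ u w) (hu : u =ᵐ[volume.restrict (polarRect ρ₁ ρ₂)] 0) :
    w =ᵐ[volume.restrict (polarRect ρ₁ ρ₂)] 0 := by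
  obtain ⟨a, h1, h2⟩ := H
  filter_upwards [h2, hu, h1.ae_zero (isOpen_polarRect ρ₁ ρ₂) hu] with x hx hx' ha
  simp [hx, hx', ha]

end Helpers

/-! ### The operators as linear maps defined on subspaces of `L²` -/

/-- The graph of the Dirichlet-Pauli operator. -/
def pauliGraph (ρ₁ ρ₂ h : ℝ) (A : ℝ × ℝ → ℝ × ℝ) :
    Submodule ℂ (Lp Spinor 2 (volume.restrict (annulus ρ₁ ρ₂)) ×
      Lp Spinor 2 (volume.restrict (annulus ρ₁ ρ₂))) where
  carrier := {x | PauliRel ρ₁ ρ₂ h A x.1 x.2}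
  add_mem' := by
    rintro x y ⟨h1, h2, w, h3, h4⟩ ⟨h1', h2', w', h3', h4'⟩
    exact ⟨(h1.add h1').congr (Lp.coeFn_add _ _), (h2.add h2').congr (Lp.coeFn_add _ _), _,
      (h3.add h3').congr (Lp.coeFn_add _ _) (ae_eq_refl _),
      (h4.add h4').congr (ae_eq_refl _) (Lp.coeFn_add _ _)⟩
  zero_mem' :=
    ⟨MemH2.zero.congr (Lp.coeFn_zero _ _ _), MemH10.zero.congr (Lp.coeFn_zero _ _ _), _,
      HasDirac.zero.congr (Lp.coeFn_zero _ _ _) (ae_eq_refl _),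
      HasDirac.zero.congr (ae_eq_refl _) (Lp.coeFn_zero _ _ _)⟩
  smul_mem' := by
    rintro c x ⟨h1, h2, w, h3, h4⟩
    exact ⟨(h1.smul c).congr (Lp.coeFn_smul _ _), (h2.smul c).congr (Lp.coeFn_smul _ _), _,
      (h3.smul c).congr (Lp.coeFn_smul _ _) (ae_eq_refl _),
      (h4.smul c).congr (ae_eq_refl _) (Lp.coeFn_smul _ _)⟩

/-- The graph of the fibered operator. -/
def fiberGraph (ρ₁ ρ₂ h γ : ℝ) (B φ : ℝ × ℝ → ℝ) (m : ℤ) :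
    Submodule ℂ (Lp Spinor 2 (volume.restrict (Set.Ioo ρ₁ ρ₂)) ×
      Lp Spinor 2 (volume.restrict (Set.Ioo ρ₁ ρ₂))) where
  carrier := {x | FiberRel ρ₁ ρ₂ h γ B φ m x.1 x.2}
  add_mem' := by
    rintro x y ⟨h1, h2, a, b, h3, h4, h5⟩ ⟨h1', h2', a', b', h3', h4', h5'⟩
    refine ⟨(h1.add h1').congr (Lp.coeFn_add _ _), (h2.add h2').congr (Lp.coeFn_add _ _), _, _,
      (h3.add h3').congr (Lp.coeFn_add _ _), h4.add h4', ?_⟩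
    filter_upwards [h5, h5', Lp.coeFn_add x.1 y.1, Lp.coeFn_add x.2 y.2] with r e1 e2 e3 e4
    simp only [Prod.fst_add, Prod.snd_add, e3, e4, Pi.add_apply, e1, e2, map_add]
    module
  zero_mem' := by
    refine ⟨MemH2.zero.congr (Lp.coeFn_zero _ _ _), MemH10.zero.congr (Lp.coeFn_zero _ _ _), _, _,
      HasWeakDeriv.zero.congr (Lp.coeFn_zero _ _ _), HasWeakDeriv.zero, ?_⟩
    filter_upwards [Lp.coeFn_zero Spinor 2 (volume.restrict (Set.Ioo ρ₁ ρ₂))] with r e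
    simp only [Prod.fst_zero, Prod.snd_zero, e, Pi.zero_apply, map_zero, smul_zero, add_zero, sub_zero]
  smul_mem' := by
    rintro c x ⟨h1, h2, a, b, h3, h4, h5⟩
    refine ⟨(h1.smul c).congr (Lp.coeFn_smul _ _), (h2.smul c).congr (Lp.coeFn_smul _ _), _, _,
      (h3.smul c).congr (Lp.coeFn_smul _ _), h4.smul c, ?_⟩
    filter_upwards [h5, Lp.coeFn_smul c x.1, Lp.coeFn_smul c x.2] with r e1 e3 e4
    simp only [Prod.smul_fst, Prod.smul_snd, e3, e4, Pi.smul_apply, e1, map_smul]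
    module

/-- The graph of the Dirichlet-Pauli operator in polar coordinates; `L²` is taken with respect to
`r dr ds`. -/
def polarGraph (ρ₁ ρ₂ h γ : ℝ) (B φ : ℝ × ℝ → ℝ) (hρ : 0 < ρ₁) :
    Submodule ℂ (Lp Spinor 2 (polarMeasure ρ₁ ρ₂) × Lp Spinor 2 (polarMeasure ρ₁ ρ₂)) where
  carrier := {x | PolarRel ρ₁ ρ₂ h γ B φ x.1 x.2}
  add_mem' := by
    rintro x y ⟨⟨U, hU, hU', hU''⟩, a, b, w, z, h1, h2, h3, h4, h5⟩
      ⟨⟨V, hV, hV', hV''⟩, a', b', w', z', h1', h2', h3', h4', h5'⟩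
    have k1 := (ae_polarMeasure_iff hρ).1 (Lp.coeFn_add x.1 y.1)
    have k2 := (ae_polarMeasure_iff hρ).1 (Lp.coeFn_add x.2 y.2)
    refine ⟨⟨_, hU.add hV, hU'.add hV', ?_⟩, _, _, _, _, (h1.add h1').congr k1, h2.add h2',
      (h3.add h3').congr k1, h4.add h4', ?_⟩
    · filter_upwards [hU'', hV'', k1] with q e1 e2 e3
      simp only [Prod.fst_add, e3, Pi.add_apply, e1, e2]
    · filter_upwards [h5, h5', k1, k2] with q e1 e2 e3 e4
      simp only [Prod.fst_add, Prod.snd_add, e3, e4, Pi.add_apply, e1, e2, map_add]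
      module
  zero_mem' := by
    have k1 := (ae_polarMeasure_iff hρ).1 (Lp.coeFn_zero Spinor 2 (polarMeasure ρ₁ ρ₂))
    refine ⟨⟨_, MemH2.zero, MemH10.zero, k1⟩, _, _, _, _, HasWeakDeriv.zero.congr k1,
      HasWeakDeriv.zero, HasAngular.zero.congr k1, HasAngular.zero, ?_⟩
    filter_upwards [k1] with q e
    simp only [Prod.fst_zero, Prod.snd_zero, e, Pi.zero_apply, map_zero, smul_zero, add_zero, sub_zero]
  smul_mem' := by
    rintro c x ⟨⟨U, hU, hU', hU''⟩, a, b, w, z, h1, h2, h3, h4, h5⟩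
    have k1 := (ae_polarMeasure_iff hρ).1 (Lp.coeFn_smul c x.1)
    have k2 := (ae_polarMeasure_iff hρ).1 (Lp.coeFn_smul c x.2)
    refine ⟨⟨_, hU.smul c, hU'.smul c, ?_⟩, _, _, _, _, (h1.smul c).congr k1, h2.smul c,
      (h3.smul c).congr k1, h4.smul c, ?_⟩
    · filter_upwards [hU'', k1] with q e1 e3
      simp only [Prod.smul_fst, e3, Pi.smul_apply, e1]
    · filter_upwards [h5, k1, k2] with q e1 e3 e4
      simp only [Prod.smul_fst, Prod.smul_snd, e3, e4, Pi.smul_apply, e1, map_smul]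
      module

/-- The Dirichlet-Pauli operator `P_h = [σ · (p - A)]²` on `L²(Ω, ℂ²)`, with domain
`H² ∩ H¹₀(Ω, ℂ²)`. -/
def pauliOp (ρ₁ ρ₂ h : ℝ) (A : ℝ × ℝ → ℝ × ℝ) :
    Lp Spinor 2 (volume.restrict (annulus ρ₁ ρ₂)) →ₗ.[ℂ]
      Lp Spinor 2 (volume.restrict (annulus ρ₁ ρ₂)) :=
  (pauliGraph ρ₁ ρ₂ h A).toLinearPMap

/-- The fibered operator `P_{h,m}` on `L²(]ρ₁, ρ₂[, ℂ²)`, with domain `H² ∩ H¹₀`. -/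
def fiberOp (ρ₁ ρ₂ h γ : ℝ) (B φ : ℝ × ℝ → ℝ) (m : ℤ) :
    Lp Spinor 2 (volume.restrict (Set.Ioo ρ₁ ρ₂)) →ₗ.[ℂ]
      Lp Spinor 2 (volume.restrict (Set.Ioo ρ₁ ρ₂)) :=
  (fiberGraph ρ₁ ρ₂ h γ B φ m).toLinearPMap

/-- The Dirichlet-Pauli operator in polar coordinates, on `L²(]ρ₁, ρ₂[ × ]0, 2π[, ℂ² ; r dr ds)`. -/
def polarOp (ρ₁ ρ₂ h γ : ℝ) (B φ : ℝ × ℝ → ℝ) (hρ : 0 < ρ₁) :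
    Lp Spinor 2 (polarMeasure ρ₁ ρ₂) →ₗ.[ℂ] Lp Spinor 2 (polarMeasure ρ₁ ρ₂) :=
  (polarGraph ρ₁ ρ₂ h γ B φ hρ).toLinearPMap

theorem pauliOp_graph (ρ₁ ρ₂ h : ℝ) (A : ℝ × ℝ → ℝ × ℝ) :
    (pauliOp ρ₁ ρ₂ h A).graph = pauliGraph ρ₁ ρ₂ h A := by
  apply Submodule.toLinearPMap_graph_eq
  rintro ⟨u, f⟩ ⟨_, _, w, h3, h4⟩ (rfl : u = 0)
  have hO := isOpen_annulus ρ₁ ρ₂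
  exact (Lp.eq_zero_iff_ae_eq_zero).2
    (h4.ae_zero hO (h3.ae_zero hO (Lp.coeFn_zero _ _ _)))

theorem fiberOp_graph (ρ₁ ρ₂ h γ : ℝ) (B φ : ℝ × ℝ → ℝ) (m : ℤ) :
    (fiberOp ρ₁ ρ₂ h γ B φ m).graph = fiberGraph ρ₁ ρ₂ h γ B φ m := by
  apply Submodule.toLinearPMap_graph_eq
  rintro ⟨u, f⟩ ⟨_, _, a, b, h3, h4, h5⟩ (rfl : u = 0)
  apply (Lp.eq_zero_iff_ae_eq_zero).2
  have k0 := Lp.coeFn_zero Spinor 2 (volume.restrict (Set.Ioo ρ₁ ρ₂))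
  have k1 := h3.ae_zero isOpen_Ioo k0
  filter_upwards [h5, k0, h4.ae_zero isOpen_Ioo k1] with r e1 e2 e3
  simp only [e1, e2, e3, Pi.zero_apply, map_zero, smul_zero, add_zero, sub_zero]

theorem polarOp_graph (ρ₁ ρ₂ h γ : ℝ) (B φ : ℝ × ℝ → ℝ) (hρ : 0 < ρ₁) :
    (polarOp ρ₁ ρ₂ h γ B φ hρ).graph = polarGraph ρ₁ ρ₂ h γ B φ hρ := by
  apply Submodule.toLinearPMap_graph_eq
  rintro ⟨u, f⟩ ⟨_, a, b, w, z, h1, h2, h3, h4, h5⟩ (rfl : u = 0)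
  apply (Lp.eq_zero_iff_ae_eq_zero).2
  have hO := isOpen_polarRect ρ₁ ρ₂
  have k0 := (ae_polarMeasure_iff hρ).1 (Lp.coeFn_zero Spinor 2 (polarMeasure ρ₁ ρ₂))
  have k1 := h1.ae_zero hO k0
  refine (ae_polarMeasure_iff hρ).2 ?_
  filter_upwards [h5, k0, k1, h2.ae_zero hO k1, h4.ae_zero (h3.ae_zero k0)] with q e1 e2 e3 e4 e5
  simp only [e1, e2, e3, e4, e5, Pi.zero_apply, map_zero, smul_zero, add_zero, sub_zero]

end DirichletPauli

end

/-!
The scalar potential is radial: the Dirichlet problem has one solution (`dirichlet_unique`), and an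
explicit radial function solves it (`exists_radial_potential`). Hence `A_{h,p} = a(r) e_θ` is an
angular field with `a = ∂_rφ + h γ_{h,p} / r` (`exists_gaugePotential_profile`), and its rotational
is `B`. This profile is all that the fibered operators see of `φ` and `γ_{h,p}` (`fiberRel_iff`).

*From `A` to `A_{h,p}`.* The difference `A_{h,p} - A` is closed, and by the choice of `γ_{h,p}` its
circulation on the inner circle is `2πhp`. So it is `-ih ∇E / E` for a function `E` of modulus one
(`exists_gauge`): a primitive `f` exists after pull back by the complex exponential to a strip,
which is convex, and `E = exp(i f / h)` does not depend on the branch of the logarithm, as `f`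
increases by `2πhp` in one turn. Multiplication by `E` is unitary, preserves `H² ∩ H¹₀` and
conjugates the two Pauli operators, which thus have the same spectrum (`IsGauge.opSpectrum_eq`).

*Angular potentials.* `L²(Ω)` is the Hilbert sum of the spaces of functions
`(2πr)^{-1/2} v(r) e^{ims}`, `m ∈ ℤ` (`isHilbertSum_modeMap`; completeness is a form of the
Stone-Weierstrass theorem). On these modes `σ · (p - A)` is the sum of a raising and a lowering
part, and its square is the fibered operator (`dirac_sq_apply`). The Pauli operator is reduced by
this decomposition: modes of the domain of a fiber are in its domain (`FiberExprRel.pauliRel`), and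
conversely the radial coefficients of a function of its domain are in the domains of the fibers
(`PauliRel.fiberExprRel`), because they are Sobolev functions and because the Pauli operator is
symmetric. A reduced operator has the spectra of its parts in its spectrum
(`resolventSet_subset_of_reducing`). The reverse inclusion (`opSpectrum_pauliOp`) is not formal,
since the spectrum of an infinite sum may exceed the union of the spectra: if `z` is in all the
resolvent sets, the centrifugal term `(h m / r - a)²` makes the resolvents of the fibers bounded
uniformly in `m`, with a gain of two powers of `m` (`exists_uniform_resolvent_bound`). Therefore the
solutions on the fibers add up to a function of `H² ∩ H¹₀` (`memH2_of_hasSum`), which solves the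
equation on `Ω`.

*Polar coordinates.* Conjugation by `r^{-1/2}` turns `∂_r² + r⁻¹ ∂_r` into `∂_r² + 1 / (4r²)`
(`liouville_identity`), so `r^{-1/2} v(r) e^{ims}` is an eigenfunction whenever `v` is
(`exists_isEigenfunction_polarOp`).
-/

noncomputable section

namespace DirichletPauli

/-! ### Resolvents of orthogonal sums -/

section Abstract

set_option linter.unusedSectionVars false

variable {H K ι : Type*} [NormedAddCommGroup H] [InnerProductSpace ℂ H] [CompleteSpace H]
  [NormedAddCommGroup K] [InnerProductSpace ℂ K] [CompleteSpace K]

/-- A point `z` is in the resolvent set exactly when `T - z` is onto and bounded below. The pair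
`(u, f + z • u)` of the graph encodes `(T - z) u = f`. -/
theorem mem_resolventSet_iff {T : H →ₗ.[ℂ] H} {z : ℂ} :
    z ∈ resolventSet T ↔ (∀ f, ∃ u, (u, f + z • u) ∈ T.graph) ∧
      ∃ C : ℝ, ∀ u g, (u, g) ∈ T.graph → ‖u‖ ≤ C * ‖g - z • u‖ := by
  constructor
  · rintro ⟨R, h1, h2⟩
    refine ⟨fun f => ?_, ‖R‖, fun u g hug => ?_⟩
    · obtain ⟨u, hu, hf⟩ := h1 f
      exact ⟨u, (LinearPMap.mem_graph_iff _).2 ⟨u, rfl, by simp [← hf]⟩⟩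
    · obtain ⟨y, hy, hg⟩ := (LinearPMap.mem_graph_iff _).1 hug
      simp only at hy hg
      have := h2 y
      rw [hg, hy] at this
      calc ‖u‖ = ‖R (g - z • u)‖ := by rw [this]
        _ ≤ _ := R.le_opNorm _
  · rintro ⟨h1, C, h2⟩
    choose r hr using h1
    have huniq : ∀ u g, (u, g) ∈ T.graph → r (g - z • u) = u := by
      intro u g hug
      have h3 := T.graph.sub_mem (hr (g - z • u)) hug
      have h4 := h2 _ _ h3
      simp only at h4
      have h5 : g - z • u + z • r (g - z • u) - g - z • (r (g - z • u) - u) = 0 := by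
        module
      rw [h5, norm_zero, mul_zero] at h4
      exact sub_eq_zero.1 (norm_le_zero_iff.1 h4)
    let R₀ : H →ₗ[ℂ] H :=
      { toFun := r
        map_add' := fun f g => by
          have := huniq _ _ (T.graph.add_mem (hr f) (hr g))
          rw [← this]
          congr 1
          simp only
          module
        map_smul' := fun c f => by
          have := huniq _ _ (T.graph.smul_mem c (hr f))
          simp only [RingHom.id_apply]
          refine Eq.trans ?_ this
          congr 1
          simp only
          module }
    have hb : ∀ f, ‖R₀ f‖ ≤ C * ‖f‖ := by
      intro f
      have := h2 _ _ (hr f)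
      rwa [add_sub_cancel_right] at this
    refine ⟨R₀.mkContinuous C hb, fun f => ?_, fun u => ?_⟩
    · obtain ⟨y, hy, hg⟩ := (LinearPMap.mem_graph_iff _).1 (hr f)
      refine ⟨y, hy, ?_⟩
      simp only at hy hg
      rw [hg, hy]; simp
    · exact huniq u (T u) ((LinearPMap.mem_graph_iff _).2 ⟨u, rfl, rfl⟩)

variable {T : ι → K →ₗᵢ[ℂ] H}

/-- The component of `U` along the isometry `T m`. -/
def component (T : ι → K →ₗᵢ[ℂ] H) (m : ι) : H →L[ℂ] K :=
  ContinuousLinearMap.adjoint (T m).toContinuousLinearMap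

theorem inner_component (T : ι → K →ₗᵢ[ℂ] H) (m : ι) (u : K) (U : H) :
    inner ℂ u (component T m U) = inner ℂ (T m u) U := by
  rw [component, ContinuousLinearMap.adjoint_inner_right]
  rfl

theorem component_self (m : ι) (u : K) : component T m (T m u) = u := by
  refine ext_inner_left ℂ fun v => ?_
  rw [inner_component, LinearIsometry.inner_map_map]

theorem linearIsometryEquiv_apply_eq (hT : IsHilbertSum ℂ (fun _ : ι => K) T) (U : H) (m : ι) :
    hT.linearIsometryEquiv U m = component T m U := by
  classical
  refine ext_inner_left ℂ fun v => ?_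
  have h1 : inner ℂ v (hT.linearIsometryEquiv U m) =
      inner ℂ (lp.single 2 m v) (hT.linearIsometryEquiv U) :=
    (lp.inner_single_left m v (hT.linearIsometryEquiv U)).symm
  rw [inner_component, h1, ← hT.linearIsometryEquiv_symm_apply_single v,
    ← LinearIsometryEquiv.inner_map_map hT.linearIsometryEquiv,
    LinearIsometryEquiv.apply_symm_apply]

theorem hasSum_component (hT : IsHilbertSum ℂ (fun _ : ι => K) T) (U : H) :
    HasSum (fun m => T m (component T m U)) U := by
  have := hT.hasSum_linearIsometryEquiv_symm (hT.linearIsometryEquiv U)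
  simpa [linearIsometryEquiv_apply_eq hT] using this

theorem hasSum_norm_sq_component (hT : IsHilbertSum ℂ (fun _ : ι => K) T) (U : H) :
    HasSum (fun m => ‖component T m U‖ ^ 2) (‖U‖ ^ 2) := by
  have := lp.hasSum_norm (p := 2) (by norm_num) (hT.linearIsometryEquiv U)
  simpa [linearIsometryEquiv_apply_eq hT] using this

theorem component_eq_of_hasSum (hT : IsHilbertSum ℂ (fun _ : ι => K) T) {u : ι → K} {U : H}
    (hU : HasSum (fun m => T m (u m)) U) (m : ι) : component T m U = u m := by
  have h1 := hU.mapL (component T m)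
  refine h1.unique ?_
  have h2 : ∀ k, k ≠ m → component T m (T k (u k)) = 0 := by
    intro k hk
    refine ext_inner_left ℂ fun v => ?_
    rw [inner_component, inner_zero_right]
    exact hT.OrthogonalFamily hk.symm v (u k)
  have := hasSum_single m h2
  rwa [component_self] at this

theorem ext_component (hT : IsHilbertSum ℂ (fun _ : ι => K) T) {U V : H}
    (h : ∀ m, component T m U = component T m V) : U = V := by
  refine (hasSum_component hT U).unique ?_
  simp only [h]
  exact hasSum_component hT V

variable {P : H →ₗ.[ℂ] H} {p : ι → K →ₗ.[ℂ] K}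

/-- A reducing part of `P` has its spectrum in the spectrum of `P`. -/
theorem resolventSet_subset_of_reducing
    (h1 : ∀ m u f, (u, f) ∈ (p m).graph → (T m u, T m f) ∈ P.graph)
    (h2 : ∀ m U F, (U, F) ∈ P.graph → (component T m U, component T m F) ∈ (p m).graph) (m : ι) :
    resolventSet P ⊆ resolventSet (p m) := by
  intro z hz
  obtain ⟨hs, C, hC⟩ := mem_resolventSet_iff.1 hz
  refine mem_resolventSet_iff.2 ⟨fun f => ?_, C, fun u g hug => ?_⟩
  · obtain ⟨U, hU⟩ := hs (T m f)
    refine ⟨component T m U, ?_⟩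
    have := h2 m _ _ hU
    rwa [map_add, map_smul, component_self] at this
  · have := hC _ _ (h1 m u g hug)
    rwa [← map_smul, ← map_sub, LinearIsometry.norm_map, LinearIsometry.norm_map] at this

/-- If `P - z` is onto and the resolvents of the parts of `P` are uniformly bounded, then `z` is
in the resolvent set of `P`. -/
theorem mem_resolventSet_of_reducing (hT : IsHilbertSum ℂ (fun _ : ι => K) T)
    (h2 : ∀ m U F, (U, F) ∈ P.graph → (component T m U, component T m F) ∈ (p m).graph) {z : ℂ}
    {C : ℝ} (hC : ∀ m u g, (u, g) ∈ (p m).graph → ‖u‖ ≤ C * ‖g - z • u‖)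
    (hs : ∀ F, ∃ U, (U, F + z • U) ∈ P.graph) : z ∈ resolventSet P := by
  refine mem_resolventSet_iff.2 ⟨hs, |C|, fun U G hUG => ?_⟩
  have h3 := hasSum_norm_sq_component hT U
  have h4 := (hasSum_norm_sq_component hT (G - z • U)).mul_left (C ^ 2)
  have h5 : ‖U‖ ^ 2 ≤ C ^ 2 * ‖G - z • U‖ ^ 2 := by
    refine hasSum_le (fun m => ?_) h3 h4
    have := hC m _ _ (h2 m _ _ hUG)
    rw [map_sub, map_smul, ← mul_pow]
    exact pow_le_pow_left₀ (norm_nonneg _) this 2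
  refine le_of_sq_le_sq ?_ (by positivity)
  rwa [mul_pow, sq_abs]

end Abstract

/-! ### Calculus of weak derivatives -/

section Weak

set_option linter.unusedSectionVars false

variable {E F G : Type*} [NormedAddCommGroup E] [NormedSpace ℝ E] [MeasureSpace E] [BorelSpace E]
  [NormedAddCommGroup F] [NormedSpace ℝ F] [NormedAddCommGroup G] [NormedSpace ℝ G]
  {Ω : Set E} {v w : E} {u g g' : E → F}

theorem memLp_locallyIntegrableOn [IsLocallyFiniteMeasure (volume : Measure E)]
    (hu : MemLp u 2 (volume.restrict Ω)) : LocallyIntegrableOn u Ω :=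
  locallyIntegrableOn_of_locallyIntegrable_restrict (hu.locallyIntegrable (by norm_num))

theorem integrable_continuous_smul (hu : LocallyIntegrableOn u Ω) {η : E → ℝ}
    (hη : Continuous η) (hc : HasCompactSupport η) (hs : tsupport η ⊆ Ω) :
    Integrable (fun x => η x • u x) := by
  have h1 : IntegrableOn u (tsupport η) := hu.integrableOn_compact_subset hs hc
  have h2 : IntegrableOn (fun x => η x • u x) (tsupport η) :=
    IntegrableOn.continuousOn_smul h1 hη.continuousOn hc
  rw [← integrableOn_iff_integrable_of_support_subset (s := tsupport η)]
  · exact h2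
  · intro x hx
    apply subset_tsupport
    intro h0
    apply hx
    simp [h0]

theorem IsTestFunction.fderiv_apply {η : E → F} (hη : IsTestFunction Ω η) (v : E) :
    IsTestFunction Ω (fun x => fderiv ℝ η x v) :=
  ⟨(hη.1.fderiv_right (m := ∞) (by simp)).clm_apply contDiff_const,
    hη.2.1.fderiv_apply (𝕜 := ℝ) v, (tsupport_fderiv_apply_subset ℝ v).trans hη.2.2⟩

theorem IsTestFunction.eq_zero {η : E → F} (hη : IsTestFunction Ω η) {x : E} (hx : x ∉ Ω) :
    η x = 0 := by
  by_contra h0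
  exact hx (hη.2.2 (subset_tsupport η h0))

theorem IsTestFunction.mono {Ω' : Set E} {η : E → F} (hη : IsTestFunction Ω η) (h : Ω ⊆ Ω') :
    IsTestFunction Ω' η :=
  ⟨hη.1, hη.2.1, hη.2.2.trans h⟩

theorem IsTestFunction.clm {η : E → F} (hη : IsTestFunction Ω η) (L : F →L[ℝ] G) :
    IsTestFunction Ω (fun x => L (η x)) := by
  refine ⟨L.contDiff.comp hη.1, hη.2.1.comp_left (g := L) (map_zero L), ?_⟩
  refine (closure_mono fun x hx => ?_).trans hη.2.2
  intro h0
  apply hx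
  simp [h0]

theorem IsTestFunction.smul_const {η : E → ℝ} (hη : IsTestFunction Ω η) (c : F) :
    IsTestFunction Ω (fun x => η x • c) :=
  hη.clm ((ContinuousLinearMap.id ℝ ℝ).smulRight c)

theorem contDiff_of_tsupport_subset (hΩ : IsOpen Ω) {η : E → F} (hη : ContDiffOn ℝ ∞ η Ω)
    (hs : tsupport η ⊆ Ω) : ContDiff ℝ ∞ η := by
  rw [contDiff_iff_contDiffAt]
  intro x
  by_cases hx : x ∈ Ω
  · exact hη.contDiffAt (hΩ.mem_nhds hx)
  · have : x ∉ tsupport η := fun h => hx (hs h)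
    refine (contDiffAt_const (c := (0 : F))).congr_of_eventuallyEq ?_
    exact notMem_tsupport_iff_eventuallyEq.1 this

theorem IsTestFunction.smooth_smul {𝕜 : Type*} [NontriviallyNormedField 𝕜] [NormedAlgebra ℝ 𝕜]
    [NormedSpace 𝕜 F] [IsScalarTower ℝ 𝕜 F]
    (hΩ : IsOpen Ω) {a : E → 𝕜} (ha : ContDiffOn ℝ ∞ a Ω) {η : E → F}
    (hη : IsTestFunction Ω η) : IsTestFunction Ω (fun x => a x • η x) := by
  have hs : tsupport (fun x => a x • η x) ⊆ tsupport η :=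
    closure_mono (Function.support_smul_subset_right a η)
  refine ⟨contDiff_of_tsupport_subset hΩ (ha.smul hη.1.contDiffOn) (hs.trans hη.2.2),
    hη.2.1.smul_left, hs.trans hη.2.2⟩

theorem integral_test (hη : ∀ x ∉ Ω, u x = 0) : ∫ x in Ω, u x = ∫ x, u x :=
  setIntegral_eq_integral_of_forall_compl_eq_zero hη

theorem HasWeakDeriv.clm (h : HasWeakDeriv Ω v u g) [CompleteSpace F] [CompleteSpace G]
    (L : F →L[ℝ] G) : HasWeakDeriv Ω v (fun x => L (u x)) (fun x => L (g x)) := by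
  have hl : ∀ {f : E → F}, LocallyIntegrableOn f Ω → LocallyIntegrableOn (fun x => L (f x)) Ω := by
    intro f hf x hx
    obtain ⟨s, hs, hi⟩ := hf x hx
    exact ⟨s, hs, L.integrable_comp hi⟩
  refine ⟨hl h.1, hl h.2.1, fun η hη => ?_⟩
  have h1 := integrable_continuous_smul h.1 ((hη.fderiv_apply v).1.continuous)
    (hη.fderiv_apply v).2.1 (hη.fderiv_apply v).2.2
  have h2 := integrable_continuous_smul h.2.1 hη.1.continuous hη.2.1 hη.2.2
  simp only [← map_smul]
  rw [L.integral_comp_comm h1.integrableOn, L.integral_comp_comm h2.integrableOn, h.2.2 η hη,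
    map_neg]

theorem HasWeakDeriv.add' {u' : E → F} (h : HasWeakDeriv Ω v u g) (h' : HasWeakDeriv Ω v u' g') :
    HasWeakDeriv Ω v (fun x => u x + u' x) (fun x => g x + g' x) := by
  refine ⟨h.1.add h'.1, h.2.1.add h'.2.1, fun η hη => ?_⟩
  have hη' := hη.fderiv_apply v
  simp only [smul_add]
  rw [integral_add, integral_add, h.2.2 η hη, h'.2.2 η hη, neg_add]
  · exact (integrable_continuous_smul h.2.1 hη.1.continuous hη.2.1 hη.2.2).integrableOn
  · exact (integrable_continuous_smul h'.2.1 hη.1.continuous hη.2.1 hη.2.2).integrableOn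
  · exact (integrable_continuous_smul h.1 hη'.1.continuous hη'.2.1 hη'.2.2).integrableOn
  · exact (integrable_continuous_smul h'.1 hη'.1.continuous hη'.2.1 hη'.2.2).integrableOn

theorem locallyIntegrableOn_congr_ae {f f' : E → F} (hf : LocallyIntegrableOn f Ω)
    (h : f' =ᵐ[volume.restrict Ω] f) : LocallyIntegrableOn f' Ω := by
  intro x hx
  obtain ⟨s, hs, hi⟩ := hf x hx
  refine ⟨s ∩ Ω, Filter.inter_mem hs self_mem_nhdsWithin, ?_⟩
  exact (hi.mono_set Set.inter_subset_left).congr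
    (ae_mono (Measure.restrict_mono Set.inter_subset_right le_rfl) h.symm)

theorem HasWeakDeriv.congr₂ {u' : E → F} (h : HasWeakDeriv Ω v u g)
    (hu : u' =ᵐ[volume.restrict Ω] u) (hg : g' =ᵐ[volume.restrict Ω] g) :
    HasWeakDeriv Ω v u' g' := by
  refine ⟨locallyIntegrableOn_congr_ae h.1 hu, locallyIntegrableOn_congr_ae h.2.1 hg, fun η hη => ?_⟩
  have h1 : ∫ x in Ω, (fderiv ℝ η x v) • u' x = ∫ x in Ω, (fderiv ℝ η x v) • u x := by
    apply integral_congr_ae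
    filter_upwards [hu] with x hx
    rw [hx]
  have h2 : ∫ x in Ω, η x • g' x = ∫ x in Ω, η x • g x := by
    apply integral_congr_ae
    filter_upwards [hg] with x hx
    rw [hx]
  rw [h1, h2, h.2.2 η hη]

/-- Weak derivatives depend linearly on the direction. -/
theorem HasWeakDeriv.dir_add (h : HasWeakDeriv Ω v u g) (h' : HasWeakDeriv Ω w u g') (a b : ℝ) :
    HasWeakDeriv Ω (a • v + b • w) u (fun x => a • g x + b • g' x) := by
  have hl : ∀ {f : E → F} (c : ℝ), LocallyIntegrableOn f Ω →
      LocallyIntegrableOn (fun x => c • f x) Ω := by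
    intro f c hf x hx
    obtain ⟨s, hs, hi⟩ := hf x hx
    exact ⟨s, hs, Integrable.smul c hi⟩
  refine ⟨h.1, (hl a h.2.1).add (hl b h'.2.1), fun η hη => ?_⟩
  have i1 := integrable_continuous_smul h.1 (hη.fderiv_apply v).1.continuous
    (hη.fderiv_apply v).2.1 (hη.fderiv_apply v).2.2
  have i2 := integrable_continuous_smul h.1 (hη.fderiv_apply w).1.continuous
    (hη.fderiv_apply w).2.1 (hη.fderiv_apply w).2.2
  have i3 := integrable_continuous_smul h.2.1 hη.1.continuous hη.2.1 hη.2.2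
  have i4 := integrable_continuous_smul h'.2.1 hη.1.continuous hη.2.1 hη.2.2
  have e1 : ∀ x, (fderiv ℝ η x (a • v + b • w)) • u x =
      a • (fderiv ℝ η x v • u x) + b • (fderiv ℝ η x w • u x) := by
    intro x
    simp only [map_add, map_smul, smul_eq_mul]
    module
  have e2 : ∀ x, η x • (a • g x + b • g' x) = a • (η x • g x) + b • (η x • g' x) := by
    intro x
    module
  simp only [e1, e2]
  rw [integral_add (i1.integrableOn.integrable.fun_smul a) (i2.integrableOn.integrable.fun_smul b),
    integral_add (i3.integrableOn.integrable.fun_smul a) (i4.integrableOn.integrable.fun_smul b)]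
  simp only [integral_smul, h.2.2 η hη, h'.2.2 η hη]
  module

variable [FiniteDimensional ℝ E]

/-- Weak derivatives are unique. -/
theorem HasWeakDeriv.ae_eq [CompleteSpace F] (hΩ : IsOpen Ω) (h : HasWeakDeriv Ω v u g)
    (h' : HasWeakDeriv Ω v u g') : g =ᵐ[volume.restrict Ω] g' := by
  have key := hΩ.ae_eq_zero_of_integral_contDiff_smul_eq_zero (h.2.1.sub h'.2.1)
    (fun η h1 h2 h3 => ?_)
  · refine (ae_restrict_iff' hΩ.measurableSet).2 ?_
    filter_upwards [key] with x hx hx'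
    exact sub_eq_zero.1 (hx hx')
  · have hη : IsTestFunction Ω η := ⟨h1, h2, h3⟩
    have i1 := integrable_continuous_smul h.2.1 h1.continuous h2 h3
    have i2 := integrable_continuous_smul h'.2.1 h1.continuous h2 h3
    have e := (h.2.2 η hη).symm.trans (h'.2.2 η hη)
    rw [neg_inj, integral_test (fun x hx => by simp [hη.eq_zero hx]),
      integral_test (fun x hx => by simp [hη.eq_zero hx])] at e
    simp only [Pi.sub_apply, smul_sub]
    rw [integral_sub i1 i2, e, sub_self]

/-- The product rule for a weakly differentiable function and a smooth one. -/
theorem HasWeakDeriv.smooth_smul (hΩ : IsOpen Ω) (h : HasWeakDeriv Ω v u g) {a : E → ℝ}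
    (ha : ContDiffOn ℝ ∞ a Ω) :
    HasWeakDeriv Ω v (fun x => a x • u x) (fun x => fderiv ℝ a x v • u x + a x • g x) := by
  have hl : ∀ {f : E → F} {b : E → ℝ}, ContinuousOn b Ω → LocallyIntegrableOn f Ω →
      LocallyIntegrableOn (fun x => b x • f x) Ω := fun hb hf =>
    hf.continuousOn_smul hΩ.isLocallyClosed hb
  have hda : ContinuousOn (fun x => fderiv ℝ a x v) Ω :=
    (ha.continuousOn_fderiv_of_isOpen hΩ (by simp)).clm_apply continuousOn_const
  have l1 : LocallyIntegrableOn (fun x => fderiv ℝ a x v • u x) Ω := hl hda h.1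
  have l2 : LocallyIntegrableOn (fun x => a x • g x) Ω := hl ha.continuousOn h.2.1
  refine ⟨hl ha.continuousOn h.1, l1.add l2, fun η hη => ?_⟩
  have hη' := hη.smooth_smul hΩ ha
  have e := h.2.2 _ hη'
  have e1 : ∀ x ∈ Ω, fderiv ℝ (fun x => a x • η x) x v • u x =
      fderiv ℝ η x v • a x • u x + η x • fderiv ℝ a x v • u x := by
    intro x hx
    have d1 : DifferentiableAt ℝ a x :=
      (ha.contDiffAt (hΩ.mem_nhds hx)).differentiableAt (by simp)
    have d2 : DifferentiableAt ℝ η x := hη.1.differentiable (by simp) x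
    rw [fderiv_fun_smul d1 d2]
    simp only [add_apply, smul_apply, smul_eq_mul,
      ContinuousLinearMap.smulRight_apply]
    module
  rw [setIntegral_congr_fun hΩ.measurableSet e1] at e
  have i1 := integrable_continuous_smul (hl ha.continuousOn h.1)
    (hη.fderiv_apply v).1.continuous (hη.fderiv_apply v).2.1 (hη.fderiv_apply v).2.2
  have i2 := integrable_continuous_smul l1 hη.1.continuous hη.2.1 hη.2.2
  have i3 := integrable_continuous_smul l2 hη.1.continuous hη.2.1 hη.2.2
  rw [integral_add i1.integrableOn i2.integrableOn] at e
  simp only [smul_add]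
  rw [integral_add i2.integrableOn i3.integrableOn, eq_sub_of_add_eq e]
  have e3 : ∀ x, (a x • η x) • g x = η x • a x • g x := by
    intro x
    rw [smul_eq_mul, mul_comm, mul_smul]
  simp only [e3]
  abel

variable [(volume : Measure E).IsAddHaarMeasure]

/-- Classical derivatives are weak derivatives. -/
theorem HasWeakDeriv.of_contDiffOn (hΩ : IsOpen Ω) (hu : ContDiffOn ℝ 1 u Ω) :
    HasWeakDeriv Ω v u (fun x => fderiv ℝ u x v) := by
  have hdu : ContinuousOn (fun x => fderiv ℝ u x v) Ω :=
    (hu.continuousOn_fderiv_of_isOpen hΩ (by simp)).clm_apply continuousOn_const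
  have l1 := hu.continuousOn.locallyIntegrableOn (μ := volume) hΩ.measurableSet
  have l2 := hdu.locallyIntegrableOn (μ := volume) hΩ.measurableSet
  refine ⟨l1, l2, fun η hη => ?_⟩
  have hη' := hη.fderiv_apply v
  rw [integral_test (fun x hx => by simp [hη'.eq_zero hx]),
    integral_test (fun x hx => by simp [hη.eq_zero hx]), eq_comm, neg_eq_iff_eq_neg]
  -- the cut-off function vanishes off `Ω`, so only points of its support matter
  have d : ∀ x ∈ tsupport η, DifferentiableAt ℝ u x := fun x hx =>
    (hu.contDiffAt (hΩ.mem_nhds (hη.2.2 hx))).differentiableAt (by simp)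
  exact integral_bilinear_hasLineDerivAt_right_eq_neg_left_of_integrable
    (B := ContinuousLinearMap.lsmul ℝ ℝ) (f := η) (g := u) (f' := fun x => fderiv ℝ η x v)
    (g' := fun x => fderiv ℝ u x v) (μ := volume)
    (integrable_continuous_smul l1 hη'.1.continuous hη'.2.1 hη'.2.2)
    (integrable_continuous_smul l2 hη.1.continuous hη.2.1 hη.2.2)
    (integrable_continuous_smul l1 hη.1.continuous hη.2.1 hη.2.2)
    (fun x _ => (hη.1.differentiable (by simp) x).hasFDerivAt.hasLineDerivAt v)
    (fun x hx => (d x hx).hasFDerivAt.hasLineDerivAt v)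

theorem tendsto_integral_test_smul {η : E → ℝ}
    (hη : Continuous η) (hc : HasCompactSupport η) {un : ℕ → E → F}
    (hun : ∀ n, MemLp (un n) 2 (volume.restrict Ω)) (hu : MemLp u 2 (volume.restrict Ω))
    (h : Tendsto (fun n => eLpNorm (fun x => un n x - u x) 2 (volume.restrict Ω)) atTop (𝓝 0)) :
    Tendsto (fun n => ∫ x in Ω, η x • un n x) atTop (𝓝 (∫ x in Ω, η x • u x)) := by
  have hη2 : MemLp η 2 (volume.restrict Ω) := hη.memLp_of_hasCompactSupport hc
  have hi : ∀ {f : E → F}, MemLp f 2 (volume.restrict Ω) →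
      Integrable (fun x => η x • f x) (volume.restrict Ω) := by
    intro f hf
    exact memLp_one_iff_integrable.1 (hf.smul hη2)
  refine tendsto_integral_of_L1 _ (hi hu).aestronglyMeasurable
    (Eventually.of_forall fun n => hi (hun n)) ?_
  have hb : ∀ n, ∫⁻ x in Ω, ‖η x • un n x - η x • u x‖ₑ ≤
      eLpNorm η 2 (volume.restrict Ω) *
        eLpNorm (fun x => un n x - u x) 2 (volume.restrict Ω) := by
    intro n
    have := eLpNorm_smul_le_mul_eLpNorm (p := 2) (q := 2) (r := 1)
      ((hun n).sub hu).aestronglyMeasurable hη2.aestronglyMeasurable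
    rw [eLpNorm_one_eq_lintegral_enorm] at this
    refine le_trans (le_of_eq ?_) this
    refine lintegral_congr fun x => ?_
    simp [smul_sub]
  have h0 := ENNReal.Tendsto.const_mul h (Or.inr hη2.eLpNorm_ne_top)
  rw [mul_zero] at h0
  exact tendsto_of_tendsto_of_tendsto_of_le_of_le tendsto_const_nhds h0 (fun _ => zero_le) hb

/-- The weak derivative is a closed operator of `L²`. -/
theorem HasWeakDeriv.of_tendsto {un gn : ℕ → E → F} (h : ∀ n, HasWeakDeriv Ω v (un n) (gn n))
    (hun : ∀ n, MemLp (un n) 2 (volume.restrict Ω)) (hu : MemLp u 2 (volume.restrict Ω))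
    (hgn : ∀ n, MemLp (gn n) 2 (volume.restrict Ω)) (hg : MemLp g 2 (volume.restrict Ω))
    (h1 : Tendsto (fun n => eLpNorm (fun x => un n x - u x) 2 (volume.restrict Ω)) atTop (𝓝 0))
    (h2 : Tendsto (fun n => eLpNorm (fun x => gn n x - g x) 2 (volume.restrict Ω)) atTop (𝓝 0)) :
    HasWeakDeriv Ω v u g := by
  refine ⟨memLp_locallyIntegrableOn hu, memLp_locallyIntegrableOn hg, fun η hη => ?_⟩
  have hη' := hη.fderiv_apply v
  have t1 := tendsto_integral_test_smul hη'.1.continuous hη'.2.1 hun hu h1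
  have t2 := (tendsto_integral_test_smul hη.1.continuous hη.2.1 hgn hg h2).neg
  refine tendsto_nhds_unique t1 (t2.congr fun n => ?_)
  rw [(h n).2.2 η hη]

theorem IsTestFunction.hasWeakDeriv (hΩ : IsOpen Ω) {η : E → F} (hη : IsTestFunction Ω η) (v : E) :
    HasWeakDeriv Ω v η (fun x => fderiv ℝ η x v) :=
  HasWeakDeriv.of_contDiffOn hΩ (hη.1.of_le (by simp)).contDiffOn

theorem IsTestFunction.memLp {η : E → F} (hη : IsTestFunction Ω η) :
    MemLp η 2 (volume.restrict Ω) :=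
  hη.1.continuous.memLp_of_hasCompactSupport hη.2.1

/-- A function of `H¹₀` has weak derivatives, the limits of those of the test functions. -/
theorem hasWeakDeriv_of_tendsto_test (hΩ : IsOpen Ω) {η : ℕ → E → F}
    (hη : ∀ n, IsTestFunction Ω (η n)) (hu : MemLp u 2 (volume.restrict Ω))
    (hg : MemLp g 2 (volume.restrict Ω))
    (h1 : Tendsto (fun n => eLpNorm (fun x => η n x - u x) 2 (volume.restrict Ω)) atTop (𝓝 0))
    (h2 : Tendsto (fun n => eLpNorm (fun x => fderiv ℝ (η n) x v - g x) 2 (volume.restrict Ω))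
      atTop (𝓝 0)) : HasWeakDeriv Ω v u g :=
  HasWeakDeriv.of_tendsto (fun n => (hη n).hasWeakDeriv hΩ v) (fun n => (hη n).memLp) hu
    (fun n => ((hη n).fderiv_apply v).memLp) hg h1 h2

end Weak

/-! ### Spinor-valued Sobolev functions -/

section SpinorWeak

set_option linter.unusedSectionVars false

variable {E : Type*} [NormedAddCommGroup E] [NormedSpace ℝ E] [MeasureSpace E] [BorelSpace E]
  {Ω : Set E} {v w : E} {u g g' : E → Spinor}

/-- A real basis of `ℂ²`, used to reduce spinor-valued test functions to real-valued ones. -/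
def spinBasis : Module.Basis (Fin (Module.finrank ℝ Spinor)) ℝ Spinor := Module.finBasis ℝ Spinor

/-- The real coordinates of a spinor in `spinBasis`. -/
def spinCoord (k : Fin (Module.finrank ℝ Spinor)) : Spinor →L[ℝ] ℝ :=
  LinearMap.toContinuousLinearMap (spinBasis.coord k)

theorem sum_spinCoord (a : Spinor) : ∑ k, spinCoord k a • spinBasis k = a :=
  spinBasis.sum_repr a

theorem inner_real_smul_left (r : ℝ) (x y : Spinor) :
    inner ℂ (r • x) y = (r : ℂ) * inner ℂ x y := by
  rw [← Complex.coe_smul, inner_smul_left, Complex.conj_ofReal]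

theorem inner_real_smul_right (r : ℝ) (x y : Spinor) :
    inner ℂ x (r • y) = (r : ℂ) * inner ℂ x y := by
  rw [← Complex.coe_smul, inner_smul_right]

theorem inner_eq_sum_spinCoord (a b : Spinor) :
    inner ℂ a b = ∑ k, inner ℂ (spinBasis k) (spinCoord k a • b) := by
  conv_lhs => rw [← sum_spinCoord a]
  rw [sum_inner]
  refine Finset.sum_congr rfl fun k _ => ?_
  rw [inner_real_smul_left, inner_real_smul_right]

theorem integrable_inner_test {η : E → Spinor} (hη : IsTestFunction Ω η)
    (hu : LocallyIntegrableOn u Ω) :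
    Integrable (fun x => inner ℂ (η x) (u x)) (volume.restrict Ω) := by
  have he : (fun x => inner ℂ (η x) (u x)) = _ :=
    funext fun x => inner_eq_sum_spinCoord (η x) (u x)
  rw [he]
  refine integrable_finsetSum _ fun k _ => Integrable.const_inner _ ?_
  have h1 := hη.clm (spinCoord k)
  exact (integrable_continuous_smul hu h1.1.continuous h1.2.1 h1.2.2).integrableOn

theorem integral_inner_test {η : E → Spinor} (hη : IsTestFunction Ω η)
    (hu : LocallyIntegrableOn u Ω) :
    ∫ x in Ω, inner ℂ (η x) (u x) =
      ∑ k, inner ℂ (spinBasis k) (∫ x in Ω, spinCoord k (η x) • u x) := by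
  have hi : ∀ k, Integrable (fun x => spinCoord k (η x) • u x) (volume.restrict Ω) := fun k =>
    (integrable_continuous_smul hu (hη.clm (spinCoord k)).1.continuous (hη.clm (spinCoord k)).2.1
      (hη.clm (spinCoord k)).2.2).integrableOn
  have he : (fun x => inner ℂ (η x) (u x)) = _ :=
    funext fun x => inner_eq_sum_spinCoord (η x) (u x)
  rw [he]
  rw [integral_finsetSum _ fun k _ => (hi k).const_inner _]
  exact Finset.sum_congr rfl fun k _ => integral_inner (hi k) _

/-- Weak derivatives can be tested against spinor-valued test functions. -/
theorem HasWeakDeriv.inner_test (h : HasWeakDeriv Ω v u g) {η : E → Spinor}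
    (hη : IsTestFunction Ω η) :
    ∫ x in Ω, inner ℂ (fderiv ℝ η x v) (u x) = -∫ x in Ω, inner ℂ (η x) (g x) := by
  rw [integral_inner_test (hη.fderiv_apply v) h.1, integral_inner_test hη h.2.1,
    ← Finset.sum_neg_distrib]
  refine Finset.sum_congr rfl fun k _ => ?_
  rw [← inner_neg_right, ← h.2.2 _ (hη.clm (spinCoord k))]
  congr 1
  refine integral_congr_ae (Eventually.of_forall fun x => ?_)
  have hd : DifferentiableAt ℝ η x := hη.1.differentiable (by simp) x
  have : fderiv ℝ (fun x => spinCoord k (η x)) x = (spinCoord k).comp (fderiv ℝ η x) :=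
    ((spinCoord k).hasFDerivAt.comp x hd.hasFDerivAt).fderiv
  simp only [this]
  rfl

variable [FiniteDimensional ℝ E] [(volume : Measure E).IsAddHaarMeasure]

/-- Test functions are dense in `L²(Ω, ℂ²)`. -/
theorem exists_tendsto_test (hΩ : IsOpen Ω) (hu : MemLp u 2 (volume.restrict Ω)) :
    ∃ η : ℕ → E → Spinor, (∀ n, IsTestFunction Ω (η n)) ∧
      Tendsto (fun n => eLpNorm (fun x => η n x - u x) 2 (volume.restrict Ω)) atTop (𝓝 0) := by
  let K : Submodule ℂ (Lp Spinor 2 (volume.restrict Ω)) :=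
    { carrier := {f | ∃ η : E → Spinor, IsTestFunction Ω η ∧ f =ᵐ[volume.restrict Ω] η}
      add_mem' := by
        rintro f g ⟨η, h1, h2⟩ ⟨ξ, h3, h4⟩
        refine ⟨_, h1.add h3, ?_⟩
        filter_upwards [Lp.coeFn_add f g, h2, h4] with x e1 e2 e3
        rw [e1, Pi.add_apply, e2, e3]
      zero_mem' := by
        refine ⟨fun _ => 0, ⟨contDiff_const, HasCompactSupport.zero, by simp [tsupport]⟩, ?_⟩
        exact Lp.coeFn_zero _ _ _
      smul_mem' := by
        rintro c f ⟨η, h1, h2⟩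
        refine ⟨_, h1.smul c, ?_⟩
        filter_upwards [Lp.coeFn_smul c f, h2] with x e1 e2
        rw [e1, Pi.smul_apply, e2] }
  have hK : K.topologicalClosure = ⊤ := by
    rw [Submodule.topologicalClosure_eq_top_iff, Submodule.eq_bot_iff]
    intro f hf
    have hl := memLp_locallyIntegrableOn (Lp.memLp f)
    refine Lp.eq_zero_iff_ae_eq_zero.2 ?_
    refine (ae_restrict_iff' hΩ.measurableSet).2
      (hΩ.ae_eq_zero_of_integral_contDiff_smul_eq_zero hl fun η h1 h2 h3 => ?_)
    have hη : IsTestFunction Ω η := ⟨h1, h2, h3⟩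
    refine ext_inner_left ℂ fun a => ?_
    have hi := integrable_continuous_smul hl h1.continuous h2 h3
    rw [inner_zero_right, ← integral_inner hi]
    have hηa := hη.smul_const a
    have hmem : MemLp (fun x => η x • a) 2 (volume.restrict Ω) := hηa.memLp
    have := (Submodule.mem_orthogonal K f).1 hf (hmem.toLp _) ⟨_, hηa, hmem.coeFn_toLp⟩
    rw [L2.inner_def] at this
    rw [← integral_test (Ω := Ω) (fun x hx => by simp [hη.eq_zero hx]), ← this]
    refine integral_congr_ae ?_
    filter_upwards [hmem.coeFn_toLp] with x hx
    rw [hx, ← Complex.coe_smul, ← Complex.coe_smul, inner_smul_right, inner_smul_left,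
      Complex.conj_ofReal]
  have hmem : hu.toLp u ∈ closure (K : Set (Lp Spinor 2 (volume.restrict Ω))) := by
    rw [← Submodule.topologicalClosure_coe, hK]
    trivial
  obtain ⟨f, hfK, hf⟩ := mem_closure_iff_seq_limit.1 hmem
  choose η hη hfη using hfK
  refine ⟨η, hη, ?_⟩
  have h2 := (Lp.tendsto_Lp_iff_tendsto_eLpNorm' f (hu.toLp u)).1 hf
  refine h2.congr fun n => eLpNorm_congr_ae ?_
  filter_upwards [hfη n, hu.coeFn_toLp] with x e1 e2
  simp [e1, e2]

end SpinorWeak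

section Plane

variable {Ω : Set (ℝ × ℝ)} {U G₁ G₂ : ℝ × ℝ → Spinor}

theorem dir_decomp (v : ℝ × ℝ) : v.1 • ((1, 0) : ℝ × ℝ) + v.2 • ((0, 1) : ℝ × ℝ) = v := by
  ext <;> simp

theorem memLp_comb {μ : Measure (ℝ × ℝ)} (h1 : MemLp G₁ 2 μ) (h2 : MemLp G₂ 2 μ) (a b : ℝ) :
    MemLp (fun x => a • G₁ x + b • G₂ x) 2 μ :=
  (h1.const_smul a).add (h2.const_smul b)

/-- It suffices to differentiate in the directions of the two coordinates. -/
theorem memH2_of_plane (hU : MemLp U 2 (volume.restrict Ω))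
    {G : Fin 2 → ℝ × ℝ → Spinor} (hG : ∀ i, MemLp (G i) 2 (volume.restrict Ω))
    (hUG : ∀ i, HasWeakDeriv Ω (![(1, 0), (0, 1)] i) U (G i))
    {K : Fin 2 → Fin 2 → ℝ × ℝ → Spinor} (hK : ∀ i j, MemLp (K i j) 2 (volume.restrict Ω))
    (hGK : ∀ i j, HasWeakDeriv Ω (![(1, 0), (0, 1)] j) (G i) (K i j)) : MemH2 Ω U := by
  refine ⟨hU, fun v => ⟨_, memLp_comb (hG 0) (hG 1) v.1 v.2, ?_, fun w => ?_⟩⟩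
  · have := (hUG 0).dir_add (hUG 1) v.1 v.2
    simpa only [Matrix.cons_val_zero, Matrix.cons_val_one, dir_decomp] using this
  · have h0 := ((hGK 0 0).dir_add (hGK 0 1) w.1 w.2)
    have h1 := ((hGK 1 0).dir_add (hGK 1 1) w.1 w.2)
    simp only [Matrix.cons_val_zero, Matrix.cons_val_one, dir_decomp] at h0 h1
    refine ⟨_, memLp_comb (memLp_comb (hK 0 0) (hK 0 1) w.1 w.2)
      (memLp_comb (hK 1 0) (hK 1 1) w.1 w.2) v.1 v.2, ?_⟩
    have s0 := h0.smul (v.1 : ℂ)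
    have s1 := h1.smul (v.2 : ℂ)
    simp only [Complex.coe_smul] at s0 s1
    exact s0.add s1

/-- Membership in `H¹₀`, by approximation in the two coordinate directions with an arbitrary error.
-/
theorem memH10_of_approx (hU : MemLp U 2 (volume.restrict Ω))
    (h1 : MemLp G₁ 2 (volume.restrict Ω)) (h2 : MemLp G₂ 2 (volume.restrict Ω))
    (h : ∀ ε : ℝ≥0∞, 0 < ε → ∃ η : ℝ × ℝ → Spinor, IsTestFunction Ω η ∧
      eLpNorm (fun x => η x - U x) 2 (volume.restrict Ω) ≤ ε ∧
      eLpNorm (fun x => fderiv ℝ η x (1, 0) - G₁ x) 2 (volume.restrict Ω) ≤ ε ∧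
      eLpNorm (fun x => fderiv ℝ η x (0, 1) - G₂ x) 2 (volume.restrict Ω) ≤ ε) :
    MemH10 Ω U := by
  have hpos : ∀ n : ℕ, (0 : ℝ≥0∞) < ((n : ℝ≥0∞) + 1)⁻¹ := fun n => by
    rw [ENNReal.inv_pos]
    exact ENNReal.add_ne_top.2 ⟨ENNReal.natCast_ne_top n, ENNReal.one_ne_top⟩
  have hlim : Tendsto (fun n : ℕ => ((n : ℝ≥0∞) + 1)⁻¹) atTop (𝓝 0) := by
    have := (tendsto_add_atTop_iff_nat (f := fun n : ℕ => ((n : ℝ≥0∞))⁻¹) 1).2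
      ENNReal.tendsto_inv_nat_nhds_zero
    simpa using this
  choose η hη a b c using fun n : ℕ => h _ (hpos n)
  have sq : ∀ {f : ℕ → ℝ≥0∞}, (∀ n, f n ≤ ((n : ℝ≥0∞) + 1)⁻¹) → Tendsto f atTop (𝓝 0) :=
    fun hf => tendsto_of_tendsto_of_tendsto_of_le_of_le tendsto_const_nhds hlim
      (fun _ => zero_le) hf
  refine ⟨hU, η, hη, sq a, fun v => ⟨_, memLp_comb h1 h2 v.1 v.2, ?_⟩⟩
  have t1 := tendsto_smul_aux (v.1 : ℂ) (sq b)
  have t2 := tendsto_smul_aux (v.2 : ℂ) (sq c)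
  have t := tendsto_add_aux (fun n => ((hη n).aesm_fderiv (1, 0)).const_smul (v.1 : ℂ))
    (fun n => ((hη n).aesm_fderiv (0, 1)).const_smul (v.2 : ℂ))
    (h1.1.const_smul (v.1 : ℂ)) (h2.1.const_smul (v.2 : ℂ)) t1 t2
  refine t.congr fun n => ?_
  congr 1
  funext x
  have : fderiv ℝ (η n) x v = v.1 • fderiv ℝ (η n) x (1, 0) + v.2 • fderiv ℝ (η n) x (0, 1) := by
    rw [← map_smul, ← map_smul, ← map_add, dir_decomp]
  rw [this]
  simp only [Pi.smul_apply, Complex.coe_smul]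

end Plane

/-! ### Sobolev functions on an interval -/

section Interval

set_option linter.unusedSectionVars false

variable {F : Type*} [NormedAddCommGroup F] [NormedSpace ℝ F] [CompleteSpace F] {a b : ℝ}

theorem contDiff_primitive {ζ : ℝ → F} (hζ : ContDiff ℝ ∞ ζ) (a : ℝ) :
    ContDiff ℝ ∞ (fun x => ∫ t in a..x, ζ t) := by
  have hd : ∀ x, HasDerivAt (fun x => ∫ t in a..x, ζ t) (ζ x) x := fun x =>
    (hζ.continuous.integral_hasStrictDerivAt a x).hasDerivAt
  refine contDiff_infty_iff_deriv.2 ⟨fun x => (hd x).differentiableAt, ?_⟩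
  rwa [funext fun x => (hd x).deriv]

theorem fderiv_primitive {ζ : ℝ → F} (hζ : Continuous ζ) (a x v : ℝ) :
    fderiv ℝ (fun x => ∫ t in a..x, ζ t) x v = v • ζ x := by
  have hd : HasDerivAt (fun x => ∫ t in a..x, ζ t) (ζ x) x :=
    (hζ.integral_hasStrictDerivAt a x).hasDerivAt
  rw [hd.hasFDerivAt.fderiv]
  simp

/-- A test function of mean zero has a primitive which is a test function. -/
theorem IsTestFunction.primitive {ζ : ℝ → F} (hζ : IsTestFunction (Set.Ioo a b) ζ)
    (h0 : ∫ t in a..b, ζ t = 0) :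
    IsTestFunction (Set.Ioo a b) (fun x => ∫ t in a..x, ζ t) := by
  rcases (tsupport ζ).eq_empty_or_nonempty with he | hne
  · have hz : ζ = 0 := tsupport_eq_empty_iff.1 he
    subst hz
    simp only [Pi.zero_apply, intervalIntegral.integral_zero]
    exact hζ
  have hc : IsCompact (tsupport ζ) := hζ.2.1
  obtain ⟨l, hl, hl'⟩ := hc.exists_isLeast hne
  obtain ⟨r, hr, hr'⟩ := hc.exists_isGreatest hne
  have hlI := hζ.2.2 hl
  have hrI := hζ.2.2 hr
  have hz : ∀ t, t ∉ Set.Icc l r → ζ t = 0 := fun t ht => by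
    by_contra h
    exact ht ⟨hl' (subset_tsupport ζ h), hr' (subset_tsupport ζ h)⟩
  have hi : ∀ x y, IntervalIntegrable ζ volume x y := fun x y =>
    hζ.1.continuous.intervalIntegrable x y
  have hsupp : tsupport (fun x => ∫ t in a..x, ζ t) ⊆ Set.Icc l r := by
    refine closure_minimal (fun x hx => ?_) isClosed_Icc
    by_contra hx'
    apply hx
    rw [Set.mem_Icc, not_and_or, not_le, not_le] at hx'
    rcases hx' with h | h
    · refine intervalIntegral.integral_zero_ae (Eventually.of_forall fun t ht => hz t fun h' => ?_)
      rcases Set.mem_uIoc.1 ht with h2 | h2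
      · linarith [h'.1, h2.2]
      · linarith [h'.1, h2.2, hlI.1]
    · have e : ∫ t in x..b, ζ t = 0 := by
        refine intervalIntegral.integral_zero_ae
          (Eventually.of_forall fun t ht => hz t fun h' => ?_)
        rcases Set.mem_uIoc.1 ht with h2 | h2
        · linarith [h'.2, h2.1]
        · linarith [h'.2, h2.1, hrI.2]
      have := intervalIntegral.integral_add_adjacent_intervals (hi a x) (hi x b)
      rw [e, add_zero, h0] at this
      exact this
  exact ⟨contDiff_primitive hζ.1 a, isCompact_Icc.of_isClosed_subset (isClosed_tsupport _) hsupp,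
    hsupp.trans fun x hx => ⟨hlI.1.trans_le hx.1, hx.2.trans_lt hrI.2⟩⟩

theorem exists_test_integral_one (hab : a < b) :
    ∃ χ : ℝ → ℝ, IsTestFunction (Set.Ioo a b) χ ∧ ∫ t in a..b, χ t = 1 := by
  let f : ContDiffBump ((a + b) / 2) := ⟨(b - a) / 8, (b - a) / 4, by linarith, by linarith⟩
  have hs : tsupport (f.normed volume) ⊆ Set.Ioo a b := by
    rw [f.tsupport_normed_eq, Real.closedBall_eq_Icc]
    intro x hx
    have h1 : (a + b) / 2 - (b - a) / 4 ≤ x := hx.1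
    have h2 : x ≤ (a + b) / 2 + (b - a) / 4 := hx.2
    constructor <;> linarith
  refine ⟨f.normed volume, ⟨f.contDiff_normed, f.hasCompactSupport_normed, hs⟩, ?_⟩
  rw [intervalIntegral.integral_of_le hab.le, setIntegral_eq_integral_of_forall_compl_eq_zero,
    f.integral_normed]
  intro x hx
  by_contra h
  exact hx (Set.Ioo_subset_Ioc_self (hs (subset_tsupport _ h)))

theorem intervalIntegral_eq_Ioo (hab : a ≤ b) (f : ℝ → F) :
    ∫ t in a..b, f t = ∫ t in Set.Ioo a b, f t := by
  rw [intervalIntegral.integral_of_le hab, integral_Ioc_eq_integral_Ioo]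

/-- The lemma of du Bois-Reymond. -/
theorem ae_eq_const_of_hasWeakDeriv_zero (hab : a < b) {u : ℝ → F}
    (h : HasWeakDeriv (Set.Ioo a b) (1 : ℝ) u (fun _ => 0)) :
    ∃ c : F, u =ᵐ[volume.restrict (Set.Ioo a b)] fun _ => c := by
  obtain ⟨χ, hχ, hχ1⟩ := exists_test_integral_one hab
  refine ⟨∫ x in Set.Ioo a b, χ x • u x, ?_⟩
  set c := ∫ x in Set.Ioo a b, χ x • u x
  have hlc : LocallyIntegrableOn (fun _ : ℝ => c) (Set.Ioo a b) :=
    continuousOn_const.locallyIntegrableOn measurableSet_Ioo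
  have key := isOpen_Ioo.ae_eq_zero_of_integral_contDiff_smul_eq_zero (h.1.sub hlc)
    (fun η h1 h2 h3 => ?_)
  · refine (ae_restrict_iff' measurableSet_Ioo).2 ?_
    filter_upwards [key] with x hx hx'
    exact sub_eq_zero.1 (hx hx')
  · have hη : IsTestFunction (Set.Ioo a b) η := ⟨h1, h2, h3⟩
    set s := ∫ t in a..b, η t with hs
    have hζ : IsTestFunction (Set.Ioo a b) (fun x => η x + (-s) • χ x) :=
      hη.add ((hχ.clm ((-s) • ContinuousLinearMap.id ℝ ℝ)))
    have hζ0 : ∫ t in a..b, (η t + (-s) • χ t) = 0 := by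
      rw [intervalIntegral.integral_add (h1.continuous.intervalIntegrable _ _)
        ((hχ.1.continuous.fun_const_smul (-s)).intervalIntegrable _ _),
        intervalIntegral.integral_smul, hχ1, ← hs]
      simp
    have e := h.2.2 _ (hζ.primitive hζ0)
    have e1 : ∀ x, fderiv ℝ (fun x => ∫ t in a..x, (η t + (-s) • χ t)) x 1 =
        η x + (-s) • χ x := fun x => by
      rw [fderiv_primitive hζ.1.continuous, one_smul]
    simp only [e1, smul_zero, integral_zero, neg_zero, add_smul, smul_assoc] at e
    have i1 := integrable_continuous_smul h.1 h1.continuous h2 h3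
    have i2 := integrable_continuous_smul h.1 hχ.1.continuous hχ.2.1 hχ.2.2
    rw [integral_add i1.integrableOn (i2.integrableOn.integrable.fun_smul (-s)), integral_smul] at e
    have i3 : Integrable (fun x => η x • c) := integrable_continuous_smul hlc h1.continuous h2 h3
    simp only [Pi.sub_apply, smul_sub]
    rw [integral_sub i1 i3, integral_smul_const,
      ← integral_test (Ω := Set.Ioo a b) (fun x hx => by simp [hη.eq_zero hx]),
      ← integral_test (Ω := Set.Ioo a b) (u := η) (fun x hx => hη.eq_zero hx),
      ← intervalIntegral_eq_Ioo hab.le η, ← hs]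
    rw [neg_smul, ← sub_eq_add_neg] at e
    exact e

end Interval

section IntervalLp

variable {a b : ℝ} {u g : ℝ → Spinor}

theorem intervalIntegrable_of_memLp (hg : MemLp g 2 (volume.restrict (Set.Ioo a b))) {x y : ℝ}
    (hx : x ∈ Set.Icc a b) (hy : y ∈ Set.Icc a b) : IntervalIntegrable g volume x y := by
  have h1 : IntegrableOn g (Set.Icc a b) := by
    rw [integrableOn_Icc_iff_integrableOn_Ioo]
    exact hg.integrable (by norm_num)
  refine (h1.mono_set ?_).intervalIntegrable
  exact Set.uIcc_subset_Icc hx hy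

theorem continuousOn_primitive (hg : MemLp g 2 (volume.restrict (Set.Ioo a b))) :
    ContinuousOn (fun x => ∫ t in a..x, g t) (Set.Icc a b) := by
  have h1 : IntegrableOn g (Set.Icc a b) := by
    rw [integrableOn_Icc_iff_integrableOn_Ioo]
    exact hg.integrable (by norm_num)
  rcases le_or_gt a b with h | h
  · have := intervalIntegral.continuousOn_primitive_interval (μ := volume) (f := g) (a := a)
      (b := b) (by rwa [Set.uIcc_of_le h])
    rwa [Set.uIcc_of_le h] at this
  · simp [h]

theorem aesm_primitive (hg : MemLp g 2 (volume.restrict (Set.Ioo a b))) :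
    AEStronglyMeasurable (fun x => ∫ t in a..x, g t) (volume.restrict (Set.Ioo a b)) :=
  ((continuousOn_primitive hg).mono Set.Ioo_subset_Icc_self).aestronglyMeasurable measurableSet_Ioo

/-- Taking primitives is bounded on `L²(]a, b[)`. -/
theorem exists_eLpNorm_primitive_le (a b : ℝ) : ∃ C : ℝ≥0∞, C ≠ ⊤ ∧ ∀ g : ℝ → Spinor,
    MemLp g 2 (volume.restrict (Set.Ioo a b)) →
    eLpNorm (fun x => ∫ t in a..x, g t) 2 (volume.restrict (Set.Ioo a b)) ≤
      C * eLpNorm g 2 (volume.restrict (Set.Ioo a b)) := by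
  set μ := volume.restrict (Set.Ioo a b)
  refine ⟨μ Set.univ ^ (1 / (1 : ℝ≥0∞).toReal - 1 / (2 : ℝ≥0∞).toReal) *
    μ Set.univ ^ (2 : ℝ≥0∞).toReal⁻¹, ?_, fun g hg => ?_⟩
  · refine ENNReal.mul_ne_top ?_ ?_ <;>
      exact ENNReal.rpow_ne_top_of_nonneg (by norm_num) (measure_ne_top μ _)
  · have h1 := eLpNorm_le_eLpNorm_mul_rpow_measure_univ (p := 1) (q := 2) (by norm_num) hg.1
    have h2 : ∀ᵐ x ∂μ, ‖∫ t in a..x, g t‖ₑ ≤ eLpNorm g 1 μ := by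
      filter_upwards [ae_restrict_mem measurableSet_Ioo] with x hx
      rw [intervalIntegral_eq_Ioo hx.1.le, eLpNorm_one_eq_lintegral_enorm]
      refine (enorm_integral_le_lintegral_enorm _).trans ?_
      exact lintegral_mono' (Measure.restrict_mono (Set.Ioo_subset_Ioo_right hx.2.le) le_rfl)
        le_rfl
    refine (eLpNorm_le_of_ae_enorm_bound h2).trans ?_
    rw [smul_eq_mul]
    calc _ ≤ eLpNorm g 2 μ * μ Set.univ ^ (1 / (1 : ℝ≥0∞).toReal - 1 / (2 : ℝ≥0∞).toReal) *
        μ Set.univ ^ (2 : ℝ≥0∞).toReal⁻¹ := by gcongr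
      _ = _ := by ring

theorem memLp_primitive (hg : MemLp g 2 (volume.restrict (Set.Ioo a b))) :
    MemLp (fun x => ∫ t in a..x, g t) 2 (volume.restrict (Set.Ioo a b)) := by
  obtain ⟨C, hC, h⟩ := exists_eLpNorm_primitive_le a b
  exact ⟨aesm_primitive hg, (h g hg).trans_lt (ENNReal.mul_lt_top hC.lt_top hg.2)⟩

theorem tendsto_primitive {gn : ℕ → ℝ → Spinor}
    (hgn : ∀ n, MemLp (gn n) 2 (volume.restrict (Set.Ioo a b)))
    (hg : MemLp g 2 (volume.restrict (Set.Ioo a b)))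
    (h : Tendsto (fun n => eLpNorm (fun x => gn n x - g x) 2 (volume.restrict (Set.Ioo a b)))
      atTop (𝓝 0)) :
    Tendsto (fun n => eLpNorm (fun x => (∫ t in a..x, gn n t) - ∫ t in a..x, g t) 2
      (volume.restrict (Set.Ioo a b))) atTop (𝓝 0) := by
  obtain ⟨C, hC, hb⟩ := exists_eLpNorm_primitive_le a b
  have h0 := ENNReal.Tendsto.const_mul h (Or.inr hC)
  rw [mul_zero] at h0
  refine tendsto_of_tendsto_of_tendsto_of_le_of_le tendsto_const_nhds h0 (fun _ => zero_le)
    fun n => ?_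
  refine le_trans (le_of_eq (eLpNorm_congr_ae ?_)) (hb _ ((hgn n).sub hg))
  filter_upwards [ae_restrict_mem measurableSet_Ioo] with x hx
  have ha : a ∈ Set.Icc a b := ⟨le_rfl, (hx.1.trans hx.2).le⟩
  rw [← intervalIntegral.integral_sub
    (intervalIntegrable_of_memLp (hgn n) ha (Set.Ioo_subset_Icc_self hx))
    (intervalIntegrable_of_memLp hg ha (Set.Ioo_subset_Icc_self hx))]

theorem hasWeakDeriv_primitive (hg : MemLp g 2 (volume.restrict (Set.Ioo a b))) :
    HasWeakDeriv (Set.Ioo a b) (1 : ℝ) (fun x => ∫ t in a..x, g t) g := by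
  obtain ⟨η, hη, hlim⟩ := exists_tendsto_test isOpen_Ioo hg
  refine HasWeakDeriv.of_tendsto (un := fun n x => ∫ t in a..x, η n t) (gn := η) (fun n => ?_)
    (fun n => memLp_primitive (hη n).memLp) (memLp_primitive hg) (fun n => (hη n).memLp) hg
    (tendsto_primitive (fun n => (hη n).memLp) hg hlim) hlim
  have := HasWeakDeriv.of_contDiffOn (v := (1 : ℝ)) (isOpen_Ioo (a := a) (b := b))
    ((contDiff_primitive (hη n).1 a).of_le (by simp)).contDiffOn
  simpa only [fderiv_primitive (hη n).1.continuous, one_smul] using this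

/-- A function with a weak derivative in `L²` is a primitive of it. -/
theorem HasWeakDeriv.ae_eq_primitive (hab : a < b) (h : HasWeakDeriv (Set.Ioo a b) (1 : ℝ) u g)
    (hg : MemLp g 2 (volume.restrict (Set.Ioo a b))) :
    ∃ c : Spinor, u =ᵐ[volume.restrict (Set.Ioo a b)] fun x => c + ∫ t in a..x, g t := by
  have h1 := h.add ((hasWeakDeriv_primitive hg).smul (-1 : ℂ))
  simp only [neg_smul, one_smul, add_neg_cancel] at h1
  obtain ⟨c, hc⟩ := ae_eq_const_of_hasWeakDeriv_zero hab h1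
  refine ⟨c, ?_⟩
  filter_upwards [hc] with x hx
  rw [← hx]
  abel

/-- A primitive vanishing at both ends of the interval is in `H¹₀`. -/
theorem memH10_of_primitive (hab : a < b) (hg : MemLp g 2 (volume.restrict (Set.Ioo a b)))
    (h0 : ∫ t in a..b, g t = 0)
    (hu : u =ᵐ[volume.restrict (Set.Ioo a b)] fun x => ∫ t in a..x, g t) :
    MemH10 (Set.Ioo a b) u := by
  refine MemH10.congr ?_ hu
  obtain ⟨η, hη, hlim⟩ := exists_tendsto_test isOpen_Ioo hg
  obtain ⟨χ, hχ, hχ1⟩ := exists_test_integral_one hab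
  -- the approximations of `g` are corrected so as to have mean zero
  let c : ℕ → Spinor := fun n => ∫ t in a..b, η n t
  let ζ : ℕ → ℝ → Spinor := fun n x => η n x + χ x • (-c n)
  have hζ : ∀ n, IsTestFunction (Set.Ioo a b) (ζ n) := fun n => (hη n).add (hχ.smul_const _)
  have hζ0 : ∀ n, ∫ t in a..b, ζ n t = 0 := fun n => by
    simp only [ζ]
    rw [intervalIntegral.integral_add ((hη n).1.continuous.intervalIntegrable _ _)
      ((hχ.smul_const _).1.continuous.intervalIntegrable _ _),
      intervalIntegral.integral_smul_const, hχ1]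
    simp [c]
  have hc : Tendsto c atTop (𝓝 0) := by
    have hi := fun {f : ℝ → Spinor} (hf : MemLp f 2 (volume.restrict (Set.Ioo a b))) =>
      hf.integrable (by norm_num : (1 : ℝ≥0∞) ≤ 2)
    have := tendsto_integral_of_L1' g (hi hg).aestronglyMeasurable (F := η) (l := atTop)
      (μ := volume.restrict (Set.Ioo a b))
      (Eventually.of_forall fun n => hi (hη n).memLp) ?_
    · simp only [c, intervalIntegral_eq_Ioo hab.le] at h0 ⊢
      rwa [h0] at this
    · have hb : ∀ n, eLpNorm (η n - g) 1 (volume.restrict (Set.Ioo a b)) ≤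
          eLpNorm (fun x => η n x - g x) 2 (volume.restrict (Set.Ioo a b)) *
            (volume.restrict (Set.Ioo a b)) Set.univ ^
              (1 / (1 : ℝ≥0∞).toReal - 1 / (2 : ℝ≥0∞).toReal) := fun n =>
        eLpNorm_le_eLpNorm_mul_rpow_measure_univ (p := 1) (q := 2) (by norm_num)
          ((hη n).memLp.sub hg).1
      have h1 := ENNReal.Tendsto.mul_const hlim (b := (volume.restrict (Set.Ioo a b)) Set.univ ^
              (1 / (1 : ℝ≥0∞).toReal - 1 / (2 : ℝ≥0∞).toReal))
              (Or.inr (ENNReal.rpow_ne_top_of_nonneg (by norm_num) (measure_ne_top _ _)))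
      rw [zero_mul] at h1
      exact tendsto_of_tendsto_of_tendsto_of_le_of_le tendsto_const_nhds h1 (fun _ => zero_le) hb
  have hχc : Tendsto (fun n => eLpNorm (fun x => χ x • (-c n) - (0 : ℝ → Spinor) x) 2
      (volume.restrict (Set.Ioo a b))) atTop (𝓝 0) := by
    have hb : ∀ n, eLpNorm (fun x => χ x • (-c n) - (0 : ℝ → Spinor) x) 2
        (volume.restrict (Set.Ioo a b)) =
        eLpNorm χ 2 (volume.restrict (Set.Ioo a b)) * ‖c n‖ₑ := fun n => by
      rw [mul_comm, ← enorm_norm (c n), ← eLpNorm_const_smul]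
      refine eLpNorm_congr_enorm_ae (Eventually.of_forall fun x => ?_)
      simp [enorm_smul, mul_comm]
    have h1 := ENNReal.Tendsto.const_mul (hc.enorm) (a := eLpNorm χ 2
      (volume.restrict (Set.Ioo a b))) (Or.inr hχ.memLp.2.ne)
    simpa only [hb, enorm_zero, mul_zero] using h1
  have hζlim : Tendsto (fun n => eLpNorm (fun x => ζ n x - g x) 2
      (volume.restrict (Set.Ioo a b))) atTop (𝓝 0) := by
    have := tendsto_add_aux (fun n => (hη n).memLp.1)
      (fun n => (hχ.smul_const (-c n)).memLp.1) hg.1 aestronglyMeasurable_zero hlim hχc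
    simpa [ζ] using this
  refine ⟨memLp_primitive hg, fun n x => ∫ t in a..x, ζ n t, fun n => (hζ n).primitive (hζ0 n),
    tendsto_primitive (fun n => (hζ n).memLp) hg hζlim, fun v => ⟨fun x => (v : ℂ) • g x,
      hg.const_smul (v : ℂ), ?_⟩⟩
  have := tendsto_smul_aux (v : ℂ) hζlim
  simpa only [fderiv_primitive (hζ _).1.continuous, ← Complex.coe_smul] using this

/-- Density of smooth functions, with compact support in `]0, ∞[`, in `H¹(]a, b[)`. -/
theorem exists_smooth_approx (ha : 0 < a) (hab : a < b)
    (hg : MemLp g 2 (volume.restrict (Set.Ioo a b)))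
    (h : HasWeakDeriv (Set.Ioo a b) (1 : ℝ) u g) :
    ∃ η : ℕ → ℝ → Spinor, (∀ n, IsTestFunction (Set.Ioi 0) (η n)) ∧
      Tendsto (fun n => eLpNorm (fun x => η n x - u x) 2 (volume.restrict (Set.Ioo a b)))
        atTop (𝓝 0) ∧
      Tendsto (fun n => eLpNorm (fun x => fderiv ℝ (η n) x 1 - g x) 2
        (volume.restrict (Set.Ioo a b))) atTop (𝓝 0) := by
  obtain ⟨c, hc⟩ := h.ae_eq_primitive hab hg
  obtain ⟨ζ, hζ, hlim⟩ := exists_tendsto_test isOpen_Ioo hg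
  let κ : ContDiffBump ((a + b) / 2) := ⟨(b - a) / 2, b / 2, by linarith, by linarith⟩
  have hκ1 : ∀ x ∈ Set.Ioo a b, κ =ᶠ[𝓝 x] fun _ => 1 := fun x hx => by
    filter_upwards [isOpen_Ioo.mem_nhds hx] with y hy
    apply κ.one_of_mem_closedBall
    rw [Real.closedBall_eq_Icc]
    change y ∈ Set.Icc ((a + b) / 2 - (b - a) / 2) ((a + b) / 2 + (b - a) / 2)
    constructor <;> linarith [hy.1, hy.2]
  have hκs : tsupport κ ⊆ Set.Ioi 0 := by
    rw [κ.tsupport_eq, Real.closedBall_eq_Icc]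
    intro x hx
    have h1 : (a + b) / 2 - b / 2 ≤ x := hx.1
    exact Set.mem_Ioi.2 (by linarith)
  let p : ℕ → ℝ → Spinor := fun n x => c + ∫ t in a..x, ζ n t
  have hp : ∀ n, ContDiff ℝ ∞ (p n) := fun n => contDiff_const.add (contDiff_primitive (hζ n).1 a)
  refine ⟨fun n x => κ x • p n x, fun n => ⟨κ.contDiff.smul (hp n),
    κ.hasCompactSupport.smul_right, (closure_mono (Function.support_smul_subset_left κ _)).trans
      hκs⟩, ?_, ?_⟩
  · refine (tendsto_primitive (fun n => (hζ n).memLp) hg hlim).congr fun n => eLpNorm_congr_ae ?_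
    filter_upwards [hc, ae_restrict_mem measurableSet_Ioo] with x hx hx'
    rw [hx, (hκ1 x hx').self_of_nhds, one_smul]
    simp only [p]
    abel
  · refine hlim.congr fun n => eLpNorm_congr_ae ?_
    filter_upwards [ae_restrict_mem measurableSet_Ioo] with x hx
    have e : (fun x => κ x • p n x) =ᶠ[𝓝 x] p n := by
      filter_upwards [hκ1 x hx] with y hy
      rw [hy, one_smul]
    rw [e.fderiv_eq]
    simp only [p]
    rw [fderiv_const_add, fderiv_primitive (hζ n).1.continuous, one_smul]

end IntervalLp

/-! ### Polar coordinates and angular modes -/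

section Polar

/-- The Euclidean norm of a point of the plane. -/
def rad (x : ℝ × ℝ) : ℝ := Real.sqrt (x.1 ^ 2 + x.2 ^ 2)

/-- The angular function `e^{ims}` at the point with polar coordinates `(r, s)`. -/
def eang (m : ℤ) (x : ℝ × ℝ) : ℂ := (((x.1 : ℂ) + x.2 * Complex.I) / (rad x : ℂ)) ^ m

theorem continuous_rad : Continuous rad := by
  unfold rad
  fun_prop

theorem rad_sq (x : ℝ × ℝ) : rad x ^ 2 = x.1 ^ 2 + x.2 ^ 2 := Real.sq_sqrt (by positivity)

theorem rad_nonneg (x : ℝ × ℝ) : 0 ≤ rad x := Real.sqrt_nonneg _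

theorem rad_polar {r : ℝ} (hr : 0 ≤ r) (s : ℝ) : rad (r * Real.cos s, r * Real.sin s) = r := by
  rw [rad, show (r * Real.cos s) ^ 2 + (r * Real.sin s) ^ 2 = r ^ 2 by
    rw [mul_pow, mul_pow, ← mul_add, Real.cos_sq_add_sin_sq, mul_one], Real.sqrt_sq hr]

theorem ofReal_rad_sq (x : ℝ × ℝ) : (rad x : ℂ) ^ 2 = (x.1 : ℂ) ^ 2 + (x.2 : ℂ) ^ 2 := by
  exact_mod_cast congrArg (fun t : ℝ => (t : ℂ)) (rad_sq x)

theorem rad_ne_zero {x : ℝ × ℝ} (hx : 0 < rad x) : (rad x : ℂ) ≠ 0 := by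
  exact_mod_cast hx.ne'

theorem norm_coord (x : ℝ × ℝ) : ‖(x.1 : ℂ) + x.2 * Complex.I‖ = rad x := by
  rw [Complex.norm_add_mul_I, rad]

theorem norm_eang {x : ℝ × ℝ} (hx : 0 < rad x) (m : ℤ) : ‖eang m x‖ = 1 := by
  rw [eang, norm_zpow, norm_div, norm_coord, Complex.norm_real, Real.norm_of_nonneg hx.le,
    div_self hx.ne', one_zpow]

theorem eang_base_ne {x : ℝ × ℝ} (hx : 0 < rad x) :
    ((x.1 : ℂ) + x.2 * Complex.I) / (rad x : ℂ) ≠ 0 := by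
  intro h
  have := norm_eang hx 1
  rw [eang, h] at this
  simp at this

theorem eang_ne_zero {x : ℝ × ℝ} (hx : 0 < rad x) (m : ℤ) : eang m x ≠ 0 :=
  zpow_ne_zero m (eang_base_ne hx)

theorem eang_add {x : ℝ × ℝ} (hx : 0 < rad x) (m n : ℤ) :
    eang (m + n) x = eang m x * eang n x :=
  zpow_add₀ (eang_base_ne hx) m n

theorem eang_zero (x : ℝ × ℝ) : eang 0 x = 1 := zpow_zero _

theorem eang_one (x : ℝ × ℝ) : eang 1 x = ((x.1 : ℂ) + x.2 * Complex.I) / rad x := zpow_one _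

theorem eang_neg_one {x : ℝ × ℝ} (hx : 0 < rad x) :
    eang (-1) x = ((x.1 : ℂ) - x.2 * Complex.I) / rad x := by
  have hr := rad_ne_zero hx
  have h1 := eang_ne_zero hx 1
  have h2 : eang 1 x * eang (-1) x = 1 := by
    rw [← eang_add hx]
    exact eang_zero x
  have h3 : eang 1 x * (((x.1 : ℂ) - x.2 * Complex.I) / rad x) = 1 := by
    rw [eang_one]
    field_simp
    rw [ofReal_rad_sq]
    linear_combination (-(x.2 : ℂ) ^ 2) * Complex.I_sq
  exact mul_left_cancel₀ h1 (h2.trans h3.symm)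

theorem conj_eang {x : ℝ × ℝ} (hx : 0 < rad x) (m : ℤ) :
    (starRingEnd ℂ) (eang m x) = eang (-m) x := by
  have h1 : eang m x * (starRingEnd ℂ) (eang m x) = 1 := by
    rw [Complex.mul_conj, Complex.normSq_eq_norm_sq, norm_eang hx]
    simp
  have h2 : eang m x * eang (-m) x = 1 := by
    rw [← eang_add hx, add_neg_cancel]
    exact eang_zero x
  exact mul_left_cancel₀ (eang_ne_zero hx m) (h1.trans h2.symm)

theorem eang_polar {r : ℝ} (hr : 0 < r) (s : ℝ) (m : ℤ) :
    eang m (r * Real.cos s, r * Real.sin s) = Complex.exp (Complex.I * m * s) := by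
  have hr' : (r : ℂ) ≠ 0 := by exact_mod_cast hr.ne'
  have h1 : (((r * Real.cos s : ℝ) : ℂ) + ((r * Real.sin s : ℝ) : ℂ) * Complex.I) / (r : ℂ) =
      Complex.exp (s * Complex.I) := by
    rw [Complex.exp_mul_I]
    push_cast
    field_simp
  rw [eang, rad_polar hr.le]
  simp only
  rw [h1, ← Complex.exp_int_mul]
  congr 1
  ring

theorem contDiffAt_rad {x : ℝ × ℝ} (hx : 0 < rad x) : ContDiffAt ℝ ∞ rad x := by
  have h : x.1 ^ 2 + x.2 ^ 2 ≠ 0 := by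
    rw [← rad_sq]
    positivity
  exact ((contDiff_fst.pow 2).add (contDiff_snd.pow 2)).contDiffAt.sqrt h

theorem contDiffAt_eang {x : ℝ × ℝ} (hx : 0 < rad x) (m : ℤ) : ContDiffAt ℝ ∞ (eang m) x := by
  have hof : ContDiff ℝ ∞ (fun t : ℝ => (t : ℂ)) := Complex.ofRealCLM.contDiff
  have h1 : ContDiffAt ℝ ∞ (fun x : ℝ × ℝ =>
      ((x.1 : ℂ) + x.2 * Complex.I) / (rad x : ℂ)) x := by
    simp only [div_eq_mul_inv]
    refine ContDiffAt.mul ?_ (ContDiffAt.inv ?_ (rad_ne_zero hx))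
    · exact ((hof.comp contDiff_fst).add ((hof.comp contDiff_snd).mul contDiff_const)).contDiffAt
    · exact hof.contDiffAt.comp x (contDiffAt_rad hx)
  have hne := eang_base_ne hx
  rcases m with n | n
  · have e : eang (Int.ofNat n) = fun x : ℝ × ℝ =>
        (((x.1 : ℂ) + x.2 * Complex.I) / (rad x : ℂ)) ^ n := funext fun y => zpow_natCast _ n
    rw [e]
    exact h1.pow n
  · have e : eang (Int.negSucc n) = fun x : ℝ × ℝ =>
        ((((x.1 : ℂ) + x.2 * Complex.I) / (rad x : ℂ)) ^ (n + 1))⁻¹ :=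
      funext fun y => zpow_negSucc _ n
    rw [e]
    exact (h1.pow (n + 1)).inv (pow_ne_zero _ hne)

variable {ρ₁ ρ₂ : ℝ}

theorem mem_annulus_iff (hρ₁ : 0 < ρ₁) (hρ : ρ₁ < ρ₂) {x : ℝ × ℝ} :
    x ∈ annulus ρ₁ ρ₂ ↔ rad x ∈ Set.Ioo ρ₁ ρ₂ := by
  rw [annulus, Set.mem_ofPred_eq, ← rad_sq]
  constructor
  · rintro ⟨h1, h2⟩
    exact ⟨lt_of_pow_lt_pow_left₀ 2 (rad_nonneg x) h1,
      lt_of_pow_lt_pow_left₀ 2 (hρ₁.trans hρ).le h2⟩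
  · rintro ⟨h1, h2⟩
    exact ⟨pow_lt_pow_left₀ h1 hρ₁.le (by norm_num),
      pow_lt_pow_left₀ h2 (rad_nonneg x) (by norm_num)⟩

theorem rad_pos_of_mem (hρ₁ : 0 < ρ₁) (hρ : ρ₁ < ρ₂) {x : ℝ × ℝ} (hx : x ∈ annulus ρ₁ ρ₂) :
    0 < rad x :=
  hρ₁.trans ((mem_annulus_iff hρ₁ hρ).1 hx).1

theorem ae_mem_annulus (ρ₁ ρ₂ : ℝ) : ∀ᵐ x ∂volume.restrict (annulus ρ₁ ρ₂), x ∈ annulus ρ₁ ρ₂ :=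
  ae_restrict_mem (isOpen_annulus ρ₁ ρ₂).measurableSet

/-- Polar coordinates for the functions of `|x|`. -/
theorem lintegral_annulus (hρ₁ : 0 < ρ₁) (hρ : ρ₁ < ρ₂) {g : ℝ → ℝ≥0∞} (hg : Measurable g) :
    ∫⁻ x in annulus ρ₁ ρ₂, g (rad x) =
      ENNReal.ofReal (2 * Real.pi) * ∫⁻ r in Set.Ioo ρ₁ ρ₂, ENNReal.ofReal r * g r := by
  rw [← lintegral_indicator (isOpen_annulus ρ₁ ρ₂).measurableSet, ← lintegral_comp_polarCoord_symm]
  have h1 : ∀ p ∈ polarCoord.target, ENNReal.ofReal p.1 •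
      (annulus ρ₁ ρ₂).indicator (fun x => g (rad x)) (polarCoord.symm p) =
      (Set.Ioo ρ₁ ρ₂).indicator (fun r => ENNReal.ofReal r * g r) p.1 * 1 := by
    intro p hp
    have hp1 : 0 < p.1 := hp.1
    have hr : rad (polarCoord.symm p) = p.1 := rad_polar hp1.le p.2
    by_cases h : p.1 ∈ Set.Ioo ρ₁ ρ₂
    · rw [Set.indicator_of_mem h, Set.indicator_of_mem ((mem_annulus_iff hρ₁ hρ).2 (hr ▸ h)), hr,
        smul_eq_mul, mul_one]
    · rw [Set.indicator_of_notMem h, Set.indicator_of_notMem fun h' =>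
        h (hr ▸ (mem_annulus_iff hρ₁ hρ).1 h'), smul_zero, zero_mul]
  rw [setLIntegral_congr_fun polarCoord.open_target.measurableSet h1, polarCoord_target,
    Measure.volume_eq_prod, ← Measure.prod_restrict]
  have hm : Measurable ((Set.Ioo ρ₁ ρ₂).indicator (fun r => ENNReal.ofReal r * g r)) :=
    (ENNReal.measurable_ofReal.mul hg).indicator measurableSet_Ioo
  rw [lintegral_prod_mul hm.aemeasurable aemeasurable_const, mul_comm,
    lintegral_indicator measurableSet_Ioo, Measure.restrict_restrict measurableSet_Ioo]
  congr 1
  · rw [setLIntegral_const, one_mul, Real.volume_Ioo]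
    congr 1
    ring
  · have : Set.Ioo ρ₁ ρ₂ ∩ Set.Ioi 0 = Set.Ioo ρ₁ ρ₂ :=
      Set.inter_eq_left.2 fun r hr => Set.mem_Ioi.2 (hρ₁.trans hr.1)
    rw [this]

/-- Profiles which agree almost everywhere give functions of `|x|` which agree almost everywhere. -/
theorem quasiMeasurePreserving_rad (hρ₁ : 0 < ρ₁) (hρ : ρ₁ < ρ₂) :
    Measure.QuasiMeasurePreserving rad (volume.restrict (annulus ρ₁ ρ₂))
      (volume.restrict (Set.Ioo ρ₁ ρ₂)) := by
  refine ⟨continuous_rad.measurable, Measure.AbsolutelyContinuous.mk fun s hs h0 => ?_⟩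
  rw [Measure.map_apply continuous_rad.measurable hs]
  have h1 := lintegral_annulus hρ₁ hρ (g := s.indicator 1) (measurable_one.indicator hs)
  have h2 : ∀ x, s.indicator (1 : ℝ → ℝ≥0∞) (rad x) = (rad ⁻¹' s).indicator 1 x := fun x => rfl
  simp only [h2] at h1
  rw [lintegral_indicator_one (continuous_rad.measurable hs)] at h1
  rw [h1, mul_eq_zero]
  right
  rw [lintegral_eq_zero_iff' (by
    exact (ENNReal.measurable_ofReal.mul (measurable_one.indicator hs)).aemeasurable)]
  have h3 : ∀ᵐ r ∂volume.restrict (Set.Ioo ρ₁ ρ₂), r ∉ s := measure_eq_zero_iff_ae_notMem.1 h0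
  filter_upwards [h3] with r hr
  simp [hr]

/-- A nonconstant angular mode has mean zero on each circle. -/
theorem integral_eang_mul (hρ₁ : 0 < ρ₁) (hρ : ρ₁ < ρ₂) {k : ℤ} (hk : k ≠ 0) (G : ℝ → ℂ) :
    ∫ x in annulus ρ₁ ρ₂, eang k x * G (rad x) = 0 := by
  rw [← integral_indicator (isOpen_annulus ρ₁ ρ₂).measurableSet, ← integral_comp_polarCoord_symm]
  have h1 : ∀ p ∈ polarCoord.target, p.1 •
      (annulus ρ₁ ρ₂).indicator (fun x => eang k x * G (rad x)) (polarCoord.symm p) =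
      (Set.Ioo ρ₁ ρ₂).indicator (fun r => r * G r) p.1 *
        Complex.exp (Complex.I * k * (p.2 : ℂ)) := by
    intro p hp
    have hp1 : 0 < p.1 := hp.1
    have hr : rad (polarCoord.symm p) = p.1 := rad_polar hp1.le p.2
    by_cases h : p.1 ∈ Set.Ioo ρ₁ ρ₂
    · rw [Set.indicator_of_mem h, Set.indicator_of_mem ((mem_annulus_iff hρ₁ hρ).2 (hr ▸ h)), hr,
        Complex.real_smul, ← eang_polar hp1]
      simp only [polarCoord_symm_apply]
      ring
    · rw [Set.indicator_of_notMem h, Set.indicator_of_notMem fun h' =>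
        h (hr ▸ (mem_annulus_iff hρ₁ hρ).1 h'), smul_zero, zero_mul]
  rw [setIntegral_congr_fun polarCoord.open_target.measurableSet h1, polarCoord_target,
    Measure.volume_eq_prod, setIntegral_prod_mul
      ((Set.Ioo ρ₁ ρ₂).indicator (fun r => (r : ℂ) * G r))
      (fun s : ℝ => Complex.exp (Complex.I * k * (s : ℂ)))]
  have h2 : ∫ s in Set.Ioo (-Real.pi) Real.pi, Complex.exp (Complex.I * k * (s : ℂ)) = 0 := by
    rw [← integral_Ioc_eq_integral_Ioo, ← intervalIntegral.integral_of_le (by linarith [Real.pi_pos]),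
      integral_exp_mul_complex (mul_ne_zero Complex.I_ne_zero (by exact_mod_cast hk)),
      div_eq_zero_iff]
    left
    rw [sub_eq_zero, Complex.exp_eq_exp_iff_exists_int]
    refine ⟨k, ?_⟩
    push_cast
    ring
  rw [h2, mul_zero]

/-- The function with polar expression `(2πr)^{-1/2} v(r) e^{ims}`. -/
def modeFun (m : ℤ) (v : ℝ → Spinor) (x : ℝ × ℝ) : Spinor :=
  (((Real.sqrt (2 * Real.pi * rad x))⁻¹ : ℝ) * eang m x : ℂ) • v (rad x)

theorem aesm_modeCoef (hρ₁ : 0 < ρ₁) (hρ : ρ₁ < ρ₂) (m : ℤ) :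
    AEStronglyMeasurable (fun x => (((Real.sqrt (2 * Real.pi * rad x))⁻¹ : ℝ) * eang m x : ℂ))
      (volume.restrict (annulus ρ₁ ρ₂)) := by
  refine AEStronglyMeasurable.mul ?_ ?_
  · have : Measurable (fun x => (((Real.sqrt (2 * Real.pi * rad x))⁻¹ : ℝ) : ℂ)) := by
      have := continuous_rad.measurable
      fun_prop
    exact this.aestronglyMeasurable
  · refine ContinuousOn.aestronglyMeasurable (fun x hx => ?_)
      (isOpen_annulus ρ₁ ρ₂).measurableSet
    exact (contDiffAt_eang (rad_pos_of_mem hρ₁ hρ hx) m).continuousAt.continuousWithinAt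

theorem modeFun_congr (hρ₁ : 0 < ρ₁) (hρ : ρ₁ < ρ₂) (m : ℤ) {v w : ℝ → Spinor}
    (h : v =ᵐ[volume.restrict (Set.Ioo ρ₁ ρ₂)] w) :
    modeFun m v =ᵐ[volume.restrict (annulus ρ₁ ρ₂)] modeFun m w := by
  filter_upwards [(quasiMeasurePreserving_rad hρ₁ hρ).ae h] with x hx
  rw [modeFun, modeFun, hx]

theorem aesm_modeFun (hρ₁ : 0 < ρ₁) (hρ : ρ₁ < ρ₂) (m : ℤ) {v : ℝ → Spinor}
    (hv : AEStronglyMeasurable v (volume.restrict (Set.Ioo ρ₁ ρ₂))) :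
    AEStronglyMeasurable (modeFun m v) (volume.restrict (annulus ρ₁ ρ₂)) :=
  (aesm_modeCoef hρ₁ hρ m).smul (hv.comp_quasiMeasurePreserving (quasiMeasurePreserving_rad hρ₁ hρ))

theorem eLpNorm_modeFun (hρ₁ : 0 < ρ₁) (hρ : ρ₁ < ρ₂) (m : ℤ) {v : ℝ → Spinor}
    (hv : AEStronglyMeasurable v (volume.restrict (Set.Ioo ρ₁ ρ₂))) :
    eLpNorm (modeFun m v) 2 (volume.restrict (annulus ρ₁ ρ₂)) =
      eLpNorm v 2 (volume.restrict (Set.Ioo ρ₁ ρ₂)) := by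
  obtain ⟨w, hw, hvw⟩ := hv
  rw [eLpNorm_congr_ae hvw, eLpNorm_congr_ae (modeFun_congr hρ₁ hρ m hvw),
    eLpNorm_eq_lintegral_rpow_enorm_toReal (by norm_num) (by norm_num),
    eLpNorm_eq_lintegral_rpow_enorm_toReal (by norm_num) (by norm_num)]
  congr 1
  have hm : Measurable fun r : ℝ => ENNReal.ofReal (2 * Real.pi * r)⁻¹ * ‖w r‖ₑ ^ (2 : ℝ) := by
    have := hw.measurable
    fun_prop
  have h1 : ∀ x ∈ annulus ρ₁ ρ₂, ‖modeFun m w x‖ₑ ^ (2 : ℝ≥0∞).toReal =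
      ENNReal.ofReal (2 * Real.pi * rad x)⁻¹ * ‖w (rad x)‖ₑ ^ (2 : ℝ) := by
    intro x hx
    have hr := rad_pos_of_mem hρ₁ hρ hx
    have hp : 0 < 2 * Real.pi * rad x := by positivity
    rw [modeFun, enorm_smul, enorm_mul]
    have e1 : ‖eang m x‖ₑ = 1 := by
      rw [← ofReal_norm, norm_eang hr, ENNReal.ofReal_one]
    have e2 : ‖(((Real.sqrt (2 * Real.pi * rad x))⁻¹ : ℝ) : ℂ)‖ₑ =
        ENNReal.ofReal (Real.sqrt (2 * Real.pi * rad x))⁻¹ := by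
      rw [← ofReal_norm, Complex.norm_real, Real.norm_of_nonneg (by positivity)]
    rw [e1, e2, mul_one, ENNReal.toReal_ofNat, ENNReal.mul_rpow_of_nonneg _ _ (by norm_num)]
    congr 1
    rw [ENNReal.rpow_ofNat, ← ENNReal.ofReal_pow (by positivity), inv_pow, Real.sq_sqrt hp.le]
  rw [setLIntegral_congr_fun (isOpen_annulus ρ₁ ρ₂).measurableSet h1,
    lintegral_annulus hρ₁ hρ hm, ← lintegral_const_mul' _ _ ENNReal.ofReal_ne_top]
  refine setLIntegral_congr_fun measurableSet_Ioo fun r hr => ?_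
  have hr0 : 0 < r := hρ₁.trans hr.1
  have hpi := Real.pi_pos
  rw [← mul_assoc, ← mul_assoc, ← ENNReal.ofReal_mul (by positivity),
    ← ENNReal.ofReal_mul (by positivity), mul_inv_cancel₀ (by positivity), ENNReal.ofReal_one,
    one_mul, ENNReal.toReal_ofNat]

theorem memLp_modeFun (hρ₁ : 0 < ρ₁) (hρ : ρ₁ < ρ₂) (m : ℤ) {v : ℝ → Spinor}
    (hv : MemLp v 2 (volume.restrict (Set.Ioo ρ₁ ρ₂))) :
    MemLp (modeFun m v) 2 (volume.restrict (annulus ρ₁ ρ₂)) :=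
  ⟨aesm_modeFun hρ₁ hρ m hv.1, by rw [eLpNorm_modeFun hρ₁ hρ m hv.1]; exact hv.2⟩

theorem inner_modeFun (m n : ℤ) (u v : ℝ → Spinor) {x : ℝ × ℝ} (hx : 0 < rad x) :
    inner ℂ (modeFun m u x) (modeFun n v x) =
      eang (n - m) x * (((2 * Real.pi * rad x)⁻¹ : ℝ) * inner ℂ (u (rad x)) (v (rad x))) := by
  have hp : 0 ≤ 2 * Real.pi * rad x := by positivity
  have h1 : ((Real.sqrt (2 * Real.pi * rad x))⁻¹ : ℝ) * ((Real.sqrt (2 * Real.pi * rad x))⁻¹ : ℝ) =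
      (2 * Real.pi * rad x)⁻¹ := by
    rw [← mul_inv, Real.mul_self_sqrt hp]
  rw [modeFun, modeFun, inner_smul_left, inner_smul_right, map_mul, Complex.conj_ofReal,
    conj_eang hx, ← h1, show n - m = -m + n by ring, eang_add hx]
  push_cast
  ring

theorem integral_inner_modeFun (hρ₁ : 0 < ρ₁) (hρ : ρ₁ < ρ₂) {m n : ℤ} (hmn : m ≠ n)
    (u v : ℝ → Spinor) :
    ∫ x in annulus ρ₁ ρ₂, inner ℂ (modeFun m u x) (modeFun n v x) = 0 := by
  rw [← integral_eang_mul hρ₁ hρ (sub_ne_zero.2 hmn.symm)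
    (fun r => ((2 * Real.pi * r)⁻¹ : ℝ) * inner ℂ (u r) (v r))]
  exact setIntegral_congr_fun (isOpen_annulus ρ₁ ρ₂).measurableSet fun x hx =>
    inner_modeFun m n u v (rad_pos_of_mem hρ₁ hρ hx)

end Polar

/-! ### The decomposition of `L²(Ω)` into angular modes -/

section Decomposition

variable {ρ₁ ρ₂ : ℝ}

theorem modeFun_add (m : ℤ) (u v : ℝ → Spinor) (x : ℝ × ℝ) :
    modeFun m (fun r => u r + v r) x = modeFun m u x + modeFun m v x :=
  smul_add _ _ _

theorem modeFun_smul (m : ℤ) (c : ℂ) (u : ℝ → Spinor) (x : ℝ × ℝ) :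
    modeFun m (fun r => c • u r) x = c • modeFun m u x :=
  smul_comm _ _ _

/-- The isometry sending `v` to the function of the annulus with polar expression
`(2πr)^{-1/2} v(r) e^{ims}`. -/
def modeMap (hρ₁ : 0 < ρ₁) (hρ : ρ₁ < ρ₂) (m : ℤ) :
    Lp Spinor 2 (volume.restrict (Set.Ioo ρ₁ ρ₂)) →ₗᵢ[ℂ]
      Lp Spinor 2 (volume.restrict (annulus ρ₁ ρ₂)) where
  toFun v := (memLp_modeFun hρ₁ hρ m (Lp.memLp v)).toLp _
  map_add' u v := by
    rw [← MemLp.toLp_add, MemLp.toLp_eq_toLp_iff]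
    filter_upwards [modeFun_congr hρ₁ hρ m (Lp.coeFn_add u v)] with x hx
    rw [hx, Pi.add_apply, ← modeFun_add]
    rfl
  map_smul' c u := by
    rw [RingHom.id_apply, ← MemLp.toLp_const_smul, MemLp.toLp_eq_toLp_iff]
    filter_upwards [modeFun_congr hρ₁ hρ m (Lp.coeFn_smul c u)] with x hx
    rw [hx, Pi.smul_apply, ← modeFun_smul]
    rfl
  norm_map' v := by
    change ‖(memLp_modeFun hρ₁ hρ m (Lp.memLp v)).toLp _‖ = ‖v‖
    rw [Lp.norm_toLp, eLpNorm_modeFun hρ₁ hρ m (Lp.aestronglyMeasurable v), Lp.norm_def]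

theorem coeFn_modeMap (hρ₁ : 0 < ρ₁) (hρ : ρ₁ < ρ₂) (m : ℤ)
    (v : Lp Spinor 2 (volume.restrict (Set.Ioo ρ₁ ρ₂))) :
    modeMap hρ₁ hρ m v =ᵐ[volume.restrict (annulus ρ₁ ρ₂)] modeFun m v :=
  (memLp_modeFun hρ₁ hρ m (Lp.memLp v)).coeFn_toLp

theorem modeMap_toLp (hρ₁ : 0 < ρ₁) (hρ : ρ₁ < ρ₂) (m : ℤ) {v : ℝ → Spinor}
    (hv : MemLp v 2 (volume.restrict (Set.Ioo ρ₁ ρ₂))) :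
    modeMap hρ₁ hρ m (hv.toLp v) = (memLp_modeFun hρ₁ hρ m hv).toLp _ := by
  refine Lp.ext ((coeFn_modeMap hρ₁ hρ m _).trans ?_)
  exact (modeFun_congr hρ₁ hρ m hv.coeFn_toLp).trans (MemLp.coeFn_toLp _).symm

theorem inner_modeMap (hρ₁ : 0 < ρ₁) (hρ : ρ₁ < ρ₂) (m : ℤ)
    (v : Lp Spinor 2 (volume.restrict (Set.Ioo ρ₁ ρ₂)))
    (U : Lp Spinor 2 (volume.restrict (annulus ρ₁ ρ₂))) :
    inner ℂ (modeMap hρ₁ hρ m v) U = ∫ x in annulus ρ₁ ρ₂, inner ℂ (modeFun m v x) (U x) := by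
  rw [L2.inner_def]
  refine integral_congr_ae ?_
  filter_upwards [coeFn_modeMap hρ₁ hρ m v] with x hx
  rw [hx]

theorem orthogonalFamily_modeMap (hρ₁ : 0 < ρ₁) (hρ : ρ₁ < ρ₂) :
    OrthogonalFamily ℂ (fun _ : ℤ => Lp Spinor 2 (volume.restrict (Set.Ioo ρ₁ ρ₂)))
      (modeMap hρ₁ hρ) := by
  intro m n hmn u v
  rw [inner_modeMap, ← integral_inner_modeFun hρ₁ hρ hmn u v]
  refine integral_congr_ae ?_
  filter_upwards [coeFn_modeMap hρ₁ hρ n v] with x hx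
  rw [hx]

theorem annulus_subset_closedBall (ρ₁ ρ₂ : ℝ) :
    annulus ρ₁ ρ₂ ⊆ Metric.closedBall 0 |ρ₂| := by
  intro x hx
  have h2 : x.1 ^ 2 + x.2 ^ 2 < ρ₂ ^ 2 := hx.2
  rw [mem_closedBall_zero_iff, Prod.norm_def, Real.norm_eq_abs, Real.norm_eq_abs, max_le_iff,
    ← sq_le_sq, ← sq_le_sq]
  constructor <;> nlinarith [sq_nonneg x.1, sq_nonneg x.2]

instance isFiniteMeasure_annulus : IsFiniteMeasure (volume.restrict (annulus ρ₁ ρ₂)) := by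
  refine ⟨?_⟩
  rw [Measure.restrict_apply_univ]
  exact (measure_mono (annulus_subset_closedBall ρ₁ ρ₂)).trans_lt
    (isCompact_closedBall 0 |ρ₂|).measure_lt_top

/-- A measurable bounded multiplier preserves `L²`. -/
theorem memLp_bdd_smul {X : Type*} [MeasurableSpace X] {μ : Measure X} {f : X → Spinor} {a : X → ℂ}
    (hf : MemLp f 2 μ) (ha : AEStronglyMeasurable a μ) {C : ℝ} (hC : ∀ᵐ x ∂μ, ‖a x‖ ≤ C) :
    MemLp (fun x => a x • f x) 2 μ := by
  refine hf.of_le_mul (c := C) (ha.smul hf.1) ?_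
  filter_upwards [hC] with x hx
  rw [norm_smul]
  exact mul_le_mul_of_nonneg_right hx (norm_nonneg _)

theorem exists_bound_annulus {a : ℝ × ℝ → ℝ} (ha : Continuous a) :
    ∃ C, ∀ᵐ x ∂volume.restrict (annulus ρ₁ ρ₂), ‖(a x : ℂ)‖ ≤ C := by
  obtain ⟨C, hC⟩ := (isCompact_closedBall (0 : ℝ × ℝ) |ρ₂|).exists_bound_of_continuousOn
    ha.continuousOn
  refine ⟨C, ?_⟩
  filter_upwards [ae_mem_annulus ρ₁ ρ₂] with x hx
  rw [Complex.norm_real]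
  exact hC x (annulus_subset_closedBall ρ₁ ρ₂ hx)

theorem memLp_continuous_smul {f : ℝ × ℝ → Spinor} {a : ℝ × ℝ → ℝ} (ha : Continuous a)
    (hf : MemLp f 2 (volume.restrict (annulus ρ₁ ρ₂))) :
    MemLp (fun x => (a x : ℂ) • f x) 2 (volume.restrict (annulus ρ₁ ρ₂)) := by
  obtain ⟨C, hC⟩ := exists_bound_annulus (ρ₁ := ρ₁) (ρ₂ := ρ₂) ha
  exact memLp_bdd_smul hf (Complex.continuous_ofReal.comp ha).aestronglyMeasurable hC

/-- The functions of `L²(Ω)` orthogonal to all the angular modes. -/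
def IsModeFree (ρ₁ ρ₂ : ℝ) (f : ℝ × ℝ → Spinor) : Prop :=
  MemLp f 2 (volume.restrict (annulus ρ₁ ρ₂)) ∧
    ∀ (m : ℤ) (v : ℝ → Spinor), MemLp v 2 (volume.restrict (Set.Ioo ρ₁ ρ₂)) →
      ∫ x in annulus ρ₁ ρ₂, inner ℂ (modeFun m v x) (f x) = 0

theorem memLp_rmul {v : ℝ → Spinor} (hv : MemLp v 2 (volume.restrict (Set.Ioo ρ₁ ρ₂))) (c : ℂ) :
    MemLp (fun r : ℝ => ((r : ℂ) * c) • v r) 2 (volume.restrict (Set.Ioo ρ₁ ρ₂)) := by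
  refine memLp_bdd_smul hv (by fun_prop) (C := (|ρ₁| + |ρ₂|) * ‖c‖) ?_
  filter_upwards [ae_restrict_mem measurableSet_Ioo] with r hr
  rw [norm_mul, Complex.norm_real, Real.norm_eq_abs]
  refine mul_le_mul_of_nonneg_right ?_ (norm_nonneg c)
  rw [abs_le]
  constructor <;> linarith [hr.1, hr.2, neg_abs_le ρ₁, le_abs_self ρ₂, abs_nonneg ρ₁, abs_nonneg ρ₂]

theorem integrable_inner_memLp {X : Type*} [MeasurableSpace X] {μ : Measure X} {f g : X → Spinor}
    (hf : MemLp f 2 μ) (hg : MemLp g 2 μ) : Integrable (fun x => inner ℂ (f x) (g x)) μ := by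
  refine (L2.integrable_inner (𝕜 := ℂ) (hf.toLp f) (hg.toLp g)).congr ?_
  filter_upwards [hf.coeFn_toLp, hg.coeFn_toLp] with x h1 h2
  rw [h1, h2]

theorem integrable_inner_modeFun (hρ₁ : 0 < ρ₁) (hρ : ρ₁ < ρ₂) (m : ℤ) {v : ℝ → Spinor}
    (hv : MemLp v 2 (volume.restrict (Set.Ioo ρ₁ ρ₂))) {f : ℝ × ℝ → Spinor}
    (hf : MemLp f 2 (volume.restrict (annulus ρ₁ ρ₂))) :
    Integrable (fun x => inner ℂ (modeFun m v x) (f x)) (volume.restrict (annulus ρ₁ ρ₂)) :=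
  integrable_inner_memLp (memLp_modeFun hρ₁ hρ m hv) hf

/-- A multiplier `r (c e^{is} + d e^{-is})` moves the modes to neighbouring ones, so it preserves
the orthogonality to all of them. -/
theorem IsModeFree.mul_of_shift (hρ₁ : 0 < ρ₁) (hρ : ρ₁ < ρ₂) {f : ℝ × ℝ → Spinor}
    (hf : IsModeFree ρ₁ ρ₂ f) {a : ℝ × ℝ → ℝ} (ha : Continuous a) (c d : ℂ)
    (h : ∀ x ∈ annulus ρ₁ ρ₂, (a x : ℂ) = rad x * c * eang 1 x + rad x * d * eang (-1) x) :
    IsModeFree ρ₁ ρ₂ (fun x => (a x : ℂ) • f x) := by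
  refine ⟨memLp_continuous_smul ha hf.1, fun m v hv => ?_⟩
  have h1 := hf.2 (m + 1) _ (memLp_rmul hv c)
  have h2 := hf.2 (m + -1) _ (memLp_rmul hv d)
  have h3 := congrArg₂ (· + ·) h1 h2
  simp only [add_zero] at h3
  rw [← h3, ← integral_add (integrable_inner_modeFun hρ₁ hρ _ (memLp_rmul hv c) hf.1)
    (integrable_inner_modeFun hρ₁ hρ _ (memLp_rmul hv d) hf.1)]
  refine setIntegral_congr_fun (isOpen_annulus ρ₁ ρ₂).measurableSet fun x hx => ?_
  have hr := rad_pos_of_mem hρ₁ hρ hx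
  simp only
  rw [← inner_add_left, ← Complex.conj_ofReal, inner_smul_right, ← inner_smul_left, h x hx]
  congr 1
  simp only [modeFun, eang_add hr]
  module

theorem IsModeFree.fst_smul (hρ₁ : 0 < ρ₁) (hρ : ρ₁ < ρ₂) {f : ℝ × ℝ → Spinor}
    (hf : IsModeFree ρ₁ ρ₂ f) : IsModeFree ρ₁ ρ₂ (fun x => (x.1 : ℂ) • f x) := by
  refine hf.mul_of_shift hρ₁ hρ continuous_fst (1 / 2) (1 / 2) fun x hx => ?_
  have hr := rad_pos_of_mem hρ₁ hρ hx
  have hr' := rad_ne_zero hr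
  rw [eang_one, eang_neg_one hr]
  field_simp
  ring

theorem IsModeFree.snd_smul (hρ₁ : 0 < ρ₁) (hρ : ρ₁ < ρ₂) {f : ℝ × ℝ → Spinor}
    (hf : IsModeFree ρ₁ ρ₂ f) : IsModeFree ρ₁ ρ₂ (fun x => (x.2 : ℂ) • f x) := by
  refine hf.mul_of_shift hρ₁ hρ continuous_snd (-Complex.I / 2) (Complex.I / 2) fun x hx => ?_
  have hr := rad_pos_of_mem hρ₁ hρ hx
  have hr' := rad_ne_zero hr
  rw [eang_one, eang_neg_one hr]
  field_simp
  linear_combination (2 * (x.2 : ℂ)) * Complex.I_sq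

theorem IsModeFree.add {f g : ℝ × ℝ → Spinor} (hρ₁ : 0 < ρ₁) (hρ : ρ₁ < ρ₂)
    (hf : IsModeFree ρ₁ ρ₂ f) (hg : IsModeFree ρ₁ ρ₂ g) :
    IsModeFree ρ₁ ρ₂ (fun x => f x + g x) := by
  refine ⟨hf.1.add hg.1, fun m v hv => ?_⟩
  simp only [inner_add_right]
  rw [integral_add (integrable_inner_modeFun hρ₁ hρ _ hv hf.1)
    (integrable_inner_modeFun hρ₁ hρ _ hv hg.1), hf.2 m v hv, hg.2 m v hv, add_zero]

theorem IsModeFree.const_smul {f : ℝ × ℝ → Spinor} (c : ℂ)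
    (hf : IsModeFree ρ₁ ρ₂ f) : IsModeFree ρ₁ ρ₂ (fun x => c • f x) := by
  refine ⟨hf.1.const_smul c, fun m v hv => ?_⟩
  simp only [inner_smul_right]
  rw [integral_const_mul, hf.2 m v hv, mul_zero]

/-- The algebra of polynomial functions of the plane. -/
def planePoly : Subalgebra ℝ C(ℝ × ℝ, ℝ) :=
  Algebra.adjoin ℝ {⟨Prod.fst, continuous_fst⟩, ⟨Prod.snd, continuous_snd⟩}

theorem separatesPoints_planePoly : planePoly.SeparatesPoints := by
  intro x y hxy
  by_cases h : x.1 = y.1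
  · refine ⟨_, ⟨⟨Prod.snd, continuous_snd⟩, Algebra.subset_adjoin (by simp), rfl⟩, fun h2 => ?_⟩
    exact hxy (Prod.ext h h2)
  · exact ⟨_, ⟨⟨Prod.fst, continuous_fst⟩, Algebra.subset_adjoin (by simp), rfl⟩, h⟩

theorem IsModeFree.poly_smul (hρ₁ : 0 < ρ₁) (hρ : ρ₁ < ρ₂) {p : C(ℝ × ℝ, ℝ)}
    (hp : p ∈ planePoly) : ∀ {f : ℝ × ℝ → Spinor}, IsModeFree ρ₁ ρ₂ f →
      IsModeFree ρ₁ ρ₂ (fun x => (p x : ℂ) • f x) := by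
  induction hp using Algebra.adjoin_induction with
  | mem p hp =>
    intro f hf
    simp only [Set.mem_insert_iff, Set.mem_singleton_iff] at hp
    rcases hp with rfl | rfl
    · exact hf.fst_smul hρ₁ hρ
    · exact hf.snd_smul hρ₁ hρ
  | algebraMap r =>
    intro f hf
    exact hf.const_smul (r : ℂ)
  | add p q _ _ hp hq =>
    intro f hf
    have := (hp hf).add hρ₁ hρ (hq hf)
    simpa [add_smul] using this
  | mul p q _ _ hp hq =>
    intro f hf
    have := hp (hq hf)
    simpa [mul_smul] using this

/-- Completeness of the angular modes: the multiplications by the coordinates shift the modes, so a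
mode-free function is orthogonal to all polynomials times constant spinors, and it vanishes by
the Stone-Weierstrass theorem. -/
theorem IsModeFree.ae_eq_zero (hρ₁ : 0 < ρ₁) (hρ : ρ₁ < ρ₂) {f : ℝ × ℝ → Spinor}
    (hf : IsModeFree ρ₁ ρ₂ f) : f =ᵐ[volume.restrict (annulus ρ₁ ρ₂)] 0 := by
  have hΩ := isOpen_annulus ρ₁ ρ₂
  have hl := memLp_locallyIntegrableOn hf.1
  have hint : Integrable f (volume.restrict (annulus ρ₁ ρ₂)) := hf.1.integrable (by norm_num)
  -- a mode-free function is orthogonal to the polynomials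
  have hpoly : ∀ p ∈ planePoly, ∫ x in annulus ρ₁ ρ₂, p x • f x = 0 := by
    intro p hp
    have h1 := hf.poly_smul hρ₁ hρ hp
    have hi : Integrable (fun x => p x • f x) (volume.restrict (annulus ρ₁ ρ₂)) := by
      have := h1.1.integrable (by norm_num)
      simpa only [Complex.coe_smul] using this
    refine ext_inner_left ℂ fun e => ?_
    rw [inner_zero_right, ← integral_inner hi]
    -- the constant spinor `e` is the mode `0` with the radial function `√(2πr) e`
    have hv : MemLp (fun r : ℝ => ((Real.sqrt (2 * Real.pi * r) : ℝ) : ℂ) • e) 2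
        (volume.restrict (Set.Ioo ρ₁ ρ₂)) := by
      refine memLp_bdd_smul (memLp_const e) (by fun_prop) (C := Real.sqrt (2 * Real.pi * ρ₂)) ?_
      filter_upwards [ae_restrict_mem measurableSet_Ioo] with r hr
      rw [Complex.norm_real, Real.norm_of_nonneg (Real.sqrt_nonneg _)]
      exact Real.sqrt_le_sqrt (by nlinarith [Real.pi_pos, hr.2])
    rw [← h1.2 0 _ hv]
    refine setIntegral_congr_fun hΩ.measurableSet fun x hx => ?_
    have hr := rad_pos_of_mem hρ₁ hρ hx
    have hne : Real.sqrt (2 * Real.pi * rad x) ≠ 0 := by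
      have := Real.pi_pos
      positivity
    simp only [modeFun, eang_zero, mul_one, smul_smul, Complex.coe_smul]
    rw [inv_mul_cancel₀ hne, one_smul]
  refine (ae_restrict_iff' hΩ.measurableSet).2
    (hΩ.ae_eq_zero_of_integral_contDiff_smul_eq_zero hl fun η h1 h2 h3 => ?_)
  have hη : IsTestFunction (annulus ρ₁ ρ₂) η := ⟨h1, h2, h3⟩
  rw [← integral_test (Ω := annulus ρ₁ ρ₂) (fun x hx => by simp [hη.eq_zero hx])]
  have hiη := (integrable_continuous_smul hl h1.continuous h2 h3).integrableOn
    (s := annulus ρ₁ ρ₂)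
  rw [← norm_le_zero_iff]
  refine le_of_forall_pos_le_add fun ε hε => ?_
  rw [zero_add]
  set M := ∫ x in annulus ρ₁ ρ₂, ‖f x‖ with hM
  have hM0 : 0 ≤ M := integral_nonneg fun x => norm_nonneg _
  obtain ⟨p, hp, hpη⟩ :=
    ContinuousMap.exists_mem_subalgebra_near_continuous_of_isCompact_of_separatesPoints
      separatesPoints_planePoly ⟨η, h1.continuous⟩ (isCompact_closedBall (0 : ℝ × ℝ) |ρ₂|)
      (ε := ε / (M + 1)) (by positivity)
  have hip : Integrable (fun x => p x • f x) (volume.restrict (annulus ρ₁ ρ₂)) := by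
    have := (hf.poly_smul hρ₁ hρ hp).1.integrable (by norm_num)
    simpa only [Complex.coe_smul] using this
  have e1 : ∫ x in annulus ρ₁ ρ₂, η x • f x =
      ∫ x in annulus ρ₁ ρ₂, (η x • f x - p x • f x) := by
    rw [integral_sub hiη hip, hpoly p hp, sub_zero]
  rw [e1]
  refine (norm_integral_le_integral_norm _).trans ?_
  have h5 : ∫ x in annulus ρ₁ ρ₂, ‖η x • f x - p x • f x‖ ≤
      ∫ x in annulus ρ₁ ρ₂, ε / (M + 1) * ‖f x‖ := by
    refine setIntegral_mono_on (hiη.sub hip).norm (hint.norm.const_mul _) hΩ.measurableSet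
      fun x hx => ?_
    rw [← sub_smul, norm_smul]
    refine mul_le_mul_of_nonneg_right ?_ (norm_nonneg _)
    rw [norm_sub_rev]
    exact (hpη x (annulus_subset_closedBall ρ₁ ρ₂ hx)).le
  rw [integral_const_mul, ← hM] at h5
  refine h5.trans ?_
  rw [div_mul_eq_mul_div, div_le_iff₀ (by positivity)]
  nlinarith

theorem isHilbertSum_modeMap (hρ₁ : 0 < ρ₁) (hρ : ρ₁ < ρ₂) :
    IsHilbertSum ℂ (fun _ : ℤ => Lp Spinor 2 (volume.restrict (Set.Ioo ρ₁ ρ₂)))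
      (modeMap hρ₁ hρ) := by
  refine IsHilbertSum.mk (orthogonalFamily_modeMap hρ₁ hρ) ?_
  rw [top_le_iff, Submodule.topologicalClosure_eq_top_iff, Submodule.eq_bot_iff]
  intro f hf
  refine Lp.eq_zero_iff_ae_eq_zero.2 (IsModeFree.ae_eq_zero hρ₁ hρ ⟨Lp.memLp f, fun m v hv => ?_⟩)
  have h1 : modeMap hρ₁ hρ m (hv.toLp v) ∈
      ⨆ i, LinearMap.range (modeMap hρ₁ hρ i).toLinearMap :=
    Submodule.mem_iSup_of_mem m ⟨_, rfl⟩
  have h2 := (Submodule.mem_orthogonal _ f).1 hf _ h1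
  rw [modeMap_toLp, L2.inner_def] at h2
  rw [← h2]
  refine integral_congr_ae ?_
  filter_upwards [(memLp_modeFun hρ₁ hρ m hv).coeFn_toLp] with x hx
  rw [hx]

end Decomposition

/-! ### Derivatives of the angular modes -/

section ModeDeriv

/-- The form `x dx + y dy = r dr`. -/
def radForm (x : ℝ × ℝ) : ℝ × ℝ →L[ℝ] ℝ :=
  x.1 • ContinuousLinearMap.fst ℝ ℝ ℝ + x.2 • ContinuousLinearMap.snd ℝ ℝ ℝ

/-- The form `x dy - y dx = r² ds`. -/
def angForm (x : ℝ × ℝ) : ℝ × ℝ →L[ℝ] ℝ :=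
  x.1 • ContinuousLinearMap.snd ℝ ℝ ℝ - x.2 • ContinuousLinearMap.fst ℝ ℝ ℝ

theorem hasFDerivAt_rad {x : ℝ × ℝ} (hx : 0 < rad x) :
    HasFDerivAt rad ((rad x)⁻¹ • radForm x) x := by
  have h : x.1 ^ 2 + x.2 ^ 2 ≠ 0 := by
    rw [← rad_sq]
    positivity
  have h1 : HasFDerivAt (fun x : ℝ × ℝ => x.1 ^ 2 + x.2 ^ 2) _ x :=
    ((hasFDerivAt_fst (𝕜 := ℝ) (p := x)).pow 2).add ((hasFDerivAt_snd (𝕜 := ℝ) (p := x)).pow 2)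
  have h2 := h1.sqrt h
  refine h2.congr_fderiv ?_
  change (1 / (2 * rad x)) • _ = _
  ext <;> simp [radForm] <;> field_simp

theorem hasFDerivAt_eang {x : ℝ × ℝ} (hx : 0 < rad x) (m : ℤ) :
    HasFDerivAt (eang m)
      ((angForm x).smulRight (m * Complex.I * eang m x / (rad x : ℂ) ^ 2)) x := by
  have hr := rad_ne_zero hx
  have hz : HasFDerivAt (fun x : ℝ × ℝ => (x.1 : ℂ) + x.2 * Complex.I) _ x :=
    (Complex.ofRealCLM.hasFDerivAt.comp x (hasFDerivAt_fst (𝕜 := ℝ) (p := x))).add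
      ((Complex.ofRealCLM.hasFDerivAt.comp x (hasFDerivAt_snd (𝕜 := ℝ) (p := x))).mul_const
        Complex.I)
  have hd : HasFDerivAt (fun x : ℝ × ℝ => (rad x : ℂ)) _ x :=
    Complex.ofRealCLM.hasFDerivAt.comp x (hasFDerivAt_rad hx)
  have hinv : HasFDerivAt (fun z : ℂ => z⁻¹) _ (rad x : ℂ) :=
    ((hasDerivAt_inv hr).hasFDerivAt).restrictScalars ℝ
  have hE := hz.mul (hinv.comp x hd)
  have hb := eang_base_ne hx
  have hp : HasFDerivAt (fun z : ℂ => z ^ m) _ (((x.1 : ℂ) + x.2 * Complex.I) / (rad x : ℂ)) :=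
    ((hasDerivAt_zpow m _ (Or.inl hb)).hasFDerivAt).restrictScalars ℝ
  have := hp.comp x hE
  refine this.congr_fderiv ?_
  have e1 : eang m x = (((x.1 : ℂ) + x.2 * Complex.I) / (rad x : ℂ)) ^ (m - 1) *
      (((x.1 : ℂ) + x.2 * Complex.I) / (rad x : ℂ)) := by
    rw [← zpow_add_one₀ hb, sub_add_cancel]
    rfl
  have e2 := ofReal_rad_sq x
  have e3 : (rad x : ℂ) ^ 3 = rad x * ((x.1 : ℂ) ^ 2 + (x.2 : ℂ) ^ 2) := by
    rw [← e2]
    ring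
  rw [e1]
  ext
  · simp [angForm, radForm]
    field_simp
    rw [e2]
    linear_combination ((m : ℂ) * (x.2 : ℂ) ^ 2) * Complex.I_sq
  · simp [angForm, radForm]
    field_simp
    rw [e2]
    linear_combination (-(m : ℂ) * x.2 * x.1) * Complex.I_sq

/-- The radial part of `(∂ₓ + i∂_y)` on the mode `m`, with `v'` in the role of the derivative
of `v`. -/
def up (m : ℤ) (v v' : ℝ → Spinor) (r : ℝ) : Spinor := v' r - (((1 / 2 + m) / r : ℝ) : ℂ) • v r

/-- The radial part of `(∂ₓ - i∂_y)` on the mode `m`, with `v'` in the role of the derivative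
of `v`. -/
def down (m : ℤ) (v v' : ℝ → Spinor) (r : ℝ) : Spinor := v' r - (((1 / 2 - m) / r : ℝ) : ℂ) • v r

/-- The partial derivative of `modeFun m v` in `x`, with `v'` in the role of the derivative
of `v`. -/
def gradX (m : ℤ) (v v' : ℝ → Spinor) (x : ℝ × ℝ) : Spinor :=
  (1 / 2 : ℂ) • (modeFun (m + 1) (up m v v') x + modeFun (m - 1) (down m v v') x)

/-- The partial derivative of `modeFun m v` in `y`, with `v'` in the role of the derivative
of `v`. -/
def gradY (m : ℤ) (v v' : ℝ → Spinor) (x : ℝ × ℝ) : Spinor :=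
  (-Complex.I / 2) • (modeFun (m + 1) (up m v v') x - modeFun (m - 1) (down m v v') x)

theorem hasDerivAt_invSqrt_smul {v : ℝ → Spinor} {v' : Spinor} {r : ℝ} (hr : 0 < r)
    (hv : HasDerivAt v v' r) :
    HasDerivAt (fun r => (((Real.sqrt (2 * Real.pi * r))⁻¹ : ℝ) : ℂ) • v r)
      ((((Real.sqrt (2 * Real.pi * r))⁻¹ : ℝ) : ℂ) • (v' - ((1 / (2 * r) : ℝ) : ℂ) • v r)) r := by
  have hp : 0 < 2 * Real.pi * r := by
    have := Real.pi_pos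
    positivity
  have h1 : HasDerivAt (fun r => 2 * Real.pi * r) (2 * Real.pi) r := by
    simpa using (hasDerivAt_id r).const_mul (2 * Real.pi)
  have h2 := (h1.sqrt hp.ne').inv (Real.sqrt_pos.2 hp).ne'
  have h3 := h2.smul hv
  simp only [Complex.coe_smul]
  refine h3.congr_deriv ?_
  have hs := Real.sqrt_pos.2 hp
  have hsq : Real.sqrt (2 * Real.pi * r) ^ 2 = 2 * Real.pi * r := Real.sq_sqrt hp.le
  rw [smul_sub, smul_smul, sub_eq_add_neg, ← neg_smul]
  simp only [Pi.inv_apply]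
  congr 2
  field_simp
  rw [hsq]

theorem hasFDerivAt_modeFun (m : ℤ) {v : ℝ → Spinor} {v' : Spinor} {x : ℝ × ℝ} (hx : 0 < rad x)
    (hv : HasDerivAt v v' (rad x)) :
    HasFDerivAt (modeFun m v)
      (eang m x • (((rad x)⁻¹ • radForm x).smulRight
        ((((Real.sqrt (2 * Real.pi * rad x))⁻¹ : ℝ) : ℂ) •
          (v' - ((1 / (2 * rad x) : ℝ) : ℂ) • v (rad x)))) +
      ((angForm x).smulRight (m * Complex.I * eang m x / (rad x : ℂ) ^ 2)).smulRight
        ((((Real.sqrt (2 * Real.pi * rad x))⁻¹ : ℝ) : ℂ) • v (rad x))) x := by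
  have h1 := (hasDerivAt_invSqrt_smul hx hv).hasFDerivAt.comp x (hasFDerivAt_rad hx)
  have h2 := (hasFDerivAt_eang hx m).smul h1
  have e : modeFun m v = fun y => eang m y •
      ((fun r => (((Real.sqrt (2 * Real.pi * r))⁻¹ : ℝ) : ℂ) • v r) ∘ rad) y := by
    funext y
    rw [modeFun, mul_comm, mul_smul]
    rfl
  rw [e]
  refine h2.congr_fderiv ?_
  ext d <;> simp
  · left; ring
  · left; ring

theorem fderiv_modeFun_fst (m : ℤ) {v v' : ℝ → Spinor} {x : ℝ × ℝ} (hx : 0 < rad x)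
    (hv : HasDerivAt v (v' (rad x)) (rad x)) :
    fderiv ℝ (modeFun m v) x (1, 0) = gradX m v v' x := by
  have hr := rad_ne_zero hx
  rw [(hasFDerivAt_modeFun m hx hv).fderiv]
  simp only [gradX, modeFun, up, down, sub_eq_add_neg m 1, eang_add hx, eang_one, eang_neg_one hx]
  simp only [radForm, angForm, add_apply, smul_apply, ContinuousLinearMap.smulRight_apply,
    sub_apply, ContinuousLinearMap.coe_fst', ContinuousLinearMap.coe_snd', ← Complex.coe_smul,
    smul_eq_mul, mul_one, mul_zero, add_zero, zero_sub]
  push_cast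
  match_scalars <;> field_simp <;> ring

theorem fderiv_modeFun_snd (m : ℤ) {v v' : ℝ → Spinor} {x : ℝ × ℝ} (hx : 0 < rad x)
    (hv : HasDerivAt v (v' (rad x)) (rad x)) :
    fderiv ℝ (modeFun m v) x (0, 1) = gradY m v v' x := by
  have hr := rad_ne_zero hx
  rw [(hasFDerivAt_modeFun m hx hv).fderiv]
  simp only [gradY, modeFun, up, down, sub_eq_add_neg m 1, eang_add hx, eang_one, eang_neg_one hx]
  simp only [radForm, angForm, add_apply, smul_apply, ContinuousLinearMap.smulRight_apply,
    sub_apply, ContinuousLinearMap.coe_fst', ContinuousLinearMap.coe_snd', ← Complex.coe_smul,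
    smul_eq_mul, mul_one, mul_zero, zero_add, sub_zero]
  push_cast
  have hI := Complex.I_sq
  match_scalars
  · field_simp
    linear_combination (eang m x * x.2 * ((Real.sqrt (2 * Real.pi * rad x) : ℝ) : ℂ)⁻¹ * 2) * hI
  · field_simp
    linear_combination (-(eang m x * x.2 * ((Real.sqrt (2 * Real.pi * rad x) : ℝ) : ℂ)⁻¹ * 2)) * hI

/-- Modes of test functions are test functions. -/
theorem isTestFunction_modeFun {S : Set ℝ} (hS : IsOpen S) (hS0 : S ⊆ Set.Ioi 0) (m : ℤ)
    {v : ℝ → Spinor} (hv : IsTestFunction S v) : IsTestFunction (rad ⁻¹' S) (modeFun m v) := by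
  have hsub : tsupport (modeFun m v) ⊆ rad ⁻¹' (tsupport v) := by
    refine closure_minimal (fun x hx => subset_tsupport v ?_)
      ((isClosed_tsupport v).preimage continuous_rad)
    intro h0
    apply hx
    simp [modeFun, h0]
  have hts : tsupport (modeFun m v) ⊆ rad ⁻¹' S := fun x hx => hv.2.2 (hsub hx)
  refine ⟨contDiff_of_tsupport_subset (hS.preimage continuous_rad) (fun x hx => ?_) hts, ?_, hts⟩
  · have hr : 0 < rad x := hS0 hx
    refine ContDiffAt.contDiffWithinAt ?_
    have hp : 2 * Real.pi * rad x ≠ 0 := by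
      have := Real.pi_pos
      positivity
    have h1 : ContDiffAt ℝ ∞ (fun x => (((Real.sqrt (2 * Real.pi * rad x))⁻¹ : ℝ) : ℂ)) x :=
      Complex.ofRealCLM.contDiff.contDiffAt.comp x
        (((contDiffAt_const.mul (contDiffAt_rad hr)).sqrt hp).inv
          (Real.sqrt_ne_zero'.2 (lt_of_le_of_ne (by positivity) hp.symm)))
    exact (h1.mul (contDiffAt_eang hr m)).smul (hv.1.contDiffAt.comp x (contDiffAt_rad hr))
  · obtain ⟨R, hR⟩ := hv.2.1.isBounded.subset_closedBall (0 : ℝ)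
    refine (isCompact_closedBall (0 : ℝ × ℝ) R).of_isClosed_subset (isClosed_tsupport _) ?_
    intro x hx
    have h1 := hR (hsub hx)
    rw [mem_closedBall_zero_iff, Real.norm_of_nonneg (rad_nonneg x)] at h1
    rw [mem_closedBall_zero_iff, Prod.norm_def, Real.norm_eq_abs, Real.norm_eq_abs]
    have h3 := rad_sq x
    have h4 := rad_nonneg x
    refine (max_le ?_ ?_).trans h1
    · exact abs_le_of_sq_le_sq (by nlinarith [sq_nonneg x.2]) h4
    · exact abs_le_of_sq_le_sq (by nlinarith [sq_nonneg x.1]) h4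

theorem IsTestFunction.hasDerivAt {F : Type*} [NormedAddCommGroup F] [NormedSpace ℝ F] {S : Set ℝ}
    {v : ℝ → F} (hv : IsTestFunction S v) (r : ℝ) : HasDerivAt v (fderiv ℝ v r 1) r := by
  have := (hv.1.differentiable (by simp) r).hasDerivAt
  rwa [← fderiv_apply_one_eq_deriv] at this

end ModeDeriv

/-! ### Sobolev regularity of the angular modes -/

section ModeSobolev

theorem tendsto_bdd_smul {X : Type*} [MeasurableSpace X] {μ : Measure X} {un : ℕ → X → Spinor}
    {u : X → Spinor} {a : X → ℂ} {C : ℝ} (hC : ∀ᵐ x ∂μ, ‖a x‖ ≤ C)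
    (h : Tendsto (fun n => eLpNorm (fun x => un n x - u x) 2 μ) atTop (𝓝 0)) :
    Tendsto (fun n => eLpNorm (fun x => a x • un n x - a x • u x) 2 μ) atTop (𝓝 0) := by
  have h2 : Tendsto (fun n => ENNReal.ofReal C * eLpNorm (fun x => un n x - u x) 2 μ) atTop
      (𝓝 0) := by
    simpa using ENNReal.Tendsto.const_mul h (Or.inr (by simp))
  refine tendsto_of_tendsto_of_tendsto_of_le_of_le tendsto_const_nhds h2 (fun _ => zero_le)
    fun n => eLpNorm_le_mul_eLpNorm_of_ae_le_mul ?_ 2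
  filter_upwards [hC] with x hx
  rw [← smul_sub, norm_smul]
  gcongr

variable {ρ₁ ρ₂ : ℝ}

theorem tendsto_modeFun (hρ₁ : 0 < ρ₁) (hρ : ρ₁ < ρ₂) (m : ℤ) {vn : ℕ → ℝ → Spinor}
    {v : ℝ → Spinor} (hvn : ∀ n, MemLp (vn n) 2 (volume.restrict (Set.Ioo ρ₁ ρ₂)))
    (hv : MemLp v 2 (volume.restrict (Set.Ioo ρ₁ ρ₂)))
    (h : Tendsto (fun n => eLpNorm (fun x => vn n x - v x) 2
      (volume.restrict (Set.Ioo ρ₁ ρ₂))) atTop (𝓝 0)) :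
    Tendsto (fun n => eLpNorm (fun x => modeFun m (vn n) x - modeFun m v x) 2
      (volume.restrict (annulus ρ₁ ρ₂))) atTop (𝓝 0) := by
  refine h.congr fun n => ?_
  have := eLpNorm_modeFun hρ₁ hρ m ((hvn n).1.sub hv.1)
  refine this.symm.trans ?_
  congr 1
  funext x
  simp [modeFun, smul_sub]

theorem norm_div_le_of_mem (hρ₁ : 0 < ρ₁) (c : ℝ) :
    ∀ᵐ r ∂volume.restrict (Set.Ioo ρ₁ ρ₂), ‖((c / r : ℝ) : ℂ)‖ ≤ |c| / ρ₁ := by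
  filter_upwards [ae_restrict_mem measurableSet_Ioo] with r hr
  rw [Complex.norm_real, norm_div, Real.norm_eq_abs, Real.norm_eq_abs,
    abs_of_pos (hρ₁.trans hr.1)]
  have := hr.1.le
  gcongr

theorem memLp_div_smul (hρ₁ : 0 < ρ₁) (c : ℝ) {v : ℝ → Spinor}
    (hv : MemLp v 2 (volume.restrict (Set.Ioo ρ₁ ρ₂))) :
    MemLp (fun r => ((c / r : ℝ) : ℂ) • v r) 2 (volume.restrict (Set.Ioo ρ₁ ρ₂)) :=
  memLp_bdd_smul hv (by fun_prop) (norm_div_le_of_mem hρ₁ c)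

theorem down_eq_up (m : ℤ) (v v' : ℝ → Spinor) : down m v v' = up (-m) v v' := by
  funext r
  simp [down, up, sub_eq_add_neg]

theorem memLp_up (hρ₁ : 0 < ρ₁) (m : ℤ) {v v' : ℝ → Spinor}
    (hv : MemLp v 2 (volume.restrict (Set.Ioo ρ₁ ρ₂)))
    (hv' : MemLp v' 2 (volume.restrict (Set.Ioo ρ₁ ρ₂))) :
    MemLp (up m v v') 2 (volume.restrict (Set.Ioo ρ₁ ρ₂)) :=
  hv'.sub (memLp_div_smul hρ₁ _ hv)

theorem memLp_down (hρ₁ : 0 < ρ₁) (m : ℤ) {v v' : ℝ → Spinor}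
    (hv : MemLp v 2 (volume.restrict (Set.Ioo ρ₁ ρ₂)))
    (hv' : MemLp v' 2 (volume.restrict (Set.Ioo ρ₁ ρ₂))) :
    MemLp (down m v v') 2 (volume.restrict (Set.Ioo ρ₁ ρ₂)) :=
  hv'.sub (memLp_div_smul hρ₁ _ hv)

theorem memLp_gradX (hρ₁ : 0 < ρ₁) (hρ : ρ₁ < ρ₂) (m : ℤ) {v v' : ℝ → Spinor}
    (hv : MemLp v 2 (volume.restrict (Set.Ioo ρ₁ ρ₂)))
    (hv' : MemLp v' 2 (volume.restrict (Set.Ioo ρ₁ ρ₂))) :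
    MemLp (gradX m v v') 2 (volume.restrict (annulus ρ₁ ρ₂)) :=
  ((memLp_modeFun hρ₁ hρ (m + 1) (memLp_up hρ₁ m hv hv')).add
    (memLp_modeFun hρ₁ hρ (m - 1) (memLp_down hρ₁ m hv hv'))).const_smul (1 / 2 : ℂ)

theorem memLp_gradY (hρ₁ : 0 < ρ₁) (hρ : ρ₁ < ρ₂) (m : ℤ) {v v' : ℝ → Spinor}
    (hv : MemLp v 2 (volume.restrict (Set.Ioo ρ₁ ρ₂)))
    (hv' : MemLp v' 2 (volume.restrict (Set.Ioo ρ₁ ρ₂))) :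
    MemLp (gradY m v v') 2 (volume.restrict (annulus ρ₁ ρ₂)) :=
  ((memLp_modeFun hρ₁ hρ (m + 1) (memLp_up hρ₁ m hv hv')).sub
    (memLp_modeFun hρ₁ hρ (m - 1) (memLp_down hρ₁ m hv hv'))).const_smul (-Complex.I / 2)

section Limits

variable {vn vn' : ℕ → ℝ → Spinor} {v v' : ℝ → Spinor}

theorem tendsto_up (hρ₁ : 0 < ρ₁) (m : ℤ)
    (hvn : ∀ n, MemLp (vn n) 2 (volume.restrict (Set.Ioo ρ₁ ρ₂)))
    (hvn' : ∀ n, MemLp (vn' n) 2 (volume.restrict (Set.Ioo ρ₁ ρ₂)))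
    (hv : MemLp v 2 (volume.restrict (Set.Ioo ρ₁ ρ₂)))
    (hv' : MemLp v' 2 (volume.restrict (Set.Ioo ρ₁ ρ₂)))
    (h : Tendsto (fun n => eLpNorm (fun x => vn n x - v x) 2
      (volume.restrict (Set.Ioo ρ₁ ρ₂))) atTop (𝓝 0))
    (h' : Tendsto (fun n => eLpNorm (fun x => vn' n x - v' x) 2
      (volume.restrict (Set.Ioo ρ₁ ρ₂))) atTop (𝓝 0)) :
    Tendsto (fun n => eLpNorm (fun x => up m (vn n) (vn' n) x - up m v v' x) 2
      (volume.restrict (Set.Ioo ρ₁ ρ₂))) atTop (𝓝 0) := by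
  have := tendsto_add_aux (fun n => (hvn' n).1)
    (fun n => ((memLp_div_smul hρ₁ (-(1 / 2 + m)) (hvn n)).1)) hv'.1
    (memLp_div_smul hρ₁ (-(1 / 2 + m)) hv).1 h'
    (tendsto_bdd_smul (norm_div_le_of_mem hρ₁ (-(1 / 2 + m))) h)
  refine this.congr fun n => ?_
  congr 1
  funext x
  simp only [up, neg_div, Complex.ofReal_neg, neg_smul]
  abel

theorem tendsto_grad (hρ₁ : 0 < ρ₁) (hρ : ρ₁ < ρ₂) (m : ℤ)
    (hvn : ∀ n, MemLp (vn n) 2 (volume.restrict (Set.Ioo ρ₁ ρ₂)))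
    (hvn' : ∀ n, MemLp (vn' n) 2 (volume.restrict (Set.Ioo ρ₁ ρ₂)))
    (hv : MemLp v 2 (volume.restrict (Set.Ioo ρ₁ ρ₂)))
    (hv' : MemLp v' 2 (volume.restrict (Set.Ioo ρ₁ ρ₂)))
    (h : Tendsto (fun n => eLpNorm (fun x => vn n x - v x) 2
      (volume.restrict (Set.Ioo ρ₁ ρ₂))) atTop (𝓝 0))
    (h' : Tendsto (fun n => eLpNorm (fun x => vn' n x - v' x) 2
      (volume.restrict (Set.Ioo ρ₁ ρ₂))) atTop (𝓝 0)) :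
    Tendsto (fun n => eLpNorm (fun x => gradX m (vn n) (vn' n) x - gradX m v v' x) 2
      (volume.restrict (annulus ρ₁ ρ₂))) atTop (𝓝 0) ∧
    Tendsto (fun n => eLpNorm (fun x => gradY m (vn n) (vn' n) x - gradY m v v' x) 2
      (volume.restrict (annulus ρ₁ ρ₂))) atTop (𝓝 0) := by
  have h1 := tendsto_modeFun hρ₁ hρ (m + 1) (fun n => memLp_up hρ₁ m (hvn n) (hvn' n))
    (memLp_up hρ₁ m hv hv') (tendsto_up hρ₁ m hvn hvn' hv hv' h h')
  have h2 : Tendsto (fun n => eLpNorm (fun x => modeFun (m - 1) (down m (vn n) (vn' n)) x -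
      modeFun (m - 1) (down m v v') x) 2 (volume.restrict (annulus ρ₁ ρ₂))) atTop (𝓝 0) := by
    simp only [down_eq_up]
    exact tendsto_modeFun hρ₁ hρ (m - 1) (fun n => memLp_up hρ₁ (-m) (hvn n) (hvn' n))
      (memLp_up hρ₁ (-m) hv hv') (tendsto_up hρ₁ (-m) hvn hvn' hv hv' h h')
  have m1 := fun n => (memLp_modeFun hρ₁ hρ (m + 1) (memLp_up hρ₁ m (hvn n) (hvn' n))).1
  have m2 := fun n => (memLp_modeFun hρ₁ hρ (m - 1) (memLp_down hρ₁ m (hvn n) (hvn' n))).1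
  have m3 := (memLp_modeFun hρ₁ hρ (m + 1) (memLp_up hρ₁ m hv hv')).1
  have m4 := (memLp_modeFun hρ₁ hρ (m - 1) (memLp_down hρ₁ m hv hv')).1
  have hX := tendsto_smul_aux (1 / 2) (tendsto_add_aux m1 m2 m3 m4 h1 h2)
  refine ⟨hX, ?_⟩
  have h3 := tendsto_smul_aux (-1) h2
  refine (tendsto_smul_aux (-Complex.I / 2) (tendsto_add_aux m1 (fun n => (m2 n).const_smul (-1 : ℂ)) m3
    (m4.const_smul (-1 : ℂ)) h1 h3)).congr fun n => ?_
  congr 1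
  funext x
  simp only [gradY, Pi.smul_apply]
  module

end Limits

theorem fderiv_modeFun_test_ae_eq (hρ₁ : 0 < ρ₁) (hρ : ρ₁ < ρ₂) {S : Set ℝ} {η : ℝ → Spinor}
    (hη : IsTestFunction S η) (m : ℤ) :
    (fun x => fderiv ℝ (modeFun m η) x (1, 0)) =ᵐ[volume.restrict (annulus ρ₁ ρ₂)]
      gradX m η (fun r => fderiv ℝ η r 1) ∧
    (fun x => fderiv ℝ (modeFun m η) x (0, 1)) =ᵐ[volume.restrict (annulus ρ₁ ρ₂)]
      gradY m η (fun r => fderiv ℝ η r 1) := by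
  constructor <;> filter_upwards [ae_mem_annulus ρ₁ ρ₂] with x hx
  · exact fderiv_modeFun_fst m (v' := fun r => fderiv ℝ η r 1) (rad_pos_of_mem hρ₁ hρ hx)
      (hη.hasDerivAt _)
  · exact fderiv_modeFun_snd m (v' := fun r => fderiv ℝ η r 1) (rad_pos_of_mem hρ₁ hρ hx)
      (hη.hasDerivAt _)

theorem IsTestFunction.memLp_restrict {S : Set ℝ} {η : ℝ → Spinor} (hη : IsTestFunction S η)
    (T : Set ℝ) : MemLp η 2 (volume.restrict T) :=
  (hη.1.continuous.memLp_of_hasCompactSupport hη.2.1).restrict T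

theorem annulus_eq_preimage (hρ₁ : 0 < ρ₁) (hρ : ρ₁ < ρ₂) :
    annulus ρ₁ ρ₂ = rad ⁻¹' Set.Ioo ρ₁ ρ₂ := by
  ext x
  exact mem_annulus_iff hρ₁ hρ

/-- The gradient of a mode with a Sobolev radial factor, by smooth approximation. -/
theorem hasWeakDeriv_modeFun (hρ₁ : 0 < ρ₁) (hρ : ρ₁ < ρ₂) (m : ℤ) {v v' : ℝ → Spinor}
    (hv : MemLp v 2 (volume.restrict (Set.Ioo ρ₁ ρ₂)))
    (hv' : MemLp v' 2 (volume.restrict (Set.Ioo ρ₁ ρ₂)))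
    (h : HasWeakDeriv (Set.Ioo ρ₁ ρ₂) (1 : ℝ) v v') :
    HasWeakDeriv (annulus ρ₁ ρ₂) (1, 0) (modeFun m v) (gradX m v v') ∧
      HasWeakDeriv (annulus ρ₁ ρ₂) (0, 1) (modeFun m v) (gradY m v v') := by
  obtain ⟨η, h1, h2, h3⟩ := exists_smooth_approx hρ₁ hρ hv' h
  have hm := fun n => (h1 n).memLp_restrict (Set.Ioo ρ₁ ρ₂)
  have hm' := fun n => ((h1 n).fderiv_apply 1).memLp_restrict (Set.Ioo ρ₁ ρ₂)
  have hg := tendsto_grad hρ₁ hρ m hm hm' hv hv' h2 h3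
  have ht := tendsto_modeFun hρ₁ hρ m hm hv h2
  have hT := fun n => isTestFunction_modeFun isOpen_Ioi subset_rfl m (h1 n)
  have hΩ : IsOpen (annulus ρ₁ ρ₂) := isOpen_annulus _ _
  have hw := fun n (d : ℝ × ℝ) => HasWeakDeriv.of_contDiffOn (v := d) hΩ
    (((hT n).1.of_le (by simp)).contDiffOn)
  have hp := fun n => memLp_modeFun hρ₁ hρ m (hm n)
  constructor
  · exact HasWeakDeriv.of_tendsto (fun n => (hw n (1, 0)).congr₂ (ae_eq_refl _)
      (fderiv_modeFun_test_ae_eq hρ₁ hρ (h1 n) m).1.symm) hp (memLp_modeFun hρ₁ hρ m hv)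
      (fun n => memLp_gradX hρ₁ hρ m (hm n) (hm' n)) (memLp_gradX hρ₁ hρ m hv hv') ht hg.1
  · exact HasWeakDeriv.of_tendsto (fun n => (hw n (0, 1)).congr₂ (ae_eq_refl _)
      (fderiv_modeFun_test_ae_eq hρ₁ hρ (h1 n) m).2.symm) hp (memLp_modeFun hρ₁ hρ m hv)
      (fun n => memLp_gradY hρ₁ hρ m (hm n) (hm' n)) (memLp_gradY hρ₁ hρ m hv hv') ht hg.2

theorem memH10_of_tendsto {Ω : Set (ℝ × ℝ)} {U G₁ G₂ : ℝ × ℝ → Spinor}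
    (hU : MemLp U 2 (volume.restrict Ω)) (h1 : MemLp G₁ 2 (volume.restrict Ω))
    (h2 : MemLp G₂ 2 (volume.restrict Ω)) {η : ℕ → ℝ × ℝ → Spinor}
    (hη : ∀ n, IsTestFunction Ω (η n))
    (t0 : Tendsto (fun n => eLpNorm (fun x => η n x - U x) 2 (volume.restrict Ω)) atTop (𝓝 0))
    (t1 : Tendsto (fun n => eLpNorm (fun x => fderiv ℝ (η n) x (1, 0) - G₁ x) 2
      (volume.restrict Ω)) atTop (𝓝 0))
    (t2 : Tendsto (fun n => eLpNorm (fun x => fderiv ℝ (η n) x (0, 1) - G₂ x) 2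
      (volume.restrict Ω)) atTop (𝓝 0)) : MemH10 Ω U := by
  refine memH10_of_approx hU h1 h2 fun ε hε => ?_
  obtain ⟨n, a, b, c⟩ := ((t0.eventually (ge_mem_nhds hε)).and ((t1.eventually
    (ge_mem_nhds hε)).and (t2.eventually (ge_mem_nhds hε)))).exists
  exact ⟨η n, hη n, a, b, c⟩

theorem memH10_modeFun (hρ₁ : 0 < ρ₁) (hρ : ρ₁ < ρ₂) (m : ℤ) {v : ℝ → Spinor}
    (hv : MemH10 (Set.Ioo ρ₁ ρ₂) v) : MemH10 (annulus ρ₁ ρ₂) (modeFun m v) := by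
  obtain ⟨hv0, η, h1, h2, h3⟩ := hv
  obtain ⟨g, hg, h3⟩ := h3 1
  have hm := fun n => (h1 n).memLp_restrict (Set.Ioo ρ₁ ρ₂)
  have hm' := fun n => ((h1 n).fderiv_apply 1).memLp_restrict (Set.Ioo ρ₁ ρ₂)
  have ht := tendsto_grad hρ₁ hρ m hm hm' hv0 hg h2 h3
  have hT : ∀ n, IsTestFunction (annulus ρ₁ ρ₂) (modeFun m (η n)) := fun n => by
    rw [annulus_eq_preimage hρ₁ hρ]
    exact isTestFunction_modeFun isOpen_Ioo (fun r hr => hρ₁.trans hr.1) m (h1 n)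
  refine memH10_of_tendsto (memLp_modeFun hρ₁ hρ m hv0) (memLp_gradX hρ₁ hρ m hv0 hg)
    (memLp_gradY hρ₁ hρ m hv0 hg) hT (tendsto_modeFun hρ₁ hρ m hm hv0 h2)
    (ht.1.congr fun n => ?_) (ht.2.congr fun n => ?_)
  · refine eLpNorm_congr_ae ?_
    filter_upwards [(fderiv_modeFun_test_ae_eq hρ₁ hρ (h1 n) m).1] with x hx
    rw [hx]
  · refine eLpNorm_congr_ae ?_
    filter_upwards [(fderiv_modeFun_test_ae_eq hρ₁ hρ (h1 n) m).2] with x hx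
    rw [hx]

/-- The derivative of `up m v v'`, with `v'`, `v''` in the role of the derivatives of `v`. -/
def derivUp (m : ℤ) (v v' v'' : ℝ → Spinor) (r : ℝ) : Spinor :=
  up m v' v'' r + (((1 / 2 + m) / r ^ 2 : ℝ) : ℂ) • v r

theorem norm_div_sq_le_of_mem (hρ₁ : 0 < ρ₁) (c : ℝ) :
    ∀ᵐ r ∂volume.restrict (Set.Ioo ρ₁ ρ₂), ‖((c / r ^ 2 : ℝ) : ℂ)‖ ≤ |c| / ρ₁ ^ 2 := by
  filter_upwards [ae_restrict_mem measurableSet_Ioo] with r hr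
  rw [Complex.norm_real, norm_div, Real.norm_eq_abs, Real.norm_eq_abs,
    abs_of_pos (pow_pos (hρ₁.trans hr.1) 2)]
  have := hr.1.le
  gcongr

theorem memLp_derivUp (hρ₁ : 0 < ρ₁) (m : ℤ) {v v' v'' : ℝ → Spinor}
    (hv : MemLp v 2 (volume.restrict (Set.Ioo ρ₁ ρ₂)))
    (hv' : MemLp v' 2 (volume.restrict (Set.Ioo ρ₁ ρ₂)))
    (hv'' : MemLp v'' 2 (volume.restrict (Set.Ioo ρ₁ ρ₂))) :
    MemLp (derivUp m v v' v'') 2 (volume.restrict (Set.Ioo ρ₁ ρ₂)) :=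
  (memLp_up hρ₁ m hv' hv'').add
    (memLp_bdd_smul hv (Complex.measurable_ofReal.comp
      (measurable_const.div (measurable_id.pow_const 2))).aestronglyMeasurable
      (norm_div_sq_le_of_mem hρ₁ _))

theorem hasWeakDeriv_smul_interval {a a' : ℝ → ℝ} {s : Set ℝ} (hs : IsOpen s)
    (ha : ContDiffOn ℝ ∞ a s) (ha' : ∀ r ∈ s, HasDerivAt a (a' r) r) {v v' : ℝ → Spinor}
    (h : HasWeakDeriv s (1 : ℝ) v v') :
    HasWeakDeriv s (1 : ℝ) (fun r => (a r : ℂ) • v r)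
      (fun r => (a' r : ℂ) • v r + (a r : ℂ) • v' r) := by
  refine (h.smooth_smul hs ha).congr₂ (ae_of_all _ fun r => Complex.coe_smul _ _) ?_
  filter_upwards [ae_restrict_mem hs.measurableSet] with r hr
  rw [fderiv_apply_one_eq_deriv, (ha' r hr).deriv, Complex.coe_smul, Complex.coe_smul]

theorem hasWeakDeriv_up (hρ₁ : 0 < ρ₁) (m : ℤ) {v v' v'' : ℝ → Spinor}
    (h : HasWeakDeriv (Set.Ioo ρ₁ ρ₂) (1 : ℝ) v v')
    (h' : HasWeakDeriv (Set.Ioo ρ₁ ρ₂) (1 : ℝ) v' v'') :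
    HasWeakDeriv (Set.Ioo ρ₁ ρ₂) (1 : ℝ) (up m v v') (derivUp m v v' v'') := by
  have h0 : ∀ r ∈ Set.Ioo ρ₁ ρ₂, r ≠ 0 := fun r hr => (hρ₁.trans hr.1).ne'
  have := hasWeakDeriv_smul_interval (a := fun r => -(1 / 2 + m) / r)
    (a' := fun r => (1 / 2 + m) / r ^ 2) isOpen_Ioo
    (contDiffOn_const.div contDiffOn_id h0) (fun r hr => ?_) h
  · refine (h'.add this).congr₂ (ae_of_all _ fun r => ?_) (ae_of_all _ fun r => ?_)
    · simp only [up]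
      push_cast
      module
    · simp only [up, derivUp]
      push_cast
      module
  · have h0r := h0 r hr
    refine ((hasDerivAt_const r (-(1 / 2 + m : ℝ))).div (hasDerivAt_id r) h0r).congr_deriv ?_
    simp

theorem MemH2.exists_interval {v : ℝ → Spinor} (hv : MemH2 (Set.Ioo ρ₁ ρ₂) v) :
    ∃ v' v'' : ℝ → Spinor, MemLp v' 2 (volume.restrict (Set.Ioo ρ₁ ρ₂)) ∧
      MemLp v'' 2 (volume.restrict (Set.Ioo ρ₁ ρ₂)) ∧
      HasWeakDeriv (Set.Ioo ρ₁ ρ₂) (1 : ℝ) v v' ∧ HasWeakDeriv (Set.Ioo ρ₁ ρ₂) (1 : ℝ) v' v'' := by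
  obtain ⟨v', a, b, c⟩ := hv.2 1
  obtain ⟨v'', d, e⟩ := c 1
  exact ⟨v', v'', a, d, b, e⟩

theorem HasWeakDeriv.dir_interval {v v' : ℝ → Spinor} {s : Set ℝ}
    (h : HasWeakDeriv s (1 : ℝ) v v') (a : ℝ) :
    HasWeakDeriv s a v (fun x => a • v' x) := by
  simpa using h.dir_add h a 0

theorem memH2_interval {v v' v'' : ℝ → Spinor}
    (hv : MemLp v 2 (volume.restrict (Set.Ioo ρ₁ ρ₂)))
    (hv' : MemLp v' 2 (volume.restrict (Set.Ioo ρ₁ ρ₂)))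
    (hv'' : MemLp v'' 2 (volume.restrict (Set.Ioo ρ₁ ρ₂)))
    (h : HasWeakDeriv (Set.Ioo ρ₁ ρ₂) (1 : ℝ) v v')
    (h' : HasWeakDeriv (Set.Ioo ρ₁ ρ₂) (1 : ℝ) v' v'') : MemH2 (Set.Ioo ρ₁ ρ₂) v := by
  refine ⟨hv, fun a => ⟨_, hv'.const_smul a, h.dir_interval a, fun b =>
    ⟨_, (hv''.const_smul b).const_smul a, ?_⟩⟩⟩
  have := (h'.dir_interval b).smul (a : ℂ)
  simp only [Complex.coe_smul] at this
  exact this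

/-- `U ∈ H¹(Ω, ℂ²)` with gradient `(G₁, G₂)`. -/
structure HasGrad (Ω : Set (ℝ × ℝ)) (U G₁ G₂ : ℝ × ℝ → Spinor) : Prop where
  memLp : MemLp U 2 (volume.restrict Ω)
  memLp_fst : MemLp G₁ 2 (volume.restrict Ω)
  memLp_snd : MemLp G₂ 2 (volume.restrict Ω)
  fst : HasWeakDeriv Ω (1, 0) U G₁
  snd : HasWeakDeriv Ω (0, 1) U G₂

section HasGrad

variable {Ω : Set (ℝ × ℝ)} {U G₁ G₂ V K₁ K₂ : ℝ × ℝ → Spinor}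

theorem HasGrad.add (h : HasGrad Ω U G₁ G₂) (h' : HasGrad Ω V K₁ K₂) :
    HasGrad Ω (fun x => U x + V x) (fun x => G₁ x + K₁ x) (fun x => G₂ x + K₂ x) :=
  ⟨h.1.add h'.1, h.2.add h'.2, h.3.add h'.3, h.4.add h'.4, h.5.add h'.5⟩

theorem HasGrad.smul (c : ℂ) (h : HasGrad Ω U G₁ G₂) :
    HasGrad Ω (fun x => c • U x) (fun x => c • G₁ x) (fun x => c • G₂ x) :=
  ⟨h.1.const_smul c, h.2.const_smul c, h.3.const_smul c, h.4.smul c, h.5.smul c⟩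

theorem HasGrad.congr (h : HasGrad Ω U G₁ G₂) (hU : V =ᵐ[volume.restrict Ω] U)
    (h1 : K₁ =ᵐ[volume.restrict Ω] G₁) (h2 : K₂ =ᵐ[volume.restrict Ω] G₂) :
    HasGrad Ω V K₁ K₂ :=
  ⟨(memLp_congr_ae hU).2 h.1, (memLp_congr_ae h1).2 h.2, (memLp_congr_ae h2).2 h.3,
    h.4.congr₂ hU h1, h.5.congr₂ hU h2⟩

theorem HasGrad.memH2 (h : HasGrad Ω U G₁ G₂) {K : Fin 2 → Fin 2 → ℝ × ℝ → Spinor}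
    (h1 : HasGrad Ω G₁ (K 0 0) (K 0 1)) (h2 : HasGrad Ω G₂ (K 1 0) (K 1 1)) : MemH2 Ω U := by
  refine memH2_of_plane h.1 (G := ![G₁, G₂]) (fun i => ?_) (fun i => ?_) (K := K)
    (fun i j => ?_) (fun i j => ?_)
  · fin_cases i
    exacts [h.2, h.3]
  · fin_cases i
    exacts [h.4, h.5]
  · fin_cases i <;> fin_cases j
    exacts [h1.2, h1.3, h2.2, h2.3]
  · fin_cases i <;> fin_cases j
    exacts [h1.4, h1.5, h2.4, h2.5]

theorem MemH2.exists_hasGrad (h : MemH2 Ω U) : ∃ G₁ G₂, ∃ K : Fin 2 → Fin 2 → ℝ × ℝ → Spinor,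
    HasGrad Ω U G₁ G₂ ∧ HasGrad Ω G₁ (K 0 0) (K 0 1) ∧ HasGrad Ω G₂ (K 1 0) (K 1 1) := by
  obtain ⟨G₁, a1, b1, c1⟩ := h.2 (1, 0)
  obtain ⟨G₂, a2, b2, c2⟩ := h.2 (0, 1)
  obtain ⟨K11, d11, e11⟩ := c1 (1, 0)
  obtain ⟨K12, d12, e12⟩ := c1 (0, 1)
  obtain ⟨K21, d21, e21⟩ := c2 (1, 0)
  obtain ⟨K22, d22, e22⟩ := c2 (0, 1)
  exact ⟨G₁, G₂, ![![K11, K12], ![K21, K22]], ⟨h.1, a1, a2, b1, b2⟩, ⟨a1, d11, d12, e11, e12⟩,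
    ⟨a2, d21, d22, e21, e22⟩⟩

end HasGrad

theorem hasGrad_modeFun (hρ₁ : 0 < ρ₁) (hρ : ρ₁ < ρ₂) (m : ℤ) {v v' : ℝ → Spinor}
    (hv : MemLp v 2 (volume.restrict (Set.Ioo ρ₁ ρ₂)))
    (hv' : MemLp v' 2 (volume.restrict (Set.Ioo ρ₁ ρ₂)))
    (h : HasWeakDeriv (Set.Ioo ρ₁ ρ₂) (1 : ℝ) v v') :
    HasGrad (annulus ρ₁ ρ₂) (modeFun m v) (gradX m v v') (gradY m v v') :=
  ⟨memLp_modeFun hρ₁ hρ m hv, memLp_gradX hρ₁ hρ m hv hv', memLp_gradY hρ₁ hρ m hv hv',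
    (hasWeakDeriv_modeFun hρ₁ hρ m hv hv' h).1, (hasWeakDeriv_modeFun hρ₁ hρ m hv hv' h).2⟩

theorem memH2_modeFun (hρ₁ : 0 < ρ₁) (hρ : ρ₁ < ρ₂) (m : ℤ) {v : ℝ → Spinor}
    (hv : MemH2 (Set.Ioo ρ₁ ρ₂) v) : MemH2 (annulus ρ₁ ρ₂) (modeFun m v) := by
  obtain ⟨v', v'', l1, l2, h1, h2⟩ := hv.exists_interval
  have A := hasGrad_modeFun hρ₁ hρ (m + 1) (memLp_up hρ₁ m hv.1 l1)
    (memLp_derivUp hρ₁ m hv.1 l1 l2) (hasWeakDeriv_up hρ₁ m h1 h2)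
  have B := hasGrad_modeFun hρ₁ hρ (m - 1) (memLp_up hρ₁ (-m) hv.1 l1)
    (memLp_derivUp hρ₁ (-m) hv.1 l1 l2) (hasWeakDeriv_up hρ₁ (-m) h1 h2)
  rw [← down_eq_up] at B
  have C := (A.add (B.smul (-1))).smul (-Complex.I / 2)
  exact (hasGrad_modeFun hρ₁ hρ m hv.1 l1 h1).memH2 (K := ![![_, _], ![_, _]])
    ((A.add B).smul (1 / 2))
    (C.congr (ae_of_all _ fun x => by simp only [gradY]; module) (ae_eq_refl _) (ae_eq_refl _))

end ModeSobolev

/-! ### Sobolev regularity of the angular coefficients -/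

section Coefficients

theorem tendsto_integral_inner (𝕜 : Type*) [RCLike 𝕜] {H X : Type*} [NormedAddCommGroup H]
    [InnerProductSpace 𝕜 H] [MeasurableSpace X] {μ : Measure X} {f u : X → H} {un : ℕ → X → H}
    (hf : MemLp f 2 μ) (hun : ∀ n, MemLp (un n) 2 μ) (hu : MemLp u 2 μ)
    (h : Tendsto (fun n => eLpNorm (fun x => un n x - u x) 2 μ) atTop (𝓝 0)) :
    Tendsto (fun n => ∫ x, inner 𝕜 (f x) (un n x) ∂μ) atTop (𝓝 (∫ x, inner 𝕜 (f x) (u x) ∂μ)) := by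
  have key : ∀ {w : X → H} (hw : MemLp w 2 μ),
      inner 𝕜 (hf.toLp f) (hw.toLp w) = ∫ x, inner 𝕜 (f x) (w x) ∂μ := fun hw => by
    rw [L2.inner_def]
    refine integral_congr_ae ?_
    filter_upwards [hf.coeFn_toLp, hw.coeFn_toLp] with x h1 h2
    rw [h1, h2]
  have ht : Tendsto (fun n => (hun n).toLp (un n)) atTop (𝓝 (hu.toLp u)) := by
    rw [Lp.tendsto_Lp_iff_tendsto_eLpNorm'']
    exact h
  have := (tendsto_const_nhds (x := hf.toLp f)).inner (𝕜 := 𝕜) ht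
  simpa only [key] using this

variable {ρ₁ ρ₂ : ℝ}

/-- `u` is the radial coefficient of the angular mode `m` of `U`. -/
def HasCoef (ρ₁ ρ₂ : ℝ) (m : ℤ) (U : ℝ × ℝ → Spinor) (u : ℝ → Spinor) : Prop :=
  MemLp u 2 (volume.restrict (Set.Ioo ρ₁ ρ₂)) ∧
    ∀ v : ℝ → Spinor, MemLp v 2 (volume.restrict (Set.Ioo ρ₁ ρ₂)) →
      ∫ x in annulus ρ₁ ρ₂, inner ℂ (modeFun m v x) (U x) =
        ∫ r in Set.Ioo ρ₁ ρ₂, inner ℂ (v r) (u r)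

theorem hasCoef_component (hρ₁ : 0 < ρ₁) (hρ : ρ₁ < ρ₂) (m : ℤ)
    (U : Lp Spinor 2 (volume.restrict (annulus ρ₁ ρ₂))) :
    HasCoef ρ₁ ρ₂ m U (component (modeMap hρ₁ hρ) m U) := by
  refine ⟨Lp.memLp _, fun v hv => ?_⟩
  have h := inner_component (modeMap hρ₁ hρ) m (hv.toLp v) U
  rw [inner_modeMap, L2.inner_def] at h
  refine Eq.trans ?_ (h.symm.trans ?_)
  · refine integral_congr_ae ?_
    filter_upwards [modeFun_congr hρ₁ hρ m hv.coeFn_toLp] with x hx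
    rw [hx]
  · refine integral_congr_ae ?_
    filter_upwards [hv.coeFn_toLp] with x hx
    rw [hx]

theorem exists_hasCoef (hρ₁ : 0 < ρ₁) (hρ : ρ₁ < ρ₂) (m : ℤ) {U : ℝ × ℝ → Spinor}
    (hU : MemLp U 2 (volume.restrict (annulus ρ₁ ρ₂))) : ∃ u, HasCoef ρ₁ ρ₂ m U u := by
  obtain ⟨h1, h2⟩ := hasCoef_component hρ₁ hρ m (hU.toLp U)
  refine ⟨_, h1, fun v hv => (h2 v hv).symm ▸ ?_⟩
  refine integral_congr_ae ?_
  filter_upwards [hU.coeFn_toLp] with x hx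
  rw [hx]

/-- For `ε = ±1`, `∂ₓ + εi∂_y` sends the mode `n` to the mode `n + ε`, on which it acts by `∂_r -
(1/2 + εn) / r`; the term `1/2` comes from the factor `r^{-1/2}`. -/
theorem mode_dbar {ε : ℤ} (hε : ε = 1 ∨ ε = -1) (n : ℤ) (v v' : ℝ → Spinor) (x : ℝ × ℝ) :
    gradX n v v' x + (ε * Complex.I) • gradY n v v' x = modeFun (n + ε) (up (ε * n) v v') x := by
  have hI := Complex.I_mul_I
  rcases hε with rfl | rfl
  · simp only [gradX, gradY, smul_smul, Int.cast_one, one_mul]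
    rw [show Complex.I * (-Complex.I / 2) = (1 / 2 : ℂ) by linear_combination (-1 / 2 : ℂ) * hI]
    module
  · simp only [gradX, gradY, smul_smul, Int.cast_neg, Int.cast_one, neg_mul, one_mul,
      ← down_eq_up]
    rw [show -(Complex.I * (-Complex.I / 2)) = (-1 / 2 : ℂ) by
      linear_combination (1 / 2 : ℂ) * hI, sub_eq_add_neg n 1]
    module

/-- The adjoint of `∂ₓ ∓ i∂_y` on the modes, tested against `χ e` in the radial variable. -/
theorem integral_coef_test (hρ₁ : 0 < ρ₁) (hρ : ρ₁ < ρ₂) {ε : ℤ} (hε : ε = 1 ∨ ε = -1) {m : ℤ}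
    {U G₁ G₂ : ℝ × ℝ → Spinor} {u g : ℝ → Spinor} (hU : HasGrad (annulus ρ₁ ρ₂) U G₁ G₂)
    (hu : HasCoef ρ₁ ρ₂ m U u)
    (hg : HasCoef ρ₁ ρ₂ (m + ε) (fun x => G₁ x + (ε * Complex.I) • G₂ x) g)
    {χ : ℝ → ℝ} (hχ : IsTestFunction (Set.Ioi 0) χ)
    (hx : ∀ e : Spinor, ∫ x in annulus ρ₁ ρ₂,
      inner ℂ (fderiv ℝ (modeFun (m + ε) fun r => χ r • e) x (1, 0)) (U x) =
        -∫ x in annulus ρ₁ ρ₂, inner ℂ (modeFun (m + ε) (fun r => χ r • e) x) (G₁ x))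
    (hy : ∀ e : Spinor, ∫ x in annulus ρ₁ ρ₂,
      inner ℂ (fderiv ℝ (modeFun (m + ε) fun r => χ r • e) x (0, 1)) (U x) =
        -∫ x in annulus ρ₁ ρ₂, inner ℂ (modeFun (m + ε) (fun r => χ r • e) x) (G₂ x)) :
    ∫ r in Set.Ioo ρ₁ ρ₂, fderiv ℝ χ r 1 • u r =
      -∫ r in Set.Ioo ρ₁ ρ₂, χ r • (g r + (((1 / 2 + ε * m) / r : ℝ) : ℂ) • u r) := by
  set I := Set.Ioo ρ₁ ρ₂
  have hdu := memLp_div_smul hρ₁ (1 / 2 + ε * m) hu.1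
  have hbd : ∀ {a : ℝ → ℝ} {w : ℝ → Spinor}, Continuous a → HasCompactSupport a →
      MemLp w 2 (volume.restrict I) → Integrable (fun r => a r • w r) (volume.restrict I) :=
    fun ha hc hw => by
      obtain ⟨C, hC⟩ := hc.exists_bound_of_continuous ha
      have := memLp_bdd_smul (a := fun r => (_ : ℂ)) hw
        (Complex.continuous_ofReal.comp ha).aestronglyMeasurable
        (ae_of_all _ fun r => (Complex.norm_real _).trans_le (hC r))
      have h1 : IsFiniteMeasure (volume.restrict I) := ⟨by simp [I]⟩
      have h2 := this.integrable (by norm_num)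
      simpa only [Complex.coe_smul, Function.comp] using h2
  have i1 := hbd (hχ.fderiv_apply 1).1.continuous (hχ.fderiv_apply 1).2.1 hu.1
  have i2 : Integrable (fun r => χ r • (g r + (((1 / 2 + ε * m) / r : ℝ) : ℂ) • u r))
      (volume.restrict I) := hbd hχ.1.continuous hχ.2.1 (hg.1.add hdu)
  refine ext_inner_left ℂ fun e => ?_
  rw [inner_neg_right, ← integral_inner i1, ← integral_inner i2]
  have hη := hχ.smul_const e
  set η : ℝ → Spinor := fun r => χ r • e
  have hη' : ∀ r, fderiv ℝ η r 1 = fderiv ℝ χ r 1 • e := fun r => by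
    have := ((hχ.hasDerivAt r).smul_const e).deriv
    rw [fderiv_apply_one_eq_deriv]
    exact this
  have hηm := hη.memLp_restrict I
  have hηm' := (hη.fderiv_apply 1).memLp_restrict I
  have hT := (isTestFunction_modeFun isOpen_Ioi subset_rfl (m + ε) hη).mono (Set.subset_univ _)
  have hTl := memLp_modeFun hρ₁ hρ (m + ε) hηm
  have hup := memLp_up hρ₁ (-ε * (m + ε)) hηm hηm'
  have hε2 : ε * ε = 1 := by rcases hε with rfl | rfl <;> rfl
  have hε2' : (ε : ℝ) * ε = 1 := by exact_mod_cast hε2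
  have k1 := memLp_gradX hρ₁ hρ (m + ε) hηm hηm'
  have k2 := memLp_gradY hρ₁ hρ (m + ε) hηm hηm'
  -- the left-hand side is the pairing of `(∂ₓ - εi∂_y) Ψ` with `U`
  have L : ∫ x in annulus ρ₁ ρ₂,
      inner ℂ (modeFun m (up (-ε * (m + ε)) η fun r => fderiv ℝ η r 1) x) (U x) =
      -∫ x in annulus ρ₁ ρ₂, inner ℂ (modeFun (m + ε) η x) (G₁ x + (ε * Complex.I) • G₂ x) := by
    have hx' := hx e
    have hy' := hy e
    have ex : ∫ x in annulus ρ₁ ρ₂, inner ℂ (fderiv ℝ (modeFun (m + ε) η) x (1, 0)) (U x) =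
        ∫ x in annulus ρ₁ ρ₂, inner ℂ (gradX (m + ε) η (fun r => fderiv ℝ η r 1) x) (U x) := by
      refine integral_congr_ae ?_
      filter_upwards [(fderiv_modeFun_test_ae_eq hρ₁ hρ hη (m + ε)).1] with x hx
      rw [hx]
    have ey : ∫ x in annulus ρ₁ ρ₂, inner ℂ (fderiv ℝ (modeFun (m + ε) η) x (0, 1)) (U x) =
        ∫ x in annulus ρ₁ ρ₂, inner ℂ (gradY (m + ε) η (fun r => fderiv ℝ η r 1) x) (U x) := by
      refine integral_congr_ae ?_
      filter_upwards [(fderiv_modeFun_test_ae_eq hρ₁ hρ hη (m + ε)).2] with x hx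
      rw [hx]
    rw [ex] at hx'
    rw [ey] at hy'
    have hm : ∀ x, modeFun m (up (-ε * (m + ε)) η fun r => fderiv ℝ η r 1) x =
        gradX (m + ε) η (fun r => fderiv ℝ η r 1) x +
          ((-ε : ℤ) * Complex.I) • gradY (m + ε) η (fun r => fderiv ℝ η r 1) x := fun x => by
      rw [mode_dbar (by omega), add_neg_cancel_right]
    have hc : (starRingEnd ℂ) ((-ε : ℤ) * Complex.I) = ε * Complex.I := by
      simp
    simp only [hm, inner_add_left, inner_add_right, inner_smul_left, inner_smul_right, hc]
    rw [integral_add (integrable_inner_memLp k1 hU.1)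
      ((integrable_inner_memLp k2 hU.1).const_mul _),
      integral_add (integrable_inner_memLp hTl hU.2)
      ((integrable_inner_memLp hTl hU.3).const_mul _), integral_const_mul, integral_const_mul,
      hx', hy']
    ring
  rw [hu.2 _ hup, hg.2 _ hηm] at L
  have e1 : ∀ r, inner ℂ (up (-ε * (m + ε)) η (fun r => fderiv ℝ η r 1) r) (u r) =
      inner ℂ e (fderiv ℝ χ r 1 • u r) +
        inner ℂ (η r) ((((1 / 2 + ε * m) / r : ℝ) : ℂ) • u r) := fun r => by
    have hc : (1 / 2 + ((-ε * (m + ε) : ℤ) : ℝ)) / r = -((1 / 2 + ε * m) / r) := by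
      push_cast
      rw [← neg_div]
      congr 1
      linear_combination -hε2'
    rw [up, hη', hc, Complex.ofReal_neg, neg_smul, sub_neg_eq_add, inner_add_left]
    rw [inner_real_smul_left, inner_real_smul_right, inner_smul_left, inner_smul_right,
      Complex.conj_ofReal]
  simp only [e1] at L
  have i3 := integrable_inner_memLp hηm hdu
  have i4 := integrable_inner_memLp hηm hg.1
  rw [integral_add (i1.const_inner e) i3] at L
  have e2 : ∀ r, inner ℂ e (χ r • (g r + (((1 / 2 + ε * m) / r : ℝ) : ℂ) • u r)) =
      inner ℂ (η r) (g r) + inner ℂ (η r) ((((1 / 2 + ε * m) / r : ℝ) : ℂ) • u r) := fun r => by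
    rw [← inner_add_right, inner_real_smul_left, inner_real_smul_right]
  simp only [e2]
  rw [integral_add i4 i3]
  linear_combination L

/-- The radial coefficients of a Sobolev function are Sobolev functions. -/
theorem HasCoef.hasWeakDeriv (hρ₁ : 0 < ρ₁) (hρ : ρ₁ < ρ₂) {ε : ℤ} (hε : ε = 1 ∨ ε = -1) {m : ℤ}
    {U G₁ G₂ : ℝ × ℝ → Spinor} {u g : ℝ → Spinor} (hU : HasGrad (annulus ρ₁ ρ₂) U G₁ G₂)
    (hu : HasCoef ρ₁ ρ₂ m U u)
    (hg : HasCoef ρ₁ ρ₂ (m + ε) (fun x => G₁ x + (ε * Complex.I) • G₂ x) g) :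
    HasWeakDeriv (Set.Ioo ρ₁ ρ₂) (1 : ℝ) u
      (fun r => g r + (((1 / 2 + ε * m) / r : ℝ) : ℂ) • u r) := by
  have hdu := memLp_div_smul hρ₁ (1 / 2 + ε * m) hu.1
  refine ⟨memLp_locallyIntegrableOn hu.1, memLp_locallyIntegrableOn (hg.1.add hdu),
    fun χ hχ => ?_⟩
  have hT : ∀ e : Spinor, IsTestFunction (annulus ρ₁ ρ₂) (modeFun (m + ε) fun r => χ r • e) :=
    fun e => by
      rw [annulus_eq_preimage hρ₁ hρ]
      exact isTestFunction_modeFun isOpen_Ioo (fun r hr => hρ₁.trans hr.1) _ (hχ.smul_const e)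
  exact integral_coef_test hρ₁ hρ hε hU hu hg (hχ.mono fun r hr => hρ₁.trans hr.1)
    (fun e => hU.4.inner_test (hT e)) (fun e => hU.5.inner_test (hT e))

/-- Integration by parts for `H¹₀` functions against functions which need not vanish on the
boundary. -/
theorem MemH10.inner_test {Ω : Set (ℝ × ℝ)} (hΩ : IsOpen Ω) {U G : ℝ × ℝ → Spinor} {d : ℝ × ℝ}
    (hU : MemH10 Ω U) (h : HasWeakDeriv Ω d U G)
    {Ψ : ℝ × ℝ → Spinor} (hΨ : IsTestFunction Set.univ Ψ) :
    ∫ x in Ω, inner ℂ (fderiv ℝ Ψ x d) (U x) = -∫ x in Ω, inner ℂ (Ψ x) (G x) := by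
  obtain ⟨hU0, η, h1, h2, h3⟩ := hU
  obtain ⟨g, hg, h3⟩ := h3 d
  have hgG := h.ae_eq hΩ (hasWeakDeriv_of_tendsto_test hΩ h1 hU0 hg h2 h3)
  have l1 : MemLp Ψ 2 (volume.restrict Ω) :=
    (hΨ.1.continuous.memLp_of_hasCompactSupport hΨ.2.1).restrict Ω
  have l2 : MemLp (fun x => fderiv ℝ Ψ x d) 2 (volume.restrict Ω) :=
    ((hΨ.fderiv_apply d).1.continuous.memLp_of_hasCompactSupport
      (hΨ.fderiv_apply d).2.1).restrict Ω
  have t1 := tendsto_integral_inner ℂ l2 (fun n => (h1 n).memLp) hU0 h2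
  have t2 := tendsto_integral_inner ℂ l1 (fun n => ((h1 n).fderiv_apply d).memLp) hg h3
  have e : ∀ n, ∫ x in Ω, inner ℂ (fderiv ℝ Ψ x d) (η n x) =
      -∫ x in Ω, inner ℂ (Ψ x) (fderiv ℝ (η n) x d) := fun n => by
    rw [integral_test fun x hx => by rw [(h1 n).eq_zero hx, inner_zero_right],
      integral_test fun x hx => by rw [((h1 n).fderiv_apply d).eq_zero hx, inner_zero_right]]
    have := (HasWeakDeriv.of_contDiffOn (v := d) isOpen_univ
      ((h1 n).1.of_le (by simp)).contDiffOn).inner_test hΨ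
    simpa using this
  have e3 : ∫ x in Ω, inner ℂ (Ψ x) (G x) = ∫ x in Ω, inner ℂ (Ψ x) (g x) := by
    refine integral_congr_ae ?_
    filter_upwards [hgG] with x hx
    rw [hx]
  rw [e3]
  exact tendsto_nhds_unique t1 (t2.neg.congr fun n => (e n).symm)

theorem indicator_memLp {s t : Set ℝ} (hs : MeasurableSet s) {u : ℝ → Spinor}
    (hu : MemLp u 2 (volume.restrict s)) : MemLp (s.indicator u) 2 (volume.restrict t) :=
  ((memLp_indicator_iff_restrict hs).2 hu).restrict t

/-- The radial coefficients of `H¹₀` functions are in `H¹₀`: the extension by zero of the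
coefficient has a weak derivative on a larger interval. -/
theorem HasCoef.memH10 (hρ₁ : 0 < ρ₁) (hρ : ρ₁ < ρ₂) {m : ℤ}
    {U G₁ G₂ : ℝ × ℝ → Spinor} {u : ℝ → Spinor} (hU : HasGrad (annulus ρ₁ ρ₂) U G₁ G₂)
    (hU0 : MemH10 (annulus ρ₁ ρ₂) U) (hu : HasCoef ρ₁ ρ₂ m U u) : MemH10 (Set.Ioo ρ₁ ρ₂) u := by
  have hΩ := isOpen_annulus ρ₁ ρ₂
  obtain ⟨g₀, hg⟩ := exists_hasCoef hρ₁ hρ (m + 1)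
    (hU.2.add (hU.3.const_smul (((1 : ℤ) : ℂ) * Complex.I)))
  have hdu := memLp_div_smul hρ₁ (1 / 2 + (1 : ℤ) * m) hu.1
  set g : ℝ → Spinor := fun r => g₀ r + (((1 / 2 + (1 : ℤ) * m) / r : ℝ) : ℂ) • u r
  have hgl : MemLp g 2 (volume.restrict (Set.Ioo ρ₁ ρ₂)) := hg.1.add hdu
  have hI : MeasurableSet (Set.Ioo ρ₁ ρ₂) := measurableSet_Ioo
  set J := Set.Ioo (ρ₁ / 2) (2 * ρ₂)
  have hIJ : Set.Ioo ρ₁ ρ₂ ⊆ J := Set.Ioo_subset_Ioo (by linarith) (by linarith)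
  have hJ : ∀ f : ℝ → Spinor, ∫ r in J, (Set.Ioo ρ₁ ρ₂).indicator f r =
      ∫ r in Set.Ioo ρ₁ ρ₂, f r := fun f => by
    rw [setIntegral_indicator hI, Set.inter_eq_self_of_subset_right hIJ]
  have hext : HasWeakDeriv J (1 : ℝ) ((Set.Ioo ρ₁ ρ₂).indicator u)
      ((Set.Ioo ρ₁ ρ₂).indicator g) := by
    refine ⟨memLp_locallyIntegrableOn (indicator_memLp hI hu.1),
      memLp_locallyIntegrableOn (indicator_memLp hI hgl), fun χ hχ => ?_⟩
    have hχ' : IsTestFunction (Set.Ioi 0) χ := hχ.mono fun r hr => (half_pos hρ₁).trans hr.1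
    have hT : ∀ e : Spinor, IsTestFunction Set.univ (modeFun (m + 1) fun r => χ r • e) := fun e =>
      (isTestFunction_modeFun isOpen_Ioi subset_rfl _ (hχ'.smul_const e)).mono (Set.subset_univ _)
    have := integral_coef_test hρ₁ hρ (Or.inl rfl) hU hu hg hχ'
      (fun e => hU0.inner_test hΩ hU.4 (hT e)) (fun e => hU0.inner_test hΩ hU.5 (hT e))
    have e1 : ∀ (a : ℝ → ℝ) (f : ℝ → Spinor) (r : ℝ), a r • (Set.Ioo ρ₁ ρ₂).indicator f r =
        (Set.Ioo ρ₁ ρ₂).indicator (fun r => a r • f r) r := fun a f r => by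
      by_cases hr : r ∈ Set.Ioo ρ₁ ρ₂ <;> simp [hr]
    simp only [e1 (fun r => fderiv ℝ χ r 1), e1 χ, hJ]
    exact this
  obtain ⟨c, hc⟩ := hext.ae_eq_primitive (by linarith) (indicator_memLp hI hgl)
  -- the primitive is continuous and vanishes on both components of the complement
  have hval : ∀ {x y : ℝ}, x < y → Set.Ioo x y ⊆ J → (Set.Ioo x y ∩ Set.Ioo ρ₁ ρ₂ = ∅) →
      ∃ r ∈ Set.Ioo x y, c + ∫ t in (ρ₁ / 2)..r, (Set.Ioo ρ₁ ρ₂).indicator g t = 0 := by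
    intro x y hxy hs he
    have h1 : ∀ᵐ r ∂volume.restrict (Set.Ioo x y), (Set.Ioo ρ₁ ρ₂).indicator u r =
        c + ∫ t in (ρ₁ / 2)..r, (Set.Ioo ρ₁ ρ₂).indicator g t :=
      ae_mono (Measure.restrict_mono hs le_rfl) hc
    rw [ae_restrict_iff' measurableSet_Ioo, ae_iff] at h1
    have h2 : ∃ r ∈ Set.Ioo x y, (Set.Ioo ρ₁ ρ₂).indicator u r =
        c + ∫ t in (ρ₁ / 2)..r, (Set.Ioo ρ₁ ρ₂).indicator g t := by
      by_contra! hcon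
      have h3 : volume (Set.Ioo x y) = 0 := measure_mono_null (fun r hr => by
        exact fun h => hcon r hr (h hr)) h1
      rw [Real.volume_Ioo, ENNReal.ofReal_eq_zero] at h3
      linarith
    obtain ⟨r, hr, h3⟩ := h2
    refine ⟨r, hr, h3.symm.trans (Set.indicator_of_notMem (fun h => ?_) _)⟩
    have : r ∈ Set.Ioo x y ∩ Set.Ioo ρ₁ ρ₂ := ⟨hr, h⟩
    rw [he] at this
    exact this
  have hint : ∀ x y : ℝ, IntervalIntegrable ((Set.Ioo ρ₁ ρ₂).indicator g) volume x y := by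
    intro x y
    refine Integrable.intervalIntegrable ?_
    have h1 : IsFiniteMeasure (volume.restrict (Set.Ioo ρ₁ ρ₂)) := ⟨by simp⟩
    exact (integrable_indicator_iff hI).2 (hgl.integrable (by norm_num))
  have hzero : ∀ {x y : ℝ}, x ≤ y → (Set.Ioo x y ∩ Set.Ioo ρ₁ ρ₂ = ∅) →
      ∫ t in x..y, (Set.Ioo ρ₁ ρ₂).indicator g t = 0 := by
    intro x y hxy he
    rw [intervalIntegral_eq_Ioo hxy]
    refine (setIntegral_congr_fun measurableSet_Ioo fun t ht => ?_).trans (integral_zero ℝ Spinor)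
    refine Set.indicator_of_notMem (fun h => ?_) _
    have : t ∈ Set.Ioo x y ∩ Set.Ioo ρ₁ ρ₂ := ⟨ht, h⟩
    rw [he] at this
    exact this
  have hp : ∀ r ∈ Set.Icc ρ₁ ρ₂, ∫ t in (ρ₁ / 2)..r, (Set.Ioo ρ₁ ρ₂).indicator g t =
      ∫ t in ρ₁..r, g t := by
    intro r hr
    rw [← intervalIntegral.integral_add_adjacent_intervals (hint _ ρ₁) (hint ρ₁ r),
      hzero (by linarith) (by ext t; simp; intro _ _ _; linarith), zero_add,
      intervalIntegral_eq_Ioo hr.1, intervalIntegral_eq_Ioo hr.1]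
    refine setIntegral_congr_fun measurableSet_Ioo fun t ht => ?_
    exact Set.indicator_of_mem (show t ∈ Set.Ioo ρ₁ ρ₂ from ⟨ht.1, ht.2.trans_le hr.2⟩) _
  obtain ⟨r1, hr1, z1⟩ := hval (x := ρ₁ / 2) (y := ρ₁) (by linarith)
    (Set.Ioo_subset_Ioo le_rfl (by linarith)) (by ext t; simp; intro _ _ _; linarith)
  rw [hzero hr1.1.le (by
    ext t; simp; intro _ h _; have := hr1.2; linarith), add_zero] at z1
  subst z1
  obtain ⟨r2, hr2, z2⟩ := hval (x := ρ₂) (y := 2 * ρ₂) (by linarith)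
    (Set.Ioo_subset_Ioo (by linarith) le_rfl) (by ext t; simp; intro _ _ _; linarith)
  rw [zero_add, ← intervalIntegral.integral_add_adjacent_intervals (hint _ ρ₂) (hint ρ₂ r2),
    hp ρ₂ ⟨hρ.le, le_rfl⟩, hzero hr2.1.le (by ext t; simp; intro _ _ _; linarith),
    add_zero] at z2
  refine memH10_of_primitive hρ hgl z2 ?_
  have h1 := ae_mono (Measure.restrict_mono hIJ le_rfl) hc
  filter_upwards [h1, ae_restrict_mem hI] with r hr hrI
  rw [Set.indicator_of_mem hrI] at hr
  rw [hr, zero_add, hp r ⟨hrI.1.le, hrI.2.le⟩]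

theorem HasCoef.memH2 (hρ₁ : 0 < ρ₁) (hρ : ρ₁ < ρ₂) {m : ℤ} {U : ℝ × ℝ → Spinor} {u : ℝ → Spinor}
    (hU : MemH2 (annulus ρ₁ ρ₂) U) (hu : HasCoef ρ₁ ρ₂ m U u) : MemH2 (Set.Ioo ρ₁ ρ₂) u := by
  obtain ⟨G₁, G₂, K, h, h1, h2⟩ := hU.exists_hasGrad
  have hV := h1.add (h2.smul (((1 : ℤ) : ℂ) * Complex.I))
  obtain ⟨g, hg⟩ := exists_hasCoef hρ₁ hρ (m + 1) hV.1
  obtain ⟨k, hk⟩ := exists_hasCoef hρ₁ hρ (m + 1 + 1)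
    (hV.2.add (hV.3.const_smul (((1 : ℤ) : ℂ) * Complex.I)))
  have w1 := hu.hasWeakDeriv hρ₁ hρ (Or.inl rfl) h hg
  have w2 := hg.hasWeakDeriv hρ₁ hρ (Or.inl rfl) hV hk
  have hdu := memLp_div_smul hρ₁ (1 / 2 + (1 : ℤ) * m) hu.1
  have hdg := memLp_div_smul hρ₁ (1 / 2 + (1 : ℤ) * (m + 1 : ℤ)) hg.1
  have h0 : ∀ r ∈ Set.Ioo ρ₁ ρ₂, r ≠ 0 := fun r hr => (hρ₁.trans hr.1).ne'
  have w3 := hasWeakDeriv_smul_interval (a := fun r => (1 / 2 + (1 : ℤ) * m) / r)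
    (a' := fun r => -(1 / 2 + (1 : ℤ) * m) / r ^ 2) isOpen_Ioo
    (contDiffOn_const.div contDiffOn_id h0) (fun r hr => by
      have h0r := h0 r hr
      refine ((hasDerivAt_const r (1 / 2 + (1 : ℤ) * m : ℝ)).div (hasDerivAt_id r)
        h0r).congr_deriv ?_
      simp) w1
  refine memH2_interval hu.1 (hg.1.add hdu) ?_ w1 (w2.add w3)
  refine (hk.1.add hdg).add (MemLp.add ?_ (memLp_div_smul hρ₁ _ (hg.1.add hdu)))
  exact memLp_bdd_smul hu.1 (Complex.measurable_ofReal.comp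
      (measurable_const.div (measurable_id.pow_const 2))).aestronglyMeasurable
      (norm_div_sq_le_of_mem hρ₁ _)

end Coefficients

/-! ### Superposition of angular modes -/

section Superposition

section Limits

variable {Ω : Set (ℝ × ℝ)}

theorem HasGrad.of_tendsto {Un G₁n G₂n : ℕ → Lp Spinor 2 (volume.restrict Ω)}
    {U G₁ G₂ : Lp Spinor 2 (volume.restrict Ω)} (h : ∀ n, HasGrad Ω (Un n) (G₁n n) (G₂n n))
    (hU : Tendsto Un atTop (𝓝 U)) (h1 : Tendsto G₁n atTop (𝓝 G₁))
    (h2 : Tendsto G₂n atTop (𝓝 G₂)) : HasGrad Ω U G₁ G₂ := by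
  rw [Lp.tendsto_Lp_iff_tendsto_eLpNorm'] at hU h1 h2
  exact ⟨Lp.memLp _, Lp.memLp _, Lp.memLp _,
    .of_tendsto (fun n => (h n).4) (fun _ => Lp.memLp _) (Lp.memLp _) (fun _ => Lp.memLp _)
      (Lp.memLp _) hU h1,
    .of_tendsto (fun n => (h n).5) (fun _ => Lp.memLp _) (Lp.memLp _) (fun _ => Lp.memLp _)
      (Lp.memLp _) hU h2⟩

theorem MemH10.exists_test (hΩ : IsOpen Ω) {U G₁ G₂ : ℝ × ℝ → Spinor} (h : MemH10 Ω U)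
    (hG : HasGrad Ω U G₁ G₂) {ε : ℝ≥0∞} (hε : 0 < ε) : ∃ η : ℝ × ℝ → Spinor, IsTestFunction Ω η ∧
      eLpNorm (fun x => η x - U x) 2 (volume.restrict Ω) ≤ ε ∧
      eLpNorm (fun x => fderiv ℝ η x (1, 0) - G₁ x) 2 (volume.restrict Ω) ≤ ε ∧
      eLpNorm (fun x => fderiv ℝ η x (0, 1) - G₂ x) 2 (volume.restrict Ω) ≤ ε := by
  obtain ⟨h0, η, t, t0, h3⟩ := h
  obtain ⟨g1, l1, t1⟩ := h3 (1, 0)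
  obtain ⟨g2, l2, t2⟩ := h3 (0, 1)
  have e1 := (hasWeakDeriv_of_tendsto_test hΩ t h0 l1 t0 t1).ae_eq hΩ hG.4
  have e2 := (hasWeakDeriv_of_tendsto_test hΩ t h0 l2 t0 t2).ae_eq hΩ hG.5
  obtain ⟨n, a, b, c⟩ := ((t0.eventually (ge_mem_nhds hε)).and ((t1.eventually
    (ge_mem_nhds hε)).and (t2.eventually (ge_mem_nhds hε)))).exists
  refine ⟨η n, t n, a, le_trans (le_of_eq ?_) b, le_trans (le_of_eq ?_) c⟩
  · refine eLpNorm_congr_ae ?_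
    filter_upwards [e1] with x hx
    rw [hx]
  · refine eLpNorm_congr_ae ?_
    filter_upwards [e2] with x hx
    rw [hx]

/-- `H¹₀` is closed in `H¹`. -/
theorem MemH10.of_tendsto (hΩ : IsOpen Ω) {Un G₁n G₂n : ℕ → Lp Spinor 2 (volume.restrict Ω)}
    {U G₁ G₂ : Lp Spinor 2 (volume.restrict Ω)} (h : ∀ n, HasGrad Ω (Un n) (G₁n n) (G₂n n))
    (h0 : ∀ n, MemH10 Ω (Un n))
    (hU : Tendsto Un atTop (𝓝 U)) (h1 : Tendsto G₁n atTop (𝓝 G₁))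
    (h2 : Tendsto G₂n atTop (𝓝 G₂)) : MemH10 Ω U := by
  rw [Lp.tendsto_Lp_iff_tendsto_eLpNorm'] at hU h1 h2
  refine memH10_of_approx (Lp.memLp _) (Lp.memLp G₁) (Lp.memLp G₂) fun ε hε => ?_
  have hε2 : 0 < ε / 2 := ENNReal.half_pos hε.ne'
  obtain ⟨n, a, b, c⟩ := ((hU.eventually (ge_mem_nhds hε2)).and ((h1.eventually
    (ge_mem_nhds hε2)).and (h2.eventually (ge_mem_nhds hε2)))).exists
  obtain ⟨η, t, a', b', c'⟩ := (h0 n).exists_test hΩ (h n) hε2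
  have key : ∀ {f g k : ℝ × ℝ → Spinor}, AEStronglyMeasurable f (volume.restrict Ω) →
      AEStronglyMeasurable g (volume.restrict Ω) → AEStronglyMeasurable k (volume.restrict Ω) →
      eLpNorm (fun x => f x - g x) 2 (volume.restrict Ω) ≤ ε / 2 →
      eLpNorm (fun x => g x - k x) 2 (volume.restrict Ω) ≤ ε / 2 →
      eLpNorm (fun x => f x - k x) 2 (volume.restrict Ω) ≤ ε := by
    intro f g k hf hg hk i1 i2
    have := eLpNorm_add_le (hf.sub hg) (hg.sub hk) (p := 2) (by norm_num)
    refine le_trans (le_trans (le_of_eq ?_) this) ((add_le_add i1 i2).trans_eq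
      (ENNReal.add_halves ε))
    congr 1
    funext x
    simp
  exact ⟨η, t, key t.1.continuous.aestronglyMeasurable (Lp.memLp _).1 (Lp.memLp _).1 a' a,
    key (t.aesm_fderiv _) (Lp.memLp _).1 (Lp.memLp _).1 b' b,
    key (t.aesm_fderiv _) (Lp.memLp _).1 (Lp.memLp _).1 c' c⟩

theorem HasGrad.zero : HasGrad Ω (fun _ => 0) (fun _ => 0) (fun _ => 0) :=
  ⟨MemLp.zero', MemLp.zero', MemLp.zero', .zero, .zero⟩

theorem HasGrad.sum {ι : Type*} {Un G₁n G₂n : ι → Lp Spinor 2 (volume.restrict Ω)}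
    (h : ∀ m, HasGrad Ω (Un m) (G₁n m) (G₂n m)) (s : Finset ι) :
    HasGrad Ω (∑ m ∈ s, Un m : Lp Spinor 2 (volume.restrict Ω))
      (∑ m ∈ s, G₁n m : Lp Spinor 2 (volume.restrict Ω))
      (∑ m ∈ s, G₂n m : Lp Spinor 2 (volume.restrict Ω)) := by
  classical
  induction s using Finset.induction_on with
  | empty =>
    simp only [Finset.sum_empty]
    exact HasGrad.zero.congr (Lp.coeFn_zero _ _ _) (Lp.coeFn_zero _ _ _) (Lp.coeFn_zero _ _ _)
  | insert m s hm ih =>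
    simp only [Finset.sum_insert hm]
    exact ((h m).add ih).congr (Lp.coeFn_add _ _) (Lp.coeFn_add _ _) (Lp.coeFn_add _ _)

theorem memH10_sum {ι : Type*} {Un : ι → Lp Spinor 2 (volume.restrict Ω)}
    (h : ∀ m, MemH10 Ω (Un m)) (s : Finset ι) :
    MemH10 Ω (∑ m ∈ s, Un m : Lp Spinor 2 (volume.restrict Ω)) := by
  classical
  induction s using Finset.induction_on with
  | empty =>
    simp only [Finset.sum_empty]
    exact MemH10.zero.congr (Lp.coeFn_zero _ _ _)
  | insert m s hm ih =>
    simp only [Finset.sum_insert hm]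
    exact ((h m).add ih).congr (Lp.coeFn_add _ _)

theorem tendsto_sum_Icc {M : Type*} [AddCommMonoid M] [TopologicalSpace M] {f : ℤ → M} {a : M}
    (h : HasSum f a) :
    Tendsto (fun n : ℕ => ∑ m ∈ Finset.Icc (-(n : ℤ)) n, f m) atTop (𝓝 a) := by
  have h' : Tendsto (fun s : Finset ℤ => ∑ m ∈ s, f m) atTop (𝓝 a) := h
  refine h'.comp ?_
  refine tendsto_atTop_finset_of_monotone (fun a b hab => Finset.Icc_subset_Icc (by omega)
    (by omega)) fun x => ⟨x.natAbs, ?_⟩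
  rw [Finset.mem_Icc]
  omega

theorem HasGrad.of_hasSum {Un G₁n G₂n : ℤ → Lp Spinor 2 (volume.restrict Ω)}
    {U G₁ G₂ : Lp Spinor 2 (volume.restrict Ω)} (h : ∀ m, HasGrad Ω (Un m) (G₁n m) (G₂n m))
    (hU : HasSum Un U) (h1 : HasSum G₁n G₁) (h2 : HasSum G₂n G₂) : HasGrad Ω U G₁ G₂ :=
  HasGrad.of_tendsto (fun _ => HasGrad.sum h _) (tendsto_sum_Icc hU) (tendsto_sum_Icc h1)
    (tendsto_sum_Icc h2)

theorem MemH10.of_hasSum (hΩ : IsOpen Ω) {Un G₁n G₂n : ℤ → Lp Spinor 2 (volume.restrict Ω)}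
    {U G₁ G₂ : Lp Spinor 2 (volume.restrict Ω)} (h : ∀ m, HasGrad Ω (Un m) (G₁n m) (G₂n m))
    (h0 : ∀ m, MemH10 Ω (Un m))
    (hU : HasSum Un U) (h1 : HasSum G₁n G₁) (h2 : HasSum G₂n G₂) : MemH10 Ω U :=
  MemH10.of_tendsto hΩ (fun _ => HasGrad.sum h _) (fun _ => memH10_sum h0 _) (tendsto_sum_Icc hU)
    (tendsto_sum_Icc h1) (tendsto_sum_Icc h2)

end Limits

variable {ρ₁ ρ₂ : ℝ}

local notation "L2I" => Lp Spinor 2 (volume.restrict (Set.Ioo ρ₁ ρ₂))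

theorem norm_toLp_bdd_smul_le {X : Type*} [MeasurableSpace X] {μ : Measure X} (f : Lp Spinor 2 μ)
    {a : X → ℂ} {C : ℝ} (hC : ∀ᵐ x ∂μ, ‖a x‖ ≤ C) (h : MemLp (fun x => a x • f x) 2 μ) :
    ‖h.toLp _‖ ≤ C * ‖f‖ := by
  refine Lp.norm_le_mul_norm_of_ae_le_mul ?_
  filter_upwards [hC, h.coeFn_toLp] with x hx h1
  rw [h1, norm_smul]
  gcongr

theorem summable_modeMap (hρ₁ : 0 < ρ₁) (hρ : ρ₁ < ρ₂) (k : ℤ) {a : ℤ → L2I}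
    (ha : Summable fun m => ‖a m‖ ^ 2) : Summable fun m => modeMap hρ₁ hρ (m + k) (a m) := by
  have h := (orthogonalFamily_modeMap hρ₁ hρ).comp (add_left_injective k)
  exact (h.summable_iff_norm_sq_summable a).2 ha

/-- The weight `1 + |m|`. -/
def wt (m : ℤ) : ℝ := 1 + |(m : ℝ)|

theorem one_le_wt (m : ℤ) : 1 ≤ wt m := le_add_of_nonneg_right (abs_nonneg _)

theorem abs_half_add_le_wt (m : ℤ) : |1 / 2 + (m : ℝ)| ≤ wt m := by
  refine (abs_add_le _ _).trans ?_
  rw [wt, abs_of_pos (by norm_num : (0 : ℝ) < 1 / 2)]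
  linarith

theorem wt_neg (m : ℤ) : wt (-m) = wt m := by simp [wt]

theorem wt_add_le (m k : ℤ) (hk : |(k : ℝ)| ≤ 1) : wt (m + k) ≤ 2 * wt m := by
  have := abs_add_le (m : ℝ) k
  have := abs_nonneg (m : ℝ)
  simp only [wt, Int.cast_add]
  linarith

/-- The `L²` version of `up`. -/
theorem exists_up (hρ₁ : 0 < ρ₁) (m : ℤ) (u u' : L2I) : ∃ a : L2I,
    a =ᵐ[volume.restrict (Set.Ioo ρ₁ ρ₂)] up m u u' ∧ ‖a‖ ≤ ‖u'‖ + wt m / ρ₁ * ‖u‖ := by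
  have h := memLp_div_smul hρ₁ (1 / 2 + m) (Lp.memLp u)
  refine ⟨u' - h.toLp _, ?_, (norm_sub_le _ _).trans ?_⟩
  · filter_upwards [Lp.coeFn_sub u' (h.toLp _), h.coeFn_toLp] with r h1 h2
    rw [h1, Pi.sub_apply, h2, up]
  · have h1 := norm_toLp_bdd_smul_le u (norm_div_le_of_mem hρ₁ _) h
    have h2 := abs_half_add_le_wt m
    have h3 : |1 / 2 + (m : ℝ)| / ρ₁ * ‖u‖ ≤ wt m / ρ₁ * ‖u‖ := by gcongr
    linarith

/-- The `L²` version of `derivUp`. -/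
theorem exists_derivUp (hρ₁ : 0 < ρ₁) (m : ℤ) (u u' u'' : L2I) : ∃ a : L2I,
    a =ᵐ[volume.restrict (Set.Ioo ρ₁ ρ₂)] derivUp m u u' u'' ∧
      ‖a‖ ≤ ‖u''‖ + wt m / ρ₁ * ‖u'‖ + wt m / ρ₁ ^ 2 * ‖u‖ := by
  obtain ⟨b, hb, hb'⟩ := exists_up hρ₁ m u' u''
  have h := memLp_bdd_smul (Lp.memLp u) (a := fun r => (((1 / 2 + m) / r ^ 2 : ℝ) : ℂ))
    (Complex.measurable_ofReal.comp
      (measurable_const.div (measurable_id.pow_const 2))).aestronglyMeasurable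
      (norm_div_sq_le_of_mem hρ₁ _)
  refine ⟨b + h.toLp _, ?_, (norm_add_le _ _).trans ?_⟩
  · filter_upwards [Lp.coeFn_add b (h.toLp _), h.coeFn_toLp, hb] with r h1 h2 h3
    rw [h1, Pi.add_apply, h2, derivUp, h3]
  · have h1 := norm_toLp_bdd_smul_le u (norm_div_sq_le_of_mem hρ₁ _) h
    have h2 := abs_half_add_le_wt m
    have h3 : |1 / 2 + (m : ℝ)| / ρ₁ ^ 2 * ‖u‖ ≤ wt m / ρ₁ ^ 2 * ‖u‖ := by gcongr
    linarith

theorem summable_sq_of_le {a : ℤ → L2I} {t : ℤ → ℝ} (ht : Summable fun m => t m ^ 2) {K : ℝ}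
    (h : ∀ m, ‖a m‖ ≤ K * t m) : Summable fun m => ‖a m‖ ^ 2 := by
  refine Summable.of_nonneg_of_le (fun m => by positivity) (fun m => ?_) (ht.mul_left (K ^ 2))
  rw [← mul_pow]
  exact pow_le_pow_left₀ (norm_nonneg _) (h m) 2

/-- The gradient of a superposition of modes. -/
theorem hasGrad_of_hasSum (hρ₁ : 0 < ρ₁) (hρ : ρ₁ < ρ₂) {u u' a b : ℤ → L2I}
    (hw : ∀ m, HasWeakDeriv (Set.Ioo ρ₁ ρ₂) (1 : ℝ) (u m) (u' m))
    (ha : ∀ m, a m =ᵐ[volume.restrict (Set.Ioo ρ₁ ρ₂)] up m (u m) (u' m))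
    (hb : ∀ m, b m =ᵐ[volume.restrict (Set.Ioo ρ₁ ρ₂)] up (-m) (u m) (u' m))
    {U V W : Lp Spinor 2 (volume.restrict (annulus ρ₁ ρ₂))}
    (hU : HasSum (fun m => modeMap hρ₁ hρ m (u m)) U)
    (hV : HasSum (fun m => modeMap hρ₁ hρ (m + 1) (a m)) V)
    (hW : HasSum (fun m => modeMap hρ₁ hρ (m + -1) (b m)) W) :
    HasGrad (annulus ρ₁ ρ₂) U ((1 / 2 : ℂ) • (V + W) : Lp Spinor 2 _)
      ((-Complex.I / 2) • (V - W) : Lp Spinor 2 _) ∧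
      ((∀ m, MemH10 (Set.Ioo ρ₁ ρ₂) (u m)) → MemH10 (annulus ρ₁ ρ₂) U) := by
  have hg : ∀ m, HasGrad (annulus ρ₁ ρ₂) (modeMap hρ₁ hρ m (u m))
      ((1 / 2 : ℂ) • (modeMap hρ₁ hρ (m + 1) (a m) + modeMap hρ₁ hρ (m + -1) (b m)) : Lp Spinor 2 _)
      ((-Complex.I / 2) •
        (modeMap hρ₁ hρ (m + 1) (a m) - modeMap hρ₁ hρ (m + -1) (b m)) : Lp Spinor 2 _) := by
    intro m
    have e1 := (coeFn_modeMap hρ₁ hρ (m + 1) (a m)).trans (modeFun_congr hρ₁ hρ _ (ha m))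
    have e2 := (coeFn_modeMap hρ₁ hρ (m + -1) (b m)).trans (modeFun_congr hρ₁ hρ _ (hb m))
    refine (hasGrad_modeFun hρ₁ hρ m (Lp.memLp _) (Lp.memLp _) (hw m)).congr
      (coeFn_modeMap hρ₁ hρ m (u m)) ?_ ?_
    · filter_upwards [e1, e2, Lp.coeFn_smul (1 / 2 : ℂ)
        (modeMap hρ₁ hρ (m + 1) (a m) + modeMap hρ₁ hρ (m + -1) (b m)),
        Lp.coeFn_add (modeMap hρ₁ hρ (m + 1) (a m)) (modeMap hρ₁ hρ (m + -1) (b m))] with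
        x h1 h2 h3 h4
      rw [h3, Pi.smul_apply, h4, Pi.add_apply, h1, h2, gradX, down_eq_up, sub_eq_add_neg]
    · filter_upwards [e1, e2, Lp.coeFn_smul (-Complex.I / 2)
        (modeMap hρ₁ hρ (m + 1) (a m) - modeMap hρ₁ hρ (m + -1) (b m)),
        Lp.coeFn_sub (modeMap hρ₁ hρ (m + 1) (a m)) (modeMap hρ₁ hρ (m + -1) (b m))] with
        x h1 h2 h3 h4
      rw [h3, Pi.smul_apply, h4, Pi.sub_apply, h1, h2, gradY, down_eq_up, sub_eq_add_neg m]
  have s1 := (hV.add hW).const_smul (1 / 2 : ℂ)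
  have s2 := (hV.sub hW).const_smul (-Complex.I / 2)
  refine ⟨HasGrad.of_hasSum hg hU s1 s2, fun h0 => MemH10.of_hasSum (isOpen_annulus _ _) hg
    (fun m => ?_) hU s1 s2⟩
  exact (memH10_modeFun hρ₁ hρ m (h0 m)).congr (coeFn_modeMap hρ₁ hρ m (u m))

/-- A superposition of modes is in `H¹` when `(1 + |m|) u_m` and `u_m'` are square summable. -/
theorem exists_hasGrad_of_hasSum (hρ₁ : 0 < ρ₁) (hρ : ρ₁ < ρ₂) {u u' : ℤ → L2I} {t : ℤ → ℝ}
    (ht : Summable fun m => t m ^ 2) {K : ℝ} (h0 : ∀ m, wt m * ‖u m‖ ≤ K * t m)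
    (h1 : ∀ m, ‖u' m‖ ≤ K * t m)
    (hw : ∀ m, HasWeakDeriv (Set.Ioo ρ₁ ρ₂) (1 : ℝ) (u m) (u' m))
    {U : Lp Spinor 2 (volume.restrict (annulus ρ₁ ρ₂))}
    (hU : HasSum (fun m => modeMap hρ₁ hρ m (u m)) U) : ∃ G₁ G₂, HasGrad (annulus ρ₁ ρ₂) U G₁ G₂ := by
  choose a ha ha' using fun m => exists_up hρ₁ m (u m) (u' m)
  choose b hb hb' using fun m => exists_up hρ₁ (-m) (u m) (u' m)
  have hbd : ∀ m, ‖u' m‖ + wt m / ρ₁ * ‖u m‖ ≤ (K + ρ₁⁻¹ * K) * t m := fun m => by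
    have : wt m / ρ₁ * ‖u m‖ = ρ₁⁻¹ * (wt m * ‖u m‖) := by ring
    rw [this]
    have := mul_le_mul_of_nonneg_left (h0 m) (inv_nonneg.2 hρ₁.le)
    linarith [h1 m]
  have sa := summable_sq_of_le ht fun m => (ha' m).trans (hbd m)
  have sb := summable_sq_of_le ht fun m => (hb' m).trans (by rw [wt_neg]; exact hbd m)
  obtain ⟨V, hV⟩ := summable_modeMap hρ₁ hρ 1 sa
  obtain ⟨W, hW⟩ := summable_modeMap hρ₁ hρ (-1) sb
  exact ⟨_, _, (hasGrad_of_hasSum hρ₁ hρ hw ha hb hU hV hW).1⟩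

theorem weakDeriv_congr_up (hρ₁ : 0 < ρ₁) {m : ℤ} {u u' u'' a a' : L2I}
    (hw : HasWeakDeriv (Set.Ioo ρ₁ ρ₂) (1 : ℝ) u u')
    (hw' : HasWeakDeriv (Set.Ioo ρ₁ ρ₂) (1 : ℝ) u' u'')
    (ha : a =ᵐ[volume.restrict (Set.Ioo ρ₁ ρ₂)] up m u u')
    (ha' : a' =ᵐ[volume.restrict (Set.Ioo ρ₁ ρ₂)] derivUp m u u' u'') :
    HasWeakDeriv (Set.Ioo ρ₁ ρ₂) (1 : ℝ) a a' :=
  (hasWeakDeriv_up hρ₁ m hw hw').congr₂ ha ha'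

/-- A superposition of modes is in `H² ∩ H¹₀` when its coefficients are, with the natural
square-summable bounds. -/
theorem memH2_of_hasSum (hρ₁ : 0 < ρ₁) (hρ : ρ₁ < ρ₂) {u u' u'' : ℤ → L2I} {t : ℤ → ℝ}
    (ht : Summable fun m => t m ^ 2) {K : ℝ} (h0 : ∀ m, wt m ^ 2 * ‖u m‖ ≤ K * t m)
    (h1 : ∀ m, wt m * ‖u' m‖ ≤ K * t m) (h2 : ∀ m, ‖u'' m‖ ≤ K * t m)
    (hw : ∀ m, HasWeakDeriv (Set.Ioo ρ₁ ρ₂) (1 : ℝ) (u m) (u' m))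
    (hw' : ∀ m, HasWeakDeriv (Set.Ioo ρ₁ ρ₂) (1 : ℝ) (u' m) (u'' m))
    (hb : ∀ m, MemH10 (Set.Ioo ρ₁ ρ₂) (u m)) :
    ∃ U : Lp Spinor 2 (volume.restrict (annulus ρ₁ ρ₂)),
      HasSum (fun m => modeMap hρ₁ hρ m (u m)) U ∧ MemH2 (annulus ρ₁ ρ₂) U ∧
        MemH10 (annulus ρ₁ ρ₂) U := by
  have hwt : ∀ m, 0 < wt m := fun m => one_pos.trans_le (one_le_wt m)
  have h0' : ∀ m, wt m * ‖u m‖ ≤ K * t m := fun m => by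
    refine le_trans ?_ (h0 m)
    have := mul_le_mul_of_nonneg_right (one_le_wt m) (mul_nonneg (hwt m).le (norm_nonneg (u m)))
    linarith
  have hle : ∀ m, ∀ x : L2I, ‖x‖ ≤ wt m * ‖x‖ := fun m x => by
    have := mul_le_mul_of_nonneg_right (one_le_wt m) (norm_nonneg x)
    linarith
  have hu' : ∀ m, ‖u' m‖ ≤ K * t m := fun m => (hle m _).trans (h1 m)
  have key : ∀ s : ℤ → ℤ, (∀ m, wt (s m) = wt m) → ∃ a a' : ℤ → L2I,
      (∀ m, a m =ᵐ[volume.restrict (Set.Ioo ρ₁ ρ₂)] up (s m) (u m) (u' m)) ∧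
      (∀ m, HasWeakDeriv (Set.Ioo ρ₁ ρ₂) (1 : ℝ) (a m) (a' m)) ∧
      (∀ m, wt m * ‖a m‖ ≤ (K + ρ₁⁻¹ * K + (ρ₁ ^ 2)⁻¹ * K) * t m) ∧
      (∀ m, ‖a' m‖ ≤ (K + ρ₁⁻¹ * K + (ρ₁ ^ 2)⁻¹ * K) * t m) := by
    intro s hs
    choose a ha ha' using fun m => exists_up hρ₁ (s m) (u m) (u' m)
    choose a' hb hb' using fun m => exists_derivUp hρ₁ (s m) (u m) (u' m) (u'' m)
    have hi := inv_nonneg.2 hρ₁.le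
    have hi2 := inv_nonneg.2 (pow_nonneg hρ₁.le 2)
    refine ⟨a, a', ha, fun m => weakDeriv_congr_up hρ₁ (hw m) (hw' m) (ha m) (hb m), fun m => ?_,
      fun m => ?_⟩
    · have e1 := mul_le_mul_of_nonneg_left (ha' m) (hwt m).le
      have e2 := mul_le_mul_of_nonneg_left (h0 m) hi
      have e3 := mul_nonneg hi2 ((mul_nonneg (hwt m).le (norm_nonneg (u m))).trans (h0' m))
      rw [hs] at e1
      have e4 : wt m * (‖u' m‖ + wt m / ρ₁ * ‖u m‖) =
          wt m * ‖u' m‖ + ρ₁⁻¹ * (wt m ^ 2 * ‖u m‖) := by ring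
      linarith [h1 m]
    · have e1 := hb' m
      have e2 := mul_le_mul_of_nonneg_left (h1 m) hi
      have e3 := mul_le_mul_of_nonneg_left (h0' m) hi2
      rw [hs] at e1
      have e4 : wt m / ρ₁ * ‖u' m‖ = ρ₁⁻¹ * (wt m * ‖u' m‖) := by ring
      have e5 : wt m / ρ₁ ^ 2 * ‖u m‖ = (ρ₁ ^ 2)⁻¹ * (wt m * ‖u m‖) := by ring
      linarith [h2 m]
  obtain ⟨a, a', ha, haw, ha0, ha1⟩ := key id fun _ => rfl
  obtain ⟨b, b', hb', hbw, hb0, hb1⟩ := key (fun m => -m) wt_neg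
  have su := summable_sq_of_le ht fun m => (hle m _).trans (h0' m)
  have sa := summable_sq_of_le ht fun m => (hle m _).trans (ha0 m)
  have sb := summable_sq_of_le ht fun m => (hle m _).trans (hb0 m)
  obtain ⟨U, hU⟩ := summable_modeMap hρ₁ hρ 0 su
  simp only [add_zero] at hU
  obtain ⟨V, hV⟩ := summable_modeMap hρ₁ hρ 1 sa
  obtain ⟨W, hW⟩ := summable_modeMap hρ₁ hρ (-1) sb
  obtain ⟨hg, h10⟩ := hasGrad_of_hasSum hρ₁ hρ hw ha hb' hU hV hW
  -- the two halves of the gradient are again superpositions of modes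
  have shift : ∀ (k : ℤ), |(k : ℝ)| ≤ 1 → ∀ (c c' : ℤ → L2I) (L : ℝ),
      (∀ m, HasWeakDeriv (Set.Ioo ρ₁ ρ₂) (1 : ℝ) (c m) (c' m)) →
      (∀ m, wt m * ‖c m‖ ≤ L * t m) → (∀ m, ‖c' m‖ ≤ L * t m) →
      ∀ X, HasSum (fun m => modeMap hρ₁ hρ (m + k) (c m)) X →
        ∃ G₁ G₂, HasGrad (annulus ρ₁ ρ₂) X G₁ G₂ := by
    intro k hk c c' L hcw hc0 hc1 X hX
    have htk : Summable fun m => t (m - k) ^ 2 :=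
      ht.comp_injective (i := fun m => m - k) (sub_left_injective)
    have hLt : ∀ m, 0 ≤ L * t m := fun m => (norm_nonneg _).trans (hc1 m)
    refine exists_hasGrad_of_hasSum hρ₁ hρ (u := fun m => c (m - k)) (u' := fun m => c' (m - k))
      htk (K := 2 * L) (fun m => ?_) (fun m => ?_) (fun m => hcw _) ?_
    · have e1 := wt_add_le (m - k) k hk
      rw [sub_add_cancel] at e1
      have e2 := mul_le_mul_of_nonneg_right e1 (norm_nonneg (c (m - k)))
      linarith [hc0 (m - k)]
    · linarith [hc1 (m - k), hLt (m - k)]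
    · rw [← (Equiv.addRight k).hasSum_iff]
      convert hX using 1
      funext m
      simp only [Function.comp, Equiv.coe_addRight, add_sub_cancel_right]
  obtain ⟨V₁, V₂, gV⟩ := shift 1 (by simp) a a' _ haw ha0 ha1 V hV
  obtain ⟨W₁, W₂, gW⟩ := shift (-1) (by simp) b b' _ hbw hb0 hb1 W hW
  refine ⟨U, hU, ?_, h10 hb⟩
  refine hg.memH2 (K := ![![_, _], ![_, _]])
    (((gV.add gW).smul (1 / 2)).congr ?_ (ae_eq_refl _) (ae_eq_refl _))
    (((gV.add (gW.smul (-1))).smul (-Complex.I / 2)).congr ?_ (ae_eq_refl _) (ae_eq_refl _))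
  · filter_upwards [Lp.coeFn_smul (1 / 2 : ℂ) (V + W), Lp.coeFn_add V W] with x e1 e2
    rw [e1, Pi.smul_apply, e2, Pi.add_apply]
  · filter_upwards [Lp.coeFn_smul (-Complex.I / 2) (V - W), Lp.coeFn_sub V W] with x e1 e2
    rw [e1, Pi.smul_apply, e2, Pi.sub_apply]
    module

end Superposition

/-! ### The scalar potential -/

section ScalarPotential

variable {ρ₁ ρ₂ : ℝ}

/-- The radial solution of the Dirichlet problem, and its derivative. -/
theorem exists_radial_solution (hρ₁ : 0 < ρ₁) (hρ : ρ₁ < ρ₂) {c : ℝ → ℝ} (hc : Continuous c) :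
    ∃ f α : ℝ → ℝ, f ρ₁ = 0 ∧ f ρ₂ = 0 ∧ ∀ r, 0 < r →
      HasDerivAt f (α r) r ∧ HasDerivAt α (c r - α r / r) r := by
  set β : ℝ → ℝ := fun r => ∫ t in ρ₁..r, t * c t
  have hβ : ∀ r, HasDerivAt β (r * c r) r := fun r => by
    have h1 : Continuous fun t => t * c t := continuous_id.mul hc
    exact intervalIntegral.integral_hasDerivAt_right (h1.intervalIntegrable _ _)
      (h1.stronglyMeasurableAtFilter _ _) h1.continuousAt
  have hβc : Continuous β := continuous_iff_continuousAt.2 fun r => (hβ r).continuousAt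
  set F : ℝ → ℝ := fun r => ∫ t in ρ₁..r, β t / t
  have hq : ContinuousOn (fun t => β t / t) (Set.Ioi 0) :=
    hβc.continuousOn.div continuousOn_id fun t ht => ne_of_gt ht
  have hF : ∀ r, 0 < r → HasDerivAt F (β r / r) r := fun r hr => by
    refine intervalIntegral.integral_hasDerivAt_right (ContinuousOn.intervalIntegrable
      (hq.mono fun t ht => ?_)) (hq.stronglyMeasurableAtFilter isOpen_Ioi _ hr)
      (hq.continuousAt (isOpen_Ioi.mem_nhds hr))
    exact (lt_min hρ₁ hr).trans_le ht.1
  have hlog : 0 < Real.log ρ₂ - Real.log ρ₁ := sub_pos.2 (Real.log_lt_log hρ₁ hρ)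
  set κ := F ρ₂ / (Real.log ρ₂ - Real.log ρ₁)
  refine ⟨fun r => F r - κ * (Real.log r - Real.log ρ₁), fun r => (β r - κ) / r, ?_, ?_,
    fun r hr => ⟨?_, ?_⟩⟩
  · simp [F]
  · change F ρ₂ - F ρ₂ / (Real.log ρ₂ - Real.log ρ₁) * (Real.log ρ₂ - Real.log ρ₁) = 0
    rw [div_mul_cancel₀ _ hlog.ne', sub_self]
  · refine ((hF r hr).sub (((Real.hasDerivAt_log hr.ne').sub_const _).const_mul κ)).congr_deriv ?_
    change _ = (β r - κ) / r
    rw [sub_div, div_eq_mul_inv κ]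
  · refine (((hβ r).sub_const κ).div (hasDerivAt_id r) hr.ne').congr_deriv ?_
    simp only [id]
    field_simp

/-- Regularity of the solutions of the radial equation. -/
theorem contDiffOn_of_radial {s : Set ℝ} (hs : IsOpen s) (hs0 : s ⊆ Set.Ioi 0) {c α : ℝ → ℝ}
    (hc : ContDiffOn ℝ ∞ c s) (hα : ∀ r ∈ s, HasDerivAt α (c r - α r / r) r) :
    ContDiffOn ℝ ∞ α s := by
  rw [contDiffOn_infty]
  intro n
  induction n with
  | zero => exact contDiffOn_zero.2 fun r hr => (hα r hr).continuousAt.continuousWithinAt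
  | succ n ih =>
    push_cast
    rw [contDiffOn_succ_iff_deriv_of_isOpen hs]
    refine ⟨fun r hr => (hα r hr).differentiableAt.differentiableWithinAt, by simp, ?_⟩
    refine ContDiffOn.congr (f := fun r => c r - α r / r) ?_ fun r hr => (hα r hr).deriv
    exact (hc.of_le (by exact_mod_cast le_top)).sub
      (ih.div contDiffOn_id fun r hr => ne_of_gt (hs0 hr))

theorem MemH10.clm {E F G : Type*} [NormedAddCommGroup E] [NormedSpace ℝ E] [MeasureSpace E]
    [BorelSpace E] [NormedAddCommGroup F] [NormedSpace ℝ F] [NormedAddCommGroup G] [NormedSpace ℝ G]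
    {Ω : Set E} {u : E → F} (h : MemH10 Ω u) (L : F →L[ℝ] G) : MemH10 Ω (fun x => L (u x)) := by
  obtain ⟨h0, η, h1, h2, h3⟩ := h
  have key : ∀ {a : ℕ → E → F} {b : E → F},
      Tendsto (fun n => eLpNorm (fun x => a n x - b x) 2 (volume.restrict Ω)) atTop (𝓝 0) →
      Tendsto (fun n => eLpNorm (fun x => L (a n x) - L (b x)) 2 (volume.restrict Ω))
        atTop (𝓝 0) := fun {a b} h => by
    have h2 : Tendsto (fun n => ENNReal.ofReal ‖L‖ *
        eLpNorm (fun x => a n x - b x) 2 (volume.restrict Ω)) atTop (𝓝 0) := by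
      simpa using ENNReal.Tendsto.const_mul h (Or.inr (by simp))
    refine tendsto_of_tendsto_of_tendsto_of_le_of_le tendsto_const_nhds h2 (fun _ => zero_le)
      fun n => eLpNorm_le_mul_eLpNorm_of_ae_le_mul (ae_of_all _ fun x => ?_) 2
    rw [← map_sub]
    exact L.le_opNorm _
  refine ⟨L.comp_memLp' h0, fun n x => L (η n x), fun n => (h1 n).clm L, key h2, fun v => ?_⟩
  obtain ⟨g, a, b⟩ := h3 v
  refine ⟨_, L.comp_memLp' a, (key b).congr fun n => ?_⟩
  congr 1
  funext x
  have := (L.hasFDerivAt.comp x ((h1 n).1.differentiable (by simp) x).hasFDerivAt).fderiv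
  change _ = fderiv ℝ (L ∘ η n) x v - L (g x)
  rw [this]
  rfl

/-- The gradients of the approximations of a function of `H¹₀` converge to each of its weak
derivatives, not just to some field. -/
theorem MemH10.exists_seq {E F : Type*} [NormedAddCommGroup E] [NormedSpace ℝ E] [MeasureSpace E]
    [BorelSpace E] [FiniteDimensional ℝ E] [(volume : Measure E).IsAddHaarMeasure]
    [NormedAddCommGroup F] [NormedSpace ℝ F] [CompleteSpace F]
    {Ω : Set E} (hΩ : IsOpen Ω) {u : E → F} (h : MemH10 Ω u) :
    ∃ η : ℕ → E → F, (∀ n, IsTestFunction Ω (η n)) ∧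
      Tendsto (fun n => eLpNorm (fun x => η n x - u x) 2 (volume.restrict Ω)) atTop (𝓝 0) ∧
      ∀ (v : E) (g : E → F), HasWeakDeriv Ω v u g → MemLp g 2 (volume.restrict Ω) ∧
        Tendsto (fun n => eLpNorm (fun x => fderiv ℝ (η n) x v - g x) 2 (volume.restrict Ω))
          atTop (𝓝 0) := by
  obtain ⟨h0, η, h1, h2, h3⟩ := h
  refine ⟨η, h1, h2, fun v g hg => ?_⟩
  obtain ⟨k, a, b⟩ := h3 v
  have e := (hasWeakDeriv_of_tendsto_test hΩ h1 h0 a h2 b).ae_eq hΩ hg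
  refine ⟨(memLp_congr_ae e).1 a, b.congr fun n => eLpNorm_congr_ae ?_⟩
  filter_upwards [e] with x hx
  rw [hx]

section Uniqueness

variable {Ω : Set (ℝ × ℝ)} {φ g₁ g₂ k₁ k₂ ψ : ℝ × ℝ → ℝ}

theorem integrable_mul_memLp {X : Type*} [MeasurableSpace X] {μ : Measure X} {f g : X → ℝ}
    (hf : MemLp f 2 μ) (hg : MemLp g 2 μ) : Integrable (fun x => f x * g x) μ :=
  hf.integrable_mul hg

theorem tendsto_integral_mul {X : Type*} [MeasurableSpace X] {μ : Measure X} {f u : X → ℝ}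
    {un : ℕ → X → ℝ} (hf : MemLp f 2 μ) (hun : ∀ n, MemLp (un n) 2 μ) (hu : MemLp u 2 μ)
    (h : Tendsto (fun n => eLpNorm (fun x => un n x - u x) 2 μ) atTop (𝓝 0)) :
    Tendsto (fun n => ∫ x, f x * un n x ∂μ) atTop (𝓝 (∫ x, f x * u x ∂μ)) := by
  have := tendsto_integral_inner ℝ hf hun hu h
  simpa [mul_comm] using this

theorem integral_eq_zero_of_sub {X : Type*} [MeasurableSpace X] {μ : Measure X} {f g k : X → ℝ}
    (hf : Integrable f μ) (hg : Integrable g μ) (e : ∫ x, f x ∂μ = ∫ x, g x ∂μ)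
    (h : ∀ᵐ x ∂μ, k x = f x - g x) : ∫ x, k x ∂μ = 0 := by
  rw [integral_congr_ae h, integral_sub hf hg, e, sub_self]

/-- A weakly divergence-free field is orthogonal to the gradients of `H¹₀` functions. -/
theorem MemH10.integral_grad_eq_zero (hΩ : IsOpen Ω) (h : MemH10 Ω φ)
    (h1 : HasWeakDeriv Ω (1, 0) φ g₁) (h2 : HasWeakDeriv Ω (0, 1) φ g₂)
    (hk1 : MemLp k₁ 2 (volume.restrict Ω)) (hk2 : MemLp k₂ 2 (volume.restrict Ω))
    (hk : ∀ η : ℝ × ℝ → ℝ, IsTestFunction Ω η →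
      ∫ x in Ω, (k₁ x * fderiv ℝ η x (1, 0) + k₂ x * fderiv ℝ η x (0, 1)) = 0) :
    ∫ x in Ω, (k₁ x * g₁ x + k₂ x * g₂ x) = 0 := by
  obtain ⟨η, t, -, t1⟩ := h.exists_seq hΩ
  obtain ⟨l1, c1⟩ := t1 _ _ h1
  obtain ⟨l2, c2⟩ := t1 _ _ h2
  have m1 := fun n => ((t n).fderiv_apply (1, 0)).memLp
  have m2 := fun n => ((t n).fderiv_apply (0, 1)).memLp
  have := (tendsto_integral_mul hk1 m1 l1 c1).add (tendsto_integral_mul hk2 m2 l2 c2)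
  rw [← integral_add (integrable_mul_memLp hk1 l1) (integrable_mul_memLp hk2 l2)] at this
  refine tendsto_nhds_unique this (tendsto_const_nhds.congr fun n => ?_)
  exact (hk _ (t n)).symm.trans
    (integral_add (integrable_mul_memLp hk1 (m1 n)) (integrable_mul_memLp hk2 (m2 n)))

/-- Integration of `∂ₓ(x φ) ψ` when `∂ₓψ = 0`. -/
theorem MemH10.integral_fst_mul (hΩ : IsOpen Ω) (hb : Bornology.IsBounded Ω) (h : MemH10 Ω φ)
    (h1 : HasWeakDeriv Ω (1, 0) φ g₁) (hψ : MemLp ψ 2 (volume.restrict Ω))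
    (h0 : HasWeakDeriv Ω (1, 0) ψ fun _ => 0) :
    ∫ x in Ω, (ψ x * φ x + x.1 * ψ x * g₁ x) = 0 := by
  obtain ⟨η, t, c0, t1⟩ := h.exists_seq hΩ
  obtain ⟨l1, c1⟩ := t1 _ _ h1
  have m1 := fun n => ((t n).fderiv_apply (1, 0)).memLp
  obtain ⟨R, hR⟩ := hb.subset_closedBall (0 : ℝ × ℝ)
  have hxψ : MemLp (fun x => x.1 * ψ x) 2 (volume.restrict Ω) := by
    refine MemLp.of_le_mul (c := R) hψ (continuous_fst.aestronglyMeasurable.mul hψ.1) ?_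
    filter_upwards [ae_restrict_mem hΩ.measurableSet] with x hx
    have := (norm_fst_le x).trans (mem_closedBall_zero_iff.1 (hR hx))
    rw [norm_mul]
    gcongr
  have := (tendsto_integral_mul hψ (fun n => (t n).memLp) h.1 c0).add
    (tendsto_integral_mul hxψ m1 l1 c1)
  rw [← integral_add (integrable_mul_memLp hψ h.1) (integrable_mul_memLp hxψ l1)] at this
  refine tendsto_nhds_unique this (tendsto_const_nhds.congr fun n => ?_)
  have ht : IsTestFunction Ω fun x : ℝ × ℝ => x.1 * η n x :=
    (t n).smooth_smul (𝕜 := ℝ) hΩ (a := fun x => x.1) contDiffOn_fst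
  have e := h0.2.2 _ ht
  simp only [smul_zero, integral_zero, neg_zero] at e
  refine e.symm.trans (Eq.trans ?_
    (integral_add (integrable_mul_memLp hψ (t n).memLp) (integrable_mul_memLp hxψ (m1 n))))
  congr 1
  funext x
  have hd : HasFDerivAt (fun x : ℝ × ℝ => x.1 * η n x) _ x := hasFDerivAt_fst.mul
    ((t n).1.differentiable (by simp) x).hasFDerivAt
  rw [hd.fderiv]
  simp
  ring

/-- Uniqueness for the Dirichlet problem. The difference `ψ` of two solutions has zero gradient, by
orthogonality; then `∫ ∂ₓ(x ψ) ψ = 0` gives `‖ψ‖² = 0`, without the Poincaré inequality. -/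
theorem dirichlet_unique (hΩ : IsOpen Ω) (hb : Bornology.IsBounded Ω) {φ' g₁' g₂' : ℝ × ℝ → ℝ}
    (h : MemH10 Ω φ) (h1 : HasWeakDeriv Ω (1, 0) φ g₁) (h2 : HasWeakDeriv Ω (0, 1) φ g₂)
    (h' : MemH10 Ω φ') (h1' : HasWeakDeriv Ω (1, 0) φ' g₁') (h2' : HasWeakDeriv Ω (0, 1) φ' g₂')
    (he : ∀ η : ℝ × ℝ → ℝ, IsTestFunction Ω η →
      ∫ x in Ω, (g₁ x * fderiv ℝ η x (1, 0) + g₂ x * fderiv ℝ η x (0, 1)) =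
      ∫ x in Ω, (g₁' x * fderiv ℝ η x (1, 0) + g₂' x * fderiv ℝ η x (0, 1))) :
    φ =ᵐ[volume.restrict Ω] φ' := by
  obtain ⟨_, _, _, t1⟩ := h.exists_seq hΩ
  obtain ⟨_, _, _, t1'⟩ := h'.exists_seq hΩ
  have l1 := (t1 _ _ h1).1
  have l2 := (t1 _ _ h2).1
  have l1' := (t1' _ _ h1').1
  have l2' := (t1' _ _ h2').1
  have hk1 := l1.sub l1'
  have hk2 := l2.sub l2'
  have hk : ∀ η : ℝ × ℝ → ℝ, IsTestFunction Ω η → ∫ x in Ω, ((g₁ - g₁') x * fderiv ℝ η x (1, 0) +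
      (g₂ - g₂') x * fderiv ℝ η x (0, 1)) = 0 := fun η hη => by
    have m1 := (hη.fderiv_apply (1, 0)).memLp
    have m2 := (hη.fderiv_apply (0, 1)).memLp
    refine integral_eq_zero_of_sub ((integrable_mul_memLp l1 m1).add (integrable_mul_memLp l2 m2))
      ((integrable_mul_memLp l1' m1).add (integrable_mul_memLp l2' m2)) (he η hη)
      (ae_of_all _ fun x => ?_)
    simp only [Pi.sub_apply, Pi.add_apply]
    ring
  have q := h.integral_grad_eq_zero hΩ h1 h2 hk1 hk2 hk
  have q' := h'.integral_grad_eq_zero hΩ h1' h2' hk1 hk2 hk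
  have hz : ∫ x in Ω, ((g₁ - g₁') x * (g₁ - g₁') x + (g₂ - g₂') x * (g₂ - g₂') x) = 0 := by
    refine integral_eq_zero_of_sub ((integrable_mul_memLp hk1 l1).add (integrable_mul_memLp hk2 l2))
      ((integrable_mul_memLp hk1 l1').add (integrable_mul_memLp hk2 l2')) (q.trans q'.symm)
      (ae_of_all _ fun x => ?_)
    simp only [Pi.sub_apply, Pi.add_apply]
    ring
  rw [integral_eq_zero_iff_of_nonneg (fun x => add_nonneg (mul_self_nonneg _) (mul_self_nonneg _))
    ((integrable_mul_memLp hk1 hk1).add (integrable_mul_memLp hk2 hk2))] at hz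
  have hg : g₁ =ᵐ[volume.restrict Ω] g₁' := by
    filter_upwards [hz] with x hx
    simp only [Pi.sub_apply, Pi.zero_apply] at hx
    nlinarith [mul_self_nonneg (g₁ x - g₁' x), mul_self_nonneg (g₂ x - g₂' x),
      mul_self_eq_zero.1 (show (g₁ x - g₁' x) * (g₁ x - g₁' x) = 0 by
        linarith [mul_self_nonneg (g₁ x - g₁' x), mul_self_nonneg (g₂ x - g₂' x)])]
  -- the difference has zero derivative in the direction `x`
  have hψ := h.1.sub h'.1
  have hψ0 : HasWeakDeriv Ω (1, 0) (φ - φ') fun _ => 0 := by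
    have := h1.add' (h1'.clm (-ContinuousLinearMap.id ℝ ℝ))
    refine this.congr₂ (ae_of_all _ fun x => by simp [sub_eq_add_neg]) ?_
    filter_upwards [hg] with x hx
    simp [hx]
  have p := h.integral_fst_mul hΩ hb h1 hψ hψ0
  have p' := h'.integral_fst_mul hΩ hb h1' hψ hψ0
  obtain ⟨R, hR⟩ := hb.subset_closedBall (0 : ℝ × ℝ)
  have hxψ : MemLp (fun x => x.1 * (φ - φ') x) 2 (volume.restrict Ω) := by
    refine MemLp.of_le_mul (c := R) hψ (continuous_fst.aestronglyMeasurable.mul hψ.1) ?_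
    filter_upwards [ae_restrict_mem hΩ.measurableSet] with x hx
    have := (norm_fst_le x).trans (mem_closedBall_zero_iff.1 (hR hx))
    rw [norm_mul]
    gcongr
  have hz2 : ∫ x in Ω, ((φ - φ') x * (φ - φ') x) = 0 := by
    refine integral_eq_zero_of_sub ((integrable_mul_memLp hψ h.1).add (integrable_mul_memLp hxψ l1))
      ((integrable_mul_memLp hψ h'.1).add (integrable_mul_memLp hxψ l1')) (p.trans p'.symm) ?_
    filter_upwards [hg] with x hx
    simp only [Pi.sub_apply, Pi.add_apply, hx]
    ring
  rw [integral_eq_zero_iff_of_nonneg (fun x => mul_self_nonneg _)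
    (integrable_mul_memLp hψ hψ)] at hz2
  filter_upwards [hz2] with x hx
  exact sub_eq_zero.1 (mul_self_eq_zero.1 hx)

end Uniqueness

/-- The differential of a radial function. -/
theorem hasFDerivAt_radial {f : ℝ → ℝ} {x : ℝ × ℝ} (hx : 0 < rad x) {a : ℝ}
    (hf : HasDerivAt f a (rad x)) :
    HasFDerivAt (fun y => f (rad y)) ((a / rad x) • radForm x) x := by
  refine (hf.hasFDerivAt.comp x (hasFDerivAt_rad hx)).congr_fderiv ?_
  ext <;> simp <;> ring

theorem annulus_isBounded (ρ₁ ρ₂ : ℝ) : Bornology.IsBounded (annulus ρ₁ ρ₂) :=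
  Metric.isBounded_closedBall.subset (annulus_subset_closedBall ρ₁ ρ₂)

theorem contDiffOn_rad (hρ₁ : 0 < ρ₁) (hρ : ρ₁ < ρ₂) : ContDiffOn ℝ ∞ rad (annulus ρ₁ ρ₂) :=
  fun _ hx => (contDiffAt_rad (rad_pos_of_mem hρ₁ hρ hx)).contDiffWithinAt

theorem contDiffOn_comp_rad (hρ₁ : 0 < ρ₁) (hρ : ρ₁ < ρ₂) {F : Type*} [NormedAddCommGroup F]
    [NormedSpace ℝ F] {f : ℝ → F} (hf : ContDiffOn ℝ ∞ f (Set.Ioo ρ₁ ρ₂)) :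
    ContDiffOn ℝ ∞ (fun x => f (rad x)) (annulus ρ₁ ρ₂) :=
  hf.comp (contDiffOn_rad hρ₁ hρ) fun _ hx => (mem_annulus_iff hρ₁ hρ).1 hx

theorem memLp_of_continuousOn_Icc {F : Type*} [NormedAddCommGroup F] [SecondCountableTopology F]
    {f : ℝ → F} (hf : ContinuousOn f (Set.Icc ρ₁ ρ₂)) :
    MemLp f 2 (volume.restrict (Set.Ioo ρ₁ ρ₂)) := by
  obtain ⟨C, hC⟩ := isCompact_Icc.exists_bound_of_continuousOn hf
  have h1 : IsFiniteMeasure (volume.restrict (Set.Ioo ρ₁ ρ₂)) := ⟨by simp⟩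
  refine MemLp.of_bound ((hf.mono Set.Ioo_subset_Icc_self).aestronglyMeasurable measurableSet_Ioo)
    C ?_
  filter_upwards [ae_restrict_mem measurableSet_Ioo] with r hr
  exact hC r (Set.Ioo_subset_Icc_self hr)

theorem MemH10.congr' {E F : Type*} [NormedAddCommGroup E] [NormedSpace ℝ E] [MeasureSpace E]
    [NormedAddCommGroup F] [NormedSpace ℝ F] {Ω : Set E} {u u' : E → F} (h : MemH10 Ω u)
    (hu : u' =ᵐ[volume.restrict Ω] u) : MemH10 Ω u' := by
  obtain ⟨h0, η, h1, h2, h3⟩ := h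
  refine ⟨(memLp_congr_ae hu).2 h0, η, h1, h2.congr fun n => ?_, h3⟩
  apply eLpNorm_congr_ae
  filter_upwards [hu] with x hx
  rw [hx]

theorem memH10_radial (hρ₁ : 0 < ρ₁) (hρ : ρ₁ < ρ₂) {f α : ℝ → ℝ} (h1 : f ρ₁ = 0) (h2 : f ρ₂ = 0)
    (hf : ∀ r, 0 < r → HasDerivAt f (α r) r) (hα : ContinuousOn α (Set.Ioi 0)) :
    MemH10 (annulus ρ₁ ρ₂) (fun x => f (rad x)) := by
  set e : Spinor := EuclideanSpace.single 0 1
  set a : ℝ → ℝ := fun r => Real.sqrt (2 * Real.pi * r) * f r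
  set a' : ℝ → ℝ := fun r => (2 * Real.pi) / (2 * Real.sqrt (2 * Real.pi * r)) * f r +
    Real.sqrt (2 * Real.pi * r) * α r
  have hp : ∀ r : ℝ, 0 < r → 0 < 2 * Real.pi * r := fun r hr => by
    have := Real.pi_pos
    positivity
  have ha : ∀ r, 0 < r → HasDerivAt a (a' r) r := fun r hr => by
    have h3 : HasDerivAt (fun r => 2 * Real.pi * r) (2 * Real.pi) r := by
      simpa using (hasDerivAt_id r).const_mul (2 * Real.pi)
    exact (h3.sqrt (hp r hr).ne').mul (hf r hr)
  have hfc : ContinuousOn f (Set.Ioi 0) := fun r hr => (hf r hr).continuousAt.continuousWithinAt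
  have ha' : ContinuousOn a' (Set.Ioi 0) := by
    have hs : Continuous fun r => Real.sqrt (2 * Real.pi * r) := by fun_prop
    refine ContinuousOn.add (ContinuousOn.mul (ContinuousOn.div continuousOn_const
      (continuous_const.mul hs).continuousOn fun r hr => ?_) hfc) (hs.continuousOn.mul hα)
    have := Real.sqrt_pos.2 (hp r hr)
    positivity
  have hsub : Set.Icc ρ₁ ρ₂ ⊆ Set.Ioi 0 := fun r hr => hρ₁.trans_le hr.1
  have hcont : ContinuousOn (fun r => a' r • e) (Set.Icc ρ₁ ρ₂) :=
    (ha'.mono hsub).smul continuousOn_const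
  have hmem := memLp_of_continuousOn_Icc hcont
  have hprim : ∀ r ∈ Set.Icc ρ₁ ρ₂, ∫ t in ρ₁..r, a' t • e = a r • e := fun r hr => by
    have hu : Set.uIcc ρ₁ r ⊆ Set.Icc ρ₁ ρ₂ := by
      rw [Set.uIcc_of_le hr.1]
      exact Set.Icc_subset_Icc_right hr.2
    rw [intervalIntegral.integral_eq_sub_of_hasDerivAt (f := fun r => a r • e)
      (fun t ht => (ha t (hsub (hu ht))).smul_const e) (hcont.mono hu).intervalIntegrable]
    simp [a, h1]
  have hv : MemH10 (Set.Ioo ρ₁ ρ₂) (fun r => a r • e) := by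
    refine memH10_of_primitive hρ hmem ?_ ?_
    · rw [hprim ρ₂ ⟨hρ.le, le_rfl⟩]
      simp [a, h2]
    · filter_upwards [ae_restrict_mem measurableSet_Ioo] with r hr
      rw [hprim r ⟨hr.1.le, hr.2.le⟩]
  set L : Spinor →L[ℝ] ℝ := Complex.reCLM.comp ((EuclideanSpace.proj (𝕜 := ℂ) 0).restrictScalars ℝ)
  refine ((memH10_modeFun hρ₁ hρ 0 hv).clm L).congr' ?_
  filter_upwards [ae_mem_annulus ρ₁ ρ₂] with x hx
  have hs := Real.sqrt_pos.2 (hp _ (rad_pos_of_mem hρ₁ hρ hx))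
  rw [modeFun, eang_zero, mul_one, Complex.coe_smul, smul_smul]
  simp only [a]
  rw [inv_mul_cancel_left₀ hs.ne', map_smul]
  simp [L, e]

/-- The radial potential solves the equation in divergence form. -/
theorem radial_weak_equation (hρ₁ : 0 < ρ₁) (hρ : ρ₁ < ρ₂) {α c : ℝ → ℝ}
    (hα : ∀ r ∈ Set.Ioo ρ₁ ρ₂, HasDerivAt α (c r - α r / r) r)
    (hs : ContDiffOn ℝ ∞ α (Set.Ioo ρ₁ ρ₂))
    {η : ℝ × ℝ → ℝ} (hη : IsTestFunction (annulus ρ₁ ρ₂) η) :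
    ∫ x in annulus ρ₁ ρ₂, (α (rad x) / rad x * x.1 * fderiv ℝ η x (1, 0) +
      α (rad x) / rad x * x.2 * fderiv ℝ η x (0, 1)) =
      -∫ x in annulus ρ₁ ρ₂, c (rad x) * η x := by
  have hΩ := isOpen_annulus ρ₁ ρ₂
  have hpos : ∀ r ∈ Set.Ioo ρ₁ ρ₂, r ≠ 0 := fun r hr => (hρ₁.trans hr.1).ne'
  have hq := contDiffOn_comp_rad hρ₁ hρ (hs.div contDiffOn_id hpos)
  have w1 := HasWeakDeriv.of_contDiffOn (v := (1, 0)) hΩ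
    ((hq.mul contDiffOn_fst).of_le (m := 1) (by simp))
  have w2 := HasWeakDeriv.of_contDiffOn (v := (0, 1)) hΩ
    ((hq.mul contDiffOn_snd).of_le (m := 1) (by simp))
  have e1 := w1.2.2 η hη
  have e2 := w2.2.2 η hη
  simp only [smul_eq_mul] at e1 e2
  have i1 := integrable_continuous_smul w1.1 (hη.fderiv_apply (1, 0)).1.continuous
    (hη.fderiv_apply (1, 0)).2.1 (hη.fderiv_apply (1, 0)).2.2
  have i2 := integrable_continuous_smul w2.1 (hη.fderiv_apply (0, 1)).1.continuous
    (hη.fderiv_apply (0, 1)).2.1 (hη.fderiv_apply (0, 1)).2.2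
  have i3 := integrable_continuous_smul w1.2.1 hη.1.continuous hη.2.1 hη.2.2
  have i4 := integrable_continuous_smul w2.2.1 hη.1.continuous hη.2.1 hη.2.2
  simp only [smul_eq_mul] at i1 i2 i3 i4
  have h1 : ∫ x in annulus ρ₁ ρ₂, (α (rad x) / rad x * x.1 * fderiv ℝ η x (1, 0) +
      α (rad x) / rad x * x.2 * fderiv ℝ η x (0, 1)) =
      ∫ x in annulus ρ₁ ρ₂, (fderiv ℝ η x (1, 0) * ((α / id : ℝ → ℝ) (rad x) * x.1) +
      fderiv ℝ η x (0, 1) * ((α / id : ℝ → ℝ) (rad x) * x.2)) := by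
    congr 1
    funext x
    simp only [Pi.div_apply, id]
    ring
  rw [h1, integral_add i1.restrict i2.restrict, e1, e2, ← neg_add,
    ← integral_add i3.restrict i4.restrict]
  congr 1
  refine setIntegral_congr_fun hΩ.measurableSet fun x hx => ?_
  have hr := rad_pos_of_mem hρ₁ hρ hx
  have hrI := (mem_annulus_iff hρ₁ hρ).1 hx
  have hd := hasFDerivAt_radial hr ((hα _ hrI).div (hasDerivAt_id _) hr.ne')
  have d1 := (hd.mul (hasFDerivAt_fst (𝕜 := ℝ) (p := x))).fderiv
  have d2 := (hd.mul (hasFDerivAt_snd (𝕜 := ℝ) (p := x))).fderiv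
  have hsq := rad_sq x
  change η x * fderiv ℝ ((fun y => (α / id : ℝ → ℝ) (rad y)) * Prod.fst) x (1, 0) +
    η x * fderiv ℝ ((fun y => (α / id : ℝ → ℝ) (rad y)) * Prod.snd) x (0, 1) = c (rad x) * η x
  rw [d1, d2]
  simp [radForm]
  field_simp
  linear_combination (-(η x) * (rad x * c (rad x) - 2 * α (rad x))) * hsq

theorem rad_axis {r : ℝ} (hr : 0 ≤ r) : rad (r, 0) = r := by
  have := rad_polar hr 0
  simpa using this

theorem mem_closedAnnulus_iff (hρ₁ : 0 < ρ₁) (hρ : ρ₁ < ρ₂) {x : ℝ × ℝ} :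
    x ∈ closedAnnulus ρ₁ ρ₂ ↔ rad x ∈ Set.Icc ρ₁ ρ₂ := by
  rw [closedAnnulus, Set.mem_ofPred_eq, ← rad_sq, Set.mem_Icc,
    pow_le_pow_iff_left₀ hρ₁.le (rad_nonneg x) two_ne_zero,
    pow_le_pow_iff_left₀ (rad_nonneg x) (hρ₁.trans hρ).le two_ne_zero]

theorem annulus_subset_closedAnnulus : annulus ρ₁ ρ₂ ⊆ closedAnnulus ρ₁ ρ₂ :=
  fun _ hx => ⟨hx.1.le, hx.2.le⟩

/-- The scalar potential is radial, and its derivative solves `(r φ')' = r B`. -/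
theorem exists_radial_potential (hρ₁ : 0 < ρ₁) (hρ : ρ₁ < ρ₂) {B φ : ℝ × ℝ → ℝ}
    (hB : ContDiffOn ℝ ∞ B (closedAnnulus ρ₁ ρ₂))
    (hBrad : ∀ x ∈ closedAnnulus ρ₁ ρ₂, ∀ y ∈ closedAnnulus ρ₁ ρ₂,
      x.1 ^ 2 + x.2 ^ 2 = y.1 ^ 2 + y.2 ^ 2 → B x = B y)
    (hφ : IsScalarPotential ρ₁ ρ₂ B φ) :
    ∃ α : ℝ → ℝ, ContDiffOn ℝ ∞ α (Set.Ioo ρ₁ ρ₂) ∧ ContinuousOn α (Set.Icc ρ₁ ρ₂) ∧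
      (∀ r ∈ Set.Icc ρ₁ ρ₂, radialDeriv ρ₁ ρ₂ φ r = α r) ∧
      (∀ r ∈ Set.Ioo ρ₁ ρ₂, HasDerivAt α (B (r, 0) - α r / r) r) ∧
      ∀ x ∈ annulus ρ₁ ρ₂, gradPerp φ x = (α (rad x) / rad x) • (-x.2, x.1) := by
  have hax : ∀ r ∈ Set.Icc ρ₁ ρ₂, ((r, 0) : ℝ × ℝ) ∈ closedAnnulus ρ₁ ρ₂ := fun r hr => by
    rw [mem_closedAnnulus_iff hρ₁ hρ, rad_axis (hρ₁.le.trans hr.1)]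
    exact hr
  have hb : ContDiffOn ℝ ∞ (fun r : ℝ => B (r, 0)) (Set.Icc ρ₁ ρ₂) :=
    hB.comp (contDiff_id.prodMk contDiff_const).contDiffOn hax
  set c : ℝ → ℝ := Set.IccExtend hρ.le ((Set.Icc ρ₁ ρ₂).domRestrict fun r : ℝ => B (r, 0))
  have hc : Continuous c := (continuousOn_iff_continuous_domRestrict.1 hb.continuousOn).Icc_extend'
  have hcB : ∀ r ∈ Set.Icc ρ₁ ρ₂, c r = B (r, 0) := fun r hr => Set.IccExtend_of_mem _ _ hr
  obtain ⟨f, α, f1, f2, hf⟩ := exists_radial_solution hρ₁ hρ hc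
  have hI : Set.Ioo ρ₁ ρ₂ ⊆ Set.Ioi 0 := fun r hr => hρ₁.trans hr.1
  have hcs : ContDiffOn ℝ ∞ c (Set.Ioo ρ₁ ρ₂) :=
    (hb.mono Set.Ioo_subset_Icc_self).congr fun r hr => hcB r (Set.Ioo_subset_Icc_self hr)
  have hs := contDiffOn_of_radial isOpen_Ioo hI hcs fun r hr => (hf r (hI hr)).2
  have hαc : ContinuousOn α (Set.Ioi 0) := fun r hr => (hf r hr).2.continuousAt.continuousWithinAt
  have hfc : ContinuousOn f (Set.Ioi 0) := fun r hr => (hf r hr).1.continuousAt.continuousWithinAt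
  have hIcc : Set.Icc ρ₁ ρ₂ ⊆ Set.Ioi 0 := fun r hr => hρ₁.trans_le hr.1
  have hΩ := isOpen_annulus ρ₁ ρ₂
  obtain ⟨hφc, hφ0, g₁, g₂, w1, w2, hw⟩ := hφ
  have hfs : ContDiffOn ℝ ∞ f (Set.Ioo ρ₁ ρ₂) := by
    rw [contDiffOn_infty_iff_deriv_of_isOpen isOpen_Ioo]
    exact ⟨fun r hr => (hf r (hI hr)).1.differentiableAt.differentiableWithinAt,
      hs.congr fun r hr => (hf r (hI hr)).1.deriv⟩
  have hfd : ∀ x ∈ annulus ρ₁ ρ₂, fderiv ℝ (fun y => f (rad y)) x =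
      (α (rad x) / rad x) • radForm x := fun x hx =>
    (hasFDerivAt_radial (rad_pos_of_mem hρ₁ hρ hx)
      (hf _ (rad_pos_of_mem hρ₁ hρ hx)).1).fderiv
  have hΦ := (contDiffOn_comp_rad hρ₁ hρ hfs).of_le (m := 1) (by simp)
  have w1' := (HasWeakDeriv.of_contDiffOn (v := (1, 0)) hΩ hΦ).congr₂ (ae_eq_refl _)
    (g' := fun x => α (rad x) / rad x * x.1) (by
      filter_upwards [ae_mem_annulus ρ₁ ρ₂] with x hx
      rw [hfd x hx]
      simp [radForm])
  have w2' := (HasWeakDeriv.of_contDiffOn (v := (0, 1)) hΩ hΦ).congr₂ (ae_eq_refl _)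
    (g' := fun x => α (rad x) / rad x * x.2) (by
      filter_upwards [ae_mem_annulus ρ₁ ρ₂] with x hx
      rw [hfd x hx]
      simp [radForm])
  have hae := dirichlet_unique hΩ (annulus_isBounded ρ₁ ρ₂) hφ0 w1 w2
    (memH10_radial hρ₁ hρ f1 f2 (fun r hr => (hf r hr).1) hαc) w1' w2' fun η hη => by
      rw [hw η hη, radial_weak_equation hρ₁ hρ (fun r hr => (hf r (hI hr)).2) hs hη]
      congr 1
      refine setIntegral_congr_fun hΩ.measurableSet fun x hx => ?_
      have hx' := annulus_subset_closedAnnulus hx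
      have hr := (mem_closedAnnulus_iff hρ₁ hρ).1 hx'
      rw [hcB _ hr, hBrad x hx' _ (hax _ hr) (by rw [← rad_sq]; simp)]
  have heq : Set.EqOn φ (fun x => f (rad x)) (annulus ρ₁ ρ₂) :=
    Measure.eqOn_open_of_ae_eq hae hΩ (hφc.mono annulus_subset_closedAnnulus) hΦ.continuousOn
  have hline : Set.EqOn (fun t => φ (t, 0)) f (Set.Icc ρ₁ ρ₂) := by
    refine Set.EqOn.of_subset_closure (s := Set.Ioo ρ₁ ρ₂) (fun t ht => ?_)
      (hφc.comp (by fun_prop) hax) (hfc.mono hIcc) Set.Ioo_subset_Icc_self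
      (closure_Ioo hρ.ne).ge
    have ht0 := rad_axis (hI ht).le
    have := heq (x := (t, 0)) ((mem_annulus_iff hρ₁ hρ).2 (by rwa [ht0]))
    simpa only [ht0] using this
  refine ⟨α, hs, hαc.mono hIcc, fun r hr => ?_, fun r hr => ?_, fun x hx => ?_⟩
  · rw [radialDeriv, derivWithin_congr hline (hline hr)]
    exact (hf r (hIcc hr)).1.hasDerivWithinAt.derivWithin (uniqueDiffOn_Icc hρ r hr)
  · rw [← hcB r (Set.Ioo_subset_Icc_self hr)]
    exact (hf r (hI hr)).2
  · have hev : φ =ᶠ[𝓝 x] fun x => f (rad x) :=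
      Filter.eventuallyEq_of_mem (hΩ.mem_nhds hx) heq
    rw [gradPerp, hev.fderiv_eq, hfd x hx]
    simp [radForm]

end ScalarPotential

/-! ### The Dirac operator on the angular modes -/

section DiracModes

theorem spinMul_apply (M : Matrix (Fin 2) (Fin 2) ℂ) (s : Spinor) (i : Fin 2) :
    spinMul M s i = M i 0 * s 0 + M i 1 * s 1 := by
  simp only [spinMul, Matrix.toLpLin_apply, Matrix.mulVec, dotProduct, Fin.sum_univ_two]

theorem inner_spinMul {M : Matrix (Fin 2) (Fin 2) ℂ} (hM : M.IsHermitian) (s t : Spinor) :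
    inner ℂ (spinMul M s) t = inner ℂ s (spinMul M t) := by
  have h00 := hM.apply 0 0
  have h01 := hM.apply 0 1
  have h10 := hM.apply 1 0
  have h11 := hM.apply 1 1
  simp only [PiLp.inner_apply, Fin.sum_univ_two, spinMul_apply, RCLike.inner_apply, map_add,
    map_mul]
  simp only [RCLike.star_def] at *
  rw [h00, h10, h01, h11]
  ring

theorem isHermitian_σ₁ : σ₁.IsHermitian := by
  ext i j
  fin_cases i <;> fin_cases j <;> simp [σ₁]

theorem isHermitian_σ₂ : σ₂.IsHermitian := by
  ext i j
  fin_cases i <;> fin_cases j <;> simp [σ₂]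

/-- The raising matrix `(σ₁ + iσ₂) / 2`. -/
def σUp : Matrix (Fin 2) (Fin 2) ℂ := !![0, 1; 0, 0]

/-- The lowering matrix `(σ₁ - iσ₂) / 2`. -/
def σDown : Matrix (Fin 2) (Fin 2) ℂ := !![0, 0; 1, 0]

/-- The action of a `2 × 2` matrix on `ℂ²`, as a continuous map. -/
def spinL (M : Matrix (Fin 2) (Fin 2) ℂ) : Spinor →L[ℝ] Spinor :=
  (LinearMap.toContinuousLinearMap (spinMul M)).restrictScalars ℝ

theorem modeFun_apply (m : ℤ) (v : ℝ → Spinor) (x : ℝ × ℝ) (i : Fin 2) :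
    modeFun m v x i =
      (((Real.sqrt (2 * Real.pi * rad x))⁻¹ : ℝ) * eang m x : ℂ) * v (rad x) i := rfl

variable {ρ₁ ρ₂ h : ℝ} {a b : ℝ → ℝ}

/-- The field `a(r) e_θ` has smooth profile, and its rotational `b(r)` is continuous up to the
boundary. -/
structure RadialField (ρ₁ ρ₂ : ℝ) (a b : ℝ → ℝ) : Prop where
  smooth : ContDiffOn ℝ ∞ a (Set.Ioo ρ₁ ρ₂)
  cont : ContinuousOn a (Set.Icc ρ₁ ρ₂)
  cont_rot : ContinuousOn b (Set.Icc ρ₁ ρ₂)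
  deriv : ∀ r ∈ Set.Ioo ρ₁ ρ₂, HasDerivAt a (b r - a r / r) r

/-- `A = a(|x|) e_θ` on the annulus. -/
def IsAngularField (ρ₁ ρ₂ : ℝ) (A : ℝ × ℝ → ℝ × ℝ) (a : ℝ → ℝ) : Prop :=
  ∀ x ∈ annulus ρ₁ ρ₂, A x = (a (rad x) / rad x) • (-x.2, x.1)

/-- The radial part, on the mode `m`, of the entry of `σ · (p - A)` which raises the mode. -/
def dUp (h : ℝ) (a : ℝ → ℝ) (m : ℤ) (v v' : ℝ → Spinor) (r : ℝ) : Spinor :=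
  (-Complex.I) • ((h : ℂ) • up m v v' r + (a r : ℂ) • v r)

/-- The radial part, on the mode `m`, of the entry of `σ · (p - A)` which lowers the mode. -/
def dDown (h : ℝ) (a : ℝ → ℝ) (m : ℤ) (v v' : ℝ → Spinor) (r : ℝ) : Spinor :=
  (-Complex.I) • ((h : ℂ) • down m v v' r - (a r : ℂ) • v r)

/-- For an angular potential, `σ · (p - A)` acts on a mode as a raising and a lowering part, each of
which exchanges the components of the spinor. -/
theorem dirac_mode_apply {A : ℝ × ℝ → ℝ × ℝ} (hA : IsAngularField ρ₁ ρ₂ A a) (hρ₁ : 0 < ρ₁)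
    (hρ : ρ₁ < ρ₂) (m : ℤ) (v v' : ℝ → Spinor) {x : ℝ × ℝ} (hx : x ∈ annulus ρ₁ ρ₂) :
    spinMul σ₁ ((-Complex.I * (h : ℂ)) • gradX m v v' x - ((A x).1 : ℂ) • modeFun m v x) +
      spinMul σ₂ ((-Complex.I * (h : ℂ)) • gradY m v v' x - ((A x).2 : ℂ) • modeFun m v x) =
    modeFun (m - 1) (fun r => spinMul σUp (dDown h a m v v' r)) x +
      modeFun (m + 1) (fun r => spinMul σDown (dUp h a m v v' r)) x := by
  have hr := rad_pos_of_mem hρ₁ hρ hx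
  have hr0 := rad_ne_zero hr
  have hI := Complex.I_sq
  have hI3 := Complex.I_pow_three
  have hm1 : eang (m + 1) x = eang m x * (((x.1 : ℂ) + x.2 * Complex.I) / rad x) := by
    rw [eang_add hr, eang_one]
  have hm2 : eang (m - 1) x = eang m x * (((x.1 : ℂ) - x.2 * Complex.I) / rad x) := by
    rw [sub_eq_add_neg, eang_add hr, eang_neg_one hr]
  rw [hA x hx]
  ext i
  fin_cases i
  · simp only [gradX, gradY, dDown, dUp, modeFun_apply, spinMul_apply, σ₁, σ₂, σUp, σDown,
      PiLp.add_apply, PiLp.smul_apply, PiLp.sub_apply, hm1, hm2, smul_eq_mul]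
    simp
    field_simp
    ring_nf
    simp only [hI, hI3, Complex.I_pow_four]
    ring
  · simp only [gradX, gradY, dDown, dUp, modeFun_apply, spinMul_apply, σ₁, σ₂, σUp, σDown,
      PiLp.add_apply, PiLp.smul_apply, PiLp.sub_apply, hm1, hm2, smul_eq_mul]
    simp
    field_simp
    ring_nf
    simp only [hI, hI3, Complex.I_pow_four]
    ring

theorem memLp_continuousOn_smul {c : ℝ → ℝ} (hc : ContinuousOn c (Set.Icc ρ₁ ρ₂)) {v : ℝ → Spinor}
    (hv : MemLp v 2 (volume.restrict (Set.Ioo ρ₁ ρ₂))) :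
    MemLp (fun r => (c r : ℂ) • v r) 2 (volume.restrict (Set.Ioo ρ₁ ρ₂)) := by
  obtain ⟨C, hC⟩ := isCompact_Icc.exists_bound_of_continuousOn hc
  refine memLp_bdd_smul (C := C) hv ((Complex.continuous_ofReal.comp_continuousOn
    (hc.mono Set.Ioo_subset_Icc_self)).aestronglyMeasurable measurableSet_Ioo) ?_
  filter_upwards [ae_restrict_mem measurableSet_Ioo] with r hr
  rw [Complex.norm_real]
  exact hC r (Set.Ioo_subset_Icc_self hr)

theorem memLp_spin {X : Type*} [MeasurableSpace X] {μ : Measure X} {f : X → Spinor}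
    (hf : MemLp f 2 μ) (M : Matrix (Fin 2) (Fin 2) ℂ) : MemLp (fun x => spinMul M (f x)) 2 μ :=
  (spinL M).comp_memLp' hf

/-- The Dirac operator on a mode. -/
theorem hasDirac_modeFun (hρ₁ : 0 < ρ₁) (hρ : ρ₁ < ρ₂) {A : ℝ × ℝ → ℝ × ℝ}
    (hA : IsAngularField ρ₁ ρ₂ A a) (m : ℤ) {v v' : ℝ → Spinor}
    (hv : MemLp v 2 (volume.restrict (Set.Ioo ρ₁ ρ₂)))
    (hv' : MemLp v' 2 (volume.restrict (Set.Ioo ρ₁ ρ₂)))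
    (hw : HasWeakDeriv (Set.Ioo ρ₁ ρ₂) (1 : ℝ) v v') :
    HasDirac (annulus ρ₁ ρ₂) h A (modeFun m v) (fun x =>
      modeFun (m - 1) (fun r => spinMul σUp (dDown h a m v v' r)) x +
      modeFun (m + 1) (fun r => spinMul σDown (dUp h a m v v' r)) x) := by
  have hg := hasWeakDeriv_modeFun hρ₁ hρ m hv hv' hw
  refine ⟨_, _, hg.1, hg.2, ?_⟩
  filter_upwards [ae_mem_annulus ρ₁ ρ₂] with x hx
  rw [dirac_mode_apply hA hρ₁ hρ m v v' hx]

/-- The derivative of `dUp h a m v v'`. -/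
def dUp' (h : ℝ) (a b : ℝ → ℝ) (m : ℤ) (v v' v'' : ℝ → Spinor) (r : ℝ) : Spinor :=
  (-Complex.I) • ((h : ℂ) • derivUp m v v' v'' r +
    (((b r - a r / r : ℝ) : ℂ) • v r + (a r : ℂ) • v' r))

/-- The derivative of `dDown h a m v v'`. -/
def dDown' (h : ℝ) (a b : ℝ → ℝ) (m : ℤ) (v v' v'' : ℝ → Spinor) (r : ℝ) : Spinor :=
  (-Complex.I) • ((h : ℂ) • derivUp (-m) v v' v'' r -
    (((b r - a r / r : ℝ) : ℂ) • v r + (a r : ℂ) • v' r))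

section Second

variable {v v' v'' : ℝ → Spinor}

theorem RadialField.cont_div (ha : RadialField ρ₁ ρ₂ a b) (hρ₁ : 0 < ρ₁) :
    ContinuousOn (fun r => b r - a r / r) (Set.Icc ρ₁ ρ₂) :=
  ha.cont_rot.sub (ha.cont.div continuousOn_id fun _ hr => (hρ₁.trans_le hr.1).ne')

theorem hasWeakDeriv_dUp (ha : RadialField ρ₁ ρ₂ a b) (hρ₁ : 0 < ρ₁) (m : ℤ)
    (hw : HasWeakDeriv (Set.Ioo ρ₁ ρ₂) (1 : ℝ) v v')
    (hw' : HasWeakDeriv (Set.Ioo ρ₁ ρ₂) (1 : ℝ) v' v'') :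
    HasWeakDeriv (Set.Ioo ρ₁ ρ₂) (1 : ℝ) (dUp h a m v v') (dUp' h a b m v v' v'') :=
  (((hasWeakDeriv_up hρ₁ m hw hw').smul (h : ℂ)).add
    (hasWeakDeriv_smul_interval isOpen_Ioo ha.smooth ha.deriv hw)).smul (-Complex.I)

theorem hasWeakDeriv_dDown (ha : RadialField ρ₁ ρ₂ a b) (hρ₁ : 0 < ρ₁) (m : ℤ)
    (hw : HasWeakDeriv (Set.Ioo ρ₁ ρ₂) (1 : ℝ) v v')
    (hw' : HasWeakDeriv (Set.Ioo ρ₁ ρ₂) (1 : ℝ) v' v'') :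
    HasWeakDeriv (Set.Ioo ρ₁ ρ₂) (1 : ℝ) (dDown h a m v v') (dDown' h a b m v v' v'') := by
  refine ((((hasWeakDeriv_up hρ₁ (-m) hw hw').smul (h : ℂ)).add
    ((hasWeakDeriv_smul_interval isOpen_Ioo ha.smooth ha.deriv hw).smul (-1))).smul
      (-Complex.I)).congr₂ (ae_of_all _ fun r => ?_) (ae_of_all _ fun r => ?_)
  · simp only [dDown, down_eq_up]
    module
  · simp only [dDown']
    module

theorem memLp_dUp (ha : RadialField ρ₁ ρ₂ a b) (hρ₁ : 0 < ρ₁) (m : ℤ)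
    (hv : MemLp v 2 (volume.restrict (Set.Ioo ρ₁ ρ₂)))
    (hv' : MemLp v' 2 (volume.restrict (Set.Ioo ρ₁ ρ₂))) :
    MemLp (dUp h a m v v') 2 (volume.restrict (Set.Ioo ρ₁ ρ₂)) :=
  (((memLp_up hρ₁ m hv hv').const_smul (h : ℂ)).add
    (memLp_continuousOn_smul ha.cont hv)).const_smul (-Complex.I)

theorem memLp_dDown (ha : RadialField ρ₁ ρ₂ a b) (hρ₁ : 0 < ρ₁) (m : ℤ)
    (hv : MemLp v 2 (volume.restrict (Set.Ioo ρ₁ ρ₂)))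
    (hv' : MemLp v' 2 (volume.restrict (Set.Ioo ρ₁ ρ₂))) :
    MemLp (dDown h a m v v') 2 (volume.restrict (Set.Ioo ρ₁ ρ₂)) :=
  (((memLp_down hρ₁ m hv hv').const_smul (h : ℂ)).sub
    (memLp_continuousOn_smul ha.cont hv)).const_smul (-Complex.I)

theorem memLp_dUp' (ha : RadialField ρ₁ ρ₂ a b) (hρ₁ : 0 < ρ₁) (m : ℤ)
    (hv : MemLp v 2 (volume.restrict (Set.Ioo ρ₁ ρ₂)))
    (hv' : MemLp v' 2 (volume.restrict (Set.Ioo ρ₁ ρ₂)))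
    (hv'' : MemLp v'' 2 (volume.restrict (Set.Ioo ρ₁ ρ₂))) :
    MemLp (dUp' h a b m v v' v'') 2 (volume.restrict (Set.Ioo ρ₁ ρ₂)) :=
  (((memLp_derivUp hρ₁ m hv hv' hv'').const_smul (h : ℂ)).add
    ((memLp_continuousOn_smul (ha.cont_div hρ₁) hv).add
      (memLp_continuousOn_smul ha.cont hv'))).const_smul (-Complex.I)

theorem memLp_dDown' (ha : RadialField ρ₁ ρ₂ a b) (hρ₁ : 0 < ρ₁) (m : ℤ)
    (hv : MemLp v 2 (volume.restrict (Set.Ioo ρ₁ ρ₂)))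
    (hv' : MemLp v' 2 (volume.restrict (Set.Ioo ρ₁ ρ₂)))
    (hv'' : MemLp v'' 2 (volume.restrict (Set.Ioo ρ₁ ρ₂))) :
    MemLp (dDown' h a b m v v' v'') 2 (volume.restrict (Set.Ioo ρ₁ ρ₂)) :=
  (((memLp_derivUp hρ₁ (-m) hv hv' hv'').const_smul (h : ℂ)).sub
    ((memLp_continuousOn_smul (ha.cont_div hρ₁) hv).add
      (memLp_continuousOn_smul ha.cont hv'))).const_smul (-Complex.I)

end Second

/-- The differential expression of the fibered operator. -/
def fiberExpr (h : ℝ) (a b : ℝ → ℝ) (m : ℤ) (v v'' : ℝ → Spinor) (r : ℝ) : Spinor :=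
  (-((h ^ 2 : ℝ) : ℂ)) • (v'' r + ((1 / (4 * r ^ 2) : ℝ) : ℂ) • v r) +
    (((h * (m / r) - a r) ^ 2 : ℝ) : ℂ) • v r - ((h * b r : ℝ) : ℂ) • spinMul σ₃ (v r)

/-- The part of the square of the Dirac operator which preserves the mode. The commutator of `∂_r`
with the profile `a` of the potential gives the term `-h B σ₃`, where `B = a' + a / r`. -/
theorem dirac_sq_apply (m : ℤ) (v v' v'' : ℝ → Spinor) {r : ℝ} (hr : r ≠ 0) :
    spinMul σDown (dUp h a (m - 1) (fun r => spinMul σUp (dDown h a m v v' r))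
      (fun r => spinMul σUp (dDown' h a b m v v' v'' r)) r) +
    spinMul σUp (dDown h a (m + 1) (fun r => spinMul σDown (dUp h a m v v' r))
      (fun r => spinMul σDown (dUp' h a b m v v' v'' r)) r) = fiberExpr h a b m v v'' r := by
  have hr0 : (r : ℂ) ≠ 0 := by exact_mod_cast hr
  have hI := Complex.I_sq
  ext i
  fin_cases i
  · simp only [dDown, dUp, dDown', dUp', fiberExpr, derivUp, up, down, spinMul_apply, σUp, σDown,
      σ₃, PiLp.add_apply, PiLp.smul_apply, PiLp.sub_apply, smul_eq_mul]
    simp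
    field_simp
    ring_nf
    simp only [hI]
    ring
  · simp only [dDown, dUp, dDown', dUp', fiberExpr, derivUp, up, down, spinMul_apply, σUp, σDown,
      σ₃, PiLp.add_apply, PiLp.smul_apply, PiLp.sub_apply, smul_eq_mul]
    simp
    field_simp
    ring_nf
    simp only [hI]
    ring

theorem spinMul_σUp_σUp (s : Spinor) : spinMul σUp (spinMul σUp s) = 0 := by
  ext i
  fin_cases i <;> simp [spinMul_apply, σUp]

theorem spinMul_σDown_σDown (s : Spinor) : spinMul σDown (spinMul σDown s) = 0 := by
  ext i
  fin_cases i <;> simp [spinMul_apply, σDown]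

/-- The square of the Dirac operator preserves the modes. -/
theorem hasDirac_sq_modeFun (hρ₁ : 0 < ρ₁) (hρ : ρ₁ < ρ₂) {A : ℝ × ℝ → ℝ × ℝ}
    (hA : IsAngularField ρ₁ ρ₂ A a) (ha : RadialField ρ₁ ρ₂ a b) (m : ℤ) {v v' v'' : ℝ → Spinor}
    (hv : MemLp v 2 (volume.restrict (Set.Ioo ρ₁ ρ₂)))
    (hv' : MemLp v' 2 (volume.restrict (Set.Ioo ρ₁ ρ₂)))
    (hv'' : MemLp v'' 2 (volume.restrict (Set.Ioo ρ₁ ρ₂)))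
    (hw : HasWeakDeriv (Set.Ioo ρ₁ ρ₂) (1 : ℝ) v v')
    (hw' : HasWeakDeriv (Set.Ioo ρ₁ ρ₂) (1 : ℝ) v' v'') :
    ∃ w, HasDirac (annulus ρ₁ ρ₂) h A (modeFun m v) w ∧
      HasDirac (annulus ρ₁ ρ₂) h A w (modeFun m (fiberExpr h a b m v v'')) := by
  have h1 := hasDirac_modeFun (h := h) hρ₁ hρ hA m hv hv' hw
  have hd := hasDirac_modeFun (h := h) hρ₁ hρ hA (m - 1)
    (memLp_spin (memLp_dDown (h := h) ha hρ₁ m hv hv') σUp)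
    (memLp_spin (memLp_dDown' (h := h) ha hρ₁ m hv hv' hv'') σUp)
    ((hasWeakDeriv_dDown ha hρ₁ m hw hw').clm (spinL σUp))
  have hu := hasDirac_modeFun (h := h) hρ₁ hρ hA (m + 1)
    (memLp_spin (memLp_dUp (h := h) ha hρ₁ m hv hv') σDown)
    (memLp_spin (memLp_dUp' (h := h) ha hρ₁ m hv hv' hv'') σDown)
    ((hasWeakDeriv_dUp ha hρ₁ m hw hw').clm (spinL σDown))
  refine ⟨_, h1, (hd.add hu).congr (ae_eq_refl _) ?_⟩
  filter_upwards [ae_mem_annulus ρ₁ ρ₂] with x hx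
  have hr := rad_pos_of_mem hρ₁ hρ hx
  have e1 : ∀ (k : ℤ) (f f' : ℝ → Spinor), spinMul σUp (dDown h a k
      (fun r => spinMul σUp (f r)) (fun r => spinMul σUp (f' r)) (rad x)) = 0 := fun k f f' => by
    simp only [dDown, down, map_smul, map_sub, spinMul_σUp_σUp, smul_zero, sub_zero]
  have e2 : ∀ (k : ℤ) (f f' : ℝ → Spinor), spinMul σDown (dUp h a k
      (fun r => spinMul σDown (f r)) (fun r => spinMul σDown (f' r)) (rad x)) = 0 :=
    fun k f f' => by
      simp only [dUp, up, map_smul, map_sub, map_add, spinMul_σDown_σDown, smul_zero, sub_zero,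
        add_zero]
  have e3 := dirac_sq_apply (h := h) (a := a) (b := b) m v v' v'' hr.ne'
  simp only [modeFun, e1, e2, ← e3, smul_zero, zero_add, add_zero, sub_add_cancel,
    add_sub_cancel_right, smul_add]

end DiracModes

/-! ### Symmetry of the Pauli operator, and its reduction to the fibers -/

section Symmetry

variable {Ω : Set (ℝ × ℝ)} {h : ℝ} {A : ℝ × ℝ → ℝ × ℝ}

theorem HasWeakDeriv.inner_test' {d : ℝ × ℝ} {u g η : ℝ × ℝ → Spinor} (H : HasWeakDeriv Ω d u g)
    (hη : IsTestFunction Ω η) :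
    ∫ x in Ω, inner ℂ (g x) (η x) = -∫ x in Ω, inner ℂ (u x) (fderiv ℝ η x d) := by
  have := congrArg (starRingEnd ℂ) (H.inner_test hη)
  rw [map_neg, ← integral_conj, ← integral_conj] at this
  simp only [inner_conj_symm] at this
  rw [this, neg_neg]

theorem integrable_inner_test' {u η : ℝ × ℝ → Spinor} (hη : IsTestFunction Ω η)
    (hu : LocallyIntegrableOn u Ω) :
    Integrable (fun x => inner ℂ (u x) (η x)) (volume.restrict Ω) := by
  have := (integrable_inner_test hη hu)
  have := (Complex.conjCLE : ℂ →L[ℝ] ℂ).integrable_comp this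
  simpa [inner_conj_symm] using this

/-- One component `σ (-ih∂ - a)` of the Dirac operator, tested against a test function. -/
theorem integral_dirac_part (hΩ : IsOpen Ω) {a : ℝ × ℝ → ℝ} (ha : ContDiffOn ℝ ∞ a Ω)
    {M : Matrix (Fin 2) (Fin 2) ℂ} {d : ℝ × ℝ} {W W' η : ℝ × ℝ → Spinor}
    (H : HasWeakDeriv Ω d W W') (hη : IsTestFunction Ω η) :
    Integrable (fun x => inner ℂ (spinMul M ((-Complex.I * (h : ℂ)) • W' x - (a x : ℂ) • W x)) (η x))
      (volume.restrict Ω) ∧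
    ∫ x in Ω, inner ℂ (spinMul M ((-Complex.I * (h : ℂ)) • W' x - (a x : ℂ) • W x)) (η x) =
      (-Complex.I * (h : ℂ)) * (∫ x in Ω, inner ℂ (spinMul M (W x)) (fderiv ℝ η x d)) -
      ∫ x in Ω, inner ℂ ((a x : ℂ) • spinMul M (W x)) (η x) := by
  have haη : IsTestFunction Ω fun x => a x • η x := hη.smooth_smul hΩ ha
  have hM : HasWeakDeriv Ω d (fun x => spinMul M (W x)) (fun x => spinMul M (W' x)) :=
    H.clm (spinL M)
  have e : ∀ x, inner ℂ (spinMul M ((-Complex.I * (h : ℂ)) • W' x - (a x : ℂ) • W x)) (η x) =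
      (Complex.I * h) * inner ℂ (spinMul M (W' x)) (η x) -
        inner ℂ (spinMul M (W x)) (a x • η x) := fun x => by
    rw [map_sub, map_smul, map_smul, inner_sub_left, inner_smul_left, inner_smul_left,
      inner_real_smul_right]
    simp
  have e' : ∀ x, inner ℂ ((a x : ℂ) • spinMul M (W x)) (η x) =
      inner ℂ (spinMul M (W x)) (a x • η x) := fun x => by
    rw [inner_smul_left, inner_real_smul_right, Complex.conj_ofReal]
  have i1 := (integrable_inner_test' hη hM.2.1).const_mul (Complex.I * h)
  have i2 := integrable_inner_test' haη hM.1
  simp only [e, e']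
  refine ⟨i1.sub i2, ?_⟩
  rw [integral_sub i1 i2, integral_const_mul, hM.inner_test' hη]
  ring

theorem HasDirac.integral_inner_test (hΩ : IsOpen Ω) (hA : ContDiffOn ℝ ∞ A Ω)
    {W F η : ℝ × ℝ → Spinor} (H : HasDirac Ω h A W F) (hη : IsTestFunction Ω η) :
    ∫ x in Ω, inner ℂ (F x) (η x) =
      ((-Complex.I * (h : ℂ)) * (∫ x in Ω, inner ℂ (spinMul σ₁ (W x)) (fderiv ℝ η x (1, 0))) -
        ∫ x in Ω, inner ℂ (((A x).1 : ℂ) • spinMul σ₁ (W x)) (η x)) +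
      ((-Complex.I * (h : ℂ)) * (∫ x in Ω, inner ℂ (spinMul σ₂ (W x)) (fderiv ℝ η x (0, 1))) -
        ∫ x in Ω, inner ℂ (((A x).2 : ℂ) • spinMul σ₂ (W x)) (η x)) := by
  obtain ⟨W₁, W₂, h1, h2, h3⟩ := H
  obtain ⟨i1, e1⟩ := integral_dirac_part (h := h) (M := σ₁) (a := fun x => (A x).1) hΩ (contDiff_fst.comp_contDiffOn hA)
    h1 hη
  obtain ⟨i2, e2⟩ := integral_dirac_part (h := h) (M := σ₂) (a := fun x => (A x).2) hΩ (contDiff_snd.comp_contDiffOn hA)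
    h2 hη
  rw [← e1, ← e2, ← integral_add i1 i2]
  refine integral_congr_ae ?_
  filter_upwards [h3] with x hx
  rw [hx, inner_add_left]

theorem memLp_field_smul (hΩ : IsOpen Ω) {a : ℝ × ℝ → ℝ} (ha : ContinuousOn a Ω) {C : ℝ}
    (hC : ∀ x ∈ Ω, ‖a x‖ ≤ C) {W : ℝ × ℝ → Spinor} (hW : MemLp W 2 (volume.restrict Ω)) :
    MemLp (fun x => (a x : ℂ) • W x) 2 (volume.restrict Ω) := by
  refine memLp_bdd_smul (C := C) hW ((Complex.continuous_ofReal.comp_continuousOn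
    ha).aestronglyMeasurable hΩ.measurableSet) ?_
  filter_upwards [ae_restrict_mem hΩ.measurableSet] with x hx
  rw [Complex.norm_real]
  exact hC x hx

/-- The Dirac operator is symmetric when one of the two functions is in `H¹₀`. -/
theorem HasDirac.integral_inner (hΩ : IsOpen Ω) (hA : ContDiffOn ℝ ∞ A Ω) {C : ℝ}
    (hC : ∀ x ∈ Ω, ‖A x‖ ≤ C) {W F U w G₁ G₂ : ℝ × ℝ → Spinor} (H : HasDirac Ω h A W F)
    (hW : MemLp W 2 (volume.restrict Ω)) (hF : MemLp F 2 (volume.restrict Ω))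
    (hU : MemH10 Ω U) (hG : HasGrad Ω U G₁ G₂) (hw : HasDirac Ω h A U w) :
    ∫ x in Ω, inner ℂ (F x) (U x) = ∫ x in Ω, inner ℂ (W x) (w x) := by
  obtain ⟨η, t, t0, tg⟩ := hU.exists_seq hΩ
  have m0 := fun n => (t n).memLp
  have m1 := fun n => ((t n).fderiv_apply (1, 0)).memLp
  have m2 := fun n => ((t n).fderiv_apply (0, 1)).memLp
  have lA1 := memLp_field_smul (a := fun x => (A x).1) hΩ (continuous_fst.comp_continuousOn hA.continuousOn)
    (fun x hx => (norm_fst_le (A x)).trans (hC x hx)) (memLp_spin hW σ₁)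
  have lA2 := memLp_field_smul (a := fun x => (A x).2) hΩ (continuous_snd.comp_continuousOn hA.continuousOn)
    (fun x hx => (norm_snd_le (A x)).trans (hC x hx)) (memLp_spin hW σ₂)
  have L := tendsto_integral_inner ℂ hF m0 hG.1 t0
  have R1 := tendsto_integral_inner ℂ (memLp_spin hW σ₁) m1 hG.2 (tg _ _ hG.4).2
  have R2 := tendsto_integral_inner ℂ lA1 m0 hG.1 t0
  have R3 := tendsto_integral_inner ℂ (memLp_spin hW σ₂) m2 hG.3 (tg _ _ hG.5).2
  have R4 := tendsto_integral_inner ℂ lA2 m0 hG.1 t0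
  have R := ((R1.const_mul (-Complex.I * (h : ℂ))).sub R2).add
    ((R3.const_mul (-Complex.I * (h : ℂ))).sub R4)
  have key := tendsto_nhds_unique L (R.congr fun n =>
    (H.integral_inner_test hΩ hA (t n)).symm)
  have j1 := (integrable_inner_memLp (memLp_spin hW σ₁) hG.2).const_mul (-Complex.I * (h : ℂ))
  have j2 := integrable_inner_memLp lA1 hG.1
  have j3 := (integrable_inner_memLp (memLp_spin hW σ₂) hG.3).const_mul (-Complex.I * (h : ℂ))
  have j4 := integrable_inner_memLp lA2 hG.1
  have j5 : Integrable (fun x => -Complex.I * h * inner ℂ (spinMul σ₁ (W x)) (G₁ x) -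
    inner ℂ (((A x).1 : ℂ) • spinMul σ₁ (W x)) (U x)) (volume.restrict Ω) := j1.sub j2
  have j6 : Integrable (fun x => -Complex.I * h * inner ℂ (spinMul σ₂ (W x)) (G₂ x) -
    inner ℂ (((A x).2 : ℂ) • spinMul σ₂ (W x)) (U x)) (volume.restrict Ω) := j3.sub j4
  rw [key, ← integral_const_mul, ← integral_const_mul, ← integral_sub j1 j2,
    ← integral_sub j3 j4, ← integral_add j5 j6]
  obtain ⟨u₁, u₂, k1, k2, k3⟩ := hw
  refine integral_congr_ae ?_
  filter_upwards [k3, hG.4.ae_eq hΩ k1, hG.5.ae_eq hΩ k2] with x hx e1 e2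
  rw [hx, e1, e2, inner_add_right, ← inner_spinMul isHermitian_σ₁, ← inner_spinMul isHermitian_σ₂,
    inner_sub_right, inner_sub_right, inner_smul_right, inner_smul_right, inner_smul_right,
    inner_smul_right, inner_smul_left, inner_smul_left, Complex.conj_ofReal, Complex.conj_ofReal]

theorem HasDirac.memLp (hΩ : IsOpen Ω) (hA : ContDiffOn ℝ ∞ A Ω) {C : ℝ}
    (hC : ∀ x ∈ Ω, ‖A x‖ ≤ C) {U w G₁ G₂ : ℝ × ℝ → Spinor} (hG : HasGrad Ω U G₁ G₂)
    (hw : HasDirac Ω h A U w) : MemLp w 2 (volume.restrict Ω) := by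
  obtain ⟨u₁, u₂, k1, k2, k3⟩ := hw
  have l1 := memLp_field_smul (a := fun x => (A x).1) hΩ (continuous_fst.comp_continuousOn hA.continuousOn)
    (fun x hx => (norm_fst_le (A x)).trans (hC x hx)) hG.1
  have l2 := memLp_field_smul (a := fun x => (A x).2) hΩ (continuous_snd.comp_continuousOn hA.continuousOn)
    (fun x hx => (norm_snd_le (A x)).trans (hC x hx)) hG.1
  refine (memLp_congr_ae ?_).1 ((memLp_spin ((hG.2.const_smul (-Complex.I * (h : ℂ))).sub l1)
    σ₁).add (memLp_spin ((hG.3.const_smul (-Complex.I * (h : ℂ))).sub l2) σ₂))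
  filter_upwards [k3, hG.4.ae_eq hΩ k1, hG.5.ae_eq hΩ k2] with x hx e1 e2
  rw [hx, ← e1, ← e2]
  rfl

/-- The Dirichlet-Pauli operator is symmetric. -/
theorem PauliRel.integral_inner {ρ₁ ρ₂ : ℝ} (hA : ContDiffOn ℝ ∞ A (annulus ρ₁ ρ₂)) {C : ℝ}
    (hC : ∀ x ∈ annulus ρ₁ ρ₂, ‖A x‖ ≤ C) {U F V K : ℝ × ℝ → Spinor}
    (H : PauliRel ρ₁ ρ₂ h A U F) (H' : PauliRel ρ₁ ρ₂ h A V K)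
    (hF : MemLp F 2 (volume.restrict (annulus ρ₁ ρ₂)))
    (hK : MemLp K 2 (volume.restrict (annulus ρ₁ ρ₂))) :
    ∫ x in annulus ρ₁ ρ₂, inner ℂ (F x) (V x) = ∫ x in annulus ρ₁ ρ₂, inner ℂ (U x) (K x) := by
  have hΩ := isOpen_annulus ρ₁ ρ₂
  obtain ⟨a1, a2, w, a3, a4⟩ := H
  obtain ⟨b1, b2, y, b3, b4⟩ := H'
  obtain ⟨G₁, G₂, -, hG, -⟩ := a1.exists_hasGrad
  obtain ⟨G₁', G₂', -, hG', -⟩ := b1.exists_hasGrad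
  have e1 := a4.integral_inner hΩ hA hC (a3.memLp hΩ hA hC hG) hF b2 hG' b3
  have e2 := b4.integral_inner hΩ hA hC (b3.memLp hΩ hA hC hG') hK a2 hG a3
  have e3 := congrArg (starRingEnd ℂ) e2
  rw [← integral_conj, ← integral_conj] at e3
  simp only [inner_conj_symm] at e3
  rw [e1, e3]

end Symmetry

section Fibers

variable {ρ₁ ρ₂ h : ℝ} {a b : ℝ → ℝ} {A : ℝ × ℝ → ℝ × ℝ} {m : ℤ}

/-- The fibered operator, written with the profile `a` of the angular field. -/
def FiberExprRel (ρ₁ ρ₂ h : ℝ) (a b : ℝ → ℝ) (m : ℤ) (u f : ℝ → Spinor) : Prop :=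
  MemH10 (Set.Ioo ρ₁ ρ₂) u ∧ ∃ u₁ u₂ : ℝ → Spinor,
    MemLp u₁ 2 (volume.restrict (Set.Ioo ρ₁ ρ₂)) ∧ MemLp u₂ 2 (volume.restrict (Set.Ioo ρ₁ ρ₂)) ∧
      HasWeakDeriv (Set.Ioo ρ₁ ρ₂) (1 : ℝ) u u₁ ∧ HasWeakDeriv (Set.Ioo ρ₁ ρ₂) (1 : ℝ) u₁ u₂ ∧
      f =ᵐ[volume.restrict (Set.Ioo ρ₁ ρ₂)] fiberExpr h a b m u u₂

theorem FiberExprRel.memH2 {u f : ℝ → Spinor} (H : FiberExprRel ρ₁ ρ₂ h a b m u f) :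
    MemH2 (Set.Ioo ρ₁ ρ₂) u := by
  obtain ⟨h0, u₁, u₂, l1, l2, w1, w2, -⟩ := H
  exact memH2_interval h0.1 l1 l2 w1 w2

/-- The fibered operator only depends on `γ` and `φ` through the profile `a = ∂_rφ + h γ / r`. -/
theorem fiberRel_iff {γ : ℝ} {B φ : ℝ × ℝ → ℝ}
    (hφ : ∀ r ∈ Set.Ioo ρ₁ ρ₂, radialDeriv ρ₁ ρ₂ φ r = a r - h * γ / r)
    (hB : ∀ r ∈ Set.Ioo ρ₁ ρ₂, B (r, 0) = b r) {u f : ℝ → Spinor} :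
    FiberRel ρ₁ ρ₂ h γ B φ m u f ↔ FiberExprRel ρ₁ ρ₂ h a b m u f := by
  have key : ∀ u u₂ : ℝ → Spinor, (fun r =>
        (-((h ^ 2 : ℝ) : ℂ)) • (u₂ r + ((1 / (4 * r ^ 2) : ℝ) : ℂ) • u r) +
        (((h * (((m : ℝ) - γ) / r) - radialDeriv ρ₁ ρ₂ φ r) ^ 2 : ℝ) : ℂ) • u r -
        ((h * B (r, 0) : ℝ) : ℂ) • spinMul σ₃ (u r)) =ᵐ[volume.restrict (Set.Ioo ρ₁ ρ₂)]
        fiberExpr h a b m u u₂ := fun u u₂ => by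
    filter_upwards [ae_restrict_mem measurableSet_Ioo] with r hr
    have e : h * (((m : ℝ) - γ) / r) - (a r - h * γ / r) = h * (m / r) - a r := by ring
    simp only [fiberExpr, hφ r hr, hB r hr, e]
  constructor
  · rintro ⟨h2, h0, u₁, u₂, w1, w2, hf⟩
    obtain ⟨v₁, v₂, l1, l2, y1, y2⟩ := h2.exists_interval
    have e1 := w1.ae_eq isOpen_Ioo y1
    have e2 := (w2.congr e1.symm).ae_eq isOpen_Ioo y2
    exact ⟨h0, u₁, u₂, (memLp_congr_ae e1).2 l1, (memLp_congr_ae e2).2 l2, w1, w2,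
      hf.trans (key u u₂)⟩
  · intro H
    have h2 := H.memH2
    obtain ⟨h0, u₁, u₂, l1, l2, w1, w2, hf⟩ := H
    exact ⟨h2, h0, u₁, u₂, w1, w2, hf.trans (key u u₂).symm⟩

theorem continuousOn_fiber_potential (ha : RadialField ρ₁ ρ₂ a b) (hρ₁ : 0 < ρ₁) (m : ℤ) :
    ContinuousOn (fun r => (h * (m / r) - a r) ^ 2) (Set.Icc ρ₁ ρ₂) :=
  (((continuousOn_const.div continuousOn_id fun _ hr =>
    (hρ₁.trans_le hr.1).ne').const_mul h).sub ha.cont).pow 2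

theorem continuousOn_hardy (hρ₁ : 0 < ρ₁) :
    ContinuousOn (fun r : ℝ => 1 / (4 * r ^ 2)) (Set.Icc ρ₁ ρ₂) :=
  continuousOn_const.div (by fun_prop) fun r hr => by
    have := hρ₁.trans_le hr.1
    positivity

theorem memLp_fiberExpr (ha : RadialField ρ₁ ρ₂ a b) (hρ₁ : 0 < ρ₁) (m : ℤ) {u u₂ : ℝ → Spinor}
    (hu : MemLp u 2 (volume.restrict (Set.Ioo ρ₁ ρ₂)))
    (hu₂ : MemLp u₂ 2 (volume.restrict (Set.Ioo ρ₁ ρ₂))) :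
    MemLp (fiberExpr h a b m u u₂) 2 (volume.restrict (Set.Ioo ρ₁ ρ₂)) := by
  have h1 := memLp_continuousOn_smul (c := fun r => 1 / (4 * r ^ 2)) (continuousOn_hardy hρ₁) hu
  have h2 := memLp_continuousOn_smul (c := fun r => (h * (m / r) - a r) ^ 2)
    (continuousOn_fiber_potential ha hρ₁ m) hu
  have h3 := memLp_continuousOn_smul (c := fun r => h * b r) (ha.cont_rot.const_mul h)
    (memLp_spin hu σ₃)
  have h4 := (hu₂.add h1).const_smul (-((h ^ 2 : ℝ) : ℂ))
  exact (h4.add h2).sub h3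

/-- A mode of a function of the domain of the fibered operator is in the domain of the Pauli
operator. -/
theorem FiberExprRel.pauliRel (hρ₁ : 0 < ρ₁) (hρ : ρ₁ < ρ₂) (hA : IsAngularField ρ₁ ρ₂ A a)
    (ha : RadialField ρ₁ ρ₂ a b) {u f : ℝ → Spinor} (H : FiberExprRel ρ₁ ρ₂ h a b m u f) :
    PauliRel ρ₁ ρ₂ h A (modeFun m u) (modeFun m f) := by
  have h2 := H.memH2
  obtain ⟨h0, u₁, u₂, l1, l2, w1, w2, hf⟩ := H
  obtain ⟨w, d1, d2⟩ := hasDirac_sq_modeFun (h := h) hρ₁ hρ hA ha m h0.1 l1 l2 w1 w2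
  exact ⟨memH2_modeFun hρ₁ hρ m h2, memH10_modeFun hρ₁ hρ m h0, w, d1,
    d2.congr (ae_eq_refl _) (modeFun_congr hρ₁ hρ m hf)⟩

theorem IsTestFunction.memH10 {E : Type*} [NormedAddCommGroup E] [NormedSpace ℝ E] [MeasureSpace E]
    [BorelSpace E] [FiniteDimensional ℝ E] [(volume : Measure E).IsAddHaarMeasure] {S : Set E}
    {v : E → Spinor} (hv : IsTestFunction S v) : MemH10 S v :=
  ⟨hv.memLp, fun _ => v, fun _ => hv, by simp, fun d =>
    ⟨_, (hv.fderiv_apply d).memLp, by simp⟩⟩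

theorem IsTestFunction.fiberExprRel {v : ℝ → Spinor} (hv : IsTestFunction (Set.Ioo ρ₁ ρ₂) v) :
    ∃ v₂, MemLp v₂ 2 (volume.restrict (Set.Ioo ρ₁ ρ₂)) ∧
      FiberExprRel ρ₁ ρ₂ h a b m v (fiberExpr h a b m v v₂) :=
  ⟨_, ((hv.fderiv_apply 1).fderiv_apply 1).memLp, hv.memH10, _, _, (hv.fderiv_apply 1).memLp,
    ((hv.fderiv_apply 1).fderiv_apply 1).memLp, hv.hasWeakDeriv isOpen_Ioo 1,
    (hv.fderiv_apply 1).hasWeakDeriv isOpen_Ioo 1, ae_eq_refl _⟩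

/-- Functions of `L²` are determined by their pairings with the test functions. -/
theorem ae_eq_of_inner_test {S : Set ℝ} (hS : IsOpen S) {f g : ℝ → Spinor}
    (hf : MemLp f 2 (volume.restrict S)) (hg : MemLp g 2 (volume.restrict S))
    (H : ∀ v, IsTestFunction S v →
      ∫ r in S, inner ℂ (v r) (f r) = ∫ r in S, inner ℂ (v r) (g r)) :
    f =ᵐ[volume.restrict S] g := by
  have hfg := hf.sub hg
  obtain ⟨η, t, t0⟩ := exists_tendsto_test hS hfg
  have L := tendsto_integral_inner ℂ hfg (fun n => (t n).memLp) hfg t0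
  have z : ∀ n, ∫ r in S, inner ℂ ((f - g) r) (η n r) = 0 := fun n => by
    have e := H (η n) (t n)
    rw [← sub_eq_zero, ← integral_sub (integrable_inner_memLp (t n).memLp hf)
      (integrable_inner_memLp (t n).memLp hg)] at e
    have := congrArg (starRingEnd ℂ) e
    rw [← integral_conj, map_zero] at this
    rw [← this]
    congr 1
    funext r
    rw [← inner_sub_right, inner_conj_symm]
    rfl
  have key := tendsto_nhds_unique L (tendsto_const_nhds.congr fun n => (z n).symm)
  have h0 : inner ℂ (hfg.toLp _) (hfg.toLp _) = 0 := by
    rw [L2.inner_def, ← key]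
    refine integral_congr_ae ?_
    filter_upwards [hfg.coeFn_toLp] with r hr
    rw [hr]
  have h1 := (hfg.toLp_eq_toLp_iff MemLp.zero').1
    ((inner_self_eq_zero.1 h0).trans (MemLp.toLp_zero (MemLp.zero')).symm)
  filter_upwards [h1] with r hr
  exact sub_eq_zero.1 hr

/-- The coefficients of a function of the domain of the Pauli operator are in the domain of the
fibered operators. Both sides are compared after pairing with the modes of test functions, where
the symmetry of the Pauli operator moves it onto the test mode. -/
theorem PauliRel.fiberExprRel (hρ₁ : 0 < ρ₁) (hρ : ρ₁ < ρ₂) (hA : IsAngularField ρ₁ ρ₂ A a)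
    (ha : RadialField ρ₁ ρ₂ a b) (hAs : ContDiffOn ℝ ∞ A (annulus ρ₁ ρ₂)) {C : ℝ}
    (hC : ∀ x ∈ annulus ρ₁ ρ₂, ‖A x‖ ≤ C) {U F : ℝ × ℝ → Spinor} {u f : ℝ → Spinor}
    (H : PauliRel ρ₁ ρ₂ h A U F) (hF : MemLp F 2 (volume.restrict (annulus ρ₁ ρ₂)))
    (hu : HasCoef ρ₁ ρ₂ m U u) (hf : HasCoef ρ₁ ρ₂ m F f) : FiberExprRel ρ₁ ρ₂ h a b m u f := by
  obtain ⟨G₁, G₂, -, hG, -⟩ := H.1.exists_hasGrad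
  have h10 := hu.memH10 hρ₁ hρ hG H.2.1
  obtain ⟨u₁, u₂, l1, l2, w1, w2⟩ := (hu.memH2 hρ₁ hρ H.1).exists_interval
  have lf := memLp_fiberExpr (h := h) ha hρ₁ m hu.1 l2
  have hrel : FiberExprRel ρ₁ ρ₂ h a b m u (fiberExpr h a b m u u₂) :=
    ⟨h10, u₁, u₂, l1, l2, w1, w2, ae_eq_refl _⟩
  refine ⟨h10, u₁, u₂, l1, l2, w1, w2, ae_eq_of_inner_test isOpen_Ioo hf.1 lf fun v hv => ?_⟩
  obtain ⟨v₂, lv, rv⟩ := hv.fiberExprRel (h := h) (a := a) (b := b) (m := m)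
  have lg := memLp_fiberExpr (h := h) ha hρ₁ m hv.memLp lv
  have s1 := (rv.pauliRel hρ₁ hρ hA ha).integral_inner hAs hC H
    (memLp_modeFun hρ₁ hρ m lg) hF
  have s2 := (rv.pauliRel hρ₁ hρ hA ha).integral_inner hAs hC (hrel.pauliRel hρ₁ hρ hA ha)
    (memLp_modeFun hρ₁ hρ m lg) (memLp_modeFun hρ₁ hρ m lf)
  have coef : ∀ {k : ℝ → Spinor}, MemLp k 2 (volume.restrict (Set.Ioo ρ₁ ρ₂)) →
      HasCoef ρ₁ ρ₂ m (modeFun m k) k := fun {k} hk => by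
    refine ⟨hk, fun v hv => ?_⟩
    have := inner_modeMap hρ₁ hρ m (hv.toLp v) (modeMap hρ₁ hρ m (hk.toLp k))
    rw [LinearIsometry.inner_map_map, L2.inner_def] at this
    refine Eq.trans ?_ (this.symm.trans ?_)
    · refine integral_congr_ae ?_
      filter_upwards [modeFun_congr hρ₁ hρ m hv.coeFn_toLp,
        coeFn_modeMap hρ₁ hρ m (hk.toLp k), modeFun_congr hρ₁ hρ m hk.coeFn_toLp] with x e1 e2 e3
      rw [e1, e2, e3]
    · refine integral_congr_ae ?_
      filter_upwards [hv.coeFn_toLp, hk.coeFn_toLp] with r e1 e2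
      rw [e1, e2]
  rw [hu.2 _ lg, hf.2 _ hv.memLp] at s1
  rw [(coef hu.1).2 _ lg, (coef lf).2 _ hv.memLp] at s2
  rw [← s1, s2]

end Fibers

/-! ### Bounded smooth multipliers, and the Pauli operator on `H²` -/

section Multipliers

variable {Ω : Set (ℝ × ℝ)} {F G : Type*} [NormedAddCommGroup F] [NormedSpace ℝ F]
  [NormedAddCommGroup G] [NormedSpace ℝ G]

/-- A smooth function on `Ω` which is bounded together with its differential. -/
structure BoundedSmooth (Ω : Set (ℝ × ℝ)) (f : ℝ × ℝ → F) : Prop where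
  smooth : ContDiffOn ℝ ∞ f Ω
  bdd : ∃ C, ∀ x ∈ Ω, ‖f x‖ ≤ C
  bdd_fderiv : ∃ C, ∀ x ∈ Ω, ‖fderiv ℝ f x‖ ≤ C

theorem BoundedSmooth.differentiableAt {f : ℝ × ℝ → F} (hf : BoundedSmooth Ω f) (hΩ : IsOpen Ω)
    {x : ℝ × ℝ} (hx : x ∈ Ω) : DifferentiableAt ℝ f x :=
  (hf.smooth.contDiffAt (hΩ.mem_nhds hx)).differentiableAt (by simp)

theorem BoundedSmooth.clm {f : ℝ × ℝ → F} (hf : BoundedSmooth Ω f) (hΩ : IsOpen Ω) (L : F →L[ℝ] G) :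
    BoundedSmooth Ω fun x => L (f x) := by
  obtain ⟨C, hC⟩ := hf.bdd
  obtain ⟨C', hC'⟩ := hf.bdd_fderiv
  refine ⟨L.contDiff.comp_contDiffOn hf.smooth, ⟨‖L‖ * C, fun x hx => ?_⟩, ?_⟩
  · exact (L.le_opNorm _).trans (by gcongr; exact hC x hx)
  · refine ⟨‖L‖ * C', fun x hx => ?_⟩
    have e : fderiv ℝ (fun x => L (f x)) x = L.comp (fderiv ℝ f x) :=
      HasFDerivAt.fderiv (L.hasFDerivAt.comp x (hf.differentiableAt hΩ hx).hasFDerivAt)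
    rw [e]
    exact (ContinuousLinearMap.opNorm_comp_le _ _).trans (by gcongr; exact hC' x hx)

theorem HasWeakDeriv.smooth_smul_complex (hΩ : IsOpen Ω) {E : ℝ × ℝ → ℂ} (hE : ContDiffOn ℝ ∞ E Ω)
    {v : ℝ × ℝ} {u g : ℝ × ℝ → Spinor} (h : HasWeakDeriv Ω v u g) :
    HasWeakDeriv Ω v (fun x => E x • u x) (fun x => fderiv ℝ E x v • u x + E x • g x) := by
  have h1 := h.smooth_smul hΩ (a := fun x => (E x).re) (Complex.reCLM.contDiff.comp_contDiffOn hE)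
  have h2 := h.smooth_smul hΩ (a := fun x => (E x).im) (Complex.imCLM.contDiff.comp_contDiffOn hE)
  refine (h1.add (h2.smul Complex.I)).congr₂ (Eventually.of_forall fun x => ?_) ?_
  · dsimp only
    conv_lhs => rw [← Complex.re_add_im (E x)]
    rw [← Complex.coe_smul, ← Complex.coe_smul]
    module
  · filter_upwards [ae_restrict_mem hΩ.measurableSet] with x hx
    have hd : HasFDerivAt E (fderiv ℝ E x) x :=
      ((hE.contDiffAt (hΩ.mem_nhds hx)).differentiableAt (by simp)).hasFDerivAt
    have e1 : fderiv ℝ (fun x => (E x).re) x = Complex.reCLM.comp (fderiv ℝ E x) :=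
      HasFDerivAt.fderiv (Complex.reCLM.hasFDerivAt.comp x hd)
    have e2 : fderiv ℝ (fun x => (E x).im) x = Complex.imCLM.comp (fderiv ℝ E x) :=
      HasFDerivAt.fderiv (Complex.imCLM.hasFDerivAt.comp x hd)
    rw [e1, e2]
    simp only [ContinuousLinearMap.comp_apply, Complex.reCLM_apply, Complex.imCLM_apply]
    conv_lhs => rw [← Complex.re_add_im (E x), ← Complex.re_add_im (fderiv ℝ E x v)]
    simp only [← Complex.coe_smul]
    module

theorem memLp_bounded_smul (hΩ : IsOpen Ω) {E : ℝ × ℝ → ℂ} (hE : ContinuousOn E Ω) {C : ℝ}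
    (hC : ∀ x ∈ Ω, ‖E x‖ ≤ C) {W : ℝ × ℝ → Spinor} (hW : MemLp W 2 (volume.restrict Ω)) :
    MemLp (fun x => E x • W x) 2 (volume.restrict Ω) := by
  refine memLp_bdd_smul (C := C) hW (hE.aestronglyMeasurable hΩ.measurableSet) ?_
  filter_upwards [ae_restrict_mem hΩ.measurableSet] with x hx
  exact hC x hx

variable {U G₁ G₂ : ℝ × ℝ → Spinor}

theorem BoundedSmooth.memLp_fderiv_smul (hΩ : IsOpen Ω) {E : ℝ × ℝ → ℂ} (hE : BoundedSmooth Ω E)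
    (v : ℝ × ℝ) {W : ℝ × ℝ → Spinor} (hW : MemLp W 2 (volume.restrict Ω)) :
    MemLp (fun x => fderiv ℝ E x v • W x) 2 (volume.restrict Ω) := by
  obtain ⟨C, hC⟩ := hE.bdd_fderiv
  refine memLp_bounded_smul (C := C * ‖v‖) hΩ
    ((hE.smooth.continuousOn_fderiv_of_isOpen hΩ (by simp)).clm_apply continuousOn_const)
    (fun x hx => ?_) hW
  exact (ContinuousLinearMap.le_opNorm _ _).trans (by gcongr; exact hC x hx)

theorem BoundedSmooth.memLp_smul (hΩ : IsOpen Ω) {E : ℝ × ℝ → ℂ} (hE : BoundedSmooth Ω E)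
    {W : ℝ × ℝ → Spinor} (hW : MemLp W 2 (volume.restrict Ω)) :
    MemLp (fun x => E x • W x) 2 (volume.restrict Ω) := by
  obtain ⟨C, hC⟩ := hE.bdd
  exact memLp_bounded_smul hΩ hE.smooth.continuousOn hC hW

theorem HasGrad.bounded_smul (hΩ : IsOpen Ω) {E : ℝ × ℝ → ℂ} (hE : BoundedSmooth Ω E)
    (h : HasGrad Ω U G₁ G₂) : HasGrad Ω (fun x => E x • U x)
      (fun x => fderiv ℝ E x (1, 0) • U x + E x • G₁ x)
      (fun x => fderiv ℝ E x (0, 1) • U x + E x • G₂ x) :=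
  ⟨hE.memLp_smul hΩ h.1, (hE.memLp_fderiv_smul hΩ _ h.1).add (hE.memLp_smul hΩ h.2),
    (hE.memLp_fderiv_smul hΩ _ h.1).add (hE.memLp_smul hΩ h.3),
    h.4.smooth_smul_complex hΩ hE.smooth, h.5.smooth_smul_complex hΩ hE.smooth⟩

theorem HasGrad.spin (h : HasGrad Ω U G₁ G₂) (M : Matrix (Fin 2) (Fin 2) ℂ) :
    HasGrad Ω (fun x => spinMul M (U x)) (fun x => spinMul M (G₁ x)) (fun x => spinMul M (G₂ x)) :=
  ⟨memLp_spin h.1 M, memLp_spin h.2 M, memLp_spin h.3 M, h.4.clm (spinL M), h.5.clm (spinL M)⟩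

variable {h : ℝ} {A : ℝ × ℝ → ℝ × ℝ}

theorem BoundedSmooth.fst (hA : BoundedSmooth Ω A) (hΩ : IsOpen Ω) :
    BoundedSmooth Ω fun x => ((A x).1 : ℂ) :=
  hA.clm hΩ (Complex.ofRealCLM.comp (ContinuousLinearMap.fst ℝ ℝ ℝ))

theorem BoundedSmooth.snd (hA : BoundedSmooth Ω A) (hΩ : IsOpen Ω) :
    BoundedSmooth Ω fun x => ((A x).2 : ℂ) :=
  hA.clm hΩ (Complex.ofRealCLM.comp (ContinuousLinearMap.snd ℝ ℝ ℝ))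

/-- The Dirac operator maps `H²` to `H¹`. -/
theorem MemH2.exists_hasDirac (hΩ : IsOpen Ω) (hA : BoundedSmooth Ω A) (hU : MemH2 Ω U) :
    ∃ w W₁ W₂, HasDirac Ω h A U w ∧ HasGrad Ω w W₁ W₂ := by
  obtain ⟨G₁, G₂, K, hG, hG₁, hG₂⟩ := hU.exists_hasGrad
  exact ⟨_, _, _, ⟨G₁, G₂, hG.4, hG.5, ae_eq_refl _⟩,
    HasGrad.congr (((((hG₁.smul (-Complex.I * h)).add ((hG.bounded_smul hΩ (hA.fst hΩ)).smul
      (-1))).spin σ₁)).add ((((hG₂.smul (-Complex.I * h)).add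
      ((hG.bounded_smul hΩ (hA.snd hΩ)).smul (-1))).spin σ₂)))
      (Eventually.of_forall fun x => by simp only [sub_eq_add_neg, neg_one_smul])
      (ae_eq_refl _) (ae_eq_refl _)⟩

/-- The Pauli operator is defined, as an element of `L²`, on the whole of `H² ∩ H¹₀`. -/
theorem exists_pauliRel {ρ₁ ρ₂ : ℝ} (hA : BoundedSmooth (annulus ρ₁ ρ₂) A)
    (hU : MemH2 (annulus ρ₁ ρ₂) U) (hU0 : MemH10 (annulus ρ₁ ρ₂) U) :
    ∃ F, MemLp F 2 (volume.restrict (annulus ρ₁ ρ₂)) ∧ PauliRel ρ₁ ρ₂ h A U F := by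
  have hΩ := isOpen_annulus ρ₁ ρ₂
  obtain ⟨w, W₁, W₂, hw, hG⟩ := hU.exists_hasDirac (h := h) hΩ hA
  obtain ⟨C, hC⟩ := hA.bdd
  have hF : HasDirac (annulus ρ₁ ρ₂) h A w _ := ⟨W₁, W₂, hG.4, hG.5, ae_eq_refl _⟩
  exact ⟨_, hF.memLp hΩ hA.smooth hC hG, hU, hU0, w, hw, hF⟩

end Multipliers

/-! ### Energy estimates on the fibers -/

section Energy

variable {ρ₁ ρ₂ h : ℝ} {a b : ℝ → ℝ}

local notation "L2I" => Lp Spinor 2 (volume.restrict (Set.Ioo ρ₁ ρ₂))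

/-- Integration by parts: `⟨u, u''⟩ = -‖u'‖²` for `u ∈ H² ∩ H¹₀`. -/
theorem inner_weakDeriv_two {u u' u'' : L2I} (h0 : MemH10 (Set.Ioo ρ₁ ρ₂) u)
    (h1 : HasWeakDeriv (Set.Ioo ρ₁ ρ₂) (1 : ℝ) u u')
    (h2 : HasWeakDeriv (Set.Ioo ρ₁ ρ₂) (1 : ℝ) u' u'') :
    (inner ℂ u'' u : ℂ) = -((‖u'‖ ^ 2 : ℝ) : ℂ) := by
  obtain ⟨η, t, t0, tg⟩ := h0.exists_seq isOpen_Ioo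
  have T0 := tendsto_integral_inner ℂ (Lp.memLp u'') (fun n => (t n).memLp) (Lp.memLp u) t0
  have T1 := (tendsto_integral_inner ℂ (Lp.memLp u') (fun n => ((t n).fderiv_apply 1).memLp)
    (Lp.memLp u') (tg 1 _ h1).2).neg
  have key := tendsto_nhds_unique T0 (T1.congr fun n => by
    have := congrArg (starRingEnd ℂ) (h2.inner_test (t n))
    rw [map_neg, ← integral_conj, ← integral_conj] at this
    simp only [inner_conj_symm] at this
    rw [this, neg_neg])
  rw [L2.inner_def, key, ← L2.inner_def, inner_self_eq_norm_sq_to_K]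
  simp

/-- The terms of order zero of the fibered operator. -/
def fiberPot (h : ℝ) (a b : ℝ → ℝ) (m : ℤ) (r : ℝ) (s : Spinor) : Spinor :=
  ((-(h ^ 2) * (1 / (4 * r ^ 2)) + (h * (m / r) - a r) ^ 2 : ℝ) : ℂ) • s -
    ((h * b r : ℝ) : ℂ) • spinMul σ₃ s

theorem fiberExpr_eq (m : ℤ) (v v'' : ℝ → Spinor) (r : ℝ) :
    fiberExpr h a b m v v'' r = (-((h ^ 2 : ℝ) : ℂ)) • v'' r + fiberPot h a b m r (v r) := by
  simp only [fiberExpr, fiberPot]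
  push_cast
  module

/-- The centrifugal term `(h m / r - a)²` dominates the terms of order zero for large `m`: they are
coercive, and bounded, at the order `m²`. -/
theorem exists_fiberPot_bounds (hρ₁ : 0 < ρ₁) (hρ : ρ₁ < ρ₂) (hh : 0 < h)
    (ha : RadialField ρ₁ ρ₂ a b) : ∃ c C : ℝ, 0 < c ∧ 0 ≤ C ∧
      ∀ (m : ℤ), ∀ r ∈ Set.Ioo ρ₁ ρ₂, ∀ s : Spinor,
        (c * wt m ^ 2 - C) * ‖s‖ ^ 2 ≤ (inner ℂ (fiberPot h a b m r s) s : ℂ).re ∧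
        ‖fiberPot h a b m r s‖ ≤ C * wt m ^ 2 * ‖s‖ := by
  have hρ₂ := hρ₁.trans hρ
  obtain ⟨Ma, hMa⟩ := isCompact_Icc.exists_bound_of_continuousOn ha.cont
  obtain ⟨Mb, hMb⟩ := isCompact_Icc.exists_bound_of_continuousOn ha.cont_rot
  have a0 : 0 ≤ Ma := (norm_nonneg _).trans (hMa ρ₁ ⟨le_rfl, hρ.le⟩)
  have b0 : 0 ≤ Mb := (norm_nonneg _).trans (hMb ρ₁ ⟨le_rfl, hρ.le⟩)
  set S := ‖spinL σ₃‖
  have S0 : 0 ≤ S := norm_nonneg _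
  set D := h ^ 2 / (4 * ρ₁ ^ 2) + h * Mb * S with hD
  have D0 : 0 ≤ D := by positivity
  refine ⟨h ^ 2 / (4 * ρ₂ ^ 2), D + Ma ^ 2 + h ^ 2 / (2 * ρ₂ ^ 2) + 2 * h ^ 2 / ρ₁ ^ 2 + 2 * Ma ^ 2,
    by positivity, by positivity, fun m r hr s => ?_⟩
  have r0 : 0 < r := hρ₁.trans hr.1
  have har : a r ^ 2 ≤ Ma ^ 2 := sq_le_sq' (by
    have := neg_le_of_abs_le (hMa r ⟨hr.1.le, hr.2.le⟩); linarith)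
    (le_of_abs_le (hMa r ⟨hr.1.le, hr.2.le⟩))
  have hbr : |b r| ≤ Mb := hMb r ⟨hr.1.le, hr.2.le⟩
  have hs3 : ‖spinMul σ₃ s‖ ≤ S * ‖s‖ := (spinL σ₃).le_opNorm s
  have w1 : 1 ≤ wt m := one_le_wt m
  have w2 : wt m ^ 2 ≤ 2 + 2 * (m : ℝ) ^ 2 := by
    rw [wt, ← sq_abs (m : ℝ)]
    nlinarith [sq_nonneg (|(m : ℝ)| - 1)]
  have w3 : (m : ℝ) ^ 2 ≤ wt m ^ 2 := by
    rw [wt, ← sq_abs (m : ℝ)]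
    nlinarith [abs_nonneg (m : ℝ)]
  have k1 : h ^ 2 * (1 / (4 * r ^ 2)) ≤ h ^ 2 / (4 * ρ₁ ^ 2) := by
    rw [mul_one_div]
    gcongr
    exact hr.1.le
  have k10 : 0 ≤ h ^ 2 * (1 / (4 * r ^ 2)) := by positivity
  have k2 : (m : ℝ) ^ 2 / ρ₂ ^ 2 ≤ (m / r) ^ 2 := by
    rw [div_pow]
    gcongr
    exact hr.2.le
  have k3 : (m / r : ℝ) ^ 2 ≤ (m : ℝ) ^ 2 / ρ₁ ^ 2 := by
    rw [div_pow]
    gcongr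
    exact hr.1.le
  set q := (h * (m / r) - a r) ^ 2 with hq
  have q0 : 0 ≤ q := sq_nonneg _
  have q1 : h ^ 2 / 2 * (m / r) ^ 2 - a r ^ 2 ≤ q := by
    rw [hq]; nlinarith [sq_nonneg (h * (m / r) - 2 * a r)]
  have q2 : q ≤ 2 * h ^ 2 * (m / r) ^ 2 + 2 * a r ^ 2 := by
    rw [hq]; nlinarith [sq_nonneg (h * (m / r) + a r)]
  have hB : ‖((h * b r : ℝ) : ℂ)‖ ≤ h * Mb := by
    rw [Complex.norm_real, Real.norm_eq_abs, abs_mul, abs_of_pos hh]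
    gcongr
  have hBs : ‖((h * b r : ℝ) : ℂ) • spinMul σ₃ s‖ ≤ h * Mb * S * ‖s‖ := by
    rw [norm_smul, mul_assoc]
    gcongr
  constructor
  · have e : (inner ℂ (fiberPot h a b m r s) s : ℂ).re =
        (-(h ^ 2) * (1 / (4 * r ^ 2)) + q) * ‖s‖ ^ 2 -
          (inner ℂ (((h * b r : ℝ) : ℂ) • spinMul σ₃ s) s : ℂ).re := by
      rw [fiberPot, inner_sub_left, inner_smul_left, Complex.conj_ofReal, Complex.sub_re,
        Complex.re_ofReal_mul]
      congr 2
      exact inner_self_eq_norm_sq (𝕜 := ℂ) s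
    have i1 : (inner ℂ (((h * b r : ℝ) : ℂ) • spinMul σ₃ s) s : ℂ).re ≤ h * Mb * S * ‖s‖ ^ 2 := by
      refine (Complex.re_le_norm _).trans ((norm_inner_le_norm _ _).trans ?_)
      calc _ ≤ h * Mb * S * ‖s‖ * ‖s‖ := by gcongr
        _ = _ := by ring
    rw [e]
    have i2 : h ^ 2 / (4 * ρ₂ ^ 2) * wt m ^ 2 - (D + Ma ^ 2 + h ^ 2 / (2 * ρ₂ ^ 2)) ≤
        -(h ^ 2) * (1 / (4 * r ^ 2)) + q - h * Mb * S := by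
      have : h ^ 2 / (4 * ρ₂ ^ 2) * wt m ^ 2 ≤
          h ^ 2 / (2 * ρ₂ ^ 2) + h ^ 2 / 2 * ((m : ℝ) ^ 2 / ρ₂ ^ 2) := by
        calc _ ≤ h ^ 2 / (4 * ρ₂ ^ 2) * (2 + 2 * (m : ℝ) ^ 2) := by gcongr
          _ = _ := by field_simp; ring
      have : h ^ 2 / 2 * ((m : ℝ) ^ 2 / ρ₂ ^ 2) ≤ h ^ 2 / 2 * (m / r) ^ 2 := by gcongr
      linarith
    have i3 : 0 ≤ 2 * h ^ 2 / ρ₁ ^ 2 + 2 * Ma ^ 2 := by positivity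
    calc _ ≤ (-(h ^ 2) * (1 / (4 * r ^ 2)) + q - h * Mb * S) * ‖s‖ ^ 2 :=
          mul_le_mul_of_nonneg_right (by linarith) (sq_nonneg _)
      _ = (-(h ^ 2) * (1 / (4 * r ^ 2)) + q) * ‖s‖ ^ 2 - h * Mb * S * ‖s‖ ^ 2 := by ring
      _ ≤ _ := by linarith
  · have i1 : ‖((-(h ^ 2) * (1 / (4 * r ^ 2)) + q : ℝ) : ℂ) • s‖ ≤
        (h ^ 2 / (4 * ρ₁ ^ 2) + (2 * h ^ 2 / ρ₁ ^ 2 * wt m ^ 2 + 2 * Ma ^ 2)) * ‖s‖ := by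
      rw [norm_smul, Complex.norm_real]
      gcongr
      have : q ≤ 2 * h ^ 2 / ρ₁ ^ 2 * wt m ^ 2 + 2 * Ma ^ 2 := by
        have : 2 * h ^ 2 * (m / r) ^ 2 ≤ 2 * h ^ 2 * (wt m ^ 2 / ρ₁ ^ 2) := by
          gcongr
          exact k3.trans (by gcongr)
        have e : 2 * h ^ 2 * (wt m ^ 2 / ρ₁ ^ 2) = 2 * h ^ 2 / ρ₁ ^ 2 * wt m ^ 2 := by ring
        linarith
      have : 0 ≤ 2 * h ^ 2 / ρ₁ ^ 2 * wt m ^ 2 + 2 * Ma ^ 2 := by positivity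
      rw [Real.norm_eq_abs, abs_le]
      constructor <;> linarith
    refine (norm_sub_le _ _).trans ((add_le_add i1 hBs).trans ?_)
    rw [← add_mul]
    gcongr
    have w4 : 1 ≤ wt m ^ 2 := one_le_pow₀ w1
    have i5 : 0 ≤ Ma ^ 2 + h ^ 2 / (2 * ρ₂ ^ 2) := by positivity
    have i6 : D + 2 * Ma ^ 2 ≤ (D + 2 * Ma ^ 2) * wt m ^ 2 :=
      le_mul_of_one_le_right (by positivity) w4
    have i7 : 0 ≤ (Ma ^ 2 + h ^ 2 / (2 * ρ₂ ^ 2)) * wt m ^ 2 := by positivity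
    calc _ = D + 2 * Ma ^ 2 + 2 * h ^ 2 / ρ₁ ^ 2 * wt m ^ 2 := by rw [hD]; ring
      _ ≤ (D + 2 * Ma ^ 2) * wt m ^ 2 + 2 * h ^ 2 / ρ₁ ^ 2 * wt m ^ 2 +
          (Ma ^ 2 + h ^ 2 / (2 * ρ₂ ^ 2)) * wt m ^ 2 := by linarith
      _ = _ := by ring

end Energy

/-! ### The spectrum of the Pauli operator with an angular potential -/

section Spectrum

variable {ρ₁ ρ₂ h : ℝ} {a b : ℝ → ℝ} {m : ℤ}

local notation "L2I" => Lp Spinor 2 (volume.restrict (Set.Ioo ρ₁ ρ₂))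

theorem FiberExprRel.exists_data {u g : L2I} (H : FiberExprRel ρ₁ ρ₂ h a b m u g) :
    ∃ u' u'' k : L2I, HasWeakDeriv (Set.Ioo ρ₁ ρ₂) (1 : ℝ) u u' ∧
      HasWeakDeriv (Set.Ioo ρ₁ ρ₂) (1 : ℝ) u' u'' ∧ g = (-((h ^ 2 : ℝ) : ℂ)) • u'' + k ∧
      k =ᵐ[volume.restrict (Set.Ioo ρ₁ ρ₂)] fun r => fiberPot h a b m r (u r) := by
  obtain ⟨-, u₁, u₂, l1, l2, w1, w2, hf⟩ := H
  refine ⟨l1.toLp, l2.toLp, g - (-((h ^ 2 : ℝ) : ℂ)) • l2.toLp,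
    w1.congr₂ (ae_eq_refl _) l1.coeFn_toLp, w2.congr₂ l1.coeFn_toLp l2.coeFn_toLp,
    (add_sub_cancel _ _).symm, ?_⟩
  filter_upwards [hf, Lp.coeFn_sub g ((-((h ^ 2 : ℝ) : ℂ)) • l2.toLp),
    Lp.coeFn_smul (-((h ^ 2 : ℝ) : ℂ)) l2.toLp, l2.coeFn_toLp] with r e1 e2 e3 e4
  rw [e2, Pi.sub_apply, e3, Pi.smul_apply, e4, e1, fiberExpr_eq, add_sub_cancel_left]

/-- The energy inequality on the fiber `m`: the kinetic energy controls `u'`, and the centrifugal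
term controls `m² ‖u‖²`. -/
theorem exists_energy_bounds (hρ₁ : 0 < ρ₁) (hρ : ρ₁ < ρ₂) (hh : 0 < h)
    (ha : RadialField ρ₁ ρ₂ a b) : ∃ c C : ℝ, 0 < c ∧ 0 ≤ C ∧
      ∀ (m : ℤ) (u g : L2I), FiberExprRel ρ₁ ρ₂ h a b m u g →
        ∃ u' u'' : L2I, HasWeakDeriv (Set.Ioo ρ₁ ρ₂) (1 : ℝ) u u' ∧
          HasWeakDeriv (Set.Ioo ρ₁ ρ₂) (1 : ℝ) u' u'' ∧
          h ^ 2 * ‖u'‖ ^ 2 + (c * wt m ^ 2 - C) * ‖u‖ ^ 2 ≤ ‖g‖ * ‖u‖ ∧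
          h ^ 2 * ‖u''‖ ≤ C * wt m ^ 2 * ‖u‖ + ‖g‖ := by
  obtain ⟨c, C, c0, C0, hb⟩ := exists_fiberPot_bounds hρ₁ hρ hh ha
  refine ⟨c, C, c0, C0, fun m u g H => ?_⟩
  obtain ⟨u', u'', k, w1, w2, rfl, hk⟩ := H.exists_data
  refine ⟨u', u'', w1, w2, ?_, ?_⟩
  · have i1 : (c * wt m ^ 2 - C) * ‖u‖ ^ 2 ≤ (inner ℂ k u : ℂ).re := by
      have e1 : ‖u‖ ^ 2 = ∫ r in Set.Ioo ρ₁ ρ₂, ‖u r‖ ^ 2 := by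
        have e : ((‖u‖ ^ 2 : ℝ) : ℂ) = ∫ r in Set.Ioo ρ₁ ρ₂, ((‖u r‖ ^ 2 : ℝ) : ℂ) := by
          have := inner_self_eq_norm_sq_to_K (𝕜 := ℂ) u
          rw [L2.inner_def] at this
          rw [Complex.ofReal_pow]
          refine this.symm.trans (integral_congr_ae (Eventually.of_forall fun r => ?_))
          dsimp only
          rw [inner_self_eq_norm_sq_to_K]
          simp
        rw [integral_complex_ofReal] at e
        exact_mod_cast e
      have hi := L2.integrable_inner (𝕜 := ℂ) k u
      have e2 : (inner ℂ k u : ℂ).re = ∫ r in Set.Ioo ρ₁ ρ₂, (inner ℂ (k r) (u r) : ℂ).re := by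
        rw [L2.inner_def]
        exact (integral_re hi).symm
      rw [e1, e2, ← integral_const_mul]
      refine integral_mono_ae (((Lp.memLp u).integrable_norm_pow (by norm_num)).const_mul _)
        hi.re ?_
      filter_upwards [hk, ae_restrict_mem measurableSet_Ioo] with r hr hm
      rw [hr]
      exact (hb m r hm (u r)).1
    have i2 : (inner ℂ ((-((h ^ 2 : ℝ) : ℂ)) • u'' + k) u : ℂ).re =
        h ^ 2 * ‖u'‖ ^ 2 + (inner ℂ k u : ℂ).re := by
      rw [inner_add_left, inner_smul_left, inner_weakDeriv_two H.1 w1 w2, map_neg,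
        Complex.conj_ofReal, neg_mul_neg, ← Complex.ofReal_mul, Complex.add_re, Complex.ofReal_re]
    have i3 := (Complex.re_le_norm _).trans
      (norm_inner_le_norm (𝕜 := ℂ) ((-((h ^ 2 : ℝ) : ℂ)) • u'' + k) u)
    rw [i2] at i3
    linarith
  · have i1 : ‖k‖ ≤ C * wt m ^ 2 * ‖u‖ := by
      refine Lp.norm_le_mul_norm_of_ae_le_mul ?_
      filter_upwards [hk, ae_restrict_mem measurableSet_Ioo] with r hr hm
      rw [hr]
      exact (hb m r hm (u r)).2
    have e : h ^ 2 * ‖u''‖ = ‖k - ((-((h ^ 2 : ℝ) : ℂ)) • u'' + k)‖ := by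
      rw [sub_add_cancel_right, norm_neg, norm_smul, norm_neg, Complex.norm_real,
        Real.norm_of_nonneg (sq_nonneg h)]
    rw [e]
    exact (norm_sub_le _ _).trans (by gcongr)

/-- The energy inequality for large weight `w`, with `n = ‖u‖`, `n' = ‖u'‖`, `Z = |z|` and `f = ‖(P
- z) u‖`: the resolvent gains two powers of the weight. -/
theorem sq_mul_le_of_energy {h c C Z w n n' f : ℝ} (hc : 0 < c) (hn : 0 ≤ n) (hf : 0 ≤ f)
    (e : h ^ 2 * n' ^ 2 + (c * w ^ 2 - C) * n ^ 2 ≤ (f + Z * n) * n)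
    (hw : 2 * (C + Z) ≤ c * w ^ 2) : w ^ 2 * n ≤ 2 / c * f := by
  have i1 : c / 2 * w ^ 2 * n * n ≤ f * n := by
    have j1 := mul_le_mul_of_nonneg_right hw (sq_nonneg n)
    have j2 : 0 ≤ h ^ 2 * n' ^ 2 := by positivity
    linarith
  have i2 : c / 2 * w ^ 2 * n ≤ f := by
    rcases hn.eq_or_lt with h0 | h0
    · rw [← h0, mul_zero]
      exact hf
    · exact le_of_mul_le_mul_right i1 h0
  calc w ^ 2 * n = 2 / c * (c / 2 * w ^ 2 * n) := by field_simp
    _ ≤ 2 / c * f := by gcongr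

/-- The energy inequality bounds the derivative `n' = ‖u'‖`, with a gain of one power of the weight,
once `n = ‖u‖` is bounded with a gain of two powers. -/
theorem mul_le_of_energy {h c C Z K w n n' f : ℝ} (hh : 0 < h) (hc : 0 ≤ c) (hC : 0 ≤ C)
    (hZ : 0 ≤ Z) (hK : 0 ≤ K) (hw : 1 ≤ w) (hn : 0 ≤ n) (hf : 0 ≤ f)
    (e : h ^ 2 * n' ^ 2 + (c * w ^ 2 - C) * n ^ 2 ≤ (f + Z * n) * n) (b : w ^ 2 * n ≤ K * f) :
    w * n' ≤ (1 + (K + (C + Z) * K ^ 2)) / h * f := by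
  have b1 : w * n ≤ K * f := by
    refine le_trans ?_ b
    rw [pow_two, mul_assoc]
    exact le_mul_of_one_le_left (by positivity) hw
  have hM : 0 ≤ K + (C + Z) * K ^ 2 := by positivity
  have b3 : (h * (w * n')) ^ 2 ≤ ((1 + (K + (C + Z) * K ^ 2)) * f) ^ 2 := by
    have j1 : (w * n) ^ 2 ≤ (K * f) ^ 2 := by gcongr
    have j2 : h ^ 2 * n' ^ 2 ≤ f * n + (C + Z) * n ^ 2 := by
      have : 0 ≤ c * w ^ 2 * n ^ 2 := by positivity
      linarith
    calc (h * (w * n')) ^ 2 = w ^ 2 * (h ^ 2 * n' ^ 2) := by ring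
      _ ≤ w ^ 2 * (f * n + (C + Z) * n ^ 2) := by gcongr
      _ = f * (w ^ 2 * n) + (C + Z) * (w * n) ^ 2 := by ring
      _ ≤ f * (K * f) + (C + Z) * (K * f) ^ 2 := by gcongr
      _ = (K + (C + Z) * K ^ 2) * f ^ 2 := by ring
      _ ≤ (1 + (K + (C + Z) * K ^ 2)) ^ 2 * f ^ 2 := by
        gcongr
        nlinarith
      _ = _ := by ring
  have := le_of_abs_le (abs_le_of_sq_le_sq b3 (by positivity))
  rw [div_mul_eq_mul_div, le_div_iff₀ hh]
  linarith

/-- If `z` is in the resolvent sets of all the fibered operators, then the resolvents gain two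
powers of `m`, uniformly. For large `m` this is the energy inequality; each of the other fibers
has a bound of its own. -/
theorem exists_uniform_resolvent_bound (hρ₁ : 0 < ρ₁) (hρ : ρ₁ < ρ₂) (hh : 0 < h)
    (ha : RadialField ρ₁ ρ₂ a b) {z : ℂ}
    (hz : ∀ m : ℤ, ∃ K : ℝ, ∀ u g : L2I, FiberExprRel ρ₁ ρ₂ h a b m u g →
      ‖u‖ ≤ K * ‖g - z • u‖) :
    ∃ K : ℝ, ∀ (m : ℤ) (u g : L2I), FiberExprRel ρ₁ ρ₂ h a b m u g →
      ∃ u' u'' : L2I, HasWeakDeriv (Set.Ioo ρ₁ ρ₂) (1 : ℝ) u u' ∧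
        HasWeakDeriv (Set.Ioo ρ₁ ρ₂) (1 : ℝ) u' u'' ∧ wt m ^ 2 * ‖u‖ ≤ K * ‖g - z • u‖ ∧
        wt m * ‖u'‖ ≤ K * ‖g - z • u‖ ∧ ‖u''‖ ≤ K * ‖g - z • u‖ := by
  obtain ⟨c, C, c0, C0, hb⟩ := exists_energy_bounds hρ₁ hρ hh ha
  choose k hk using hz
  obtain ⟨N, hN⟩ := exists_nat_gt (2 * (C + ‖z‖) / c)
  set s := Finset.Icc (-(N : ℤ)) N
  set K₀ := 2 / c + ∑ m ∈ s, wt m ^ 2 * |k m| with hK₀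
  have hs0 : 0 ≤ ∑ m ∈ s, wt m ^ 2 * |k m| := Finset.sum_nonneg fun m _ => by positivity
  have hK0 : 0 ≤ K₀ := by positivity
  have z0 := norm_nonneg z
  set K₂ := C * K₀ + 1 + ‖z‖ * K₀ with hK₂
  have hK20 : 0 ≤ K₂ := by positivity
  refine ⟨K₀ + (1 + (K₀ + (C + ‖z‖) * K₀ ^ 2)) / h + K₂ / h ^ 2, fun m u g H => ?_⟩
  obtain ⟨u', u'', w1, w2, e1, e2⟩ := hb m u g H
  have f0 := norm_nonneg (g - z • u)
  have n0 := norm_nonneg u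
  have hw := one_le_wt m
  have hg : ‖g‖ ≤ ‖g - z • u‖ + ‖z‖ * ‖u‖ := by
    rw [← norm_smul]
    exact norm_le_norm_sub_add _ _
  set f := ‖g - z • u‖
  have e3 : h ^ 2 * ‖u'‖ ^ 2 + (c * wt m ^ 2 - C) * ‖u‖ ^ 2 ≤ (f + ‖z‖ * ‖u‖) * ‖u‖ :=
    e1.trans (by gcongr)
  have b0 : wt m ^ 2 * ‖u‖ ≤ K₀ * f := by
    by_cases hm : m ∈ s
    · have i1 : wt m ^ 2 * |k m| ≤ K₀ := by
        have := Finset.single_le_sum (f := fun m => wt m ^ 2 * |k m|)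
          (fun m _ => by positivity) hm
        have : 0 ≤ 2 / c := by positivity
        linarith
      calc wt m ^ 2 * ‖u‖ ≤ wt m ^ 2 * (|k m| * f) := by
            gcongr
            exact (hk m u g H).trans (by gcongr; exact le_abs_self _)
        _ = wt m ^ 2 * |k m| * f := by ring
        _ ≤ _ := by gcongr
    · have i1 : 2 * (C + ‖z‖) ≤ c * wt m ^ 2 := by
        have hmN : (N : ℝ) ≤ wt m := by
          have : (N : ℤ) ≤ |m| := by
            by_contra hlt
            exact hm (Finset.mem_Icc.2 (abs_le.1 (by omega)))
          have : (N : ℝ) ≤ |(m : ℝ)| := by exact_mod_cast this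
          rw [wt]
          linarith
        have i2 : 2 * (C + ‖z‖) / c ≤ wt m ^ 2 :=
          (hN.le.trans hmN).trans (le_self_pow₀ hw two_ne_zero)
        rwa [div_le_iff₀' c0] at i2
      refine (sq_mul_le_of_energy c0 n0 f0 e3 i1).trans ?_
      gcongr
      rw [hK₀]
      linarith
  have b2 : ‖u‖ ≤ K₀ * f := (le_mul_of_one_le_left n0 (one_le_pow₀ hw)).trans b0
  have b4 := mul_le_of_energy hh c0.le C0 z0 hK0 hw n0 f0 e3 b0
  have b5 : ‖u''‖ ≤ K₂ / h ^ 2 * f := by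
    rw [div_mul_eq_mul_div, le_div_iff₀ (by positivity)]
    have : C * (wt m ^ 2 * ‖u‖) ≤ C * (K₀ * f) := by gcongr
    have : ‖z‖ * ‖u‖ ≤ ‖z‖ * (K₀ * f) := by gcongr
    rw [hK₂]
    linarith
  have p1 : 0 ≤ (1 + (K₀ + (C + ‖z‖) * K₀ ^ 2)) / h * f := by positivity
  have p2 : 0 ≤ K₂ / h ^ 2 * f := by positivity
  have p0 : 0 ≤ K₀ * f := by positivity
  refine ⟨u', u'', w1, w2, ?_, ?_, ?_⟩ <;> linarith

theorem PauliRel.congr {A : ℝ × ℝ → ℝ × ℝ} {U F V K : ℝ × ℝ → Spinor} (H : PauliRel ρ₁ ρ₂ h A U F)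
    (hV : V =ᵐ[volume.restrict (annulus ρ₁ ρ₂)] U)
    (hK : K =ᵐ[volume.restrict (annulus ρ₁ ρ₂)] F) : PauliRel ρ₁ ρ₂ h A V K := by
  obtain ⟨h2, h0, w, d1, d2⟩ := H
  exact ⟨h2.congr hV, h0.congr hV, w, d1.congr hV (ae_eq_refl _), d2.congr (ae_eq_refl _) hK⟩

/-- For an angular potential, the spectrum of the Pauli operator is the union of the spectra of the
fibered operators. -/
theorem opSpectrum_pauliOp (hρ₁ : 0 < ρ₁) (hρ : ρ₁ < ρ₂) (hh : 0 < h) {A : ℝ × ℝ → ℝ × ℝ}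
    (hA : IsAngularField ρ₁ ρ₂ A a) (ha : RadialField ρ₁ ρ₂ a b)
    (hAs : BoundedSmooth (annulus ρ₁ ρ₂) A) {γ : ℝ} {B φ : ℝ × ℝ → ℝ}
    (hφ : ∀ r ∈ Set.Ioo ρ₁ ρ₂, radialDeriv ρ₁ ρ₂ φ r = a r - h * γ / r)
    (hB : ∀ r ∈ Set.Ioo ρ₁ ρ₂, B (r, 0) = b r) :
    opSpectrum (pauliOp ρ₁ ρ₂ h A) = ⋃ m : ℤ, opSpectrum (fiberOp ρ₁ ρ₂ h γ B φ m) := by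
  obtain ⟨CA, hCA⟩ := hAs.bdd
  have hT := isHilbertSum_modeMap hρ₁ hρ
  have hp : ∀ (m : ℤ) (u f : L2I), (u, f) ∈ (fiberOp ρ₁ ρ₂ h γ B φ m).graph ↔
      FiberExprRel ρ₁ ρ₂ h a b m u f := fun m u f => by
    rw [fiberOp_graph]
    exact fiberRel_iff hφ hB
  have hP : ∀ U F, (U, F) ∈ (pauliOp ρ₁ ρ₂ h A).graph ↔ PauliRel ρ₁ ρ₂ h A U F := fun U F => by
    rw [pauliOp_graph]
    exact Iff.rfl
  have h1 : ∀ (m : ℤ) (u f : L2I), (u, f) ∈ (fiberOp ρ₁ ρ₂ h γ B φ m).graph →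
      (modeMap hρ₁ hρ m u, modeMap hρ₁ hρ m f) ∈ (pauliOp ρ₁ ρ₂ h A).graph := fun m u f H =>
    (hP _ _).2 ((((hp m u f).1 H).pauliRel hρ₁ hρ hA ha).congr (coeFn_modeMap hρ₁ hρ m u)
      (coeFn_modeMap hρ₁ hρ m f))
  have h2 : ∀ (m : ℤ) U F, (U, F) ∈ (pauliOp ρ₁ ρ₂ h A).graph →
      (component (modeMap hρ₁ hρ) m U, component (modeMap hρ₁ hρ) m F) ∈
        (fiberOp ρ₁ ρ₂ h γ B φ m).graph := fun m U F H =>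
    (hp _ _ _).2 (((hP _ _).1 H).fiberExprRel hρ₁ hρ hA ha hAs.smooth hCA (Lp.memLp F)
      (hasCoef_component hρ₁ hρ m U) (hasCoef_component hρ₁ hρ m F))
  simp only [opSpectrum, ← Set.compl_iInter]
  congr 1
  refine Set.Subset.antisymm (Set.subset_iInter fun m =>
    resolventSet_subset_of_reducing h1 h2 m) fun z hz => ?_
  have hz' := fun m => mem_resolventSet_iff.1 (Set.mem_iInter.1 hz m)
  obtain ⟨K, hK⟩ := exists_uniform_resolvent_bound hρ₁ hρ hh ha (z := z) fun m => by
    obtain ⟨C, hC⟩ := (hz' m).2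
    exact ⟨C, fun u g H => hC u g ((hp m u g).2 H)⟩
  have hKu : ∀ m (u g : L2I), (u, g) ∈ (fiberOp ρ₁ ρ₂ h γ B φ m).graph →
      ‖u‖ ≤ K * ‖g - z • u‖ := fun m u g H => by
    obtain ⟨-, -, -, -, e, -⟩ := hK m u g ((hp m u g).1 H)
    exact le_trans (le_mul_of_one_le_left (norm_nonneg _) (one_le_pow₀ (one_le_wt m))) e
  refine mem_resolventSet_of_reducing hT h2 hKu fun F => ?_
  choose u hu using fun m => (hz' m).1 (component (modeMap hρ₁ hρ) m F)
  choose u' u'' w1 w2 e0 e1 e2 using fun m => hK m _ _ ((hp _ _ _).1 (hu m))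
  simp only [add_sub_cancel_right] at e0 e1 e2
  obtain ⟨U, hU, hU2, hU0⟩ := memH2_of_hasSum hρ₁ hρ
    (hasSum_norm_sq_component hT F).summable e0 e1 e2 w1 w2
    (fun m => ((hp _ _ _).1 (hu m)).1)
  obtain ⟨F', hF', hrel⟩ := exists_pauliRel (h := h) hAs hU2 hU0
  have hUF : (U, hF'.toLp) ∈ (pauliOp ρ₁ ρ₂ h A).graph :=
    (hP _ _).2 (hrel.congr (ae_eq_refl _) hF'.coeFn_toLp)
  have e : hF'.toLp = F + z • U := ext_component hT fun m => by
    have k1 := h2 m _ _ hUF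
    have k2 := component_eq_of_hasSum hT hU m
    rw [k2] at k1
    rw [map_add, map_smul, k2]
    exact LinearPMap.mem_graph_snd_inj _ k1 (hu m) rfl
  exact ⟨U, e ▸ hUF⟩

end Spectrum

/-! ### Angular fields, and the potential `A_{h,p}` -/

section Angular

variable {ρ₁ ρ₂ h : ℝ} {a b : ℝ → ℝ} {A : ℝ × ℝ → ℝ × ℝ}

/-- The rotation by `π / 2`. -/
def rotJ : ℝ × ℝ →L[ℝ] ℝ × ℝ :=
  (-ContinuousLinearMap.snd ℝ ℝ ℝ).prod (ContinuousLinearMap.fst ℝ ℝ ℝ)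

theorem hasFDerivAt_angular {c : ℝ → ℝ} {x : ℝ × ℝ} (hx : 0 < rad x) {c' : ℝ}
    (hc : HasDerivAt c c' (rad x)) :
    HasFDerivAt (fun y => c (rad y) • rotJ y)
      (c (rad x) • rotJ + ((c' / rad x) • radForm x).smulRight (rotJ x)) x :=
  (hasFDerivAt_radial hx hc).smul rotJ.hasFDerivAt

theorem norm_radForm_le (x : ℝ × ℝ) : ‖radForm x‖ ≤ 2 * rad x := by
  have h1 : |x.1| ≤ rad x := Real.abs_le_sqrt (by nlinarith [sq_nonneg x.2])
  have h2 : |x.2| ≤ rad x := Real.abs_le_sqrt (by nlinarith [sq_nonneg x.1])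
  refine ContinuousLinearMap.opNorm_le_bound _ (by have := rad_nonneg x; positivity) fun v => ?_
  have h3 : |v.1| ≤ ‖v‖ := norm_fst_le v
  have h4 : |v.2| ≤ ‖v‖ := norm_snd_le v
  calc ‖radForm x v‖ = |x.1 * v.1 + x.2 * v.2| := rfl
    _ ≤ |x.1| * |v.1| + |x.2| * |v.2| := by
      rw [← abs_mul, ← abs_mul]; exact abs_add_le _ _
    _ ≤ rad x * ‖v‖ + rad x * ‖v‖ := by
      have := rad_nonneg x
      gcongr
    _ = _ := by ring

theorem norm_le_rad (x : ℝ × ℝ) : ‖x‖ ≤ rad x :=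
  max_le (Real.abs_le_sqrt (by nlinarith [sq_nonneg x.2]))
    (Real.abs_le_sqrt (by nlinarith [sq_nonneg x.1]))

theorem norm_rotJ_le (x : ℝ × ℝ) : ‖rotJ x‖ ≤ rad x :=
  max_le (by
    change |-x.2| ≤ _
    rw [abs_neg]
    exact Real.abs_le_sqrt (by nlinarith [sq_nonneg x.1])) (by
    change |x.1| ≤ _
    exact Real.abs_le_sqrt (by nlinarith [sq_nonneg x.2]))

theorem IsAngularField.eqOn (hA : IsAngularField ρ₁ ρ₂ A a) {x : ℝ × ℝ}
    (hx : x ∈ annulus ρ₁ ρ₂) : A x = (a (rad x) / rad x) • rotJ x := hA x hx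

theorem IsAngularField.hasFDerivAt (hρ₁ : 0 < ρ₁) (hρ : ρ₁ < ρ₂)
    (hA : IsAngularField ρ₁ ρ₂ A a) (ha : RadialField ρ₁ ρ₂ a b) {x : ℝ × ℝ}
    (hx : x ∈ annulus ρ₁ ρ₂) :
    HasFDerivAt A ((a (rad x) / rad x) • rotJ +
      (((b (rad x) - 2 * (a (rad x) / rad x)) / rad x / rad x) • radForm x).smulRight
        (rotJ x)) x := by
  have hr := rad_pos_of_mem hρ₁ hρ hx
  have hd : HasDerivAt (fun r => a r / r) ((b (rad x) - 2 * (a (rad x) / rad x)) / rad x) (rad x) := by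
    refine ((ha.deriv _ ((mem_annulus_iff hρ₁ hρ).1 hx)).div (hasDerivAt_id _) hr.ne').congr_deriv ?_
    simp only [id]
    field_simp
    ring
  refine (hasFDerivAt_angular hr hd).congr_of_eventuallyEq ?_
  filter_upwards [(isOpen_annulus ρ₁ ρ₂).mem_nhds hx] with y hy
  exact hA.eqOn hy

theorem IsAngularField.rot_eq (hρ₁ : 0 < ρ₁) (hρ : ρ₁ < ρ₂)
    (hA : IsAngularField ρ₁ ρ₂ A a) (ha : RadialField ρ₁ ρ₂ a b) {x : ℝ × ℝ}
    (hx : x ∈ annulus ρ₁ ρ₂) : rot A x = b (rad x) := by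
  have hr := rad_pos_of_mem hρ₁ hρ hx
  have hd := hA.hasFDerivAt hρ₁ hρ ha hx
  have e1 : fderiv ℝ (fun y => (A y).1) x = (ContinuousLinearMap.fst ℝ ℝ ℝ).comp _ :=
    HasFDerivAt.fderiv ((ContinuousLinearMap.fst ℝ ℝ ℝ).hasFDerivAt.comp x hd)
  have e2 : fderiv ℝ (fun y => (A y).2) x = (ContinuousLinearMap.snd ℝ ℝ ℝ).comp _ :=
    HasFDerivAt.fderiv ((ContinuousLinearMap.snd ℝ ℝ ℝ).hasFDerivAt.comp x hd)
  rw [rot, e1, e2]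
  simp [rotJ, radForm]
  have := rad_sq x
  field_simp
  linear_combination (-(b (rad x) * rad x) + 2 * a (rad x)) * this

theorem IsAngularField.boundedSmooth (hρ₁ : 0 < ρ₁) (hρ : ρ₁ < ρ₂)
    (hA : IsAngularField ρ₁ ρ₂ A a) (ha : RadialField ρ₁ ρ₂ a b) :
    BoundedSmooth (annulus ρ₁ ρ₂) A := by
  obtain ⟨Ma, hMa⟩ := isCompact_Icc.exists_bound_of_continuousOn ha.cont
  obtain ⟨Mb, hMb⟩ := isCompact_Icc.exists_bound_of_continuousOn ha.cont_rot
  have a0 : 0 ≤ Ma := (norm_nonneg _).trans (hMa ρ₁ ⟨le_rfl, hρ.le⟩)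
  have b0 : 0 ≤ Mb := (norm_nonneg _).trans (hMb ρ₁ ⟨le_rfl, hρ.le⟩)
  have key : ∀ x ∈ annulus ρ₁ ρ₂, 0 < rad x ∧ ρ₁ ≤ rad x ∧ |a (rad x)| ≤ Ma ∧ |b (rad x)| ≤ Mb :=
    fun x hx => by
      have hm := (mem_annulus_iff hρ₁ hρ).1 hx
      exact ⟨hρ₁.trans hm.1, hm.1.le, hMa _ ⟨hm.1.le, hm.2.le⟩, hMb _ ⟨hm.1.le, hm.2.le⟩⟩
  refine ⟨?_, ⟨Ma, fun x hx => ?_⟩, ⟨Ma / ρ₁ * ‖rotJ‖ + (Mb + 2 * (Ma / ρ₁)) * 2, fun x hx => ?_⟩⟩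
  · refine ContDiffOn.congr (f := fun x => (a (rad x) / rad x) • rotJ x) ?_ fun x hx => hA.eqOn hx
    exact ((contDiffOn_comp_rad hρ₁ hρ ha.smooth).div (contDiffOn_rad hρ₁ hρ) fun x hx =>
      (rad_pos_of_mem hρ₁ hρ hx).ne').smul rotJ.contDiff.contDiffOn
  · obtain ⟨r0, r1, h1, h2⟩ := key x hx
    rw [hA.eqOn hx, norm_smul, norm_div, Real.norm_eq_abs, Real.norm_eq_abs, abs_of_pos r0]
    calc |a (rad x)| / rad x * ‖rotJ x‖ ≤ |a (rad x)| / rad x * rad x := by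
          gcongr; exact norm_rotJ_le x
      _ = |a (rad x)| := by field_simp
      _ ≤ Ma := h1
  · obtain ⟨r0, r1, h1, h2⟩ := key x hx
    rw [(hA.hasFDerivAt hρ₁ hρ ha hx).fderiv]
    have h3 : |a (rad x) / rad x| ≤ Ma / ρ₁ := by
      rw [abs_div, abs_of_pos r0]
      gcongr
    refine (norm_add_le _ _).trans (add_le_add ?_ ?_)
    · rw [norm_smul]
      gcongr
      exact h3
    · rw [ContinuousLinearMap.norm_smulRight_apply, norm_smul]
      have h4 : |b (rad x) - 2 * (a (rad x) / rad x)| ≤ Mb + 2 * (Ma / ρ₁) := by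
        refine (abs_sub _ _).trans (add_le_add h2 ?_)
        rw [abs_mul, abs_two]
        gcongr
      rw [norm_div, norm_div, Real.norm_eq_abs, Real.norm_eq_abs, abs_of_pos r0]
      calc _ ≤ (Mb + 2 * (Ma / ρ₁)) / rad x / rad x * (2 * rad x) * rad x := by
            gcongr
            · exact norm_radForm_le x
            · exact norm_rotJ_le x
        _ = _ := by field_simp

theorem gradPerp_harmonicPotential (hρ₁ : 0 < ρ₁) (hρ : ρ₁ < ρ₂) {x : ℝ × ℝ} (hx : 0 < rad x) :
    Real.log (ρ₁ / ρ₂) • gradPerp (harmonicPotential ρ₁ ρ₂) x =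
      (1 / rad x ^ 2) • ((-x.2, x.1) : ℝ × ℝ) := by
  have hρ₂ := hρ₁.trans hρ
  have hl : Real.log (ρ₁ / ρ₂) ≠ 0 :=
    (Real.log_neg (by positivity) ((div_lt_one hρ₂).2 hρ)).ne
  have hd : HasDerivAt (fun r => Real.log (r / ρ₂) / Real.log (ρ₁ / ρ₂))
      (1 / rad x / Real.log (ρ₁ / ρ₂)) (rad x) := by
    have h0 : HasDerivAt (fun r : ℝ => r / ρ₂) (1 / ρ₂) (rad x) := (hasDerivAt_id _).div_const ρ₂
    refine ((h0.log (div_pos hx hρ₂).ne').div_const _).congr_deriv ?_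
    field_simp
  have e : fderiv ℝ (harmonicPotential ρ₁ ρ₂) x = _ := (hasFDerivAt_radial hx hd).fderiv
  rw [gradPerp, e]
  ext <;> simp [radForm] <;> field_simp

/-- The potential `A_{h,p}` is angular: its profile is `∂_rφ + h γ_{h,p} / r`. -/
theorem exists_gaugePotential_profile (hρ₁ : 0 < ρ₁) (hρ : ρ₁ < ρ₂) {B φ : ℝ × ℝ → ℝ}
    (hB : ContDiffOn ℝ ∞ B (closedAnnulus ρ₁ ρ₂))
    (hBrad : ∀ x ∈ closedAnnulus ρ₁ ρ₂, ∀ y ∈ closedAnnulus ρ₁ ρ₂,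
      x.1 ^ 2 + x.2 ^ 2 = y.1 ^ 2 + y.2 ^ 2 → B x = B y)
    (hφ : IsScalarPotential ρ₁ ρ₂ B φ) (p : ℤ) :
    ∃ a : ℝ → ℝ, RadialField ρ₁ ρ₂ a (fun r => B (r, 0)) ∧
      IsAngularField ρ₁ ρ₂ (gaugePotential ρ₁ ρ₂ h A φ p) a ∧
      ∀ r ∈ Set.Icc ρ₁ ρ₂,
        radialDeriv ρ₁ ρ₂ φ r = a r - h * gaugeConst ρ₁ ρ₂ h A φ p / r := by
  obtain ⟨α, h1, h2, h3, h4, h5⟩ := exists_radial_potential hρ₁ hρ hB hBrad hφ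
  set γ := gaugeConst ρ₁ ρ₂ h A φ p with hγ
  have i0 : ∀ r ∈ Set.Ioo ρ₁ ρ₂, r ≠ 0 := fun r hr => (hρ₁.trans hr.1).ne'
  have i1 : ∀ r ∈ Set.Icc ρ₁ ρ₂, r ≠ 0 := fun r hr => (hρ₁.trans_le hr.1).ne'
  refine ⟨fun r => α r + h * γ / r, ⟨h1.add (contDiffOn_const.div contDiffOn_id i0),
    h2.add (continuousOn_const.div continuousOn_id i1), ?_, fun r hr => ?_⟩, fun x hx => ?_,
    fun r hr => ?_⟩
  · refine hB.continuousOn.comp (by fun_prop) fun r hr => (mem_closedAnnulus_iff hρ₁ hρ).2 ?_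
    rwa [rad_axis (hρ₁.le.trans hr.1)]
  · have := i0 r hr
    refine ((h4 r hr).add ((hasDerivAt_const r (h * γ)).div (hasDerivAt_id r)
      this)).congr_deriv ?_
    simp only [id]
    field_simp
    ring
  · have hr := rad_pos_of_mem hρ₁ hρ hx
    rw [gaugePotential, h5 x hx, mul_smul, gradPerp_harmonicPotential hρ₁ hρ hr, ← hγ, smul_smul,
      ← add_smul]
    congr 1
    field_simp
  · rw [h3 r hr]
    ring

/-- A smooth function on the closed annulus is bounded, with its differential, in the interior. -/
theorem boundedSmooth_of_closed (hρ₁ : 0 < ρ₁) (hρ : ρ₁ < ρ₂)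
    (hA : ContDiffOn ℝ ∞ A (closedAnnulus ρ₁ ρ₂)) : BoundedSmooth (annulus ρ₁ ρ₂) A := by
  have hcl : IsClosed (closedAnnulus ρ₁ ρ₂) :=
    (isClosed_le (f := fun _ : ℝ × ℝ => ρ₁ ^ 2) (g := fun x => x.1 ^ 2 + x.2 ^ 2)
      (by fun_prop) (by fun_prop)).inter
    (isClosed_le (f := fun x : ℝ × ℝ => x.1 ^ 2 + x.2 ^ 2) (g := fun _ => ρ₂ ^ 2)
      (by fun_prop) (by fun_prop))
  have hK : IsCompact (closedAnnulus ρ₁ ρ₂) := by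
    refine Metric.isCompact_of_isClosed_isBounded hcl
      (Metric.isBounded_closedBall (x := (0 : ℝ × ℝ)) (r := ρ₂) |>.subset fun x hx => ?_)
    rw [mem_closedBall_zero_iff]
    exact (norm_le_rad x).trans ((mem_closedAnnulus_iff hρ₁ hρ).1 hx).2
  refine ⟨hA.mono annulus_subset_closedAnnulus, ?_, ?_⟩
  · obtain ⟨C, hC⟩ := hK.exists_bound_of_continuousOn hA.continuousOn
    exact ⟨C, fun x hx => hC x (annulus_subset_closedAnnulus hx)⟩
  · suffices H : ∃ C, ∀ x ∈ closedAnnulus ρ₁ ρ₂, x ∈ annulus ρ₁ ρ₂ → ‖fderiv ℝ A x‖ ≤ C by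
      obtain ⟨C, hC⟩ := H
      exact ⟨C, fun x hx => hC x (annulus_subset_closedAnnulus hx) hx⟩
    refine hK.induction_on (p := fun s => ∃ C, ∀ x ∈ s, x ∈ annulus ρ₁ ρ₂ → ‖fderiv ℝ A x‖ ≤ C)
      ⟨0, by simp⟩ (fun s t hst ⟨C, hC⟩ => ⟨C, fun x hx => hC x (hst hx)⟩)
      (fun s t ⟨C, hC⟩ ⟨D, hD⟩ => ⟨max C D, fun x hx hm => hx.elim
        (fun hx => (hC x hx hm).trans (le_max_left _ _))
        fun hx => (hD x hx hm).trans (le_max_right _ _)⟩) fun x hx => ?_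
    have h1 : ContDiffWithinAt ℝ (0 + 1) A (closedAnnulus ρ₁ ρ₂) x :=
      (hA x hx).of_le (by simp)
    obtain ⟨u, hu, hus, -, f', hf', hf''⟩ :=
      (contDiffWithinAt_succ_iff_hasFDerivWithinAt' (by simp)).1 h1
    rw [Set.insert_eq_of_mem hx] at hu
    have hb : ∀ᶠ y in 𝓝[closedAnnulus ρ₁ ρ₂] x, ‖f' y‖ < ‖f' x‖ + 1 :=
      hf''.continuousWithinAt.norm.eventually_lt tendsto_const_nhds (lt_add_one _)
    refine ⟨u ∩ {y | ‖f' y‖ < ‖f' x‖ + 1}, inter_mem hu hb, ‖f' x‖ + 1, fun y hy hm => ?_⟩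
    have hd : HasFDerivAt A (f' y) y := (hf' y hy.1).hasFDerivAt
      (mem_of_superset ((isOpen_annulus ρ₁ ρ₂).mem_nhds hm) annulus_subset_closedAnnulus)
    rw [hd.fderiv]
    exact hy.2.le

end Angular

/-! ### The gauge function -/

section Gauge

variable {ρ₁ ρ₂ h : ℝ} {D : ℝ × ℝ → ℝ × ℝ}

/-- The linear form `w · dx`. -/
def dotForm (w : ℝ × ℝ) : ℝ × ℝ →L[ℝ] ℝ :=
  w.1 • ContinuousLinearMap.fst ℝ ℝ ℝ + w.2 • ContinuousLinearMap.snd ℝ ℝ ℝ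

theorem dotForm_apply (w v : ℝ × ℝ) : dotForm w v = w.1 * v.1 + w.2 * v.2 := rfl

/-- The form `v ↦ Re (z v)`, as a linear function of `z`. -/
def reForm : ℂ →L[ℝ] ℂ →L[ℝ] ℝ :=
  (ContinuousLinearMap.compL ℝ ℂ ℂ ℝ Complex.reCLM).comp (ContinuousLinearMap.mul ℝ ℂ)

/-- The form `v ↦ Im (z v)`, as a linear function of `z`. -/
def imForm : ℂ →L[ℝ] ℂ →L[ℝ] ℝ :=
  (ContinuousLinearMap.compL ℝ ℂ ℂ ℝ Complex.imCLM).comp (ContinuousLinearMap.mul ℝ ℂ)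

/-- The exponential map, from the strip to the annulus. -/
def expMap (ζ : ℂ) : ℝ × ℝ := Complex.equivRealProdCLM (Complex.exp ζ)

theorem expMap_fst (ζ : ℂ) : (expMap ζ).1 = (Complex.exp ζ).re := rfl

theorem expMap_snd (ζ : ℂ) : (expMap ζ).2 = (Complex.exp ζ).im := rfl

theorem rad_expMap (ζ : ℂ) : rad (expMap ζ) = Real.exp ζ.re := by
  rw [← norm_coord, ← Complex.norm_exp, expMap_fst, expMap_snd, Complex.re_add_im]

theorem hasFDerivAt_exp_real (ζ : ℂ) :
    HasFDerivAt Complex.exp (ContinuousLinearMap.mul ℝ ℂ (Complex.exp ζ)) ζ := by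
  refine ((Complex.hasDerivAt_exp ζ).hasFDerivAt.restrictScalars ℝ).congr_fderiv ?_
  ext
  simp [mul_comm]

/-- The strip of the logarithms of the points of the annulus. -/
def strip (ρ₁ ρ₂ : ℝ) : Set ℂ := {ζ | Real.log ρ₁ < ζ.re ∧ ζ.re < Real.log ρ₂}

theorem isOpen_strip : IsOpen (strip ρ₁ ρ₂) :=
  (isOpen_lt continuous_const Complex.continuous_re).inter
    (isOpen_lt Complex.continuous_re continuous_const)

theorem convex_strip : Convex ℝ (strip ρ₁ ρ₂) :=
  (convex_Ioo (Real.log ρ₁) (Real.log ρ₂)).linear_preimage Complex.reLm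

theorem mem_strip_iff (hρ₁ : 0 < ρ₁) (hρ : ρ₁ < ρ₂) {ζ : ℂ} :
    ζ ∈ strip ρ₁ ρ₂ ↔ expMap ζ ∈ annulus ρ₁ ρ₂ := by
  rw [mem_annulus_iff hρ₁ hρ, rad_expMap, Set.mem_Ioo, ← Real.log_lt_iff_lt_exp hρ₁,
    ← Real.lt_log_iff_exp_lt (hρ₁.trans hρ)]
  rfl

/-- The pull back of the form `D · dx` by the exponential map. -/
def logForm (D : ℝ × ℝ → ℝ × ℝ) (ζ : ℂ) : ℂ →L[ℝ] ℝ :=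
  (D (expMap ζ)).1 • reForm (Complex.exp ζ) + (D (expMap ζ)).2 • imForm (Complex.exp ζ)

theorem logForm_apply (ζ v : ℂ) : logForm D ζ v =
    (D (expMap ζ)).1 * (Complex.exp ζ * v).re + (D (expMap ζ)).2 * (Complex.exp ζ * v).im := rfl

/-- A closed form on the annulus has a primitive on the strip, which is simply connected. -/
theorem exists_log_primitive (hρ₁ : 0 < ρ₁) (hρ : ρ₁ < ρ₂) (hD : ContDiffOn ℝ ∞ D (annulus ρ₁ ρ₂))
    (hrot : ∀ x ∈ annulus ρ₁ ρ₂, rot D x = 0) :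
    ∃ f : ℂ → ℝ, ∀ ζ ∈ strip ρ₁ ρ₂, HasFDerivAt f (logForm D ζ) ζ := by
  have hX : ∀ ζ, HasFDerivAt expMap ((Complex.equivRealProdCLM : ℂ →L[ℝ] ℝ × ℝ).comp
      (ContinuousLinearMap.mul ℝ ℂ (Complex.exp ζ))) ζ := fun ζ =>
    (Complex.equivRealProdCLM : ℂ →L[ℝ] ℝ × ℝ).hasFDerivAt.comp ζ (hasFDerivAt_exp_real ζ)
  have hω : ∀ ζ ∈ strip ρ₁ ρ₂, HasFDerivAt (logForm D) _ ζ := fun ζ hζ => by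
    have hx := (mem_strip_iff hρ₁ hρ).1 hζ
    have hd : HasFDerivAt D (fderiv ℝ D (expMap ζ)) (expMap ζ) :=
      ((hD.contDiffAt ((isOpen_annulus ρ₁ ρ₂).mem_nhds hx)).differentiableAt
        (by simp)).hasFDerivAt
    have h1 := (ContinuousLinearMap.fst ℝ ℝ ℝ).hasFDerivAt.comp ζ (hd.comp ζ (hX ζ))
    have h2 := (ContinuousLinearMap.snd ℝ ℝ ℝ).hasFDerivAt.comp ζ (hd.comp ζ (hX ζ))
    have h3 := reForm.hasFDerivAt.comp ζ (hasFDerivAt_exp_real ζ)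
    have h4 := imForm.hasFDerivAt.comp ζ (hasFDerivAt_exp_real ζ)
    exact (h1.smul h3).add (h2.smul h4)
  refine convex_strip.exists_forall_hasFDerivAt_of_fderiv_symmetric isOpen_strip
    (fun ζ hζ => (hω ζ hζ).differentiableAt.differentiableWithinAt) fun ζ hζ v w => ?_
  have hx := (mem_strip_iff hρ₁ hρ).1 hζ
  have hd : DifferentiableAt ℝ D (expMap ζ) :=
    (hD.contDiffAt ((isOpen_annulus ρ₁ ρ₂).mem_nhds hx)).differentiableAt (by simp)
  have hr := hrot _ hx
  have e1 : fderiv ℝ (fun y => (D y).1) (expMap ζ) = (ContinuousLinearMap.fst ℝ ℝ ℝ).comp _ :=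
    HasFDerivAt.fderiv ((ContinuousLinearMap.fst ℝ ℝ ℝ).hasFDerivAt.comp _ hd.hasFDerivAt)
  have e2 : fderiv ℝ (fun y => (D y).2) (expMap ζ) = (ContinuousLinearMap.snd ℝ ℝ ℝ).comp _ :=
    HasFDerivAt.fderiv ((ContinuousLinearMap.snd ℝ ℝ ℝ).hasFDerivAt.comp _ hd.hasFDerivAt)
  rw [rot, e1, e2] at hr
  have hlin : ∀ q : ℝ × ℝ, fderiv ℝ D (expMap ζ) q =
      q.1 • fderiv ℝ D (expMap ζ) (1, 0) + q.2 • fderiv ℝ D (expMap ζ) (0, 1) := fun q => by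
    rw [← map_smul, ← map_smul, ← map_add]
    congr 1
    ext <;> simp
  have hval : ∀ v w : ℂ, fderiv ℝ (logForm D) ζ v w =
      (D (expMap ζ)).1 * (Complex.exp ζ * v * w).re +
        (fderiv ℝ D (expMap ζ) ((Complex.exp ζ * v).re, (Complex.exp ζ * v).im)).1 *
          (Complex.exp ζ * w).re +
      ((D (expMap ζ)).2 * (Complex.exp ζ * v * w).im +
        (fderiv ℝ D (expMap ζ) ((Complex.exp ζ * v).re, (Complex.exp ζ * v).im)).2 *
          (Complex.exp ζ * w).im) := fun v w => by
    rw [(hω ζ hζ).fderiv]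
    rfl
  have hr' : (fderiv ℝ D (expMap ζ) (1, 0)).2 - (fderiv ℝ D (expMap ζ) (0, 1)).1 = 0 := hr
  rw [hval, hval, hlin ((Complex.exp ζ * v).re, _), hlin ((Complex.exp ζ * w).re, _),
    mul_right_comm (Complex.exp ζ) v w]
  simp only [Prod.fst_add, Prod.snd_add, Prod.smul_fst, Prod.smul_snd, smul_eq_mul]
  linear_combination ((Complex.exp ζ * v).re * (Complex.exp ζ * w).im -
    (Complex.exp ζ * v).im * (Complex.exp ζ * w).re) * hr'

theorem strip_add (ζ : ℂ) (n : ℤ) : ζ + n * (2 * Real.pi * Complex.I) ∈ strip ρ₁ ρ₂ ↔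
    ζ ∈ strip ρ₁ ρ₂ := by
  have : (ζ + n * (2 * Real.pi * Complex.I)).re = ζ.re := by simp
  simp only [strip, Set.mem_ofPred_eq, this]

/-- The primitive increases by the circulation after one turn. -/
theorem log_primitive_add (hρ₁ : 0 < ρ₁) (hρ : ρ₁ < ρ₂) (hD : ContDiffOn ℝ ∞ D (annulus ρ₁ ρ₂))
    {c : ℝ} (hc : Tendsto (fun ρ => circulation ρ D) (𝓝[>] ρ₁) (𝓝 c)) {f : ℂ → ℝ}
    (hf : ∀ ζ ∈ strip ρ₁ ρ₂, HasFDerivAt f (logForm D ζ) ζ) {ζ : ℂ} (hζ : ζ ∈ strip ρ₁ ρ₂) :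
    f (ζ + 2 * Real.pi * Complex.I) = f ζ + c := by
  have hper : ∀ ζ, logForm D (ζ + 2 * Real.pi * Complex.I) = logForm D ζ := fun ζ => by
    simp only [logForm, expMap, Complex.exp_periodic ζ]
  have hmem : ∀ ζ, ζ ∈ strip ρ₁ ρ₂ → ζ + 2 * Real.pi * Complex.I ∈ strip ρ₁ ρ₂ := fun ζ h => by
    simpa using (strip_add ζ 1).2 h
  have hF : ∀ ζ ∈ strip ρ₁ ρ₂,
      HasFDerivAt (fun ζ => f (ζ + 2 * Real.pi * Complex.I) - f ζ) (0 : ℂ →L[ℝ] ℝ) ζ :=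
    fun ζ h => by
    have h1 := hf _ (hmem ζ h)
    rw [hper] at h1
    exact ((h1.comp ζ ((hasFDerivAt_id ζ).add_const _)).sub (hf ζ h)).congr_fderiv
      (by rw [ContinuousLinearMap.comp_id, sub_self])
  have hcirc : ∀ ρ ∈ Set.Ioo ρ₁ ρ₂, circulation ρ D =
      f (Real.log ρ + 2 * Real.pi * Complex.I) - f (Real.log ρ) := fun ρ hρm => by
    have hρ0 := hρ₁.trans hρm.1
    have hm : ∀ t : ℝ, (Real.log ρ + t * Complex.I : ℂ) ∈ strip ρ₁ ρ₂ := fun t => by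
      simp only [strip, Set.mem_ofPred_eq, Complex.add_re, Complex.ofReal_re, Complex.mul_re,
        Complex.I_re, Complex.I_im, Complex.ofReal_im, mul_zero, zero_mul, sub_zero, add_zero]
      exact ⟨Real.log_lt_log hρ₁ hρm.1, Real.log_lt_log hρ0 hρm.2⟩
    have hexp : ∀ t : ℝ, Complex.exp (Real.log ρ + t * Complex.I) =
        ((ρ * Real.cos t : ℝ) : ℂ) + ((ρ * Real.sin t : ℝ) : ℂ) * Complex.I := fun t => by
      rw [Complex.exp_add, Complex.exp_mul_I, ← Complex.ofReal_exp, Real.exp_log hρ0]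
      push_cast
      ring
    have hX : ∀ t : ℝ, expMap (Real.log ρ + t * Complex.I) =
        (ρ * Real.cos t, ρ * Real.sin t) := fun t => by
      ext
      · rw [expMap_fst, hexp]; simp [Complex.cos_ofReal_re]
      · rw [expMap_snd, hexp]; simp [Complex.sin_ofReal_re]
    have hd : ∀ t : ℝ, HasDerivAt (fun t : ℝ => f (Real.log ρ + t * Complex.I))
        ((D (ρ * Real.cos t, ρ * Real.sin t)).1 * (-(ρ * Real.sin t)) +
          (D (ρ * Real.cos t, ρ * Real.sin t)).2 * (ρ * Real.cos t)) t := fun t => by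
      have h1 : HasDerivAt (fun t : ℝ => (Real.log ρ + t * Complex.I : ℂ)) Complex.I t := by
        simpa using ((Complex.ofRealCLM.hasDerivAt (x := t)).mul_const Complex.I).const_add
          (Real.log ρ : ℂ)
      refine ((hf _ (hm t)).comp_hasDerivAt t h1).congr_deriv ?_
      rw [logForm_apply, hX, hexp]
      simp [Complex.cos_ofReal_re, Complex.sin_ofReal_re]
    have hcont : Continuous fun t : ℝ => (D (ρ * Real.cos t, ρ * Real.sin t)).1 *
        (-(ρ * Real.sin t)) + (D (ρ * Real.cos t, ρ * Real.sin t)).2 * (ρ * Real.cos t) := by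
      have hDc : Continuous fun t : ℝ => D (ρ * Real.cos t, ρ * Real.sin t) := by
        refine continuous_iff_continuousAt.2 fun t => ?_
        have hx : (ρ * Real.cos t, ρ * Real.sin t) ∈ annulus ρ₁ ρ₂ := by
          rw [← hX]
          exact (mem_strip_iff hρ₁ hρ).1 (hm t)
        exact ContinuousAt.comp
          (hD.continuousOn.continuousAt ((isOpen_annulus ρ₁ ρ₂).mem_nhds hx)) (by fun_prop)
      exact ((continuous_fst.comp hDc).mul (by fun_prop)).add
        ((continuous_snd.comp hDc).mul (by fun_prop))
    rw [circulation, intervalIntegral.integral_eq_sub_of_hasDerivAt (fun t _ => hd t)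
      (hcont.intervalIntegrable _ _)]
    simp
  obtain ⟨K, hK⟩ := isOpen_strip.exists_is_const_of_fderiv_eq_zero convex_strip.isPreconnected
    (fun ζ h => (hF ζ h).differentiableAt.differentiableWithinAt) (fun ζ h => (hF ζ h).fderiv)
  have hKc : c = K := by
    refine tendsto_nhds_unique hc (tendsto_const_nhds.congr' ?_)
    filter_upwards [Ioo_mem_nhdsGT hρ] with ρ hm
    rw [hcirc ρ hm]
    refine (hK _ ?_).symm
    exact ⟨by simpa using Real.log_lt_log hρ₁ hm.1,
      by simpa using Real.log_lt_log (hρ₁.trans hm.1) hm.2⟩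
  have := hK ζ hζ
  rw [hKc]
  linarith

/-- A closed field `D` whose circulation is an integer multiple of `2πh` is the logarithmic gradient
of a function of modulus one. It is defined with the principal logarithm; because of the
quantization, all the branches of the logarithm give the same function, which is thus smooth. -/
theorem exists_gauge (hρ₁ : 0 < ρ₁) (hρ : ρ₁ < ρ₂) (hh : 0 < h)
    (hD : ContDiffOn ℝ ∞ D (annulus ρ₁ ρ₂)) (hrot : ∀ x ∈ annulus ρ₁ ρ₂, rot D x = 0) (p : ℤ)
    (hc : Tendsto (fun ρ => circulation ρ D) (𝓝[>] ρ₁) (𝓝 (2 * Real.pi * (h * p)))) :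
    ∃ E : ℝ × ℝ → ℂ, ∀ x ∈ annulus ρ₁ ρ₂, ‖E x‖ = 1 ∧
      HasFDerivAt E ((dotForm (D x)).smulRight (Complex.I / h * E x)) x := by
  obtain ⟨f, hf⟩ := exists_log_primitive hρ₁ hρ hD hrot
  have hh' : (h : ℂ) ≠ 0 := by exact_mod_cast hh.ne'
  set g : ℂ → ℂ := fun ζ => Complex.exp ((f ζ : ℂ) * (Complex.I / h)) with hg
  have hg1 : ∀ ζ ∈ strip ρ₁ ρ₂, g (ζ + 2 * Real.pi * Complex.I) = g ζ := fun ζ hζ => by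
    have e := log_primitive_add hρ₁ hρ hD hc hf hζ
    simp only [hg]
    rw [e, Complex.exp_eq_exp_iff_exists_int]
    refine ⟨p, ?_⟩
    push_cast
    field_simp
  have hgn : ∀ (n : ℤ), ∀ ζ ∈ strip ρ₁ ρ₂, g (ζ + n * (2 * Real.pi * Complex.I)) = g ζ := by
    intro n ζ hζ
    induction n with
    | zero => simp
    | succ n ih =>
      rw [← ih, ← hg1 _ ((strip_add ζ n).2 hζ)]
      congr 1
      push_cast
      ring
    | pred n ih =>
      rw [← ih, ← hg1 (ζ + ((-(n : ℤ) - 1 : ℤ) : ℂ) * (2 * Real.pi * Complex.I))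
        ((strip_add ζ (-(n : ℤ) - 1)).2 hζ)]
      congr 1
      push_cast
      ring
  set Z : ℝ × ℝ →L[ℝ] ℂ := (Complex.equivRealProdCLM.symm : ℝ × ℝ →L[ℝ] ℂ) with hZ
  have hXZ : ∀ ζ (x : ℝ × ℝ), Complex.exp ζ = Z x → expMap ζ = x := fun ζ x e => by
    rw [expMap, e, hZ]
    exact Complex.equivRealProdCLM.apply_symm_apply x
  have hZ0 : ∀ x ∈ annulus ρ₁ ρ₂, Z x ≠ 0 := fun x hx e => by
    have := Complex.equivRealProdCLM.symm.map_eq_zero_iff.1 e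
    have h0 := rad_pos_of_mem hρ₁ hρ hx
    rw [this] at h0
    simp [rad] at h0
  refine ⟨fun x => g (Complex.log (Z x)), fun x hx => ⟨?_, ?_⟩⟩
  · have : (f (Complex.log (Z x)) : ℂ) * (Complex.I / h) =
        ((f (Complex.log (Z x)) / h : ℝ) : ℂ) * Complex.I := by
      push_cast
      ring
    simp only [hg, this, Complex.norm_exp_ofReal_mul_I]
  · have hz := hZ0 x hx
    set L : ℝ × ℝ → ℂ := fun y => Complex.log (Z y / Z x) + Complex.log (Z x) with hL
    have hLx : L x = Complex.log (Z x) := by simp [hL, div_self hz]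
    have hLd : HasFDerivAt L ((Z x)⁻¹ • Z) x := by
      have h1 : HasFDerivAt (fun y => Z y / Z x) ((Z x)⁻¹ • Z) x := by
        simpa [div_eq_inv_mul] using (Z.hasFDerivAt (x := x)).const_mul (Z x)⁻¹
      have h2 := (Complex.hasStrictDerivAt_log (x := Z x / Z x) (by
        rw [div_self hz]; exact Complex.one_mem_slitPlane)).hasDerivAt.comp_hasFDerivAt x h1
      refine (h2.add_const _).congr_fderiv ?_
      simp [div_self hz]
    have hev : ∀ᶠ y in 𝓝 x, y ∈ annulus ρ₁ ρ₂ := (isOpen_annulus ρ₁ ρ₂).mem_nhds hx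
    have hLe : ∀ y ∈ annulus ρ₁ ρ₂, Complex.exp (L y) = Z y := fun y hy => by
      simp only [hL]
      rw [Complex.exp_add, Complex.exp_log (div_ne_zero (hZ0 y hy) hz), Complex.exp_log hz,
        div_mul_cancel₀ _ hz]
    have hEL : (fun y => g (Complex.log (Z y))) =ᶠ[𝓝 x] fun y => g (L y) := by
      filter_upwards [hev] with y hy
      obtain ⟨n, hn⟩ := Complex.exp_eq_exp_iff_exists_int.1
        ((Complex.exp_log (hZ0 y hy)).trans (hLe y hy).symm)
      rw [hn]
      exact hgn n _ ((mem_strip_iff hρ₁ hρ).2 (by rwa [hXZ _ _ (hLe y hy)]))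
    have hmx : L x ∈ strip ρ₁ ρ₂ := (mem_strip_iff hρ₁ hρ).2 (by rwa [hXZ _ _ (hLe x hx)])
    have hfd : HasFDerivAt (fun y => f (L y)) (dotForm (D x)) x := by
      refine ((hf _ hmx).comp x hLd).congr_fderiv ?_
      refine ContinuousLinearMap.ext fun v => ?_
      rw [ContinuousLinearMap.comp_apply, logForm_apply, hLe x hx, hXZ _ _ (hLe x hx),
        smul_apply, smul_eq_mul, mul_inv_cancel_left₀ hz]
      rfl
    have hgd : HasFDerivAt (fun y => g (L y))
        ((dotForm (D x)).smulRight (Complex.I / h * g (L x))) x := by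
      have h1 := ((Complex.ofRealCLM.hasFDerivAt.comp x hfd).mul_const (Complex.I / h)).cexp
      refine h1.congr_fderiv (ContinuousLinearMap.ext fun v => ?_)
      simp [hg]
      ring
    change HasFDerivAt _ ((dotForm (D x)).smulRight (Complex.I / h * g (Complex.log (Z x)))) x
    rw [← hLx]
    exact hgd.congr_of_eventuallyEq hEL

end Gauge

/-! ### Gauge invariance of the spectrum -/

section GaugeInvariance

variable {ρ₁ ρ₂ h : ℝ} {A A' : ℝ × ℝ → ℝ × ℝ} {E : ℝ × ℝ → ℂ}

local notation "L2Ω" => Lp Spinor 2 (volume.restrict (annulus ρ₁ ρ₂))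

theorem norm_dotForm_le (w : ℝ × ℝ) : ‖dotForm w‖ ≤ 2 * ‖w‖ := by
  refine ContinuousLinearMap.opNorm_le_bound _ (by positivity) fun v => ?_
  have h1 : |w.1| ≤ ‖w‖ := norm_fst_le w
  have h2 : |w.2| ≤ ‖w‖ := norm_snd_le w
  have h3 : |v.1| ≤ ‖v‖ := norm_fst_le v
  have h4 : |v.2| ≤ ‖v‖ := norm_snd_le v
  calc ‖dotForm w v‖ = |w.1 * v.1 + w.2 * v.2| := rfl
    _ ≤ |w.1| * |v.1| + |w.2| * |v.2| := by
      rw [← abs_mul, ← abs_mul]; exact abs_add_le _ _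
    _ ≤ ‖w‖ * ‖v‖ + ‖w‖ * ‖v‖ := by gcongr
    _ = _ := by ring

/-- The multiplication by `E` is a gauge transformation, from the potential `A` to `A'`. -/
structure IsGauge (Ω : Set (ℝ × ℝ)) (h : ℝ) (A A' : ℝ × ℝ → ℝ × ℝ) (E : ℝ × ℝ → ℂ) : Prop where
  norm_eq : ∀ x ∈ Ω, ‖E x‖ = 1
  hasFDerivAt : ∀ x ∈ Ω,
    HasFDerivAt E ((dotForm (A' x - A x)).smulRight (Complex.I / h * E x)) x

theorem IsGauge.symm {Ω : Set (ℝ × ℝ)} (hE : IsGauge Ω h A A' E) :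
    IsGauge Ω h A' A fun x => starRingEnd ℂ (E x) := by
  refine ⟨fun x hx => by rw [RCLike.norm_conj, hE.norm_eq x hx], fun x hx => ?_⟩
  have h1 := (Complex.conjCLE : ℂ →L[ℝ] ℂ).hasFDerivAt.comp x (hE.hasFDerivAt x hx)
  refine h1.congr_fderiv (ContinuousLinearMap.ext fun v => ?_)
  simp only [ContinuousLinearMap.comp_apply, ContinuousLinearMap.smulRight_apply,
    ContinuousLinearEquiv.coe_coe, Complex.conjCLE_apply, dotForm_apply, Complex.real_smul,
    map_mul, map_div₀, Complex.conj_ofReal, Complex.conj_I, Prod.fst_sub, Prod.snd_sub]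
  push_cast
  ring

/-- A gauge function inherits the regularity of the potentials, by bootstrap in the equation `∇E =
(i / h) (A' - A) E`. -/
theorem IsGauge.boundedSmooth {Ω : Set (ℝ × ℝ)} (hΩ : IsOpen Ω) (hh : 0 < h)
    (hA : BoundedSmooth Ω A) (hA' : BoundedSmooth Ω A') (hE : IsGauge Ω h A A' E) :
    BoundedSmooth Ω E := by
  obtain ⟨C, hC⟩ := hA.bdd
  obtain ⟨C', hC'⟩ := hA'.bdd
  refine ⟨?_, ⟨1, fun x hx => (hE.norm_eq x hx).le⟩, ⟨2 * (C' + C) * (1 / h), fun x hx => ?_⟩⟩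
  · rw [contDiffOn_infty]
    intro n
    induction n with
    | zero =>
      exact contDiffOn_zero.2 fun x hx => (hE.hasFDerivAt x hx).continuousAt.continuousWithinAt
    | succ n ih =>
      push_cast
      rw [contDiffOn_succ_iff_fderiv_of_isOpen hΩ]
      refine ⟨fun x hx => (hE.hasFDerivAt x hx).differentiableAt.differentiableWithinAt, by simp,
        ?_⟩
      refine ContDiffOn.congr (f := fun x =>
        (dotForm (A' x - A x)).smulRight (Complex.I / h * E x)) ?_
        fun x hx => (hE.hasFDerivAt x hx).fderiv
      have hD : ContDiffOn ℝ n (fun x => A' x - A x) Ω :=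
        (hA'.smooth.sub hA.smooth).of_le (by exact_mod_cast le_top)
      have h1 : ContDiffOn ℝ n (fun x => dotForm (A' x - A x)) Ω :=
        ((contDiff_fst.comp_contDiffOn hD).smul contDiffOn_const).add
          ((contDiff_snd.comp_contDiffOn hD).smul contDiffOn_const)
      exact h1.smulRight (contDiffOn_const.mul ih)
  · rw [(hE.hasFDerivAt x hx).fderiv, ContinuousLinearMap.norm_smulRight_apply]
    have h1 : ‖Complex.I / h * E x‖ = 1 / h := by
      rw [norm_mul, hE.norm_eq x hx, norm_div, Complex.norm_I, Complex.norm_real,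
        Real.norm_of_nonneg hh.le, mul_one]
    rw [h1]
    gcongr
    refine (norm_dotForm_le _).trans ?_
    gcongr
    exact (norm_sub_le _ _).trans (add_le_add (hC' x hx) (hC x hx))

/-- Gauge covariance of `σ · (p - A)`. -/
theorem HasDirac.gauge {Ω : Set (ℝ × ℝ)} (hΩ : IsOpen Ω) (hh : 0 < h) (hEs : ContDiffOn ℝ ∞ E Ω)
    (hE : IsGauge Ω h A A' E) {U W : ℝ × ℝ → Spinor} (H : HasDirac Ω h A U W) :
    HasDirac Ω h A' (fun x => E x • U x) (fun x => E x • W x) := by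
  obtain ⟨u₁, u₂, k1, k2, k3⟩ := H
  have hh' : (h : ℂ) ≠ 0 := by exact_mod_cast hh.ne'
  refine ⟨_, _, k1.smooth_smul_complex hΩ hEs, k2.smooth_smul_complex hΩ hEs, ?_⟩
  filter_upwards [k3, ae_restrict_mem hΩ.measurableSet] with x hx hm
  rw [hx, (hE.hasFDerivAt x hm).fderiv]
  have key : ∀ (d a a' : ℝ) (s t : Spinor), d = a' - a →
      (-Complex.I * (h : ℂ)) • ((d • (Complex.I / h * E x)) • s + E x • t) -
        (a' : ℂ) • (E x • s) = E x • ((-Complex.I * (h : ℂ)) • t - (a : ℂ) • s) := by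
    rintro d a a' s t rfl
    have e : (-Complex.I * (h : ℂ)) * ((a' - a : ℝ) * (Complex.I / h * E x)) =
        ((a' : ℂ) - a) * E x := by
      push_cast
      field_simp
      linear_combination (-((a' : ℂ) - a)) * E x * Complex.I_sq
    rw [smul_add, smul_smul, Complex.real_smul, e]
    module
  rw [ContinuousLinearMap.smulRight_apply, ContinuousLinearMap.smulRight_apply,
    key _ (A x).1 _ _ _ (by simp [dotForm_apply]), key _ (A x).2 _ _ _ (by simp [dotForm_apply]),
    map_smul, map_smul, smul_add]

theorem MemH10.bounded_smul {Ω : Set (ℝ × ℝ)} (hΩ : IsOpen Ω) (hE : BoundedSmooth Ω E)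
    {U G₁ G₂ : ℝ × ℝ → Spinor} (hU : MemH10 Ω U) (hG : HasGrad Ω U G₁ G₂) :
    MemH10 Ω (fun x => E x • U x) := by
  obtain ⟨η, t, t0, tg⟩ := hU.exists_seq hΩ
  obtain ⟨C, hC⟩ := hE.bdd
  obtain ⟨C', hC'⟩ := hE.bdd_fderiv
  have hC1 : ∀ᵐ x ∂volume.restrict Ω, ‖E x‖ ≤ C := by
    filter_upwards [ae_restrict_mem hΩ.measurableSet] with x hx using hC x hx
  have hC2 : ∀ v, ∀ᵐ x ∂volume.restrict Ω, ‖fderiv ℝ E x v‖ ≤ C' * ‖v‖ := fun v => by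
    filter_upwards [ae_restrict_mem hΩ.measurableSet] with x hx
    exact (ContinuousLinearMap.le_opNorm _ _).trans (by gcongr; exact hC' x hx)
  have hG' := hG.bounded_smul hΩ hE
  have key : ∀ {v : ℝ × ℝ} {G : ℝ × ℝ → Spinor}, MemLp G 2 (volume.restrict Ω) →
      HasWeakDeriv Ω v U G → Tendsto (fun n => eLpNorm (fun x =>
        fderiv ℝ (fun y => E y • η n y) x v - (fderiv ℝ E x v • U x + E x • G x)) 2
        (volume.restrict Ω)) atTop (𝓝 0) := fun {v G} hGL hw => by
    have a1 := tendsto_bdd_smul (hC2 v) t0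
    have a2 := tendsto_bdd_smul hC1 (tg v G hw).2
    refine (tendsto_add_aux
      (fun n => (hE.memLp_fderiv_smul hΩ v (t n).memLp).1)
      (fun n => (hE.memLp_smul hΩ ((t n).fderiv_apply v).memLp).1)
      (hE.memLp_fderiv_smul hΩ v hG.1).1 (hE.memLp_smul hΩ hGL).1 a1 a2).congr fun n => ?_
    refine eLpNorm_congr_ae ?_
    filter_upwards [ae_restrict_mem hΩ.measurableSet] with x hx
    have e : fderiv ℝ (fun y => E y • η n y) x = _ :=
      ((hE.differentiableAt hΩ hx).hasFDerivAt.smul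
        ((t n).1.differentiable (by simp) x).hasFDerivAt).fderiv
    rw [e]
    simp only [add_apply, smul_apply,
      ContinuousLinearMap.smulRight_apply]
    rw [add_comm (E x • _) _]
  exact memH10_of_tendsto hG'.1 hG'.2 hG'.3 (fun n => (t n).smooth_smul hΩ hE.smooth)
    (tendsto_bdd_smul hC1 t0) (key hG.2 hG.4) (key hG.3 hG.5)

theorem MemH2.gauge {Ω : Set (ℝ × ℝ)} (hΩ : IsOpen Ω) (hA : BoundedSmooth Ω A)
    (hA' : BoundedSmooth Ω A') (hE : IsGauge Ω h A A' E) (hEb : BoundedSmooth Ω E)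
    {U : ℝ × ℝ → Spinor} (hU : MemH2 Ω U) : MemH2 Ω (fun x => E x • U x) := by
  obtain ⟨G₁, G₂, K, hG, hG₁, hG₂⟩ := hU.exists_hasGrad
  -- the gradient of `E U` is `E ((i / h) D U + ∇U)` with a bounded smooth field `D`
  have key : ∀ {v : ℝ × ℝ} {G K₁ K₂ : ℝ × ℝ → Spinor} {a a' : ℝ × ℝ → ℂ}, HasGrad Ω G K₁ K₂ →
      BoundedSmooth Ω a → BoundedSmooth Ω a' →
      (∀ x ∈ Ω, (dotForm (A' x - A x) v : ℂ) = a' x - a x) →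
      ∃ L₁ L₂, HasGrad Ω (fun x => fderiv ℝ E x v • U x + E x • G x) L₁ L₂ :=
    fun {v G K₁ K₂ a a'} hGK ha ha' he => by
    refine ⟨_, _, HasGrad.congr ((((((hG.bounded_smul hΩ ha').smul (Complex.I / h)).add
      ((hG.bounded_smul hΩ ha).smul (-(Complex.I / h)))).add hGK).bounded_smul hΩ hEb)) ?_
      (ae_eq_refl _) (ae_eq_refl _)⟩
    filter_upwards [ae_restrict_mem hΩ.measurableSet] with x hx
    rw [(hE.hasFDerivAt x hx).fderiv, ContinuousLinearMap.smulRight_apply, Complex.real_smul,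
      he x hx]
    module
  obtain ⟨L₁, L₂, hL⟩ := key (v := (1, 0)) hG₁ (hA.fst hΩ) (hA'.fst hΩ)
    fun x hx => by simp [dotForm_apply]
  obtain ⟨M₁, M₂, hM⟩ := key (v := (0, 1)) hG₂ (hA.snd hΩ) (hA'.snd hΩ)
    fun x hx => by simp [dotForm_apply]
  exact (hG.bounded_smul hΩ hEb).memH2 (K := ![![L₁, L₂], ![M₁, M₂]]) hL hM

theorem PauliRel.gauge (hh : 0 < h) (hA : BoundedSmooth (annulus ρ₁ ρ₂) A)
    (hA' : BoundedSmooth (annulus ρ₁ ρ₂) A') (hE : IsGauge (annulus ρ₁ ρ₂) h A A' E)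
    {U F : ℝ × ℝ → Spinor} (H : PauliRel ρ₁ ρ₂ h A U F) :
    PauliRel ρ₁ ρ₂ h A' (fun x => E x • U x) (fun x => E x • F x) := by
  have hΩ := isOpen_annulus ρ₁ ρ₂
  have hEb := hE.boundedSmooth hΩ hh hA hA'
  obtain ⟨h2, h0, w, d1, d2⟩ := H
  obtain ⟨G₁, G₂, -, hG, -⟩ := h2.exists_hasGrad
  exact ⟨h2.gauge hΩ hA hA' hE hEb, h0.bounded_smul hΩ hEb hG, _,
    d1.gauge hΩ hh hEb.smooth hE, d2.gauge hΩ hh hEb.smooth hE⟩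

/-- The multiplication by a function of modulus one, on `L²`. -/
theorem exists_mul_isometry (hE : ContinuousOn E (annulus ρ₁ ρ₂))
    (h1 : ∀ x ∈ annulus ρ₁ ρ₂, ‖E x‖ = 1) :
    ∃ M : L2Ω →ₗᵢ[ℂ] L2Ω,
      ∀ f : L2Ω, M f =ᵐ[volume.restrict (annulus ρ₁ ρ₂)] fun x => E x • f x := by
  have hΩ := isOpen_annulus ρ₁ ρ₂
  have hm : ∀ f : L2Ω, MemLp (fun x => E x • f x) 2 (volume.restrict (annulus ρ₁ ρ₂)) := fun f =>
    memLp_bounded_smul (C := 1) hΩ hE (fun x hx => (h1 x hx).le) (Lp.memLp f)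
  refine ⟨⟨⟨⟨fun f => (hm f).toLp, fun f g => ?_⟩, fun c f => ?_⟩, fun f => ?_⟩,
    fun f => (hm f).coeFn_toLp⟩
  · apply Lp.ext
    filter_upwards [(hm (f + g)).coeFn_toLp, Lp.coeFn_add ((hm f).toLp) ((hm g).toLp),
      (hm f).coeFn_toLp, (hm g).coeFn_toLp, Lp.coeFn_add f g] with x e1 e2 e3 e4 e5
    rw [e1, e2, Pi.add_apply, e3, e4, e5, Pi.add_apply, smul_add]
  · apply Lp.ext
    filter_upwards [(hm (c • f)).coeFn_toLp, Lp.coeFn_smul c ((hm f).toLp),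
      (hm f).coeFn_toLp, Lp.coeFn_smul c f] with x e1 e2 e3 e4
    rw [e1, RingHom.id_apply, e2, Pi.smul_apply, e3, e4, Pi.smul_apply, smul_comm]
  · change ‖(hm f).toLp‖ = ‖f‖
    rw [Lp.norm_toLp, Lp.norm_def]
    congr 1
    refine eLpNorm_congr_norm_ae ?_
    filter_upwards [ae_mem_annulus ρ₁ ρ₂] with x hx
    rw [norm_smul, h1 x hx, one_mul]

theorem resolventSet_subset_of_isometry {H : Type*} [NormedAddCommGroup H] [InnerProductSpace ℂ H]
    [CompleteSpace H] {T T' : H →ₗ.[ℂ] H} (M M' : H →ₗᵢ[ℂ] H) (hM : ∀ f, M (M' f) = f)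
    (h1 : ∀ u f, (u, f) ∈ T.graph → (M u, M f) ∈ T'.graph)
    (h2 : ∀ u f, (u, f) ∈ T'.graph → (M' u, M' f) ∈ T.graph) :
    resolventSet T ⊆ resolventSet T' := fun z hz => by
  obtain ⟨hs, C, hC⟩ := mem_resolventSet_iff.1 hz
  refine mem_resolventSet_iff.2 ⟨fun f => ?_, C, fun u g hu => ?_⟩
  · obtain ⟨u, hu⟩ := hs (M' f)
    have := h1 _ _ hu
    rw [map_add, map_smul, hM] at this
    exact ⟨M u, this⟩
  · have := hC _ _ (h2 _ _ hu)
    rwa [← map_smul, ← map_sub, M'.norm_map, M'.norm_map] at this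

theorem resolventSet_pauliOp_subset (hh : 0 < h) (hA : BoundedSmooth (annulus ρ₁ ρ₂) A)
    (hA' : BoundedSmooth (annulus ρ₁ ρ₂) A') (hE : IsGauge (annulus ρ₁ ρ₂) h A A' E) :
    resolventSet (pauliOp ρ₁ ρ₂ h A) ⊆ resolventSet (pauliOp ρ₁ ρ₂ h A') := by
  have hΩ := isOpen_annulus ρ₁ ρ₂
  obtain ⟨M, hM⟩ := exists_mul_isometry (hE.boundedSmooth hΩ hh hA hA').smooth.continuousOn
    hE.norm_eq
  obtain ⟨M', hM'⟩ := exists_mul_isometry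
    (hE.symm.boundedSmooth hΩ hh hA' hA).smooth.continuousOn hE.symm.norm_eq
  refine resolventSet_subset_of_isometry M M' (fun f => ?_) (fun u f H => ?_) fun u f H => ?_
  · apply Lp.ext
    filter_upwards [hM (M' f), hM' f, ae_mem_annulus ρ₁ ρ₂] with x e1 e2 hx
    rw [e1, e2, smul_smul, Complex.mul_conj, Complex.normSq_eq_norm_sq, hE.norm_eq x hx]
    simp
  · rw [pauliOp_graph] at H ⊢
    exact (PauliRel.gauge hh hA hA' hE H).congr (hM u) (hM f)
  · rw [pauliOp_graph] at H ⊢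
    exact (PauliRel.gauge hh hA' hA hE.symm H).congr (hM' u) (hM' f)

/-- Gauge equivalent potentials give Pauli operators with the same spectrum. -/
theorem IsGauge.opSpectrum_eq (hh : 0 < h) (hA : BoundedSmooth (annulus ρ₁ ρ₂) A)
    (hA' : BoundedSmooth (annulus ρ₁ ρ₂) A') (hE : IsGauge (annulus ρ₁ ρ₂) h A A' E) :
    opSpectrum (pauliOp ρ₁ ρ₂ h A) = opSpectrum (pauliOp ρ₁ ρ₂ h A') :=
  congrArg compl (Set.Subset.antisymm (resolventSet_pauliOp_subset hh hA hA' hE)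
    (resolventSet_pauliOp_subset hh hA' hA hE.symm))

/-! ### The circulation of `A` and the gauge equivalence with `A_{h,p}` -/

theorem polar_mem_annulus (hρ₁ : 0 < ρ₁) (hρ : ρ₁ < ρ₂) {r : ℝ} (hr : r ∈ Set.Ioo ρ₁ ρ₂) (t : ℝ) :
    (r * Real.cos t, r * Real.sin t) ∈ annulus ρ₁ ρ₂ := by
  rwa [mem_annulus_iff hρ₁ hρ, rad_polar (hρ₁.le.trans hr.1.le)]

theorem polar_mem_closedAnnulus (hρ₁ : 0 < ρ₁) (hρ : ρ₁ < ρ₂) {r : ℝ} (hr : r ∈ Set.Icc ρ₁ ρ₂)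
    (t : ℝ) : (r * Real.cos t, r * Real.sin t) ∈ closedAnnulus ρ₁ ρ₂ := by
  rwa [mem_closedAnnulus_iff hρ₁ hρ, rad_polar (hρ₁.le.trans hr.1)]

theorem continuous_circulation_integrand (hρ₁ : 0 < ρ₁) (hρ : ρ₁ < ρ₂)
    (hA : ContinuousOn A (closedAnnulus ρ₁ ρ₂)) {r : ℝ} (hr : r ∈ Set.Icc ρ₁ ρ₂) :
    Continuous fun t => (A (r * Real.cos t, r * Real.sin t)).1 * (-(r * Real.sin t)) +
      (A (r * Real.cos t, r * Real.sin t)).2 * (r * Real.cos t) := by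
  have hc : Continuous fun t => A (r * Real.cos t, r * Real.sin t) :=
    hA.comp_continuous (by fun_prop) fun t => polar_mem_closedAnnulus hρ₁ hρ hr t
  exact ((continuous_fst.comp hc).mul (by fun_prop)).add
    ((continuous_snd.comp hc).mul (by fun_prop))

/-- The circulation on the inner circle is the limit of those on the circles of the open annulus,
where the fields are differentiable. -/
theorem tendsto_circulation (hρ₁ : 0 < ρ₁) (hρ : ρ₁ < ρ₂)
    (hA : ContDiffOn ℝ ∞ A (closedAnnulus ρ₁ ρ₂)) {C : ℝ}
    (hC : ∀ x ∈ annulus ρ₁ ρ₂, ‖A x‖ ≤ C) :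
    Tendsto (fun r => circulation r A) (𝓝[>] ρ₁) (𝓝 (circulation ρ₁ A)) := by
  have hC0 : 0 ≤ C := (norm_nonneg _).trans (hC _ (polar_mem_annulus hρ₁ hρ
    (r := (ρ₁ + ρ₂) / 2) ⟨by linarith, by linarith⟩ 0))
  have hm : ∀ᶠ r in 𝓝[>] ρ₁, r ∈ Set.Ioo ρ₁ ρ₂ := Ioo_mem_nhdsGT hρ
  refine intervalIntegral.tendsto_integral_filter_of_dominated_convergence
    (fun _ => C * ρ₂ + C * ρ₂) ?_ ?_ (by simp) ?_
  · filter_upwards [hm] with r hr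
    exact (continuous_circulation_integrand hρ₁ hρ hA.continuousOn
      ⟨hr.1.le, hr.2.le⟩).aestronglyMeasurable
  · filter_upwards [hm] with r hr
    refine ae_of_all _ fun t _ => ?_
    have r0 := hρ₁.trans hr.1
    have k := hC _ (polar_mem_annulus hρ₁ hρ hr t)
    have k1 := (norm_fst_le _).trans k
    have k2 := (norm_snd_le _).trans k
    have k3 : ‖-(r * Real.sin t)‖ ≤ ρ₂ := by
      rw [norm_neg, norm_mul, Real.norm_of_nonneg r0.le, Real.norm_eq_abs]
      exact (mul_le_of_le_one_right r0.le (Real.abs_sin_le_one t)).trans hr.2.le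
    have k4 : ‖r * Real.cos t‖ ≤ ρ₂ := by
      rw [norm_mul, Real.norm_of_nonneg r0.le, Real.norm_eq_abs]
      exact (mul_le_of_le_one_right r0.le (Real.abs_cos_le_one t)).trans hr.2.le
    refine (norm_add_le _ _).trans ?_
    rw [norm_mul, norm_mul]
    gcongr
  · refine ae_of_all _ fun t _ => ?_
    have hc : ContinuousOn (fun r => A (r * Real.cos t, r * Real.sin t)) (Set.Icc ρ₁ ρ₂) :=
      hA.continuousOn.comp (by fun_prop) fun r hr => polar_mem_closedAnnulus hρ₁ hρ hr t
    have hc' : ContinuousOn (fun r => (A (r * Real.cos t, r * Real.sin t)).1 *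
        (-(r * Real.sin t)) + (A (r * Real.cos t, r * Real.sin t)).2 * (r * Real.cos t))
        (Set.Icc ρ₁ ρ₂) :=
      ((continuous_fst.comp_continuousOn hc).mul (by fun_prop)).add
        ((continuous_snd.comp_continuousOn hc).mul (by fun_prop))
    exact ((hc' ρ₁ ⟨le_rfl, hρ.le⟩).tendsto).mono_left
      (nhdsWithin_le_iff.2 (Icc_mem_nhdsGT hρ))

/-- The integrand of the circulation of an angular field is constant on circles. -/
theorem IsAngularField.circulation_eq (hρ₁ : 0 < ρ₁) (hρ : ρ₁ < ρ₂) {a : ℝ → ℝ}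
    (hA' : IsAngularField ρ₁ ρ₂ A' a) {r : ℝ} (hr : r ∈ Set.Ioo ρ₁ ρ₂) (t : ℝ) :
    (A' (r * Real.cos t, r * Real.sin t)).1 * (-(r * Real.sin t)) +
      (A' (r * Real.cos t, r * Real.sin t)).2 * (r * Real.cos t) = r * a r := by
  have r0 := hρ₁.trans hr.1
  rw [hA' _ (polar_mem_annulus hρ₁ hρ hr t), rad_polar r0.le]
  simp only [Prod.smul_fst, Prod.smul_snd, smul_eq_mul]
  field_simp
  linear_combination a r * Real.sin_sq_add_cos_sq t

/-- The potentials `A` and `A'` are gauge equivalent when `A'` is angular, with the same magnetic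
field, and the circulations differ by a multiple of `2πh`. -/
theorem exists_isGauge (hρ₁ : 0 < ρ₁) (hρ : ρ₁ < ρ₂) (hh : 0 < h)
    (hA : ContDiffOn ℝ ∞ A (closedAnnulus ρ₁ ρ₂)) {a b : ℝ → ℝ}
    (hA' : IsAngularField ρ₁ ρ₂ A' a) (ha : RadialField ρ₁ ρ₂ a b)
    (hrot : ∀ x ∈ annulus ρ₁ ρ₂, rot A x = b (rad x)) (p : ℤ)
    (hp : 2 * Real.pi * (ρ₁ * a ρ₁) - circulation ρ₁ A = 2 * Real.pi * (h * p)) :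
    ∃ E, IsGauge (annulus ρ₁ ρ₂) h A A' E := by
  have hΩ := isOpen_annulus ρ₁ ρ₂
  have hAb := boundedSmooth_of_closed hρ₁ hρ hA
  have hAb' := hA'.boundedSmooth hρ₁ hρ ha
  obtain ⟨C, hC⟩ := hAb.bdd
  have hrotD : ∀ x ∈ annulus ρ₁ ρ₂, rot (fun x => A' x - A x) x = 0 := fun x hx => by
    have e1 := hA'.rot_eq hρ₁ hρ ha hx
    have e2 := hrot x hx
    have d := hAb.differentiableAt hΩ hx
    have d' := hAb'.differentiableAt hΩ hx
    have s1 : fderiv ℝ (fun y => (A' y - A y).1) x = _ := fderiv_fun_sub d'.fst d.fst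
    have s2 : fderiv ℝ (fun y => (A' y - A y).2) x = _ := fderiv_fun_sub d'.snd d.snd
    rw [rot] at e1 e2 ⊢
    rw [s1, s2, sub_apply, sub_apply]
    linarith
  have hcirc : Tendsto (fun r => circulation r fun x => A' x - A x) (𝓝[>] ρ₁)
      (𝓝 (2 * Real.pi * (h * p))) := by
    have t1 : Tendsto (fun r => 2 * Real.pi * (r * a r)) (𝓝[>] ρ₁)
        (𝓝 (2 * Real.pi * (ρ₁ * a ρ₁))) := by
      have hc : ContinuousOn (fun r => 2 * Real.pi * (r * a r)) (Set.Icc ρ₁ ρ₂) :=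
        continuousOn_const.mul (continuousOn_id.mul ha.cont)
      exact (hc ρ₁ ⟨le_rfl, hρ.le⟩).tendsto.mono_left (nhdsWithin_le_iff.2 (Icc_mem_nhdsGT hρ))
    have t2 := t1.sub (tendsto_circulation hρ₁ hρ hA hC)
    rw [hp] at t2
    refine t2.congr' ?_
    filter_upwards [Ioo_mem_nhdsGT hρ] with r hr
    have i1 := (continuous_circulation_integrand hρ₁ hρ hA.continuousOn
      ⟨hr.1.le, hr.2.le⟩).intervalIntegrable (μ := volume) 0 (2 * Real.pi)
    have e : ∀ t : ℝ,
        (A' (r * Real.cos t, r * Real.sin t) - A (r * Real.cos t, r * Real.sin t)).1 *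
          (-(r * Real.sin t)) +
        (A' (r * Real.cos t, r * Real.sin t) - A (r * Real.cos t, r * Real.sin t)).2 *
          (r * Real.cos t) = r * a r -
        ((A (r * Real.cos t, r * Real.sin t)).1 * (-(r * Real.sin t)) +
          (A (r * Real.cos t, r * Real.sin t)).2 * (r * Real.cos t)) := fun t => by
      rw [← hA'.circulation_eq hρ₁ hρ hr t, Prod.fst_sub, Prod.snd_sub]
      ring
    simp only [circulation, e]
    rw [intervalIntegral.integral_sub (by simp) i1, intervalIntegral.integral_const]
    simp
  obtain ⟨E, hE⟩ := exists_gauge hρ₁ hρ hh (hAb'.smooth.sub hAb.smooth) hrotD p hcirc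
  exact ⟨E, fun x hx => (hE x hx).1, fun x hx => (hE x hx).2⟩

end GaugeInvariance

/-! ### Eigenfunctions in polar coordinates -/

section PolarEigenfunctions

variable {ρ₁ ρ₂ h γ : ℝ} {y y' : ℝ → Spinor} {B φ : ℝ × ℝ → ℝ}

theorem restrict_polarRect (ρ₁ ρ₂ : ℝ) : volume.restrict (polarRect ρ₁ ρ₂) =
    (volume.restrict (Set.Ioo ρ₁ ρ₂)).prod (volume.restrict (Set.Ioo 0 (2 * Real.pi))) := by
  rw [polarRect, Measure.volume_eq_prod, Measure.prod_restrict]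

theorem memLp_comp_fst (hy : MemLp y 2 (volume.restrict (Set.Ioo ρ₁ ρ₂))) :
    MemLp (fun q : ℝ × ℝ => y q.1) 2 (volume.restrict (polarRect ρ₁ ρ₂)) := by
  rw [restrict_polarRect]
  exact hy.comp_fst _

theorem ae_polarRect_of_ae {P : ℝ → Prop} (hP : ∀ᵐ r ∂volume.restrict (Set.Ioo ρ₁ ρ₂), P r) :
    ∀ᵐ q ∂volume.restrict (polarRect ρ₁ ρ₂), P q.1 := by
  rw [restrict_polarRect]
  exact Measure.quasiMeasurePreserving_fst.ae hP

theorem ae_of_ae_polarRect {P : ℝ → Prop}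
    (hP : ∀ᵐ q ∂volume.restrict (polarRect ρ₁ ρ₂), P q.1) :
    ∀ᵐ r ∂volume.restrict (Set.Ioo ρ₁ ρ₂), P r := by
  rw [restrict_polarRect] at hP
  have hne : (ae (volume.restrict (Set.Ioo 0 (2 * Real.pi)))).NeBot := by
    rw [ae_neBot, Ne, Measure.restrict_eq_zero, Real.volume_Ioo, sub_zero]
    exact (ENNReal.ofReal_pos.2 Real.two_pi_pos).ne'
  filter_upwards [Measure.ae_ae_of_ae_prod hP] with r hr
  exact hr.exists.choose_spec

theorem IsTestFunction.slice_fst {η : ℝ × ℝ → ℝ} (hη : IsTestFunction (polarRect ρ₁ ρ₂) η) (s : ℝ) :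
    IsTestFunction (Set.Ioo ρ₁ ρ₂) (fun r => η (r, s)) ∧
      ∀ r, fderiv ℝ (fun r => η (r, s)) r 1 = fderiv ℝ η (r, s) (1, 0) := by
  refine ⟨⟨hη.1.comp (by fun_prop), ?_, fun r hr => ?_⟩, fun r => ?_⟩
  · exact hη.2.1.comp_isClosedEmbedding (g := fun r : ℝ => (r, s)) 
      (Function.LeftInverse.isClosedEmbedding (f := Prod.fst) (fun _ => rfl) continuous_fst (by fun_prop))
  · exact (hη.2.2 (tsupport_comp_subset_preimage η (f := fun r : ℝ => (r, s)) (by fun_prop) hr)).1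
  · have h1 : HasFDerivAt (fun r : ℝ => (r, s)) (ContinuousLinearMap.inl ℝ ℝ ℝ) r :=
      hasFDerivAt_prodMk_left r s
    have h2 := ((hη.1.differentiable (by simp)) (r, s)).hasFDerivAt.comp r h1
    have e : fderiv ℝ (fun r => η (r, s)) r = _ := h2.fderiv
    rw [e]
    rfl

theorem IsTestFunction.slice_snd {η : ℝ × ℝ → ℝ} (hη : IsTestFunction (polarRect ρ₁ ρ₂) η) (r : ℝ) :
    IsTestFunction (Set.Ioo 0 (2 * Real.pi)) (fun s => η (r, s)) ∧
      ∀ s, fderiv ℝ (fun s => η (r, s)) s 1 = fderiv ℝ η (r, s) (0, 1) := by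
  refine ⟨⟨hη.1.comp (by fun_prop), ?_, fun s hs => ?_⟩, fun s => ?_⟩
  · exact hη.2.1.comp_isClosedEmbedding (g := fun s : ℝ => (r, s)) 
      (Function.LeftInverse.isClosedEmbedding (f := Prod.snd) (fun _ => rfl) continuous_snd (by fun_prop))
  · exact (hη.2.2 (tsupport_comp_subset_preimage η (f := fun s : ℝ => (r, s)) (by fun_prop) hs)).2
  · have h1 : HasFDerivAt (fun s : ℝ => (r, s)) (ContinuousLinearMap.inr ℝ ℝ ℝ) s :=
      hasFDerivAt_prodMk_right r s
    have h2 := ((hη.1.differentiable (by simp)) (r, s)).hasFDerivAt.comp s h1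
    have e : fderiv ℝ (fun s => η (r, s)) s = _ := h2.fderiv
    rw [e]
    rfl

theorem hasWeakDeriv_comp_fst (hy : MemLp y 2 (volume.restrict (Set.Ioo ρ₁ ρ₂)))
    (hy' : MemLp y' 2 (volume.restrict (Set.Ioo ρ₁ ρ₂)))
    (hw : HasWeakDeriv (Set.Ioo ρ₁ ρ₂) (1 : ℝ) y y') :
    HasWeakDeriv (polarRect ρ₁ ρ₂) (1, 0) (fun q => y q.1) (fun q => y' q.1) := by
  have l1 := memLp_locallyIntegrableOn (memLp_comp_fst hy)
  have l2 := memLp_locallyIntegrableOn (memLp_comp_fst hy')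
  refine ⟨l1, l2, fun η hη => ?_⟩
  have i1 := integrable_fderiv_smul l1 hη (1, 0)
  have i2 := integrable_test_smul l2 hη.1.continuous hη.2.1 hη.2.2
  rw [restrict_polarRect] at i1 i2 ⊢
  rw [integral_prod_symm _ i1, integral_prod_symm _ i2, ← integral_neg]
  congr 1
  funext s
  obtain ⟨t, e⟩ := hη.slice_fst s
  rw [← hw.2.2 _ t]
  simp only [e]

theorem hasWeakDeriv_comp_fst_snd (hy : MemLp y 2 (volume.restrict (Set.Ioo ρ₁ ρ₂))) :
    HasWeakDeriv (polarRect ρ₁ ρ₂) (0, 1) (fun q => y q.1) (fun _ => 0) := by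
  have l1 := memLp_locallyIntegrableOn (memLp_comp_fst hy)
  refine ⟨l1, HasWeakDeriv.zero (v := (0 : ℝ × ℝ)).1, fun η hη => ?_⟩
  have i1 := integrable_fderiv_smul l1 hη (0, 1)
  rw [restrict_polarRect] at i1 ⊢
  rw [integral_prod _ i1]
  simp only [smul_zero, integral_zero, neg_zero]
  refine (integral_congr_ae (Eventually.of_forall fun r => ?_)).trans (integral_zero _ _)
  obtain ⟨t, e⟩ := hη.slice_snd r
  have hc : HasWeakDeriv (Set.Ioo 0 (2 * Real.pi)) (1 : ℝ) (fun _ => y r) _ :=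
    HasWeakDeriv.of_contDiffOn isOpen_Ioo contDiffOn_const
  have := hc.2.2 _ t
  simpa [e] using this

/-- The factor `g(r) e^{ims}`. -/
def polarFactor (g : ℝ → ℝ) (m : ℤ) (q : ℝ × ℝ) : ℂ :=
  ((g q.1 : ℝ) : ℂ) * Complex.exp (Complex.I * (m : ℂ) * (q.2 : ℂ))

variable {g g' : ℝ → ℝ} {m : ℤ}

theorem contDiffOn_polarFactor (hg : ContDiffOn ℝ ∞ g (Set.Ioo ρ₁ ρ₂)) :
    ContDiffOn ℝ ∞ (polarFactor g m) (polarRect ρ₁ ρ₂) := by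
  refine ContDiffOn.mul ?_ (ContDiff.contDiffOn ?_)
  · exact Complex.ofRealCLM.contDiff.comp_contDiffOn
      (hg.comp contDiff_fst.contDiffOn fun q hq => hq.1)
  · exact (contDiff_const.mul (Complex.ofRealCLM.contDiff.comp contDiff_snd)).cexp

theorem fderiv_polarFactor (hg : ContDiffOn ℝ ∞ g (Set.Ioo ρ₁ ρ₂))
    (hg' : ∀ r ∈ Set.Ioo ρ₁ ρ₂, HasDerivAt g (g' r) r) {q : ℝ × ℝ} (hq : q ∈ polarRect ρ₁ ρ₂) :
    fderiv ℝ (polarFactor g m) q (1, 0) = polarFactor g' m q ∧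
      fderiv ℝ (polarFactor g m) q (0, 1) = Complex.I * m * polarFactor g m q := by
  have hd : HasFDerivAt (polarFactor g m) (fderiv ℝ (polarFactor g m) q) q :=
    (((contDiffOn_polarFactor hg).contDiffAt
      ((isOpen_polarRect ρ₁ ρ₂).mem_nhds hq)).differentiableAt (by simp)).hasFDerivAt
  constructor
  · have h1 : HasDerivAt (fun r : ℝ => (r, q.2)) (1, 0) q.1 :=
      (hasDerivAt_id q.1).prodMk (hasDerivAt_const _ _)
    have h2 := hd.comp_hasDerivAt q.1 h1
    have h3 : HasDerivAt (fun r => polarFactor g m (r, q.2)) (polarFactor g' m q) q.1 :=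
      (hg' q.1 hq.1).ofReal_comp.mul_const (Complex.exp (Complex.I * (m : ℂ) * (q.2 : ℂ)))
    exact h2.unique h3
  · have h1 : HasDerivAt (fun s : ℝ => (q.1, s)) (0, 1) q.2 :=
      (hasDerivAt_const _ _).prodMk (hasDerivAt_id q.2)
    have h2 := hd.comp_hasDerivAt q.2 h1
    have h3 : HasDerivAt (fun s : ℝ => Complex.I * (m : ℂ) * (s : ℂ)) (Complex.I * m) q.2 := by
      simpa using (Complex.ofRealCLM.hasDerivAt (x := q.2)).const_mul (Complex.I * (m : ℂ))
    refine h2.unique ((h3.cexp.const_mul ((g q.1 : ℝ) : ℂ)).congr_deriv ?_)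
    rw [polarFactor]
    ring

theorem hasWeakDeriv_polarFactor_fst (hg : ContDiffOn ℝ ∞ g (Set.Ioo ρ₁ ρ₂))
    (hg' : ∀ r ∈ Set.Ioo ρ₁ ρ₂, HasDerivAt g (g' r) r)
    (hy : MemLp y 2 (volume.restrict (Set.Ioo ρ₁ ρ₂)))
    (hy' : MemLp y' 2 (volume.restrict (Set.Ioo ρ₁ ρ₂)))
    (hw : HasWeakDeriv (Set.Ioo ρ₁ ρ₂) (1 : ℝ) y y') :
    HasWeakDeriv (polarRect ρ₁ ρ₂) (1, 0) (fun q => polarFactor g m q • y q.1)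
      (fun q => polarFactor g' m q • y q.1 + polarFactor g m q • y' q.1) := by
  have hR := isOpen_polarRect ρ₁ ρ₂
  refine ((hasWeakDeriv_comp_fst hy hy' hw).smooth_smul_complex hR
    (contDiffOn_polarFactor (m := m) hg)).congr₂ (ae_eq_refl _) ?_
  filter_upwards [ae_restrict_mem hR.measurableSet] with q hq
  rw [(fderiv_polarFactor hg hg' hq).1]

theorem hasWeakDeriv_polarFactor_snd (hg : ContDiffOn ℝ ∞ g (Set.Ioo ρ₁ ρ₂))
    (hg' : ∀ r ∈ Set.Ioo ρ₁ ρ₂, HasDerivAt g (g' r) r)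
    (hy : MemLp y 2 (volume.restrict (Set.Ioo ρ₁ ρ₂))) :
    HasWeakDeriv (polarRect ρ₁ ρ₂) (0, 1) (fun q => polarFactor g m q • y q.1)
      (fun q => (Complex.I * m * polarFactor g m q) • y q.1) := by
  have hR := isOpen_polarRect ρ₁ ρ₂
  refine ((hasWeakDeriv_comp_fst_snd hy).smooth_smul_complex hR
    (contDiffOn_polarFactor (m := m) hg)).congr₂ (ae_eq_refl _) ?_
  filter_upwards [ae_restrict_mem hR.measurableSet] with q hq
  rw [(fderiv_polarFactor hg hg' hq).2, smul_zero, add_zero]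

theorem hasAngular_polarFactor (hg : ContDiffOn ℝ ∞ g (Set.Ioo ρ₁ ρ₂))
    (hg' : ∀ r ∈ Set.Ioo ρ₁ ρ₂, HasDerivAt g (g' r) r)
    (hy : MemLp y 2 (volume.restrict (Set.Ioo ρ₁ ρ₂))) :
    HasAngular ρ₁ ρ₂ h γ φ (fun q => polarFactor g m q • y q.1)
      (fun q => polarFactor g m q •
        (((h * (((m : ℝ) - γ) / q.1) - radialDeriv ρ₁ ρ₂ φ q.1 : ℝ) : ℂ) • y q.1)) := by
  refine ⟨_, hasWeakDeriv_polarFactor_snd hg hg' hy, Eventually.of_forall fun q => ?_⟩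
  have e : -Complex.I * (Complex.I * m * polarFactor g m q) = m * polarFactor g m q := by
    linear_combination (-(m : ℂ) * polarFactor g m q) * Complex.I_sq
  dsimp only
  rw [smul_smul (-Complex.I), e]
  push_cast
  module

theorem contDiffOn_invSqrt (hρ₁ : 0 < ρ₁) :
    ContDiffOn ℝ ∞ (fun r => 1 / Real.sqrt r) (Set.Ioo ρ₁ ρ₂) := fun r hr => by
  have h0 := hρ₁.trans hr.1
  exact (contDiffAt_const.div (Real.contDiffAt_sqrt h0.ne')
    (Real.sqrt_pos.2 h0).ne').contDiffWithinAt

theorem hasDerivAt_invSqrt {r : ℝ} (hr : 0 < r) :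
    HasDerivAt (fun r => 1 / Real.sqrt r) (-(1 / (2 * r)) * (1 / Real.sqrt r)) r := by
  have hs := Real.sqrt_pos.2 hr
  refine ((hasDerivAt_const r (1 : ℝ)).div (Real.hasDerivAt_sqrt hr.ne') hs.ne').congr_deriv ?_
  have e := Real.sq_sqrt hr.le
  field_simp
  rw [e]
  ring

theorem hasDerivAt_invSqrt_deriv {r : ℝ} (hr : 0 < r) :
    HasDerivAt (fun r => -(1 / (2 * r)) * (1 / Real.sqrt r))
      (3 / (4 * r ^ 2) * (1 / Real.sqrt r)) r := by
  have h1 : HasDerivAt (fun r : ℝ => -(1 / (2 * r))) (1 / (2 * r ^ 2)) r := by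
    refine ((hasDerivAt_const r (1 : ℝ)).div ((hasDerivAt_id' r).const_mul 2)
      (by simp [hr.ne'])).neg.congr_deriv ?_
    field_simp
    ring
  refine (h1.mul (hasDerivAt_invSqrt hr)).congr_deriv ?_
  have hs := Real.sqrt_pos.2 hr
  field_simp
  ring

theorem memLp_polarMeasure {f : ℝ × ℝ → Spinor}
    (hf : MemLp f 2 (volume.restrict (polarRect ρ₁ ρ₂))) : MemLp f 2 (polarMeasure ρ₁ ρ₂) := by
  refine hf.of_measure_le_smul (c := ENNReal.ofReal ρ₂) ENNReal.ofReal_ne_top ?_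
  rw [← withDensity_const]
  refine withDensity_mono ?_
  filter_upwards [ae_restrict_mem (isOpen_polarRect ρ₁ ρ₂).measurableSet] with q hq
  exact ENNReal.ofReal_le_ofReal hq.1.2.le

theorem memLp_polarFactor (hρ₁ : 0 < ρ₁) (hy : MemLp y 2 (volume.restrict (Set.Ioo ρ₁ ρ₂))) :
    MemLp (fun q => polarFactor (fun r => 1 / Real.sqrt r) m q • y q.1) 2
      (volume.restrict (polarRect ρ₁ ρ₂)) := by
  have hR := isOpen_polarRect ρ₁ ρ₂
  refine memLp_bounded_smul (C := 1 / Real.sqrt ρ₁) hR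
    (contDiffOn_polarFactor (contDiffOn_invSqrt hρ₁)).continuousOn (fun q hq => ?_)
    (memLp_comp_fst hy)
  have e : Complex.I * (m : ℂ) * (q.2 : ℂ) = ((m * q.2 : ℝ) : ℂ) * Complex.I := by
    push_cast
    ring
  rw [polarFactor, norm_mul, e, Complex.norm_exp_ofReal_mul_I, mul_one, Complex.norm_real,
    Real.norm_of_nonneg (by positivity)]
  have := Real.sqrt_pos.2 hρ₁
  gcongr
  exact hq.1.1.le

/-- Conjugation by `r^{-1/2}` turns `∂_r² + r⁻¹ ∂_r` into `∂_r² + 1 / (4r²)`; here `S = r^{-1/2}`,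
`R = 1 / r`. -/
theorem liouville_identity (S R c k d : ℂ) (x x₁ x₂ w : Spinor) :
    S • (-k • (x₂ + (R ^ 2 / 4) • x) + (c ^ 2) • x - d • w) =
      -k • ((((3 / 4 * R ^ 2 * S) • x + (-(R / 2) * S) • x₁) +
          ((-(R / 2) * S) • x₁ + S • x₂)) + R • ((-(R / 2) * S) • x + S • x₁)) +
        S • c • c • x - d • S • w := by
  module

theorem continuousOn_angularSymbol (hρ₁ : 0 < ρ₁)
    (hφ : ContinuousOn (radialDeriv ρ₁ ρ₂ φ) (Set.Icc ρ₁ ρ₂)) :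
    ContinuousOn (fun r => h * (((m : ℝ) - γ) / r) - radialDeriv ρ₁ ρ₂ φ r)
        (Set.Icc ρ₁ ρ₂) :=
  ((continuousOn_const.div continuousOn_id fun _ hr =>
    (hρ₁.trans_le hr.1).ne').const_mul h).sub hφ

theorem memLp_angularSymbol_smul (hρ₁ : 0 < ρ₁)
    (hφ : ContinuousOn (radialDeriv ρ₁ ρ₂ φ) (Set.Icc ρ₁ ρ₂))
    (hy : MemLp y 2 (volume.restrict (Set.Ioo ρ₁ ρ₂))) :
    MemLp (fun r => ((h * (((m : ℝ) - γ) / r) - radialDeriv ρ₁ ρ₂ φ r : ℝ) : ℂ) • y r) 2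
      (volume.restrict (Set.Ioo ρ₁ ρ₂)) := by
  have hcc := continuousOn_angularSymbol (h := h) (γ := γ) (m := m) hρ₁ hφ
  obtain ⟨C, hC⟩ := isCompact_Icc.exists_bound_of_continuousOn hcc
  refine memLp_bdd_smul (C := C) hy ((Complex.continuous_ofReal.comp_continuousOn
    (hcc.mono Set.Ioo_subset_Icc_self)).aestronglyMeasurable measurableSet_Ioo) ?_
  filter_upwards [ae_restrict_mem measurableSet_Ioo] with r hr
  rw [Complex.norm_real]
  exact hC r (Set.Ioo_subset_Icc_self hr)

theorem polarFactor_eq_modeFun {v : ℝ → Spinor} {q : ℝ × ℝ} (hq : q ∈ polarRect ρ₁ ρ₂)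
    (hρ₁ : 0 < ρ₁) :
    polarFactor (fun r => 1 / Real.sqrt r) m q • v q.1 =
      (Real.sqrt (2 * Real.pi) : ℂ) • modeFun m v (polarMap q) := by
  have r0 : 0 < q.1 := hρ₁.trans hq.1.1
  rw [polarMap, modeFun, rad_polar r0.le, eang_polar r0, smul_smul]
  congr 1
  rw [polarFactor, Real.sqrt_mul Real.two_pi_pos.le]
  have := Real.sqrt_pos.2 r0
  have := Real.sqrt_pos.2 Real.two_pi_pos
  push_cast
  have e1 : ((Real.sqrt q.1 : ℝ) : ℂ) ≠ 0 := by exact_mod_cast (Real.sqrt_pos.2 r0).ne'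
  have e2 : ((Real.sqrt (2 * Real.pi) : ℝ) : ℂ) ≠ 0 := by
    exact_mod_cast (Real.sqrt_pos.2 Real.two_pi_pos).ne'
  field_simp

/-- The operator in polar coordinates acts on `r^{-1/2} e^{ims} v(r)` as the fibered operator
on `v`. -/
theorem FiberRel.polarRel (hρ₁ : 0 < ρ₁) (hρ : ρ₁ < ρ₂)
    (hφ : ContinuousOn (radialDeriv ρ₁ ρ₂ φ) (Set.Icc ρ₁ ρ₂)) {v f : ℝ → Spinor}
    (H : FiberRel ρ₁ ρ₂ h γ B φ m v f) :
    PolarRel ρ₁ ρ₂ h γ B φ (fun q => polarFactor (fun r => 1 / Real.sqrt r) m q • v q.1)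
      (fun q => polarFactor (fun r => 1 / Real.sqrt r) m q • f q.1) := by
  obtain ⟨h2, h0, u₁, u₂, w1, w2, hf⟩ := H
  obtain ⟨v₁, v₂, l1, l2, y1, y2⟩ := h2.exists_interval
  have ee1 := w1.ae_eq isOpen_Ioo y1
  have ee2 := (w2.congr ee1.symm).ae_eq isOpen_Ioo y2
  have k1 := (memLp_congr_ae ee1).2 l1
  have k2 := (memLp_congr_ae ee2).2 l2
  have hR := isOpen_polarRect ρ₁ ρ₂
  have hpos : ∀ r ∈ Set.Ioo ρ₁ ρ₂, 0 < r := fun r hr => hρ₁.trans hr.1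
  set g : ℝ → ℝ := fun r => 1 / Real.sqrt r with hg
  set g' : ℝ → ℝ := fun r => -(1 / (2 * r)) * (1 / Real.sqrt r) with hg'
  set g'' : ℝ → ℝ := fun r => 3 / (4 * r ^ 2) * (1 / Real.sqrt r) with hg''
  have s0 : ContDiffOn ℝ ∞ g (Set.Ioo ρ₁ ρ₂) := contDiffOn_invSqrt hρ₁
  have s1 : ContDiffOn ℝ ∞ g' (Set.Ioo ρ₁ ρ₂) :=
    (contDiffOn_const.div (contDiffOn_const.mul contDiffOn_id) fun r hr =>
      mul_ne_zero two_ne_zero (hpos r hr).ne').neg.mul s0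
  have d0 : ∀ r ∈ Set.Ioo ρ₁ ρ₂, HasDerivAt g (g' r) r := fun r hr =>
    hasDerivAt_invSqrt (hpos r hr)
  have d1 : ∀ r ∈ Set.Ioo ρ₁ ρ₂, HasDerivAt g' (g'' r) r := fun r hr =>
    hasDerivAt_invSqrt_deriv (hpos r hr)
  have hc := memLp_angularSymbol_smul (h := h) (γ := γ) (m := m) hρ₁ hφ h0.1
  have a1 := hasWeakDeriv_polarFactor_fst (m := m) s0 d0 h0.1 k1 w1
  have a2 := (hasWeakDeriv_polarFactor_fst (m := m) s1 d1 h0.1 k1 w1).add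
    (hasWeakDeriv_polarFactor_fst (m := m) s0 d0 k1 k2 w2)
  have a3 := hasAngular_polarFactor (h := h) (γ := γ) (φ := φ) (m := m) s0 d0 h0.1
  have a4 := hasAngular_polarFactor (h := h) (γ := γ) (φ := φ) (m := m) s0 d0 hc
  refine ⟨⟨fun x => (Real.sqrt (2 * Real.pi) : ℂ) • modeFun m v x,
    (memH2_modeFun hρ₁ hρ m h2).smul _, (memH10_modeFun hρ₁ hρ m h0).smul _, ?_⟩,
    _, _, _, _, a1, a2, a3, a4, ?_⟩
  · filter_upwards [ae_restrict_mem hR.measurableSet] with q hq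
    exact polarFactor_eq_modeFun hq hρ₁
  · filter_upwards [ae_polarRect_of_ae hf, ae_restrict_mem hR.measurableSet] with q e1 hq
    rw [e1]
    have E1 : polarFactor g' m q = -(((1 / q.1 : ℝ) : ℂ) / 2) * polarFactor g m q := by
      simp only [polarFactor, hg, hg']
      push_cast
      ring
    have E2 : polarFactor g'' m q = 3 / 4 * ((1 / q.1 : ℝ) : ℂ) ^ 2 * polarFactor g m q := by
      simp only [polarFactor, hg, hg'']
      push_cast
      ring
    have E3 : ((1 / (4 * q.1 ^ 2) : ℝ) : ℂ) = ((1 / q.1 : ℝ) : ℂ) ^ 2 / 4 := by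
      push_cast
      ring
    rw [E1, E2, E3, map_smul, Complex.ofReal_pow (_ - _)]
    exact liouville_identity _ _ _ _ _ _ _ _ _

theorem PolarRel.congr {u f u' f' : ℝ × ℝ → Spinor} (H : PolarRel ρ₁ ρ₂ h γ B φ u f)
    (hu : u' =ᵐ[volume.restrict (polarRect ρ₁ ρ₂)] u)
    (hf : f' =ᵐ[volume.restrict (polarRect ρ₁ ρ₂)] f) : PolarRel ρ₁ ρ₂ h γ B φ u' f' := by
  obtain ⟨⟨U, hU, hU', e⟩, ur, urr, w, z, h1, h2, h3, h4, h5⟩ := H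
  refine ⟨⟨U, hU, hU', hu.trans e⟩, ur, urr, w, z, h1.congr hu, h2, h3.congr hu, h4, ?_⟩
  filter_upwards [hu, hf, h5] with q e1 e2 e3
  rw [e2, e3, e1]

theorem isEigenfunction_iff {H : Type*} [NormedAddCommGroup H] [NormedSpace ℂ H] {T : H →ₗ.[ℂ] H}
    {z : ℂ} {u : H} : IsEigenfunction T z u ↔ u ≠ 0 ∧ (u, z • u) ∈ T.graph := by
  simp only [IsEigenfunction, LinearPMap.mem_graph_iff]

/-- The eigenfunctions of the fibered operator give eigenfunctions in polar coordinates. -/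
theorem exists_isEigenfunction_polarOp (hρ₁ : 0 < ρ₁) (hρ : ρ₁ < ρ₂)
    (hφ : ContinuousOn (radialDeriv ρ₁ ρ₂ φ) (Set.Icc ρ₁ ρ₂)) {z : ℂ}
    {v : Lp Spinor 2 (volume.restrict (Set.Ioo ρ₁ ρ₂))}
    (hv : IsEigenfunction (fiberOp ρ₁ ρ₂ h γ B φ m) z v) :
    ∃ w : Lp Spinor 2 (polarMeasure ρ₁ ρ₂),
      (w =ᵐ[polarMeasure ρ₁ ρ₂] fun q => polarFactor (fun r => 1 / Real.sqrt r) m q • v q.1) ∧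
      IsEigenfunction (polarOp ρ₁ ρ₂ h γ B φ hρ₁) z w := by
  obtain ⟨v0, hg⟩ := isEigenfunction_iff.1 hv
  rw [fiberOp_graph] at hg
  have H : FiberRel ρ₁ ρ₂ h γ B φ m v (z • v : Lp Spinor 2 (volume.restrict (Set.Ioo ρ₁ ρ₂))) := hg
  have hL := memLp_polarMeasure (memLp_polarFactor (m := m) hρ₁ (Lp.memLp v))
  have ew : hL.toLp =ᵐ[volume.restrict (polarRect ρ₁ ρ₂)] _ :=
    (ae_polarMeasure_iff hρ₁).1 hL.coeFn_toLp
  refine ⟨hL.toLp, hL.coeFn_toLp, isEigenfunction_iff.2 ⟨fun w0 => v0 ?_, ?_⟩⟩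
  · have e0 := (ae_polarMeasure_iff hρ₁).1 ((Lp.eq_zero_iff_ae_eq_zero).1 w0)
    refine (Lp.eq_zero_iff_ae_eq_zero).2 (ae_of_ae_polarRect ?_)
    filter_upwards [ew, e0, ae_restrict_mem (isOpen_polarRect ρ₁ ρ₂).measurableSet] with q e1 e2 hq
    have r0 : 0 < q.1 := hρ₁.trans hq.1.1
    rw [e1, Pi.zero_apply, smul_eq_zero] at e2
    refine e2.resolve_left (mul_ne_zero ?_ (Complex.exp_ne_zero _))
    exact_mod_cast (one_div_pos.2 (Real.sqrt_pos.2 r0)).ne'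
  · rw [polarOp_graph]
    refine (H.polarRel hρ₁ hρ hφ).congr ew ?_
    filter_upwards [(ae_polarMeasure_iff hρ₁).1 (Lp.coeFn_smul z hL.toLp), ew,
      ae_polarRect_of_ae (Lp.coeFn_smul z v)] with q e1 e2 e3
    simp only [e1, Pi.smul_apply, e2, e3]
    exact smul_comm _ _ _

end PolarEigenfunctions

end DirichletPauli

end

theorem lemma3p2 (ρ₁ ρ₂ : ℝ) (hρ₁ : 0 < ρ₁) (hρ : ρ₁ < ρ₂)
    -- the magnetic field: smooth up to the boundary, radial and strictly positive
    (B : ℝ × ℝ → ℝ)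
    (hB : ContDiffOn ℝ ∞ B (DirichletPauli.closedAnnulus ρ₁ ρ₂))
    (hBrad : ∀ x ∈ DirichletPauli.closedAnnulus ρ₁ ρ₂, ∀ y ∈ DirichletPauli.closedAnnulus ρ₁ ρ₂,
      x.1 ^ 2 + x.2 ^ 2 = y.1 ^ 2 + y.2 ^ 2 → B x = B y)
    (hBpos : ∀ x ∈ DirichletPauli.closedAnnulus ρ₁ ρ₂, 0 < B x)
    -- a vector potential of the magnetic field
    (A : ℝ × ℝ → ℝ × ℝ)
    (hA : ContDiffOn ℝ ∞ A (DirichletPauli.closedAnnulus ρ₁ ρ₂))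
    (hrot : ∀ x ∈ DirichletPauli.annulus ρ₁ ρ₂, DirichletPauli.rot A x = B x)
    -- the scalar potential
    (φ : ℝ × ℝ → ℝ) (hφ : DirichletPauli.IsScalarPotential ρ₁ ρ₂ B φ)
    (h : ℝ) (hh : 0 < h) (hh' : h ≤ 1) (p : ℤ) :
    -- the spectrum of the Dirichlet-Pauli operator with potential `A`
    DirichletPauli.opSpectrum (DirichletPauli.pauliOp ρ₁ ρ₂ h A) =
      ⋃ m : ℤ, DirichletPauli.opSpectrum (DirichletPauli.fiberOp ρ₁ ρ₂ h
        (DirichletPauli.gaugeConst ρ₁ ρ₂ h A φ p) B φ m) ∧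
    -- the spectrum of the Dirichlet-Pauli operator with potential `A_{h,p}`
    DirichletPauli.opSpectrum (DirichletPauli.pauliOp ρ₁ ρ₂ h
        (DirichletPauli.gaugePotential ρ₁ ρ₂ h A φ p)) =
      ⋃ m : ℤ, DirichletPauli.opSpectrum (DirichletPauli.fiberOp ρ₁ ρ₂ h
        (DirichletPauli.gaugeConst ρ₁ ρ₂ h A φ p) B φ m) ∧
    -- the eigenfunctions of the operator in polar coordinates
    ∀ (m : ℤ) (z : ℂ) (v : Lp DirichletPauli.Spinor 2 (volume.restrict (Set.Ioo ρ₁ ρ₂))),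
      DirichletPauli.IsEigenfunction (DirichletPauli.fiberOp ρ₁ ρ₂ h
        (DirichletPauli.gaugeConst ρ₁ ρ₂ h A φ p) B φ m) z v →
      ∃ w : Lp DirichletPauli.Spinor 2 (DirichletPauli.polarMeasure ρ₁ ρ₂),
        (w =ᵐ[DirichletPauli.polarMeasure ρ₁ ρ₂] fun q =>
          (((1 / Real.sqrt q.1 : ℝ) : ℂ) * Complex.exp (Complex.I * (m : ℂ) * (q.2 : ℂ))) • v q.1) ∧
        DirichletPauli.IsEigenfunction (DirichletPauli.polarOp ρ₁ ρ₂ h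
          (DirichletPauli.gaugeConst ρ₁ ρ₂ h A φ p) B φ hρ₁) z w := by
  obtain ⟨a, ha, haA, haφ⟩ := DirichletPauli.exists_gaugePotential_profile (h := h) (A := A)
    hρ₁ hρ hB hBrad hφ p
  have hAs := DirichletPauli.boundedSmooth_of_closed hρ₁ hρ hA
  have hAs' := haA.boundedSmooth hρ₁ hρ ha
  have hspec := DirichletPauli.opSpectrum_pauliOp hρ₁ hρ hh haA ha hAs'
    (fun r hr => haφ r (Set.Ioo_subset_Icc_self hr)) (fun _ _ => rfl)
  have hrot' : ∀ x ∈ DirichletPauli.annulus ρ₁ ρ₂,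
      DirichletPauli.rot A x = B (DirichletPauli.rad x, 0) := fun x hx => by
    have hxc := DirichletPauli.annulus_subset_closedAnnulus hx
    have hr : DirichletPauli.rad (DirichletPauli.rad x, 0) = DirichletPauli.rad x :=
      DirichletPauli.rad_axis (DirichletPauli.rad_nonneg x)
    rw [hrot x hx]
    refine hBrad x hxc _ ?_ ?_
    · rw [DirichletPauli.mem_closedAnnulus_iff hρ₁ hρ] at hxc ⊢
      rwa [hr]
    · rw [← DirichletPauli.rad_sq, ← DirichletPauli.rad_sq, hr]
  -- `γ` is such that the circulations of `A` and of the angular potential differ by `2πhp`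
  have hflux : 2 * Real.pi * (ρ₁ * a ρ₁) - DirichletPauli.circulation ρ₁ A =
      2 * Real.pi * (h * p) := by
    have e := haφ ρ₁ (Set.left_mem_Icc.2 hρ.le)
    have e' : a ρ₁ = DirichletPauli.radialDeriv ρ₁ ρ₂ φ ρ₁ +
        h * DirichletPauli.gaugeConst ρ₁ ρ₂ h A φ p / ρ₁ := by
      rw [e]
      ring
    rw [e', DirichletPauli.gaugeConst, DirichletPauli.fluxConst]
    have := hρ₁.ne'
    have := hh.ne'
    have := Real.pi_ne_zero
    field_simp
    ring
  obtain ⟨E, hE⟩ := DirichletPauli.exists_isGauge hρ₁ hρ hh hA haA ha hrot' p hflux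
  have hcont : ContinuousOn (DirichletPauli.radialDeriv ρ₁ ρ₂ φ) (Set.Icc ρ₁ ρ₂) :=
    (ha.cont.sub (continuousOn_const.div continuousOn_id fun _ hr =>
      (hρ₁.trans_le hr.1).ne')).congr haφ
  exact ⟨(hE.opSpectrum_eq hh hAs hAs').trans hspec, hspec, fun m z v hv =>
    DirichletPauli.exists_isEigenfunction_polarOp hρ₁ hρ hcont hv⟩
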